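/- **Types.** Session types are $S ::= \mathsf{end}\mid \,!\langle C\rangle;S \mid\, ?(C);S \mid \mu t.A$, where $A$ is a non-empty sequence of actions ended by $t$ (tail recursion); types are $C ::= S \mid \langle C\rangle$ (shared). In source types no carried type is $\mathsf{end}$, and the session types are: the finite ones, the $\mu t.A$, and the types obtained from $\mu t.A$ by unfolding it once and then performing zero or more actions of $A$ (at least one action of $A$ remaining before $\mu t.A$). Target types are polyadic: $!\langle\tilde C\rangle;S$, $?(\tilde C);S$, $\langle\tilde C\rangle$. $\overline S$ is the dual of $S$; $\mathrm{tr}(S)$ means that $S$ is tail recursive (possibly partially unfolded), $\mathrm{lin}(S)$ that $S$ is a session type with not $\mathrm{tr}(S)$. A recursive type is identified with its unfolding $S\{\mu t.S/t\}$ (at top level). *Decomposition of types.* $\mathcal G(\mathsf{end})=\mathsf{end}$; $\mathcal G(\langle C\rangle)=\langle\mathcal G(C)\rangle$; $\mathcal G(!\langle C\rangle;S)$ is $!\langle\mathcal G(C)\rangle;\mathsf{end}$ if $S=\mathsf{end}$, is $\mathcal G(S)$ if $\mathrm{tr}(S)$, and is $!\langle\mathcal G(C)\rangle;\mathsf{end},\,\mathcal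 G(S)$ otherwise (similarly for $?$); $\mathcal G(\mu t.S)=\mathcal R(S)$ with $\mathcal R(t)=\epsilon$, $\mathcal R(!\langle C\rangle;S)=\mu t.!\langle\mathcal G(C)\rangle;t,\ \mathcal R(S)$ (similarly for $?$). For tail-recursive $S$, $f(S)$ is the position in $\mathcal G(S)$ of the component performing the first action of $S$ (i.e. $f(S)=|\mathcal G(S)|+1-l$, where $l$ is the number of actions of $S$, unfolded if it is a $\mu$, before its $\mu$). The breakdown of a name $u_i:C$ is $(u_i,\dots,u_{i+|\mathcal G(C)|-1})$. For an environment $E$ of names with index $1$, $\mathcal G(E)$ replaces $u_1:C$ by $u_1:\mathcal G(C)_1,\dots,u_m:\mathcal G(C)_m$, $m=|\mathcal G(C)|$. **Processes** of the session $\pi$-calculus: $P ::= \mathbf 0\mid u!\langle\tilde v\rangle.P\mid u?(\tilde y).P\mid(\nu s:C)P\mid P\mid P\mid X\mid\mu X.P$; source processes are monadic ($|\tilde v|=|\tilde y|=1$). $\Gamma;\Delta\vdash P\triangleright\diamond$ is the usual typing judgement, with shared environment $\Gamma$ and linear environment $\Delta$ ($\mathbf 0$ is typed with empty $\Delta$;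 names of type $\mathsf{end}$ can be weakened; session inputs and outputs consume the first action of the subject, inputs and outputs on $u:\langle\tilde C\rangle$ leave $u$ unchanged; session names are sent linearly; $(\nu s:S)$ introduces $s:S,\overline s:\overline S$; $\Delta$ is split by parallel composition; $X$ is typed with exactly the environment assigned to it). In the rule for $\mu X.P$, the linear environment $\Delta$ is the one assigned to $X$, and $\mathrm{dom}(\Delta)\subseteq\mathrm{fn}(P)$. *Degree.* $|\mathbf 0|=|X|=1$; $|u!\langle v\rangle.Q|=|u?(y).Q|=|\mu X.Q|=|Q|+1$; $|Q_1\mid Q_2|=|Q_1|+|Q_2|+1$; $|(\nu s:C)Q|$ is $|Q|+1$ if $\mathrm{tr}(C)$ or if it occurs in the body of a recursion, and $|Q|$ otherwise. **Breakdown.** Propagators are reserved names $c_j$, $c^r_j$, $c^r_X$. $\mathrm{fnb}(Q,\tilde x)$ lists the $u_i$ of $\tilde x$ such that $u$ (with some index) is free in $Q$. Bound names carry no index and are given index $1$ when they are broken down: for a bound $y:C$, $\tilde y$ denotes $(y_1,\dots,y_{|\mathcal G(C)|})$. In what follows, for a prefix with subject $u_i:C$: $u_l$ is $u_{f(C)}$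 if $\mathrm{tr}(C)$ and $u_i$ otherwise; $\sigma$ is $\{u_{i+1}/u_i\}$ if $\mathrm{lin}(C)$ and the identity otherwise; $\tilde x'$ is $\tilde x\setminus u_i$ if $\mathrm{lin}(C)$ and $\tilde x$ otherwise; $\tilde v$ is the breakdown of $v$. $B_k^{\tilde x}(P)$ is: - $\mathbf 0$: $c_k?(\tilde x).\mathbf 0$. - $u_i!\langle v\rangle.Q$: $c_k?(\tilde x).u_l!\langle\tilde v\rangle.\overline{c_{k+1}}!\langle\tilde z\rangle.\mathbf 0\mid B_{k+1}^{\tilde z}(Q\sigma)$, with $\tilde z=\mathrm{fnb}(Q,\tilde x')$. - $u_i?(y).Q$: $c_k?(\tilde x).u_l?(\tilde y).\overline{c_{k+1}}!\langle\tilde z\rangle.\mathbf 0\mid B_{k+1}^{\tilde z}(Q\sigma\{y_1/y\})$, with $\tilde z=\mathrm{fnb}(Q,\tilde x'\tilde y)$. - $(\nu s:C)Q$, not $\mathrm{tr}(C)$: $(\nu\tilde s:\mathcal G(C))\,B_k^{\tilde x}(Q\{s_1\overline{s_1}/s\overline s\})$. - $(\nu s:C)Q$, $\mathrm{tr}(C)$: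 $(\nu\tilde s:\mathcal G(C))(c_k?(\tilde x).\overline{c_{k+1}}!\langle\tilde z\rangle.\mathbf 0\mid B_{k+1}^{\tilde z}(Q\{s_1\overline{s_1}/s\overline s\}))$, with $\tilde z=\tilde x,\tilde s,\tilde{\overline s}$. - $Q_1\mid Q_2$: $c_k?(\tilde x).\overline{c_{k+1}}!\langle\tilde y_1\rangle.\overline{c_{k+l+1}}!\langle\tilde y_2\rangle.\mathbf 0\mid B_{k+1}^{\tilde y_1}(Q_1)\mid B_{k+l+1}^{\tilde y_2}(Q_2)$, with $l=|Q_1|$, $\tilde y_i=\mathrm{fnb}(Q_i,\tilde x)$. - $\mu X.Q$: $(\nu c^r_X:\langle\tilde M\rangle)\big(c_k?(\tilde x).\overline{c^r_{k+1}}!\langle\tilde m\rangle.\mu X.c^r_X?(\tilde m).\overline{c^r_{k+1}}!\langle\tilde m\rangle.X\mid B^{\mathsf{rec}}{}_{k+1}^{\tilde m}(Q)_{\{X\mapsto\tilde m\}}\big)$, where $\tilde m$ (of types $\tilde M$) is the breakdown of $\mathrm{fn}(Q)$. $B^{\mathsf{rec}}{}_{k}^{\tilde x}(P)_g$, for a recursion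 on $X$, depends on whether $g=\{X\mapsto\tilde m\}$ (main thread) or $g=\emptyset$; $\tilde m$ is kept fixed. Below, $\mathcal T_k^{\tilde x}[T]$ is $\mu X.c^r_k?(\tilde x).T$ on the main thread and $\mu X.c^r_k?(\tilde x).(T\mid X)$ otherwise; $\mathcal S_j\langle\tilde z\rangle$ is $\overline{c^r_j}!\langle\tilde z\rangle.X$ on the main thread and $c^r_j!\langle\tilde z\rangle.\mathbf 0$, with $c^r_j$ a shared name, otherwise; $\mathrm{car}(Q,\tilde x)$ is $\tilde m\cup\mathrm{fnb}(Q,\tilde x)$ if $X$ is free in $Q$ and $\mathrm{fnb}(Q,\tilde x)$ otherwise. - $\mathbf 0$: $\mathcal T_k^{\tilde x}[X]$ on the main thread, $\mathcal T_k^{\tilde x}[\mathbf 0]$ otherwise. - $X$: $\mathcal T_k^{\tilde x}[c^r_X!\langle\tilde m\rangle.X]$ on the main thread, $\mathcal T_k^{\tilde x}[c^r_X!\langle\tilde m\rangle.\mathbf 0]$ otherwise. - $u_i!\langle v\rangle.Q$: $\mathcal T_k^{\tilde x}[u_l!\langle\tilde v\rangle.\mathcal S_{k+1}\langle\tilde z\rangle]\mid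 B^{\mathsf{rec}}{}_{k+1}^{\tilde z}(Q\sigma)_g$, with $\tilde z=\mathrm{car}(Q,\tilde x')$. - $u_i?(y).Q$: $\mathcal T_k^{\tilde x}[u_l?(\tilde y).\mathcal S_{k+1}\langle\tilde z\rangle]\mid B^{\mathsf{rec}}{}_{k+1}^{\tilde z}(Q\sigma\{y_1/y\})_g$, with $\tilde z=\mathrm{car}(Q,\tilde x'\tilde y)$. - $(\nu s:C)Q$: $\mu X.(\nu\tilde s:\mathcal G(C))\,c^r_k?(\tilde x).\mathcal S_{k+1}\langle\tilde z\rangle\mid B^{\mathsf{rec}}{}_{k+1}^{\tilde z}(Q\{s_1\overline{s_1}/s\overline s\})_g$ (with $\mathcal S_{k+1}\langle\tilde z\rangle\mid X$ instead of $\mathcal S_{k+1}\langle\tilde z\rangle$ off the main thread), with $\tilde z=\tilde x,\tilde s$, and also $\tilde{\overline s}$ if $C$ is a session type. - $Q_1\mid Q_2$: $\mathcal T_k^{\tilde x}[\mathcal S_{k+1}\langle\tilde y_1\rangle\mid\mathcal S_{k+l+1}\langle\tilde y_2\rangle]\mid B^{\mathsf{rec}}{}_{k+1}^{\tilde y_1}(Q_1)_{g_1}\mid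 B^{\mathsf{rec}}{}_{k+l+1}^{\tilde y_2}(Q_2)_{g_2}$, with $l=|Q_1|$, $\tilde y_i=\mathrm{car}(Q_i,\tilde x)$; if $g=\emptyset$ then $g_1=g_2=\emptyset$; if $g\neq\emptyset$, the main thread enters $Q_1$ if $X$ is free in $Q_1$ or not free in $Q_2$, and $Q_2$ otherwise: for that component $g_i=g$, for the other one $g_i=\emptyset$, and each $\mathcal S$ is taken according to the $g_i$ of its component. **Theorem.** Let $\Gamma$ and $\Delta$ be environments with disjoint domains that assign to names with index $1$ source types, shared in $\Gamma$ and session types in $\Delta$. Let $P$ be a source process with $\Gamma;\Delta\vdash P\triangleright\diamond$, without free process variables and without recursion inside the body of a recursion, whose free names all have index $1$ ($P$ is initialized), whose restrictions are annotated with source types, and whose bound names carry no index, are pairwise distinct, and are distinct from the names in $\Gamma,\Delta$. Let $k\ge 0$, let $\tilde x\subseteq\mathrm{fn}(P)$ have no repetitions and contain every free name of $P$ with a tail-recursive type in $\Delta$, and let $\tilde y$ be the concatenation of the breakdowns of the names in $\tilde x$. Then $$\mathcal G(\Gamma\setminus\tilde x);\ \mathcal G(\Delta\setminus\tilde x),\Theta\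 \vdash\ B_k^{\tilde y}(P)\triangleright\diamond$$ for some balanced environment $\Theta$ (dual endpoints have dual types) such that: $\Theta(c_k)=\,?(\tilde M);\mathsf{end}$, where $\tilde M=(\mathcal G(\Gamma),\mathcal G(\Delta))(\tilde y)$; and the domain of $\Theta$ consists of the propagators of $B_k^{\tilde y}(P)$ numbered $k,k+1,\dots,k+|P|-1$ (the $j$-th one is either $c_j$ or, within the body of a recursion, $c^r_j$) together with the dual endpoints of those numbered $k+1,\dots,k+|P|-1$, except for the $c^r_j$ off the main thread, which $\Theta$ types as shared names and which are therefore placed in the shared environment of the judgement. -/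

import Mathlib

/-! ## Session types -/

/-- Types. `act true C̃ S` is the output type `!⟨C̃⟩;S`, `act false C̃ S` is the input type
`?(C̃);S`, `mu S` is `μt.S`, `tvar` is the (single) type variable `t`, `shared C̃` is the type
`⟨C̃⟩` of shared names. Payloads are tuples; the monadic types carry one-element tuples. -/
inductive Ty : Type
  | endT : Ty
  | tvar : Ty
  | act (out : Bool) (payload : List Ty) (cont : Ty) : Ty
  | mu (body : Ty) : Ty
  | shared (payload : List Ty) : Ty

namespace Ty

def isEnd : Ty → Bool
  | endT => true
  | _ => false

def isShared : Ty → Bool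
  | shared _ => true
  | _ => false

/-- Duality of session types. -/
def dual : Ty → Ty
  | endT => endT
  | tvar => tvar
  | act o ps S => act (!o) ps S.dual
  | mu S => mu S.dual
  | shared ps => shared ps

/-- `S.subst T` is `S{T/t}`; recursion is tail recursion, so payloads are closed. -/
def subst (T : Ty) : Ty → Ty
  | endT => endT
  | tvar => T
  | act o ps S => act o ps (subst T S)
  | mu S => mu S
  | shared ps => shared ps

/-- A recursive type is identified with its unfolding: `μt.S` becomes `S{μt.S/t}`. -/
def unfold : Ty → Ty
  | mu S => subst (mu S) S
  | S => S

/-- `tr S`: the session type `S` is tail recursive, possibly partially unfolded. -/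
def tr : Ty → Bool
  | mu _ => true
  | act _ _ S => S.tr
  | _ => false

/-- `lin C`: `C` is a session type that is not tail recursive. -/
def lin (C : Ty) : Bool := !C.isShared && !C.tr

/-- `Suffix A S`: the type `A` is what remains of `S` after some of its leading actions. -/
inductive Suffix : Ty → Ty → Prop
  | refl (S : Ty) : Suffix S S
  | step {A S : Ty} (o : Bool) (ps : List Ty) : Suffix A S → Suffix A (act o ps S)

mutual
/-- Monadic, contractive source types: finite session types, tail-recursive session types `μt.S`,
the types `A{μt.S/t}` reached from them by unfolding once and performing some actions,
and shared types. No carried type is `end`. -/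
inductive WF : Ty → Prop
  | endT : WF endT
  | shared {C : Ty} : WF C → C.isEnd = false → WF (shared [C])
  | act {o : Bool} {C S : Ty} : WF C → C.isEnd = false →
      WF S → S.isShared = false → S.tr = false → WF (act o [C] S)
  | mu {S : Ty} : Body S → WF (mu S)
  | unf {A o C S : _} : Body S → Suffix (act o C A) S → WF (subst (mu S) (act o C A))
/-- The bodies `S` of the tail-recursive types `μt.S`: `α₁;…;αₙ;t` with `n ≥ 1`. -/
inductive Body : Ty → Prop
  | last {o : Bool} {C : Ty} : WF C → C.isEnd = false → Body (act o [C] tvar)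
  | cons {o : Bool} {C S : Ty} : WF C → C.isEnd = false → Body S → Body (act o [C] S)
end

mutual
/-- The decomposition `G(C)` of a type into a tuple of minimal session types. -/
def G : Ty → List Ty
  | endT => [endT]
  | tvar => []
  | shared ps => [shared (Gs ps)]
  | mu S => R S
  | act o ps S =>
      if S.tr then G S
      else if S.isEnd then [act o (Gs ps) endT]
      else act o (Gs ps) endT :: G S
/-- The decomposition of the body of a tail-recursive type. -/
def R : Ty → List Ty
  | act o ps S => mu (act o (Gs ps) tvar) :: R S
  | _ => []
/-- `G` on tuples, by concatenation. -/
def Gs : List Ty → List Ty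
  | [] => []
  | C :: Cs => G C ++ Gs Cs
end

/-- The auxiliary index function `f'_l`. -/
def fAux : ℕ → Ty → ℕ
  | l, act _ _ S => fAux (l + 1) S
  | l, mu S => (R S).length + 1 - l
  | _, _ => 1

/-- The index function `f(S)`: the position, within `G(S)`, of the component that
performs the first action of the tail-recursive type `S`. -/
def f (S : Ty) : ℕ := fAux 0 S.unfold

/-- The type after the first action (unchanged for shared types). -/
def next (C : Ty) : Ty :=
  match C.unfold with
  | act _ _ S => S
  | _ => C

/-- The carried type. -/
def carried (C : Ty) : Ty :=
  match C.unfold with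
  | act _ ps _ => ps.headD endT
  | shared ps => ps.headD endT
  | _ => endT

end Ty

/-! ## Names and processes -/

/-- Names and variables. `ch b p i` is the indexed channel or variable `b_i`, with `p = false` for
the dual endpoint; the index `0` means that there is no index. `prop r k p` is the reserved
propagator `c_k` (`r = false`) or `c^r_k` (`r = true`), and `propX X p` is `c^r_X`. -/
inductive Name : Type
  | ch (b : ℕ) (p : Bool) (i : ℕ) : Name
  | prop (r : Bool) (k : ℕ) (p : Bool) : Name
  | propX (X : ℕ) (p : Bool) : Name
  deriving DecidableEq

namespace Name

def dual : Name → Name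
  | ch b p i => ch b (!p) i
  | prop r k p => prop r k (!p)
  | propX X p => propX X (!p)

/-- Replace the index of a channel name. -/
def withIdx (j : ℕ) : Name → Name
  | ch b p _ => ch b p j
  | n => n

/-- `u_i ↦ u_{i+1}`. -/
def succIdx : Name → Name
  | ch b p i => ch b p (i + 1)
  | n => n

/-- The names `u_i` and `u_j` that differ only in their index. -/
def sameBase (m n : Name) : Bool := decide (m.withIdx 0 = n.withIdx 0)

/-- A channel name with index `1`. -/
def Initial (n : Name) : Prop := ∃ b p, n = ch b p 1

end Name

/-- Processes of the polyadic session `π`-calculus with recursion. Every binder binds a name,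
and a restriction `res n C P` of a session name binds `n` and `n.dual`. -/
inductive Proc : Type
  | nil : Proc
  | pvar (X : ℕ) : Proc
  | out (u : Name) (vs : List Name) (P : Proc) : Proc
  | inp (u : Name) (ys : List Name) (P : Proc) : Proc
  | res (n : Name) (C : Ty) (P : Proc) : Proc
  | par (P Q : Proc) : Proc
  | mu (X : ℕ) (P : Proc) : Proc

namespace Proc

/-- Free names. -/
def fn : Proc → List Name
  | nil => []
  | pvar _ => []
  | out u vs P => u :: (vs ++ P.fn)
  | inp u ys P => u :: P.fn.filter (fun n => n ∉ ys)
  | res n _ P => P.fn.filter (fun m => m ≠ n ∧ m ≠ n.dual)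
  | par P Q => P.fn ++ Q.fn
  | mu _ P => P.fn

/-- `P.frv X`: the process variable `X` occurs free in `P`. -/
def frv (X : ℕ) : Proc → Bool
  | nil => false
  | pvar Y => decide (Y = X)
  | out _ _ P => frv X P
  | inp _ _ P => frv X P
  | res _ _ P => frv X P
  | par P Q => frv X P || frv X Q
  | mu Y P => !decide (Y = X) && frv X P

/-- Source processes: monadic, bound names carry no index, type annotations are source types. -/
def Source : Proc → Prop
  | nil => True
  | pvar _ => True
  | out _ vs P => (∃ v, vs = [v]) ∧ P.Source
  | inp _ ys P => (∃ b, ys = [Name.ch b true 0]) ∧ P.Source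
  | res n C P => (∃ b, n = Name.ch b true 0) ∧ C.WF ∧ P.Source
  | par P Q => P.Source ∧ Q.Source
  | mu _ P => P.Source

/-- `P` is initialized: its free names are channel names with index `1`. -/
def Initialized (P : Proc) : Prop := ∀ n ∈ P.fn, n.Initial

def MuFree : Proc → Prop
  | nil => True
  | pvar _ => True
  | out _ _ P => P.MuFree
  | inp _ _ P => P.MuFree
  | res _ _ P => P.MuFree
  | par P Q => P.MuFree ∧ Q.MuFree
  | mu _ _ => False

/-- No recursion occurs inside the body of another one. -/
def NoNestedRec : Proc → Prop
  | nil => True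
  | pvar _ => True
  | out _ _ P => P.NoNestedRec
  | inp _ _ P => P.NoNestedRec
  | res _ _ P => P.NoNestedRec
  | par P Q => P.NoNestedRec ∧ Q.NoNestedRec
  | mu _ P => P.MuFree

def nameBase : Name → List ℕ
  | .ch b _ _ => [b]
  | _ => []

/-- The base names of all binders. -/
def bound : Proc → List ℕ
  | nil => []
  | pvar _ => []
  | out _ _ P => P.bound
  | inp _ ys P => ys.flatMap nameBase ++ P.bound
  | res n _ P => nameBase n ++ P.bound
  | par P Q => P.bound ++ Q.bound
  | mu _ P => P.bound

end Proc

/-! ## The type system -/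

/-- Typing environments: partial maps from names to types. -/
abbrev Env := Name → Option Ty

namespace Env

def empty : Env := fun _ => none

def upd (E : Env) (n : Name) (o : Option Ty) : Env := fun m => if m = n then o else E m

/-- `E ∖ x̃` -/
def remove (E : Env) (x : List Name) : Env := fun n => if n ∈ x then none else E n

/-- `E, F` (used for environments with disjoint domains). -/
def union (E F : Env) : Env := fun n => (E n).orElse (fun _ => F n)

/-- The shared part of an environment. -/
def sharedPart (E : Env) : Env := fun n => (E n).filter (fun C => C.isShared)

/-- The session part of an environment. -/
def sessionPart (E : Env) : Env := fun n => (E n).filter (fun C => !C.isShared)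

/-- `Split Δ Δ₁ Δ₂`: `Δ` is the disjoint union of `Δ₁` and `Δ₂`. -/
def Split (Δ Δ₁ Δ₂ : Env) : Prop :=
  ∀ n, (Δ n = Δ₁ n ∧ Δ₂ n = none) ∨ (Δ n = Δ₂ n ∧ Δ₁ n = none)

/-- Equality of linear environments up to unfolding of recursive types. -/
def Eqv (Δ Δ' : Env) : Prop := ∀ n, (Δ n).map Ty.unfold = (Δ' n).map Ty.unfold

/-- `Γ` under a binder of `ỹ : C̃`: the names `ỹ` are shadowed, those of shared type are added. -/
def bindShared (Γ : Env) (ys : List Name) (Cs : List Ty) : Env := fun n =>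
  match (ys.zip Cs).lookup n with
  | some C => if C.isShared then some C else none
  | none => Γ n

/-- `Δ` under a binder of `ỹ : C̃`: the names of session type are added. -/
def bindLinear (Δ : Env) (ys : List Name) (Cs : List Ty) : Env := fun n =>
  match (ys.zip Cs).lookup n with
  | some C => if C.isShared then none else some C
  | none => Δ n

/-- Balanced environments: dual endpoints have dual types. -/
def Balanced (E : Env) : Prop :=
  ∀ n S T, E n = some S → E n.dual = some T → T = S.dual

end Env

open Env in
/-- `Vals Γ Δ ṽ C̃`: the judgement `Γ;Δ ⊢ ṽ ▷ C̃` for tuples of names. -/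
inductive Vals (Γ : Env) : Env → List Name → List Ty → Prop
  | nil : Vals Γ empty [] []
  | shared {Δ : Env} {v : Name} {vs : List Name} {C : Ty} {Cs : List Ty} :
      Γ v = some C → C.isShared = true → Vals Γ Δ vs Cs → Vals Γ Δ (v :: vs) (C :: Cs)
  | session {Δ Δ' : Env} {v : Name} {vs : List Name} {S T : Ty} {Cs : List Ty} :
      Δ v = some S → S.unfold = T.unfold → T.isShared = false →
      Vals Γ (Δ.upd v none) vs Cs → Vals Γ Δ (v :: vs) (T :: Cs)

open Env in
/-- `Typed Γ Ξ Δ P`: the judgement `Γ;Δ ⊢ P ▷ ⋄`, where `Γ` types shared names, `Ξ` assigns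
linear environments to process variables and `Δ` is the linear environment. -/
inductive Typed : Env → (ℕ → Option Env) → Env → Proc → Prop
  | nil {Γ Ξ} : Typed Γ Ξ empty .nil
  | ended {Γ Ξ Δ P u} : Typed Γ Ξ Δ P → Γ u = none → Δ u = none →
      Typed Γ Ξ (Δ.upd u (some .endT)) P
  | unf {Γ Ξ Δ Δ' P} : Typed Γ Ξ Δ P → Eqv Δ Δ' → Typed Γ Ξ Δ' P
  | rvar {Γ Ξ Δ X} : Ξ X = some Δ → Typed Γ Ξ Δ (.pvar X)
  | recur {Γ Ξ Δ X P} : (∀ n, Δ n ≠ none → n ∈ P.fn) →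
      Typed Γ (Function.update Ξ X (some Δ)) Δ P → Typed Γ Ξ Δ (.mu X P)
  | par {Γ Ξ Δ Δ₁ Δ₂ P Q} : Split Δ Δ₁ Δ₂ → Typed Γ Ξ Δ₁ P → Typed Γ Ξ Δ₂ Q →
      Typed Γ Ξ Δ (.par P Q)
  | res {Γ Ξ Δ n C P} : C.isShared = true → Δ n = none →
      Typed (Γ.upd n (some C)) Ξ Δ P → Typed Γ Ξ Δ (.res n C P)
  | resS {Γ Ξ Δ n S P} : S.isShared = false → Δ n = none → Δ n.dual = none →
      Typed ((Γ.upd n none).upd n.dual none) Ξ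
        ((Δ.upd n (some S)).upd n.dual (some S.dual)) P →
      Typed Γ Ξ Δ (.res n S P)
  | send {Γ Ξ Δ Δ₁ Δ₂ u vs Cs S P} : Split Δ Δ₁ Δ₂ → Δ₁ u = some (.act true Cs S) →
      Typed Γ Ξ (Δ₁.upd u (some S)) P → Vals Γ Δ₂ vs Cs → Typed Γ Ξ Δ (.out u vs P)
  | rcv {Γ Ξ Δ u ys Cs S P} : Δ u = some (.act false Cs S) →
      ys.Nodup → ys.length = Cs.length → (∀ y ∈ ys, Δ y = none) →
      Typed (bindShared Γ ys Cs) Ξ (bindLinear (Δ.upd u (some S)) ys Cs) P →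
      Typed Γ Ξ Δ (.inp u ys P)
  | req {Γ Ξ Δ Δ₁ Δ₂ u vs Cs P} : Γ u = some (.shared Cs) → Split Δ Δ₁ Δ₂ →
      Typed Γ Ξ Δ₁ P → Vals Γ Δ₂ vs Cs → Typed Γ Ξ Δ (.out u vs P)
  | acc {Γ Ξ Δ u ys Cs P} : Γ u = some (.shared Cs) →
      ys.Nodup → ys.length = Cs.length → (∀ y ∈ ys, Δ y = none) →
      Typed (bindShared Γ ys Cs) Ξ (bindLinear Δ ys Cs) P → Typed Γ Ξ Δ (.inp u ys P)

/-! ## Breaking down names and environments -/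

/-- The name breakdown `(u_i, …, u_{i+|G(C)|-1})` of `u_i : C`. -/
def bname (n : Name) (C : Ty) : List Name :=
  match n with
  | .ch b p i => (List.range C.G.length).map (fun j => Name.ch b p (i + j))
  | n => [n]

/-- The decomposition `G(E)` of an environment of initialized names: `u_1 : C` becomes
`u_1 : G(C)_1, …, u_m : G(C)_m` with `m = |G(C)|`. -/
def gEnv (E : Env) : Env
  | .ch b p (i + 1) => (E (.ch b p 1)).bind (fun C => C.G[i]?)
  | _ => none

/-- `ỹ` is the tuple of the breakdowns of the names in `x̃`, typed by `Γ, Δ`. -/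
def Indexed (Γ Δ : Env) (y x : List Name) : Prop :=
  y = x.flatMap (fun n => match Γ.union Δ n with
    | some C => bname n C
    | none => [])

/-- `fnb(Q, x̃)`, the names of `x̃` whose base occurs free in `Q`. -/
def fnb (Q : Proc) (x : List Name) : List Name :=
  x.filter (fun n => Q.fn.any (fun m => m.sameBase n))

/-! ## The breakdown function -/

/-- `P` under the restrictions `s_i : M_1, s_{i+1} : M_2, …` -/
def resAll (b : ℕ) : ℕ → List Ty → Proc → Proc
  | _, [], P => P
  | i, M :: Ms, P => .res (.ch b true i) M (resAll b (i + 1) Ms P)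

/-- `E[n ↦ C]`, `ρ[n ↦ m]`. -/
def fupd {α : Type} (h : Name → α) (n : Name) (a : α) : Name → α :=
  fun m => if m = n then a else h m

/-- `l`-indexed subject of a prefix: `u_{f(S)}` if `u_i : S` is tail recursive, `u_i` otherwise. -/
def subjName (C : Ty) (u : Name) : Name := if C.tr then u.withIdx C.f else u

/-- `w̃`: the subject itself if it is linear, and nothing otherwise. -/
def dropSubj (C : Ty) (u : Name) (x : List Name) : List Name :=
  if C.lin then x.filter (fun n => n ≠ u) else x

/-- The substitution `next(u_i)`: `u_{i+1}` for `u_i` if it is linear, nothing otherwise. -/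
def nextName (C : Ty) (u : Name) : Name := if C.lin then u.succIdx else u

/-- The broken-down restricted endpoints of `(ν s : C)`. -/
def resNames (n : Name) (C : Ty) : List Name :=
  if C.isShared then bname (n.withIdx 1) C
  else bname (n.withIdx 1) C ++ bname (n.dual.withIdx 1) C.dual

/-- The kinds of propagators: `c_k` (session), `c^r_k` (recursive session), `c^r_k` (shared). -/
inductive PKind : Type
  | plain : PKind
  | recSession : PKind
  | recShared : PKind
  deriving DecidableEq

def PKind.name (k : ℕ) : PKind → Name
  | plain => .prop false k true
  | _ => .prop true k true

/-- The propagator sends with which a trio of a recursion activates the next one: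
a session output followed by `X` on the main thread, a shared output elsewhere. -/
def sendRec (lin : Bool) (X k : ℕ) (z : List Name) : Proc :=
  if lin then .out (.prop true k false) z (.pvar X) else .out (.prop true k true) z .nil

/-- The trio `μX.c^r_k?(x̃).T` on the main thread, `μX.c^r_k?(x̃).(T ∣ X)` elsewhere. -/
def trioRec (lin : Bool) (X k : ℕ) (x : List Name) (T : Proc) : Proc :=
  .mu X (.inp (.prop true k true) x (if lin then T else .par T (.pvar X)))

/-- `g(X) ∪ fnb(Q, x̃)`, where `g(X) = m̃` is only needed if `X` occurs in `Q`. -/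
def carry (X : ℕ) (m : List Name) (Q : Proc) (x : List Name) : List Name :=
  if Q.frv X then m ++ (fnb Q x).filter (fun n => n ∉ m) else fnb Q x

/-- The main thread of a recursion on `X` enters the left component of `Q₁ ∣ Q₂`. -/
def mainLeft (X : ℕ) (Q₁ Q₂ : Proc) : Bool := Q₁.frv X || !Q₂.frv X

/-- The propagator degree of (a part of) the body of a recursion. -/
def Proc.sizeRec : Proc → ℕ
  | .nil => 1
  | .pvar _ => 1
  | .out _ _ P => P.sizeRec + 1
  | .inp _ _ P => P.sizeRec + 1
  | .res _ _ P => P.sizeRec + 1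
  | .par P Q => P.sizeRec + Q.sizeRec + 1
  | .mu _ P => P.sizeRec + 1

/-- The propagator degree `|P|`. -/
def Proc.size : Proc → ℕ
  | .nil => 1
  | .pvar _ => 1
  | .out _ _ P => P.size + 1
  | .inp _ _ P => P.size + 1
  | .res _ C P => if C.tr then P.size + 1 else P.size
  | .par P Q => P.size + Q.size + 1
  | .mu _ P => P.sizeRec + 1

/-- The breakdown `B^rec_k^{x̃}(P)_g` of a part `P` of the body of a recursion on `X`.
`lin = true` is the case `g ≠ ∅` (the main thread), `lin = false` the case `g = ∅`; `m = g(X)`.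
`E` records the current types of the names of `P`, and `ρ` is a pending substitution of indexed
names: the process that is broken down is `Pρ`. -/
def Brec (X : ℕ) (m : List Name) :
    Bool → (Name → Ty) → (Name → Name) → ℕ → List Name → Proc → Proc
  | lin, _, _, k, x, .nil => trioRec lin X k x (if lin then .pvar X else .nil)
  | lin, _, _, k, x, .pvar _ =>
      trioRec lin X k x (.out (.propX X true) m (if lin then .pvar X else .nil))
  | lin, E, ρ, k, x, .out u vs Q =>
      match vs with
      | [v] =>
          let z := carry X m Q (dropSubj (E u) (ρ u) x)
          .par
            (trioRec lin X k x
              (.out (subjName (E u) (ρ u)) (bname (ρ v) (E v)) (sendRec lin X (k + 1) z)))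
            (Brec X m lin (fupd E u (E u).next) (fupd ρ u (nextName (E u) (ρ u))) (k + 1) z Q)
      | _ => .nil
  | lin, E, ρ, k, x, .inp u ys Q =>
      match ys with
      | [y] =>
          let C := (E u).carried
          let yt := bname (y.withIdx 1) C
          let z := carry X m Q (dropSubj (E u) (ρ u) x ++ yt)
          .par
            (trioRec lin X k x (.inp (subjName (E u) (ρ u)) yt (sendRec lin X (k + 1) z)))
            (Brec X m lin (fupd (fupd E u (E u).next) y C)
              (fupd (fupd ρ u (nextName (E u) (ρ u))) y (y.withIdx 1)) (k + 1) z Q)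
      | _ => .nil
  | lin, E, ρ, k, x, .res n C Q =>
      match n with
      | .ch b _ _ =>
          let z := x ++ resNames n C
          .par
            (.mu X (resAll b 1 C.G (.inp (.prop true k true) x
              (if lin then sendRec lin X (k + 1) z
                else .par (sendRec lin X (k + 1) z) (.pvar X)))))
            (Brec X m lin (fupd (fupd E n.dual C.dual) n C)
              (fupd (fupd ρ n.dual (n.dual.withIdx 1)) n (n.withIdx 1)) (k + 1) z Q)
      | _ => .nil
  | lin, E, ρ, k, x, .par Q₁ Q₂ =>
      let y₁ := carry X m Q₁ x
      let y₂ := carry X m Q₂ x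
      let l₁ := lin && mainLeft X Q₁ Q₂
      let l₂ := lin && !mainLeft X Q₁ Q₂
      .par
        (trioRec lin X k x
          (.par (sendRec l₁ X (k + 1) y₁) (sendRec l₂ X (k + Q₁.sizeRec + 1) y₂)))
        (.par (Brec X m l₁ E ρ (k + 1) y₁ Q₁) (Brec X m l₂ E ρ (k + Q₁.sizeRec + 1) y₂ Q₂))
  | _, _, _, _, _, .mu _ _ => .nil

/-- The breakdown function `B_k^{x̃}(P)`. As in `Brec`, `E` records the current types of the names
of `P` and the process that is broken down is `Pρ`. -/
def B : (Name → Ty) → (Name → Name) → ℕ → List Name → Proc → Proc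
  | _, _, k, x, .nil => .inp (.prop false k true) x .nil
  | _, _, _, _, .pvar _ => .nil
  | E, ρ, k, x, .out u vs Q =>
      match vs with
      | [v] =>
          let z := fnb Q (dropSubj (E u) (ρ u) x)
          .par
            (.inp (.prop false k true) x
              (.out (subjName (E u) (ρ u)) (bname (ρ v) (E v))
                (.out (.prop false (k + 1) false) z .nil)))
            (B (fupd E u (E u).next) (fupd ρ u (nextName (E u) (ρ u))) (k + 1) z Q)
      | _ => .nil
  | E, ρ, k, x, .inp u ys Q =>
      match ys with
      | [y] =>
          let C := (E u).carried
          let yt := bname (y.withIdx 1) C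
          let z := fnb Q (dropSubj (E u) (ρ u) x ++ yt)
          .par
            (.inp (.prop false k true) x
              (.inp (subjName (E u) (ρ u)) yt (.out (.prop false (k + 1) false) z .nil)))
            (B (fupd (fupd E u (E u).next) y C)
              (fupd (fupd ρ u (nextName (E u) (ρ u))) y (y.withIdx 1)) (k + 1) z Q)
      | _ => .nil
  | E, ρ, k, x, .res n C Q =>
      match n with
      | .ch b _ _ =>
          let E' := fupd (fupd E n.dual C.dual) n C
          let ρ' := fupd (fupd ρ n.dual (n.dual.withIdx 1)) n (n.withIdx 1)
          if C.tr then
            let z := x ++ resNames n C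
            resAll b 1 C.G
              (.par (.inp (.prop false k true) x (.out (.prop false (k + 1) false) z .nil))
                (B E' ρ' (k + 1) z Q))
          else resAll b 1 C.G (B E' ρ' k x Q)
      | _ => .nil
  | E, ρ, k, x, .par Q₁ Q₂ =>
      let y₁ := fnb Q₁ x
      let y₂ := fnb Q₂ x
      .par
        (.inp (.prop false k true) x
          (.out (.prop false (k + 1) false) y₁
            (.out (.prop false (k + Q₁.size + 1) false) y₂ .nil)))
        (.par (B E ρ (k + 1) y₁ Q₁) (B E ρ (k + Q₁.size + 1) y₂ Q₂))
  | E, ρ, k, x, .mu X Q =>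
      -- The tuple `z̃` of the table is `x̃ ∪ m̃`, which is `m̃` since `x̃` is part of `m̃`.
      let ns := Q.fn.dedup
      let m := ns.flatMap (fun n => bname (ρ n) (E n))
      let M := ns.flatMap (fun n => (E n).G)
      .res (.propX X true) (.shared M)
        (.par
          (.inp (.prop false k true) x
            (.out (.prop true (k + 1) false) m
              (.mu X (.inp (.propX X true) m
                (.out (.prop true (k + 1) false) m (.pvar X))))))
          (Brec X m true E ρ (k + 1) m Q))

/-- The breakdown of an initialized process whose free names are typed by `Γ, Δ`. -/
def breakdown (Γ Δ : Env) (k : ℕ) (x : List Name) (P : Proc) : Proc :=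
  B (fun n => (Γ.union Δ n).getD .endT) id k x P

/-! ## Propagators -/

/-- The kinds of the propagators used by `Brec`, in the order of their numbers. -/
def kindsRec (X : ℕ) : Bool → Proc → List PKind
  | lin, .nil => [if lin then .recSession else .recShared]
  | lin, .pvar _ => [if lin then .recSession else .recShared]
  | lin, .out _ _ P => (if lin then .recSession else .recShared) :: kindsRec X lin P
  | lin, .inp _ _ P => (if lin then .recSession else .recShared) :: kindsRec X lin P
  | lin, .res _ _ P => (if lin then .recSession else .recShared) :: kindsRec X lin P
  | lin, .par P Q => (if lin then .recSession else .recShared) ::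
      (kindsRec X (lin && mainLeft X P Q) P ++ kindsRec X (lin && !mainLeft X P Q) Q)
  | lin, .mu _ P => (if lin then .recSession else .recShared) :: kindsRec X lin P

/-- The kinds of the propagators used by the breakdown of `P`, in the order of their numbers. -/
def kinds : Proc → List PKind
  | .nil => [.plain]
  | .pvar _ => [.plain]
  | .out _ _ P => .plain :: kinds P
  | .inp _ _ P => .plain :: kinds P
  | .res _ C P => if C.tr then .plain :: kinds P else kinds P
  | .par P Q => .plain :: (kinds P ++ kinds Q)
  | .mu X P => .plain :: kindsRec X true P

theorem length_kindsRec (X : ℕ) (lin : Bool) (P : Proc) :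
    (kindsRec X lin P).length = P.sizeRec := by
  induction P generalizing lin with
  | nil => simp [kindsRec, Proc.sizeRec]
  | pvar Y => simp [kindsRec, Proc.sizeRec]
  | out u vs P ih => simp [kindsRec, Proc.sizeRec, ih]
  | inp u ys P ih => simp [kindsRec, Proc.sizeRec, ih]
  | res n C P ih => simp [kindsRec, Proc.sizeRec, ih]
  | par P Q ihP ihQ => simp [kindsRec, Proc.sizeRec, ihP, ihQ]
  | mu Y P ih => simp [kindsRec, Proc.sizeRec, ih]

theorem length_kinds (P : Proc) : (kinds P).length = P.size := by
  induction P <;> simp_all [kinds, Proc.size, length_kindsRec]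
  split <;> simp_all

/-- The domain of the propagator environment: the propagators numbered `k, …, k+|P|-1`, and the
dual endpoints of those numbered `k+1, …, k+|P|-1` that are not shared names. -/
def propDom (k : ℕ) (P : Proc) : Set Name :=
  {n | ∃ j κ, (kinds P)[j]? = some κ ∧
    (n = κ.name (k + j) ∨ (0 < j ∧ κ ≠ .recShared ∧ n = (κ.name (k + j)).dual))}

/-!
The breakdown of a process consists of trios: a trio receives a tuple of names on a propagator,
performs at most one action of the source process, and sends the names still needed to the next
trios. It is typed by induction on the source process. What has to be shown is that a trio receives
the names that it uses, with suitable types, and that nothing linear is lost or duplicated.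

*Types.* The decomposition `G` has one component for each action of a session type, and the
component performs just that action, once if the type is finite and forever if it is tail recursive
(`Ty.Minimal`). So if a name of finite type performs an action, the first name of its breakdown is
used up, whereas the breakdown of a tail-recursive name is the same before and after. This relation
between the source names and their breakdowns is `Refines`, and it is preserved by actions
(`Refines.step`). Since a broken-down name keeps its type, up to unfolding, until it is used up, one
total assignment `T` of types to names suffices for a whole component; a linear environment is then
given by its set of names, and typing by the predicate `LinTyped`.

*Source process.* By `Typed.end_or_passed`, a linear name of a well-typed process is free in it
unless its type is `end` or it is passed to a process variable. Outside of recursions there are no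
process variables to pass it to, so the free names are all that has to be passed on. Types `end` are
left behind, and weakened.

*Recursion.* The linear environment of a process variable `X` consists of names free in the body of
the recursion. The type of such a name has changed into itself when `X` is reached, after at least
one action (`Typed.reduces_of_frv`), and so it is tail recursive, since finite types get smaller
(`Ty.WF.tr_of_transGen`). Hence, if `X` is free in the body, the breakdown `m̃` of the free names of
the body is available again at the end of each round (`Keeps`, `Carries`), and the trios of the
body, which run forever, can receive it again. The trios off the main thread use shared propagators.
They can be replicated because they receive all their linear names (`outcome_Brec`), and because `X`
gets no linear name there: the main thread follows the component in which `X` is free, and if `X` is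
free in two parallel components, then its linear environment has to be contained in both of them, so
it is empty (`RecState.par`).

*Outside of recursions* a component may also have free names that it does not receive, which are
among its linear names (`outcome_B`). The propagators get the types of the tuples that they carry;
`Outcome` collects such types for a component, and it is composed along the process by
`Outcome.cons` and `Outcome.par`.
-/

/-! ### Decomposition of types -/

namespace Ty

/-- What remains of a recursion body after some of its actions is the variable or again a body. -/
theorem Body.suffix {A S : Ty} (hs : Suffix A S) : Body S → A = Ty.tvar ∨ Body A := by
  induction hs with
  | refl => exact Or.inr
  | step o ps h ih =>
    intro hb
    cases hb with
    | last _ _ => cases h; exact Or.inl rfl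
    | cons _ _ hb => exact ih hb

theorem Body.exists_act {S : Ty} : Body S → ∃ o C A, S = Ty.act o [C] A ∧ C.WF ∧ C.isEnd = false ∧
    (A = Ty.tvar ∨ Body A)
  | .last h₁ h₂ => ⟨_, _, _, rfl, h₁, h₂, .inl rfl⟩
  | .cons h₁ h₂ h => ⟨_, _, _, rfl, h₁, h₂, .inr h⟩

theorem Suffix.tail {A S : Ty} {o ps} (h : Suffix (Ty.act o ps A) S) : Suffix A S := by
  induction h with
  | refl => exact .step _ _ (.refl _)
  | step o ps h ih => exact .step _ _ ih

theorem Body.tr_subst (M : Ty) : ∀ {S : Ty}, Body S → (subst (Ty.mu M) S).tr = true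
  | _, .last _ _ => rfl
  | _, .cons _ _ h => by simpa [subst, tr] using h.tr_subst M

theorem Body.G_subst (M : Ty) : ∀ {S : Ty}, Body S → (subst (Ty.mu M) S).G = M.R
  | _, .last _ _ => by simp [subst, G, tr]
  | _, .cons _ _ h => by simp [subst, G, h.tr_subst M, h.G_subst M]

theorem Body.fAux_subst (M : Ty) : ∀ {S : Ty}, Body S → ∀ l,
    fAux l (subst (Ty.mu M) S) = M.R.length + 1 - (l + S.R.length)
  | _, .last _ _, l => by simp [subst, fAux, R]
  | _, .cons _ _ h, l => by
      simp only [subst, fAux, h.fAux_subst M, R, List.length_cons]; omega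

/-- The components of a remainder of a body are the last components of the body. -/
theorem Suffix.exists_append_R {A S : Ty} (h : Suffix A S) : ∃ l, S.R = l ++ A.R := by
  induction h with
  | refl => exact ⟨[], rfl⟩
  | step o ps h ih => obtain ⟨l, hl⟩ := ih; exact ⟨_ :: l, by simp [R, hl]; rfl⟩

/-- A source type is finite or shared, or, up to unfolding, what remains of the unfolding of some
`μt.S` after part of the actions of `S`. -/
theorem WF.cases_form {C : Ty} (h : C.WF) :
    C = Ty.endT ∨ (∃ D, C = Ty.shared [D] ∧ D.WF ∧ D.isEnd = false) ∨
    (∃ o D S, C = Ty.act o [D] S ∧ D.WF ∧ D.isEnd = false ∧ S.WF ∧ S.isShared = false ∧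
      S.tr = false) ∨
    (∃ S A, Body S ∧ Suffix A S ∧ Body A ∧ C.unfold = subst (Ty.mu S) A ∧ C.tr = true ∧ C.G = S.R ∧
      C.isShared = false ∧ (C = Ty.mu S ∨ C = subst (Ty.mu S) A)) := by
  cases h with
  | endT => exact .inl rfl
  | shared h₁ h₂ => exact .inr (.inl ⟨_, rfl, h₁, h₂⟩)
  | act h₁ h₂ h₃ h₄ h₅ => exact .inr (.inr (.inl ⟨_, _, _, rfl, h₁, h₂, h₃, h₄, h₅⟩))
  | @mu S h =>
    exact .inr (.inr (.inr ⟨S, S, h, .refl _, h, rfl, rfl, by simp [G], rfl, .inl rfl⟩))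
  | @unf A o C S h₁ h₂ =>
    rcases h₁.suffix h₂ with h | h
    · exact absurd h (by simp)
    · exact .inr (.inr (.inr ⟨S, _, h₁, h₂, h, rfl, h.tr_subst S, h.G_subst S, rfl, .inr rfl⟩))

theorem Body.WF_subst {M A : Ty} (hM : Body M) (hA : Suffix A M) (h : A = Ty.tvar ∨ Body A) :
    (subst (Ty.mu M) A).WF := by
  rcases h with rfl | h
  · exact .mu hM
  · obtain ⟨o, C, B, rfl, -⟩ := h.exists_act
    exact .unf hM hA

theorem isEnd_iff {C : Ty} : C.isEnd = true ↔ C = Ty.endT := by cases C <;> simp [isEnd]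

theorem WF.unfold_eq_endT {C : Ty} (h : C.WF) : C.unfold = Ty.endT ↔ C = Ty.endT := by
  rcases h.cases_form with rfl | ⟨D, rfl, -⟩ | ⟨o, D, S, rfl, -⟩ | ⟨S, A, h₁, h₂, h₃, h₄, h₅, -⟩
  · simp [unfold]
  · simp [unfold]
  · simp [unfold]
  · obtain ⟨o, D, B, rfl, -⟩ := h₃.exists_act
    rw [h₄]
    constructor
    · simp [subst]
    · rintro rfl; simp [tr] at h₅

theorem WF.unfold_G {C : Ty} (h : C.WF) : C.unfold.G = C.G := by
  rcases h.cases_form with rfl | ⟨D, rfl, -⟩ | ⟨o, D, S, rfl, -⟩ |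
    ⟨S, A, h₁, h₂, h₃, h₄, h₅, h₆, -⟩
  · rfl
  · rfl
  · rfl
  · rw [h₄, h₆, h₃.G_subst]

theorem WF.next {C : Ty} (h : C.WF) : C.next.WF := by
  rcases h.cases_form with rfl | ⟨D, rfl, -⟩ | ⟨o, D, S, rfl, -, -, hS, -⟩ |
    ⟨S, A, h₁, h₂, h₃, h₄, h₅, h₆, h₇, -⟩
  · exact h
  · exact h
  · exact hS
  · obtain ⟨o, D, B, rfl, -, -, hB⟩ := h₃.exists_act
    simpa [Ty.next, h₄, subst] using Body.WF_subst h₁ h₂.tail hB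

theorem WF.next_tr {C : Ty} (h : C.WF) : C.next.tr = C.tr := by
  rcases h.cases_form with rfl | ⟨D, rfl, -⟩ | ⟨o, D, S, rfl, -, -, hS, -⟩ |
    ⟨S, A, h₁, h₂, h₃, h₄, h₅, h₆, h₇, -⟩
  · rfl
  · rfl
  · rfl
  · obtain ⟨o, D, B, rfl, -, -, hB⟩ := h₃.exists_act
    rw [h₅]
    simp only [Ty.next, h₄, subst]
    rcases hB with rfl | hB
    · rfl
    · exact hB.tr_subst S

theorem WF.next_isShared {C : Ty} (h : C.WF) : C.next.isShared = C.isShared := by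
  rcases h.cases_form with rfl | ⟨D, rfl, -⟩ | ⟨o, D, S, rfl, -, -, hS, hS', -⟩ |
    ⟨S, A, h₁, h₂, h₃, h₄, h₅, h₆, h₇, -⟩
  · rfl
  · rfl
  · exact hS'
  · obtain ⟨o, D, B, rfl, -, -, hB⟩ := h₃.exists_act
    rw [h₇]
    simp only [Ty.next, h₄, subst]
    rcases hB with rfl | hB
    · rfl
    · obtain ⟨o, D, B, rfl, -⟩ := hB.exists_act; rfl

/-- The components of a tail-recursive type come from the whole recursion body, so they are not
affected by actions. -/
theorem WF.next_G_of_tr {C : Ty} (h : C.WF) (ht : C.tr = true) : C.next.G = C.G := by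
  rcases h.cases_form with rfl | ⟨D, rfl, -⟩ | ⟨o, D, S, rfl, -, -, hS, -, hS'⟩ |
    ⟨S, A, h₁, h₂, h₃, h₄, h₅, h₆, h₇, -⟩
  · simp [tr] at ht
  · simp [tr] at ht
  · simp [tr, hS'] at ht
  · obtain ⟨o, D, B, rfl, -, -, hB⟩ := h₃.exists_act
    rw [h₆]
    simp only [Ty.next, h₄, subst]
    rcases hB with rfl | hB
    · simp [subst, G]
    · exact hB.G_subst S

theorem WF.next_of_shared {C : Ty} (h : C.WF) (ht : C.isShared = true) : C.next = C := by
  cases C <;> simp_all [isShared, Ty.next, unfold]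

/-- The carried type of a type that offers an action. -/
theorem WF.carried {C : Ty} (h : C.WF) (hne : C ≠ Ty.endT) :
    C.carried.WF ∧ C.carried.isEnd = false := by
  rcases h.cases_form with rfl | ⟨D, rfl, h₁, h₂⟩ | ⟨o, D, S, rfl, h₁, h₂, -⟩ |
    ⟨S, A, h₁, h₂, h₃, h₄, h₅, h₆, h₇, -⟩
  · simp at hne
  · exact ⟨h₁, h₂⟩
  · exact ⟨h₁, h₂⟩
  · obtain ⟨o, D, B, rfl, hD, hD', hB⟩ := h₃.exists_act
    simpa [Ty.carried, h₄, subst] using ⟨hD, hD'⟩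

theorem Gs_singleton (C : Ty) : Gs [C] = C.G := by simp [Gs]

/-- The component at position `f(C)` of the decomposition of a tail-recursive type performs its
first action. -/
theorem WF.G_f {C S D : Ty} {o : Bool} (h : C.WF) (ht : C.tr = true)
    (hu : C.unfold = Ty.act o [D] S) :
    1 ≤ C.f ∧ C.G[C.f - 1]? = some (Ty.mu (Ty.act o D.G Ty.tvar)) := by
  rcases h.cases_form with rfl | ⟨D, rfl, -⟩ | ⟨o, D, S, rfl, -, -, hS, -, hS'⟩ |
    ⟨M, A, h₁, h₂, h₃, h₄, h₅, h₆, h₇, -⟩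
  · simp [tr] at ht
  · simp [tr] at ht
  · simp [tr, hS'] at ht
  · obtain ⟨l, hl⟩ := h₂.exists_append_R
    have hf : C.f = l.length + 1 := by
      rw [Ty.f, h₄, h₃.fAux_subst, hl, List.length_append]; omega
    obtain ⟨o', D', B, rfl, hD, hD', hB⟩ := h₃.exists_act
    rw [h₄, subst] at hu
    simp only [act.injEq, List.cons.injEq, and_true] at hu
    obtain ⟨rfl, rfl, -⟩ := hu
    rw [hf, h₆, hl]
    simp [R, Gs_singleton]

theorem mem_R : ∀ {S M : Ty}, M ∈ S.R → ∃ o Cs, M = Ty.mu (Ty.act o Cs Ty.tvar)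
  | Ty.act o ps S, M, h => by
      rw [R, List.mem_cons] at h
      rcases h with rfl | h
      · exact ⟨_, _, rfl⟩
      · exact mem_R h
  | Ty.endT, _, h => by simp [R] at h
  | Ty.tvar, _, h => by simp [R] at h
  | mu _, _, h => by simp [R] at h
  | shared _, _, h => by simp [R] at h

theorem WF.G_of_tr {C M : Ty} (h : C.WF) (ht : C.tr = true) (hM : M ∈ C.G) :
    ∃ o Cs, M = Ty.mu (Ty.act o Cs Ty.tvar) := by
  rcases h.cases_form with rfl | ⟨D, rfl, -⟩ | ⟨o, D, S, rfl, -, -, hS, -, hS'⟩ |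
    ⟨S, A, h₁, h₂, h₃, h₄, h₅, h₆, h₇, -⟩
  · simp [tr] at ht
  · simp [tr] at ht
  · simp [tr, hS'] at ht
  · rw [h₆] at hM; exact mem_R hM

/-- The first component of a finite session type performs its first action, and the others are the
components of its continuation, if this is not `end`. -/
theorem WF.G_of_lin {C : Ty} (h : C.WF) (hl : C.lin = true) (hne : C ≠ Ty.endT) :
    ∃ o D S, C = Ty.act o [D] S ∧ S.lin = true ∧
      C.G = Ty.act o D.G Ty.endT :: (if S.isEnd then [] else S.G) := by
  rcases h.cases_form with rfl | ⟨D, rfl, -⟩ | ⟨o, D, S, rfl, -, -, hS, hS', hS''⟩ |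
    ⟨S, A, h₁, h₂, h₃, h₄, h₅, h₆, h₇, -⟩
  · simp at hne
  · simp [lin, isShared] at hl
  · refine ⟨_, _, _, rfl, by simp [lin, hS', hS''], ?_⟩
    simp only [G, hS'', Gs_singleton]
    split_ifs <;> simp_all
  · simp [lin, h₅] at hl

theorem WF.G_of_shared {C : Ty} (h : C.WF) (hl : C.isShared = true) :
    ∃ D, C = Ty.shared [D] ∧ C.G = [Ty.shared D.G] := by
  rcases h.cases_form with rfl | ⟨D, rfl, -⟩ | ⟨o, D, S, rfl, -, -, hS, hS', hS''⟩ |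
    ⟨S, A, h₁, h₂, h₃, h₄, h₅, h₆, h₇, -⟩
  · simp [isShared] at hl
  · exact ⟨D, rfl, by simp [G, Gs_singleton]⟩
  · simp [isShared] at hl
  · simp [h₇] at hl

/-- The components of a type are shared types if and only if the type is. -/
theorem WF.isShared_of_mem_G : ∀ {C M : Ty}, C.WF → M ∈ C.G → M.isShared = C.isShared
  | C, M, h, hM => by
    rcases hC : C.isShared with _ | _
    · by_cases ht : C.tr = true
      · obtain ⟨o, Cs, rfl⟩ := h.G_of_tr ht hM; rfl
      · by_cases he : C = Ty.endT
        · subst he; simp [G] at hM; subst hM; rfl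
        · obtain ⟨o, D, S, rfl, h₁, h₂⟩ := h.G_of_lin (by simp [lin, hC, ht]) he
          rw [h₂, List.mem_cons] at hM
          rcases hM with rfl | hM
          · rfl
          · split at hM
            · simp at hM
            · have hS : S.WF := h.next
              rw [hS.isShared_of_mem_G hM]
              simpa [lin] using (show S.isShared = false by
                simp [lin] at h₁; exact h₁.1)
    · obtain ⟨D, rfl, h₂⟩ := h.G_of_shared hC
      rw [h₂, List.mem_singleton] at hM; subst hM; rfl
  termination_by C => sizeOf C

theorem WF.G_ne_nil {C : Ty} (h : C.WF) : C.G ≠ [] := by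
  rcases h.cases_form with rfl | ⟨D, rfl, -⟩ | ⟨o, D, S, rfl, -, -, hS, hS', hS''⟩ |
    ⟨S, A, h₁, h₂, h₃, h₄, h₅, h₆, h₇, -⟩
  · simp [G]
  · simp [G]
  · simp only [G, hS'']; split_ifs <;> simp_all
  · obtain ⟨o, D, B, rfl, -⟩ := h₁.exists_act
    simp [h₆, R]

/-! ### Duality -/

theorem dual_dual : ∀ C : Ty, C.dual.dual = C
  | endT => rfl
  | tvar => rfl
  | Ty.act o ps S => by simp [dual, dual_dual S]
  | mu S => by simp [dual, dual_dual S]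
  | shared _ => rfl

theorem dual_isShared (C : Ty) : C.dual.isShared = C.isShared := by cases C <;> rfl

theorem dual_isEnd (C : Ty) : C.dual.isEnd = C.isEnd := by cases C <;> rfl

theorem dual_tr : ∀ C : Ty, C.dual.tr = C.tr
  | endT => rfl
  | tvar => rfl
  | Ty.act o ps S => by simpa [dual, tr] using dual_tr S
  | mu S => rfl
  | shared _ => rfl

theorem dual_R : ∀ C : Ty, C.dual.R = C.R.map dual
  | endT => by simp [dual, R]
  | tvar => by simp [dual, R]
  | Ty.act o ps S => by simp [dual, R, dual_R S]
  | mu S => by simp [dual, R]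
  | shared _ => by simp [dual, R]

theorem dual_G : ∀ C : Ty, C.dual.G = C.G.map dual
  | endT => by simp [dual, G]
  | tvar => by simp [dual, G]
  | Ty.act o ps S => by
      simp only [dual, G, dual_tr, dual_isEnd, dual_G S]
      split_ifs <;> simp [dual]
  | mu S => by simp [dual, G, dual_R]
  | shared _ => by simp [dual, G]

theorem dual_subst (T : Ty) : ∀ S : Ty, (subst T S).dual = subst T.dual S.dual
  | endT => rfl
  | tvar => rfl
  | Ty.act o ps S => by simp [dual, subst, dual_subst T S]
  | mu S => rfl
  | shared _ => rfl

theorem Suffix.dual {A S : Ty} (h : Suffix A S) : Suffix A.dual S.dual := by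
  induction h with
  | refl => exact .refl _
  | step o ps h ih => exact .step _ _ ih

theorem Body.dual : ∀ {S : Ty}, Body S → Body S.dual
  | _, .last h₁ h₂ => .last h₁ h₂
  | _, .cons h₁ h₂ h => .cons h₁ h₂ h.dual

theorem WF.dual : ∀ {C : Ty}, C.WF → C.dual.WF
  | _, .endT => .endT
  | _, .shared h₁ h₂ => .shared h₁ h₂
  | _, .act h₁ h₂ h₃ h₄ h₅ =>
      .act h₁ h₂ h₃.dual (by simp [dual_isShared, h₄]) (by simp [dual_tr, h₅])
  | _, .mu h => .mu h.dual
  | _, .unf h₁ h₂ => by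
      rw [dual_subst]; exact .unf h₁.dual h₂.dual

end Ty

/-! ### Inversion of the type system -/

open Classical in
/-- The linear environment that assigns to the names of `L` their types under `T`, as far as these
are session types. -/
noncomputable def linEnv (T : Name → Ty) (L : Set Name) : Env :=
  fun n => if n ∈ L ∧ (T n).isShared = false then some (T n) else none

open Classical in
/-- The shared environment that assigns to the names of `L` their types under `T`, as far as these
are types of shared names. -/
noncomputable def shEnv (T : Name → Ty) (L : Set Name) : Env :=
  fun n => if n ∈ L ∧ (T n).isShared = true then some (T n) else none

/-- `Γ;Δ ⊢ v ▷ C`, where `Δ'` is what remains of `Δ` when `v` is sent. -/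
def Sends (Γ Δ : Env) (v : Name) (C : Ty) (Δ' : Env) : Prop :=
  (Γ v = some C ∧ C.isShared = true ∧ Δ' = Δ) ∨
    (C.isShared = false ∧ ∃ S, Δ v = some S ∧ S.unfold = C.unfold ∧ Δ' = Δ.upd v none)

/-- The subject `u` performs an action carrying `C̃`, which turns `Δ` into `Δ'`. -/
def Acts (Γ Δ : Env) (u : Name) (o : Bool) (Cs : List Ty) (Δ' : Env) : Prop :=
  (∃ S S', Δ u = some S ∧ S.unfold = .act o Cs S' ∧ Δ' = Δ.upd u (some S')) ∨
    (Γ u = some (.shared Cs) ∧ Δ' = Δ)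

namespace Env

theorem upd_comm {E : Env} {m n : Name} (h : m ≠ n) (a b : Option Ty) :
    (E.upd m a).upd n b = (E.upd n b).upd m a := by
  funext w; simp only [upd]; grind

theorem Eqv.upd {E F : Env} (h : Eqv E F) (n : Name) (a : Option Ty) :
    Eqv (E.upd n a) (F.upd n a) := by
  intro w; have := h w; simp only [Env.upd]; grind

theorem Eqv.symm {E F : Env} (h : Eqv E F) : Eqv F E := fun n => (h n).symm

theorem Eqv.eq_some {E F : Env} (h : Eqv E F) {n : Name} {S : Ty} (hn : E n = some S) :
    ∃ T, F n = some T ∧ T.unfold = S.unfold := by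
  have := h n
  rw [hn] at this
  rcases hF : F n with _ | T
  · simp [hF] at this
  · rw [hF] at this; exact ⟨T, rfl, by simpa using this.symm⟩

theorem Eqv.eq_none {E F : Env} (h : Eqv E F) {n : Name} : E n = none ↔ F n = none := by
  have := h n
  rcases hE : E n with _ | T <;> rcases hF : F n with _ | T' <;> simp_all

end Env

open Env

theorem Sends.upd {Γ Δ Δ' : Env} {v w : Name} {C T : Ty} (h : Sends Γ Δ v C Δ') (hw : Δ w = none) :
    Sends Γ (Δ.upd w (some T)) v C (Δ'.upd w (some T)) ∧ Δ' w = none := by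
  rcases h with ⟨h₁, h₂, rfl⟩ | ⟨h₁, S, h₂, h₃, rfl⟩
  · exact ⟨.inl ⟨h₁, h₂, rfl⟩, hw⟩
  · have : v ≠ w := by rintro rfl; simp [hw] at h₂
    refine ⟨.inr ⟨h₁, S, by simp [Env.upd, this, h₂], h₃, upd_comm this _ _⟩, ?_⟩
    simp [Env.upd, hw]

theorem Sends.eqv {Γ Δ Δ' F : Env} {v : Name} {C : Ty} (h : Sends Γ Δ v C Δ') (hF : Eqv Δ F) :
    ∃ F', Sends Γ F v C F' ∧ Eqv Δ' F' := by
  rcases h with ⟨h₁, h₂, rfl⟩ | ⟨h₁, S, h₂, h₃, rfl⟩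
  · exact ⟨F, .inl ⟨h₁, h₂, rfl⟩, hF⟩
  · obtain ⟨T, hT, hT'⟩ := hF.eq_some h₂
    exact ⟨_, .inr ⟨h₁, T, hT, hT'.trans h₃, rfl⟩, hF.upd _ _⟩

theorem Acts.upd {Γ Δ Δ' : Env} {u w : Name} {Cs : List Ty} {o : Bool} {T : Ty}
    (h : Acts Γ Δ u o Cs Δ') (hw : Δ w = none) :
    Acts Γ (Δ.upd w (some T)) u o Cs (Δ'.upd w (some T)) ∧ Δ' w = none := by
  rcases h with ⟨S, S', h₁, h₂, rfl⟩ | ⟨h₁, rfl⟩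
  · have : u ≠ w := by rintro rfl; simp [hw] at h₁
    refine ⟨.inl ⟨S, S', by simp [Env.upd, this, h₁], h₂, upd_comm this _ _⟩, ?_⟩
    simp [Env.upd, hw, this.symm]
  · exact ⟨.inr ⟨h₁, rfl⟩, hw⟩

theorem Acts.eqv {Γ Δ Δ' F : Env} {u : Name} {Cs : List Ty} {o : Bool}
    (h : Acts Γ Δ u o Cs Δ') (hF : Eqv Δ F) : ∃ F', Acts Γ F u o Cs F' ∧ Eqv Δ' F' := by
  rcases h with ⟨S, S', h₁, h₂, rfl⟩ | ⟨h₁, rfl⟩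
  · obtain ⟨T, hT, hT'⟩ := hF.eq_some h₁
    exact ⟨_, .inl ⟨T, S', hT, hT'.trans h₂, rfl⟩, hF.upd _ _⟩
  · exact ⟨F, .inr ⟨h₁, rfl⟩, hF⟩

theorem Env.Split.eq_left {Δ Δ₁ Δ₂ : Env} (h : Split Δ Δ₁ Δ₂) (h₂ : Δ₂ = empty) : Δ₁ = Δ := by
  funext n; rcases h n with h | h <;> simp_all [empty]

theorem Vals.sends {Γ Δ Δ₁ Δ₂ : Env} {v : Name} {Cs : List Ty} (h : Vals Γ Δ₂ [v] Cs)
    (hs : Split Δ Δ₁ Δ₂) : ∃ C, Cs = [C] ∧ Sends Γ Δ v C Δ₁ := by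
  rcases h with _ | ⟨h₁, h₂, h₃⟩ | ⟨h₁, h₂, h₃, h₄⟩
  · cases h₃
    exact ⟨_, rfl, .inl ⟨h₁, h₂, hs.eq_left rfl⟩⟩
  · generalize hE : Env.upd Δ₂ v none = E at h₄
    cases h₄
    refine ⟨_, rfl, .inr ⟨h₃, _, ?_, h₂, ?_⟩⟩
    · rcases hs v with h | h <;> simp_all
    · funext n
      have := congrFun hE n
      have := hs n
      simp only [Env.upd, empty] at *
      grind

theorem Typed.inv_nil {Γ Ξ Δ} (h : Typed Γ Ξ Δ .nil) {n : Name} {S : Ty} (hn : Δ n = some S) :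
    S.unfold = .endT := by
  generalize hP : Proc.nil = P at h
  induction h generalizing S with
  | nil => simp [empty] at hn
  | ended h h₁ h₂ ih =>
    simp only [Env.upd] at hn
    split at hn
    · simp at hn; subst hn; rfl
    · exact ih hn hP
  | unf h he ih =>
    obtain ⟨T, hT, hT'⟩ := he.symm.eq_some hn
    rw [← hT']; exact ih hT hP
  | _ => cases hP

/-- Since weakening and unfolding can be moved into the premises, a typing of a source output ends
with the rule for outputs; what the object and the subject take from the environment is given by
`Sends` and `Acts`. -/
theorem Typed.inv_out {Γ Ξ Δ u v P} (h : Typed Γ Ξ Δ (.out u [v] P)) :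
    ∃ C Δ₁ Δ₂, Sends Γ Δ v C Δ₁ ∧ Acts Γ Δ₁ u true [C] Δ₂ ∧ Typed Γ Ξ Δ₂ P := by
  generalize hQ : Proc.out u [v] P = Q at h
  induction h with
  | ended h h₁ h₂ ih =>
    obtain ⟨C, Δ₁, Δ₂, hs, ha, ht⟩ := ih hQ
    obtain ⟨hs', hw⟩ := hs.upd (T := .endT) h₂
    obtain ⟨ha', hw'⟩ := ha.upd (T := .endT) hw
    exact ⟨C, _, _, hs', ha', ht.ended h₁ hw'⟩
  | unf h he ih =>
    obtain ⟨C, Δ₁, Δ₂, hs, ha, ht⟩ := ih hQ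
    obtain ⟨F, hs', he'⟩ := hs.eqv he
    obtain ⟨F', ha', he''⟩ := ha.eqv he'
    exact ⟨C, _, _, hs', ha', ht.unf he''⟩
  | send hsp h₁ h₂ h₃ =>
    cases hQ
    obtain ⟨C, rfl, hs⟩ := h₃.sends hsp
    exact ⟨C, _, _, hs, .inl ⟨_, _, h₁, rfl, rfl⟩, h₂⟩
  | req h₁ hsp h₂ h₃ =>
    cases hQ
    obtain ⟨C, rfl, hs⟩ := h₃.sends hsp
    exact ⟨C, _, _, hs, .inr ⟨h₁, rfl⟩, h₂⟩
  | _ => cases hQ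

theorem Env.lookup_zip_eq_none {w : Name} : ∀ {ys : List Name} {Cs : List Ty}, w ∉ ys →
    (ys.zip Cs).lookup w = none
  | [], _, _ => rfl
  | _ :: _, [], _ => rfl
  | y :: ys, C :: Cs, h => by
      simp only [List.mem_cons, not_or] at h
      simp [List.lookup_cons, lookup_zip_eq_none h.2, beq_false_of_ne h.1]

theorem Env.bindShared_of_notMem (Γ : Env) {w : Name} {ys : List Name} (Cs : List Ty)
    (h : w ∉ ys) : bindShared Γ ys Cs w = Γ w := by
  simp only [bindShared, lookup_zip_eq_none h]

theorem Env.bindLinear_of_notMem (Δ : Env) {w : Name} {ys : List Name} (Cs : List Ty)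
    (h : w ∉ ys) : bindLinear Δ ys Cs w = Δ w := by
  simp only [bindLinear, lookup_zip_eq_none h]

theorem Env.bindLinear_upd {Δ : Env} {ys : List Name} {Cs : List Ty} {w : Name} (a : Option Ty)
    (hw : w ∉ ys) : bindLinear (Δ.upd w a) ys Cs = (bindLinear Δ ys Cs).upd w a := by
  funext n
  by_cases hn : n = w
  · subst hn; simp [bindLinear_of_notMem _ _ hw, Env.upd]
  · simp [bindLinear, Env.upd, hn]

theorem Env.bindLinear_eqv {Δ F : Env} (h : Eqv Δ F) (ys : List Name) (Cs : List Ty) :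
    Eqv (bindLinear Δ ys Cs) (bindLinear F ys Cs) := by
  intro n
  simp only [bindLinear]
  split
  · rfl
  · exact h n

/-- The hypothesis `hy` excludes that the bound name also occurs in the environment: its entry
there would be overwritten. -/
theorem Typed.inv_inp {Γ Ξ Δ u y P} (h : Typed Γ Ξ Δ (.inp u [y] P)) (hy : Δ y = none) :
    ∃ C Δ₁, Acts Γ Δ u false [C] Δ₁ ∧ Δ₁ y = none ∧
      Typed (bindShared Γ [y] [C]) Ξ (bindLinear Δ₁ [y] [C]) P := by
  generalize hQ : Proc.inp u [y] P = Q at h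
  induction h with
  | @ended Γ Ξ Δ Q w h h₁ h₂ ih =>
    have hyw : w ≠ y := by rintro rfl; simp [Env.upd] at hy
    obtain ⟨C, Δ₁, ha, hy', ht⟩ := ih (by simpa [Env.upd, hyw.symm] using hy) hQ
    obtain ⟨ha', hw⟩ := ha.upd (T := .endT) h₂
    refine ⟨C, _, ha', by simp [Env.upd, hyw.symm, hy'], ?_⟩
    rw [bindLinear_upd _ (by simpa using hyw)]
    refine ht.ended ?_ ?_
    · rw [bindShared_of_notMem _ _ (by simpa using hyw), h₁]
    · rw [bindLinear_of_notMem _ _ (by simpa using hyw), hw]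
  | unf h he ih =>
    obtain ⟨C, Δ₁, ha, hy', ht⟩ := ih (he.eq_none.2 hy) hQ
    obtain ⟨F, ha', he'⟩ := ha.eqv he
    exact ⟨C, F, ha', he'.eq_none.1 hy', ht.unf (bindLinear_eqv he' _ _)⟩
  | @rcv Γ Ξ Δ u ys Cs S P h₁ hnd hl hys h₂ =>
    cases hQ
    obtain ⟨C, rfl⟩ := List.length_eq_one_iff.1 hl.symm
    refine ⟨C, _, .inl ⟨_, _, h₁, rfl, rfl⟩, ?_, h₂⟩
    have : y ≠ u := by rintro rfl; simp [hy] at h₁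
    simp [Env.upd, this, hy]
  | acc h₁ hnd hl hys h₂ =>
    cases hQ
    obtain ⟨C, rfl⟩ := List.length_eq_one_iff.1 hl.symm
    exact ⟨C, _, .inr ⟨h₁, rfl⟩, hy, h₂⟩
  | _ => cases hQ

theorem Typed.inv_par {Γ Ξ Δ P Q} (h : Typed Γ Ξ Δ (.par P Q)) :
    ∃ Δ₁ Δ₂, Split Δ Δ₁ Δ₂ ∧ Typed Γ Ξ Δ₁ P ∧ Typed Γ Ξ Δ₂ Q := by
  generalize hR : Proc.par P Q = R at h
  induction h with
  | @ended Γ Ξ Δ R w h h₁ h₂ ih =>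
    obtain ⟨Δ₁, Δ₂, hs, hP, hQ⟩ := ih hR
    have : Δ₁ w = none ∧ Δ₂ w = none := by rcases hs w with h | h <;> simp_all
    refine ⟨Δ₁.upd w (some .endT), Δ₂, ?_, hP.ended h₁ this.1, hQ⟩
    intro n
    have := hs n
    simp only [Env.upd]
    grind
  | @unf Γ Ξ Δ Δ' R h he ih =>
    obtain ⟨Δ₁, Δ₂, hs, hP, hQ⟩ := ih hR
    refine ⟨fun n => if Δ₁ n = none then none else Δ' n,
      fun n => if Δ₂ n = none then none else Δ' n,
      ?_, hP.unf ?_, hQ.unf ?_⟩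
    · intro n
      have := he.eq_none (n := n)
      have := hs n
      grind
    · intro n
      have := he n
      have := hs n
      grind
    · intro n
      have := he n
      have := hs n
      grind
  | par hs hP hQ =>
    cases hR
    exact ⟨_, _, hs, hP, hQ⟩
  | _ => cases hR

theorem Typed.inv_res {Γ Ξ Δ n C P} (h : Typed Γ Ξ Δ (.res n C P)) (hC : C.isShared = true)
    (hn : Δ n = none) : Typed (Γ.upd n (some C)) Ξ Δ P := by
  generalize hR : Proc.res n C P = R at h
  induction h with
  | @ended Γ Ξ Δ R w h h₁ h₂ ih =>
    have hw : w ≠ n := by rintro rfl; simp [Env.upd] at hn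
    refine (ih (by simpa [Env.upd, hw.symm] using hn) hR).ended ?_ h₂
    simp [Env.upd, hw, h₁]
  | unf h he ih => exact (ih (he.eq_none.2 hn) hR).unf he
  | res _ _ h => cases hR; exact h
  | resS h => cases hR; simp [hC] at h
  | _ => cases hR

theorem Typed.inv_resS {Γ Ξ Δ n C P} (h : Typed Γ Ξ Δ (.res n C P)) (hC : C.isShared = false)
    (hn : Δ n = none) (hn' : Δ n.dual = none) :
    Typed ((Γ.upd n none).upd n.dual none) Ξ
      ((Δ.upd n (some C)).upd n.dual (some C.dual)) P := by
  generalize hR : Proc.res n C P = R at h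
  induction h with
  | @ended Γ Ξ Δ R w h h₁ h₂ ih =>
    have hw : w ≠ n := by rintro rfl; simp [Env.upd] at hn
    have hw' : w ≠ n.dual := by rintro rfl; simp [Env.upd] at hn'
    rw [upd_comm hw, upd_comm hw']
    refine (ih (by simpa [Env.upd, hw.symm] using hn) (by simpa [Env.upd, hw'.symm] using hn')
      hR).ended ?_ ?_
    · simp [Env.upd, h₁]
    · simp [Env.upd, hw, hw', h₂]
  | unf h he ih =>
    exact (ih (he.eq_none.2 hn) (he.eq_none.2 hn') hR).unf ((he.upd _ _).upd _ _)
  | res h => cases hR; simp [hC] at h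
  | resS _ _ _ h => cases hR; exact h
  | _ => cases hR

/-- `Δ₀` is `Δ` up to unfolding and up to names of type `end`. -/
def Env.EqvEnd (Δ₀ Δ : Env) : Prop :=
  ∀ n, (Δ n).map Ty.unfold = (Δ₀ n).map Ty.unfold ∨
    (Δ₀ n = none ∧ (Δ n).map Ty.unfold = some .endT)

theorem Typed.inv_pvar {Γ Ξ Δ X} (h : Typed Γ Ξ Δ (.pvar X)) :
    ∃ Δ₀, Ξ X = some Δ₀ ∧ EqvEnd Δ₀ Δ := by
  generalize hR : Proc.pvar X = R at h
  induction h with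
  | @ended Γ Ξ Δ R w h h₁ h₂ ih =>
    obtain ⟨Δ₀, h₀, he⟩ := ih hR
    refine ⟨Δ₀, h₀, fun n => ?_⟩
    have := he n
    by_cases hn : n = w
    · subst hn; simp_all [Env.upd, Ty.unfold]
    · simpa [Env.upd, hn] using this
  | unf h he ih =>
    obtain ⟨Δ₀, h₀, he'⟩ := ih hR
    exact ⟨Δ₀, h₀, fun n => by rw [← he n]; exact he' n⟩
  | rvar h => cases hR; exact ⟨_, h, fun n => .inl rfl⟩
  | _ => cases hR

/-- The rule for recursion can be preceded by weakening and unfolding, so the environment `Δ₀`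
assigned to `X` need not be `Δ` itself. -/
theorem Typed.inv_mu {Γ Ξ Δ X P} (h : Typed Γ Ξ Δ (.mu X P)) :
    ∃ Δ₀, EqvEnd Δ₀ Δ ∧ (∀ n, Δ₀ n ≠ none → n ∈ P.fn) ∧
      Typed Γ (Function.update Ξ X (some Δ₀)) Δ₀ P := by
  generalize hR : Proc.mu X P = R at h
  induction h with
  | @ended Γ Ξ Δ R w h h₁ h₂ ih =>
    obtain ⟨Δ₀, he, h₀⟩ := ih hR
    refine ⟨Δ₀, fun n => ?_, h₀⟩
    have := he n
    by_cases hn : n = w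
    · subst hn; simp_all [Env.upd, Ty.unfold]
    · simpa [Env.upd, hn] using this
  | unf h he ih =>
    obtain ⟨Δ₀, he', h₀⟩ := ih hR
    exact ⟨Δ₀, fun n => by rw [← he n]; exact he' n, h₀⟩
  | recur h₁ h₂ => cases hR; exact ⟨_, fun n => .inl rfl, h₁, h₂⟩
  | _ => cases hR

/-! ### Free names and the typing environments -/

theorem Vals.dom_of_mem {Γ Δ : Env} {vs : List Name} {Cs : List Ty} (h : Vals Γ Δ vs Cs)
    {n : Name} (hn : n ∈ vs) : Γ n ≠ none ∨ Δ n ≠ none := by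
  induction h with
  | nil => simp at hn
  | shared h₁ h₂ h₃ ih =>
    rcases List.mem_cons.1 hn with rfl | hn
    · simp [h₁]
    · exact ih hn
  | session h₁ h₂ h₃ h₄ ih =>
    rcases List.mem_cons.1 hn with rfl | hn
    · simp [h₁]
    · refine (ih hn).imp id fun h => ?_
      simp only [Env.upd] at h
      grind

theorem Vals.mem_of_dom {Γ Δ : Env} {vs : List Name} {Cs : List Ty} (h : Vals Γ Δ vs Cs)
    {n : Name} (hn : Δ n ≠ none) : n ∈ vs := by
  induction h with
  | nil => simp [empty] at hn
  | shared h₁ h₂ h₃ ih => exact List.mem_cons_of_mem _ (ih hn)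
  | @session Δ Δ' v vs S T Cs h₁ h₂ h₃ h₄ ih =>
    by_cases hv : n = v
    · exact hv ▸ List.mem_cons_self
    · exact List.mem_cons_of_mem _ (ih (by simpa [Env.upd, hv] using hn))

theorem Typed.dom_of_mem_fn {Γ Ξ Δ P} (h : Typed Γ Ξ Δ P) {n : Name} (hn : n ∈ P.fn) :
    Γ n ≠ none ∨ Δ n ≠ none := by
  induction h with
  | nil => simp [Proc.fn] at hn
  | ended h h₁ h₂ ih =>
    refine (ih hn).imp id fun h => ?_
    simp only [Env.upd]; grind
  | unf h he ih => exact (ih hn).imp id (by rw [ne_eq, he.eq_none]; exact id)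
  | rvar => simp [Proc.fn] at hn
  | recur h₁ h₂ ih => exact ih hn
  | par hs hP hQ ihP ihQ =>
    rw [Proc.fn, List.mem_append] at hn
    have := hs n
    grind
  | res h₁ h₂ h₃ ih =>
    simp only [Proc.fn, List.mem_filter, decide_eq_true_eq] at hn
    simpa [Env.upd, hn.2.1] using ih hn.1
  | resS h₁ h₂ h₃ h₄ ih =>
    simp only [Proc.fn, List.mem_filter, decide_eq_true_eq] at hn
    simpa [Env.upd, hn.2.1, hn.2.2] using ih hn.1
  | send hs h₁ h₂ h₃ ih =>
    simp only [Proc.fn, List.mem_cons, List.mem_append] at hn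
    have := hs n
    have := @Vals.dom_of_mem _ _ _ _ h₃ n
    simp only [Env.upd] at ih
    grind
  | rcv h₁ h₂ h₃ h₄ h₅ ih =>
    simp only [Proc.fn, List.mem_cons, List.mem_filter, decide_eq_true_eq] at hn
    rcases hn with rfl | ⟨hn, hy⟩
    · simp [h₁]
    · have := ih hn
      rw [bindShared_of_notMem _ _ hy, bindLinear_of_notMem _ _ hy] at this
      simp only [Env.upd] at this
      grind
  | req h₀ hs h₁ h₃ ih =>
    simp only [Proc.fn, List.mem_cons, List.mem_append] at hn
    have := hs n
    have := @Vals.dom_of_mem _ _ _ _ h₃ n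
    grind
  | acc h₁ h₂ h₃ h₄ h₅ ih =>
    simp only [Proc.fn, List.mem_cons, List.mem_filter, decide_eq_true_eq] at hn
    rcases hn with rfl | ⟨hn, hy⟩
    · simp [h₁]
    · have := ih hn
      rwa [bindShared_of_notMem _ _ hy, bindLinear_of_notMem _ _ hy] at this

theorem Proc.ne_of_notMem_nameBase {b : ℕ} {p : Bool} {i : ℕ} {m : Name}
    (h : b ∉ nameBase m) : Name.ch b p i ≠ m ∧ Name.ch b p i ≠ m.dual := by
  cases m <;> simp_all [nameBase, Name.dual]

/-- A name of the linear environment that is not free in the process either has type `end` or is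
passed on to a process variable. -/
theorem Typed.end_or_passed {Γ Ξ Δ P} (h : Typed Γ Ξ Δ P) {b : ℕ} {p : Bool} {i : ℕ} {S : Ty}
    (hS : Δ (.ch b p i) = some S) (hb : b ∉ P.bound) (hn : .ch b p i ∉ P.fn) :
    S.unfold = .endT ∨ ∃ Y Δ', P.frv Y = true ∧ Ξ Y = some Δ' ∧ Δ' (.ch b p i) ≠ none := by
  set n := Name.ch b p i with hnb
  induction h generalizing S with
  | nil => simp [empty] at hS
  | ended h h₁ h₂ ih =>
    simp only [Env.upd] at hS
    split at hS
    · left; cases hS; rfl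
    · exact ih hb hS hn
  | unf h he ih =>
    obtain ⟨T, hT, hT'⟩ := he.symm.eq_some hS
    rw [← hT']; exact ih hb hT hn
  | rvar h => exact .inr ⟨_, _, by simp [Proc.frv], h, by simp [hS]⟩
  | recur h₁ h₂ ih => exact absurd (h₁ n (by simp [hS])) hn
  | par hs hP hQ ihP ihQ =>
    simp only [Proc.fn, List.mem_append, not_or] at hn
    simp only [Proc.bound, List.mem_append, not_or] at hb
    rcases hs n with ⟨h₁, h₂⟩ | ⟨h₁, h₂⟩
    · refine (ihP hb.1 (h₁ ▸ hS) hn.1).imp id ?_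
      rintro ⟨Y, Δ', hY, h⟩
      exact ⟨Y, Δ', by simp [Proc.frv, hY], h⟩
    · refine (ihQ hb.2 (h₁ ▸ hS) hn.2).imp id ?_
      rintro ⟨Y, Δ', hY, h⟩
      exact ⟨Y, Δ', by simp [Proc.frv, hY], h⟩
  | @res Γ Ξ Δ m C P h₁ h₂ h₃ ih =>
    simp only [Proc.fn, List.mem_filter, decide_eq_true_eq, not_and, not_not] at hn
    simp only [Proc.bound, List.mem_append, not_or] at hb
    obtain ⟨hm, hm'⟩ := Proc.ne_of_notMem_nameBase (p := p) (i := i) hb.1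
    exact ih hb.2 hS fun h => hm' (hn h hm)
  | @resS Γ Ξ Δ m C P h₁ h₂ h₃ h₄ ih =>
    simp only [Proc.fn, List.mem_filter, decide_eq_true_eq, not_and, not_not] at hn
    have hm : n ≠ m := by rintro rfl; simp [hS] at h₂
    have hm' : n ≠ m.dual := fun h => by simp [← h, hS] at h₃
    exact ih (by simp [Proc.bound] at hb; exact hb.2) (by simpa [Env.upd, hm, hm'] using hS)
      fun h => hm' (hn h hm)
  | @send Γ Ξ Δ Δ₁ Δ₂ u vs Cs S' P hs h₁ h₂ h₃ ih =>
    simp only [Proc.fn, List.mem_cons, List.mem_append, not_or] at hn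
    have := @Vals.mem_of_dom _ _ _ _ h₃ n
    refine ih hb ?_ hn.2.2
    have := hs n
    simp only [Env.upd]
    grind
  | @rcv Γ Ξ Δ u ys Cs S' P h₁ h₂ h₃ h₄ h₅ ih =>
    simp only [Proc.fn, List.mem_cons, List.mem_filter, decide_eq_true_eq, not_or, not_and,
      not_not] at hn
    have hy : n ∉ ys := fun h => by simp [h₄ n h] at hS
    refine ih (by simp [Proc.bound] at hb; exact hb.2) ?_ fun h => hy (hn.2 h)
    rw [bindLinear_of_notMem _ _ hy]
    simpa [Env.upd, hn.1] using hS
  | req h₀ hs h₁ h₃ ih =>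
    simp only [Proc.fn, List.mem_cons, List.mem_append, not_or] at hn
    have := @Vals.mem_of_dom _ _ _ _ h₃ n
    refine ih hb ?_ hn.2.2
    have := hs n
    grind
  | @acc Γ Ξ Δ u ys Cs P h₁ h₂ h₃ h₄ h₅ ih =>
    simp only [Proc.fn, List.mem_cons, List.mem_filter, decide_eq_true_eq, not_or, not_and,
      not_not] at hn
    have hy : n ∉ ys := fun h => by simp [h₄ n h] at hS
    refine ih (by simp [Proc.bound] at hb; exact hb.2) ?_ fun h => hy (hn.2 h)
    rw [bindLinear_of_notMem _ _ hy]
    exact hS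

/-- Performing the first action of a type, up to unfolding. -/
def Ty.Step (A A' : Ty) : Prop := ∃ o Cs S, A = .act o Cs S ∧ A' = S.unfold

/-- A name that the environment `Δ'` of the process variable `Y` assigns a type to, has in `Δ` a
type that reduces to the one in `Δ'`; the type is used if the name is free in the process. -/
theorem Typed.reduces_of_frv {Γ Ξ Δ P} (h : Typed Γ Ξ Δ P) {Y : ℕ} {Δ' : Env} {b : ℕ} {p : Bool}
    {i : ℕ} {S' : Ty} (hY : P.frv Y = true) (hΞ : Ξ Y = some Δ')
    (hS : Δ' (.ch b p i) = some S') (hb : b ∉ P.bound) (hΓ : Γ (.ch b p i) = none) :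
    ∃ S, Δ (.ch b p i) = some S ∧ Relation.ReflTransGen Ty.Step S.unfold S'.unfold ∧
      (.ch b p i ∈ P.fn → Relation.TransGen Ty.Step S.unfold S'.unfold) := by
  set n := Name.ch b p i with hnb
  induction h with
  | nil => simp [Proc.frv] at hY
  | ended h h₁ h₂ ih =>
    obtain ⟨S, hS, h⟩ := ih hY hΞ hb hΓ
    refine ⟨S, ?_, h⟩
    simp only [Env.upd]; grind
  | unf h he ih =>
    obtain ⟨S, hS, h⟩ := ih hY hΞ hb hΓ
    obtain ⟨T, hT, hT'⟩ := he.eq_some hS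
    exact ⟨T, hT, hT' ▸ h⟩
  | rvar h =>
    simp only [Proc.frv, decide_eq_true_eq] at hY
    subst hY
    rw [h] at hΞ
    cases hΞ
    exact ⟨S', hS, .refl, by simp [Proc.fn]⟩
  | recur h₁ h₂ ih =>
    simp only [Proc.frv, Bool.and_eq_true, Bool.not_eq_true', decide_eq_false_iff_not] at hY
    exact ih hY.2 (by rw [Function.update_of_ne (Ne.symm hY.1), hΞ]) hb hΓ
  | @par Γ Ξ Δ Δ₁ Δ₂ P Q hs hP hQ ihP ihQ =>
    simp only [Proc.bound, List.mem_append, not_or] at hb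
    simp only [Proc.frv, Bool.or_eq_true] at hY
    have hsn := hs n
    rcases hY with hY | hY
    · obtain ⟨S, hS, h₁, h₂⟩ := ihP hY hΞ hb.1 hΓ
      refine ⟨S, by grind, h₁, fun hn => h₂ ?_⟩
      rw [Proc.fn, List.mem_append] at hn
      have := @Typed.dom_of_mem_fn _ _ _ _ hQ n
      grind
    · obtain ⟨S, hS, h₁, h₂⟩ := ihQ hY hΞ hb.2 hΓ
      refine ⟨S, by grind, h₁, fun hn => h₂ ?_⟩
      rw [Proc.fn, List.mem_append] at hn
      have := @Typed.dom_of_mem_fn _ _ _ _ hP n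
      grind
  | @res Γ Ξ Δ m C P h₁ h₂ h₃ ih =>
    simp only [Proc.bound, List.mem_append, not_or] at hb
    obtain ⟨hm, hm'⟩ := Proc.ne_of_notMem_nameBase (p := p) (i := i) hb.1
    obtain ⟨S, hS, h₁, h₂⟩ := ih hY hΞ hb.2 (by rw [← hnb] at hm; simpa [Env.upd, hm] using hΓ)
    exact ⟨S, hS, h₁, fun hn => h₂ (by simp [Proc.fn] at hn; exact hn.1)⟩
  | @resS Γ Ξ Δ m C P h₁ h₂ h₃ h₄ ih =>
    simp only [Proc.bound, List.mem_append, not_or] at hb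
    obtain ⟨hm, hm'⟩ := Proc.ne_of_notMem_nameBase (p := p) (i := i) hb.1
    rw [← hnb] at hm hm'
    obtain ⟨S, hS, h₁, h₂⟩ := ih hY hΞ hb.2 (by simpa [Env.upd, hm, hm'] using hΓ)
    exact ⟨S, by simpa [Env.upd, hm, hm'] using hS, h₁,
      fun hn => h₂ (by simp [Proc.fn] at hn; exact hn.1)⟩
  | @send Γ Ξ Δ Δ₁ Δ₂ u vs Cs S' P hs h₁ h₂ h₃ ih =>
    obtain ⟨S, hS, h₄, h₅⟩ := ih hY hΞ hb hΓ
    have hsn := hs n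
    have := @Vals.dom_of_mem _ _ _ _ h₃ n
    simp only [Proc.fn, List.mem_cons, List.mem_append]
    simp only [Env.upd] at hS
    by_cases hu : n = u
    · subst hu
      simp only [↓reduceIte, Option.some.injEq] at hS
      subst hS
      have hst : Ty.Step (Ty.unfold (.act true Cs S')) S'.unfold := ⟨_, _, _, rfl, rfl⟩
      exact ⟨.act true Cs S', by grind, .head hst h₄, fun _ => .head' hst h₄⟩
    · rw [if_neg hu] at hS
      exact ⟨S, by grind, h₄, by grind⟩
  | @rcv Γ Ξ Δ u ys Cs S' P h₁ h₂ h₃ h₄ h₅ ih =>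
    simp only [Proc.bound, List.mem_append, not_or] at hb
    have hy : n ∉ ys := fun h => hb.1 (List.mem_flatMap.2 ⟨n, h, by simp [hnb, Proc.nameBase]⟩)
    obtain ⟨S, hS, h₆, h₇⟩ := ih hY hΞ hb.2 (by rw [bindShared_of_notMem _ _ hy, hΓ])
    rw [bindLinear_of_notMem _ _ hy] at hS
    simp only [Proc.fn, List.mem_cons, List.mem_filter, decide_eq_true_eq]
    simp only [Env.upd] at hS
    by_cases hu : n = u
    · subst hu
      simp only [↓reduceIte, Option.some.injEq] at hS
      subst hS
      have hst : Ty.Step (Ty.unfold (.act false Cs S')) S'.unfold := ⟨_, _, _, rfl, rfl⟩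
      exact ⟨.act false Cs S', h₁, .head hst h₆, fun _ => .head' hst h₆⟩
    · rw [if_neg hu] at hS
      exact ⟨S, hS, h₆, by grind⟩
  | @req Γ Ξ Δ Δ₁ Δ₂ u vs Cs P h₀ hs h₁ h₃ ih =>
    obtain ⟨S, hS, h₄, h₅⟩ := ih hY hΞ hb hΓ
    have hsn := hs n
    have := @Vals.dom_of_mem _ _ _ _ h₃ n
    simp only [Proc.fn, List.mem_cons, List.mem_append]
    exact ⟨S, by grind, h₄, by grind⟩
  | @acc Γ Ξ Δ u ys Cs P h₁ h₂ h₃ h₄ h₅ ih =>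
    simp only [Proc.bound, List.mem_append, not_or] at hb
    have hy : n ∉ ys := fun h => hb.1 (List.mem_flatMap.2 ⟨n, h, by simp [hnb, Proc.nameBase]⟩)
    obtain ⟨S, hS, h₆, h₇⟩ := ih hY hΞ hb.2 (by rw [bindShared_of_notMem _ _ hy, hΓ])
    rw [bindLinear_of_notMem _ _ hy] at hS
    simp only [Proc.fn, List.mem_cons, List.mem_filter, decide_eq_true_eq]
    exact ⟨S, hS, h₆, by grind⟩

namespace Ty

/-- A finite type gets smaller with each action. -/
theorem WF.step {A A' : Ty} (h : A.WF) (ht : A.tr = false) (hs : Step A A') :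
    A'.WF ∧ A'.tr = false ∧ sizeOf A' < sizeOf A := by
  obtain ⟨o, Cs, S, rfl, rfl⟩ := hs
  have hS : S.WF := h.next
  have hu : S.unfold = S := by
    cases S <;> first | rfl | simp [tr] at ht
  rw [hu]
  exact ⟨hS, ht, by simp⟩

/-- Only a tail-recursive type can return to itself. -/
theorem WF.tr_of_transGen {C : Ty} (h : C.WF)
    (hs : Relation.TransGen Step C.unfold C.unfold) : C.tr = true := by
  by_contra ht
  rw [Bool.not_eq_true] at ht
  have hu : C.unfold = C := by
    cases C <;> first | rfl | simp [tr] at ht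
  rw [hu] at hs
  have key : ∀ A, Relation.TransGen Step C A → A.WF ∧ A.tr = false ∧ sizeOf A < sizeOf C := by
    intro A hA
    induction hA with
    | single hs => exact h.step ht hs
    | tail _ hs ih =>
      obtain ⟨h₁, h₂, h₃⟩ := ih
      obtain ⟨h₄, h₅, h₆⟩ := h₁.step h₂ hs
      exact ⟨h₄, h₅, h₆.trans h₃⟩
  exact lt_irrefl _ (key C hs).2.2

end Ty

/-- Linear environments are finite: they arise from the empty environment of `0`, and from those
assigned to process variables, by changes in finitely many places. So names of type `end` can be
added one at a time. -/
theorem Typed.finite_support {Γ Ξ Δ P} (h : Typed Γ Ξ Δ P)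
    (hΞ : ∀ Y Δ', Ξ Y = some Δ' → {n | Δ' n ≠ none}.Finite) : {n | Δ n ≠ none}.Finite := by
  have upd_fin : ∀ {E : Env} (u : Name) (a : Option Ty), {n | E n ≠ none}.Finite →
      {n | E.upd u a n ≠ none}.Finite := by
    intro E u a h
    refine (h.insert u).subset fun n hn => ?_
    simp only [Set.mem_ofPred_eq, Env.upd, Set.mem_insert_iff] at hn ⊢
    grind
  have of_upd : ∀ {E : Env} (u : Name) (a : Option Ty), {n | E.upd u a n ≠ none}.Finite →
      {n | E n ≠ none}.Finite := by
    intro E u a h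
    refine (h.insert u).subset fun n hn => ?_
    simp only [Set.mem_ofPred_eq, Env.upd, Set.mem_insert_iff] at hn ⊢
    grind
  have bind_fin : ∀ {E : Env} (ys : List Name) (Cs : List Ty),
      {n | bindLinear E ys Cs n ≠ none}.Finite → {n | E n ≠ none}.Finite := by
    intro E ys Cs h
    refine (h.union ys.toFinset.finite_toSet).subset fun n hn => ?_
    by_cases hy : n ∈ ys
    · exact .inr (by simpa using hy)
    · exact .inl (by simpa [bindLinear_of_notMem _ _ hy] using hn)
  have split_fin : ∀ {Δ Δ₁ Δ₂ : Env}, Split Δ Δ₁ Δ₂ → {n | Δ₁ n ≠ none}.Finite →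
      {n | Δ₂ n ≠ none}.Finite → {n | Δ n ≠ none}.Finite := by
    intro Δ Δ₁ Δ₂ hs h₁ h₂
    refine (h₁.union h₂).subset fun n hn => ?_
    have := hs n
    simp only [Set.mem_ofPred_eq, Set.mem_union] at hn ⊢
    grind
  have vals_fin : ∀ {Γ Δ : Env} {vs : List Name} {Cs : List Ty}, Vals Γ Δ vs Cs →
      {n | Δ n ≠ none}.Finite := by
    intro Γ Δ vs Cs h
    exact vs.toFinset.finite_toSet.subset fun n hn => by simpa using h.mem_of_dom hn
  induction h with
  | nil => simp [empty]
  | ended h h₁ h₂ ih => exact upd_fin _ _ (ih hΞ)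
  | unf h he ih => simpa only [ne_eq, he.eq_none] using ih hΞ
  | rvar h => exact hΞ _ _ h
  | recur h₁ h₂ ih =>
    exact (List.finite_toSet _).subset fun n hn => h₁ n hn
  | par hs hP hQ ihP ihQ => exact split_fin hs (ihP hΞ) (ihQ hΞ)
  | res h₁ h₂ h₃ ih => exact ih hΞ
  | resS h₁ h₂ h₃ h₄ ih => exact of_upd _ _ (of_upd _ _ (ih hΞ))
  | send hs h₁ h₂ h₃ ih => exact split_fin hs (of_upd _ _ (ih hΞ)) (vals_fin h₃)
  | rcv h₁ h₂ h₃ h₄ h₅ ih => exact of_upd _ _ (bind_fin _ _ (ih hΞ))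
  | req h₀ hs h₁ h₃ ih => exact split_fin hs (ih hΞ) (vals_fin h₃)
  | acc h₁ h₂ h₃ h₄ h₅ ih => exact bind_fin _ _ (ih hΞ)

/-! ### Typed source processes with total type assignments -/

theorem linEnv_eq_some {T : Name → Ty} {L : Set Name} {n : Name} {S : Ty} :
    linEnv T L n = some S ↔ n ∈ L ∧ (T n).isShared = false ∧ T n = S := by
  simp only [linEnv]; split <;> simp_all

theorem linEnv_eq_none {T : Name → Ty} {L : Set Name} {n : Name} :
    linEnv T L n = none ↔ (n ∈ L → (T n).isShared = true) := by
  simp [linEnv]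

theorem shEnv_eq_some {T : Name → Ty} {L : Set Name} {n : Name} {S : Ty} :
    shEnv T L n = some S ↔ n ∈ L ∧ (T n).isShared = true ∧ T n = S := by
  simp only [shEnv]; split <;> simp_all

theorem shEnv_eq_none {T : Name → Ty} {L : Set Name} {n : Name} :
    shEnv T L n = none ↔ (n ∈ L → (T n).isShared = false) := by
  simp [shEnv]

theorem linEnv_congr {T T' : Name → Ty} {L L' : Set Name}
    (h : ∀ n, n ∈ L ∧ (T n).isShared = false ↔ n ∈ L' ∧ (T' n).isShared = false)
    (hT : ∀ n ∈ L, (T n).isShared = false → T n = T' n) : linEnv T L = linEnv T' L' := by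
  funext n
  simp only [linEnv]
  have := h n
  have := hT n
  split_ifs <;> grind

theorem shEnv_congr {T T' : Name → Ty} {L L' : Set Name}
    (h : ∀ n, n ∈ L ∧ (T n).isShared = true ↔ n ∈ L' ∧ (T' n).isShared = true)
    (hT : ∀ n ∈ L, (T n).isShared = true → T n = T' n) : shEnv T L = shEnv T' L' := by
  funext n
  simp only [shEnv]
  have := h n
  have := hT n
  split_ifs <;> grind

theorem fupd_same {α : Type} (h : Name → α) (n : Name) (a : α) : fupd h n a n = a := by
  simp [fupd]

theorem fupd_of_ne {α : Type} (h : Name → α) {n m : Name} (a : α) (hm : m ≠ n) :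
    fupd h n a m = h m := by
  simp [fupd, hm]

theorem fupd_isShared {E : Name → Ty} {u : Name} (h : (E u).WF) (n : Name) :
    (fupd E u (E u).next n).isShared = (E n).isShared := by
  by_cases hn : n = u
  · subst hn; rw [fupd_same, h.next_isShared]
  · rw [fupd_of_ne _ _ hn]

/-- The type `C` offers an output (`o = true`) or an input of its carried type. -/
def Ty.Offers (C : Ty) (o : Bool) : Prop :=
  C.unfold = .act o [C.carried] C.next ∨ C = .shared [C.carried]

theorem Acts.inv {E : Name → Ty} {V V₁ : Set Name} {u : Name} {o : Bool} {C : Ty} {Δ' : Env}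
    (hwf : ∀ n ∈ V, (E n).WF) (hV : V₁ ⊆ V)
    (h : Acts (shEnv E V) (linEnv E V₁) u o [C] Δ') :
    u ∈ V ∧ (E u).Offers o ∧ C = (E u).carried ∧ E u ≠ .endT ∧
      ((E u).isShared = false → u ∈ V₁) ∧ Δ' = linEnv (fupd E u (E u).next) V₁ := by
  rcases h with ⟨S, S', h₁, h₂, rfl⟩ | ⟨h₁, rfl⟩
  · obtain ⟨hu, hs, rfl⟩ := linEnv_eq_some.1 h₁
    have hn : (E u).next = S' := by simp [Ty.next, h₂]
    have hc : (E u).carried = C := by simp [Ty.carried, h₂]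
    refine ⟨hV hu, .inl (by rw [h₂, hn, hc]), hc.symm, ?_, fun _ => hu, ?_⟩
    · intro he; rw [he] at h₂; simp [Ty.unfold] at h₂
    · funext n
      by_cases hnu : n = u
      · subst hnu
        have := fupd_isShared (hwf n (hV hu)) n
        simp only [Env.upd, linEnv]
        grind [fupd_same]
      · have := fupd_of_ne E (E u).next hnu
        simp only [Env.upd, linEnv]
        grind
  · obtain ⟨hu, hs, h₂⟩ := shEnv_eq_some.1 h₁
    have hc : (E u).carried = C := by simp [Ty.carried, h₂, Ty.unfold]
    have hn : (E u).next = E u := (hwf u hu).next_of_shared hs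
    refine ⟨hu, .inr (by rw [hc, h₂]), hc.symm, by simp [h₂], by simp [hs], ?_⟩
    congr 1
    funext n
    by_cases hnu : n = u
    · subst hnu; rw [fupd_same, hn]
    · rw [fupd_of_ne _ _ hnu]

/-- The source process `P` is well typed when the names of `V` have their types under `E`. -/
def SJ (E : Name → Ty) (Ξ : ℕ → Option Env) (V : Set Name) (P : Proc) : Prop :=
  Typed (shEnv E V) Ξ (linEnv E V) P

namespace SJ

theorem of_typed {Γ Ξ Δ P} {E : Name → Ty} {V : Set Name} (h : Typed Γ Ξ Δ P)
    (hΓ : shEnv E V = Γ) (hΔ : linEnv E V = Δ) : SJ E Ξ V P := by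
  subst hΓ hΔ; exact h

variable {E : Name → Ty} {Ξ : ℕ → Option Env} {V : Set Name} {P Q : Proc} {u v y : Name}

theorem mem_of_mem_fn (h : SJ E Ξ V P) {n : Name} (hn : n ∈ P.fn) : n ∈ V := by
  have := Typed.dom_of_mem_fn h hn
  rw [ne_eq, ne_eq, shEnv_eq_none, linEnv_eq_none] at this
  grind

theorem inv_nil (hwf : ∀ n ∈ V, (E n).WF) (h : SJ E Ξ V .nil) {n : Name} (hn : n ∈ V)
    (hs : (E n).isShared = false) : E n = .endT :=
  (hwf n hn).unfold_eq_endT.1 (Typed.inv_nil h (linEnv_eq_some.2 ⟨hn, hs, rfl⟩))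

/-- After an output, the subject `u` has the continuation of its type, and the object `v` is gone
unless it is shared. -/
theorem inv_out (hwf : ∀ n ∈ V, (E n).WF) (h : SJ E Ξ V (.out u [v] Q)) :
    u ∈ V ∧ v ∈ V ∧ (E u).Offers true ∧ E u ≠ .endT ∧ E v ≠ .endT ∧
      (E v).G = (E u).carried.G ∧ (v = u → (E v).isShared = true) ∧
      SJ (fupd E u (E u).next) Ξ {n | n ∈ V ∧ (n = v → (E v).isShared = true)} Q := by
  obtain ⟨C, Δ₁, Δ₂, hs, ha, ht⟩ := Typed.inv_out h
  set V₁ : Set Name := {n | n ∈ V ∧ (n = v → (E v).isShared = true)}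
  have hV₁ : ∀ n, n ∈ V₁ ↔ n ∈ V ∧ (n = v → (E v).isShared = true) := fun _ => Iff.rfl
  have hsub : V₁ ⊆ V := fun n hn => hn.1
  have hΔ₁ : Δ₁ = linEnv E V₁ ∧ v ∈ V ∧ C.unfold = (E v).unfold := by
    rcases hs with ⟨h₁, h₂, rfl⟩ | ⟨h₁, S, h₂, h₃, rfl⟩
    · obtain ⟨hv, hs, rfl⟩ := shEnv_eq_some.1 h₁
      exact ⟨linEnv_congr (by simp [hV₁, hs]) (by simp), hv, rfl⟩
    · obtain ⟨hv, hs, rfl⟩ := linEnv_eq_some.1 h₂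
      refine ⟨?_, hv, h₃.symm⟩
      funext n
      have := hV₁ n
      simp only [Env.upd, linEnv]
      grind
  obtain ⟨rfl, hv, hCv⟩ := hΔ₁
  obtain ⟨hu, ho, rfl, hne, huV, rfl⟩ := ha.inv hwf hsub
  obtain ⟨hc, hc'⟩ := (hwf u hu).carried hne
  refine ⟨hu, hv, ho, hne, ?_, ?_, ?_, ?_⟩
  · intro he
    rw [he, show Ty.unfold .endT = .endT from rfl, hc.unfold_eq_endT] at hCv
    simp [hCv, Ty.isEnd] at hc'
  · rw [← (hwf v hv).unfold_G, ← hCv, hc.unfold_G]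
  · rintro rfl
    by_contra hs
    rw [Bool.not_eq_true] at hs
    have := (huV hs).2 rfl
    simp [hs] at this
  · refine of_typed ht (shEnv_congr ?_ ?_) rfl
    · intro n
      rw [fupd_isShared (hwf u hu)]
      rw [hV₁]
      grind
    · intro n hn hs
      by_cases hnu : n = u
      · subst hnu
        rw [fupd_isShared (hwf n hu)] at hs
        rw [fupd_same, (hwf n hu).next_of_shared hs]
      · rw [fupd_of_ne _ _ hnu]

theorem inv_inp (hwf : ∀ n ∈ V, (E n).WF) (hy : y ∉ V) (h : SJ E Ξ V (.inp u [y] Q)) :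
    u ∈ V ∧ (E u).Offers false ∧ E u ≠ .endT ∧
      SJ (fupd (fupd E u (E u).next) y (E u).carried) Ξ (insert y V) Q := by
  obtain ⟨C, Δ₁, ha, hy', ht⟩ := Typed.inv_inp h (linEnv_eq_none.2 fun h => absurd h hy)
  obtain ⟨hu, ho, rfl, hne, -, rfl⟩ := ha.inv hwf subset_rfl
  refine ⟨hu, ho, hne, ?_⟩
  have hyu : y ≠ u := by rintro rfl; exact hy hu
  refine of_typed ht ?_ ?_
  · funext n
    by_cases hn : n = y
    · subst hn
      have := fupd_same (fupd E u (E u).next) n (E u).carried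
      simp only [shEnv, bindShared, List.zip_cons_cons, List.zip_nil_left, List.lookup_cons_self]
      grind
    · rw [bindShared_of_notMem _ _ (by simpa using hn)]
      by_cases hnu : n = u
      · subst hnu
        have := fupd_isShared (hwf n hu) n
        have := (hwf n hu).next_of_shared
        simp only [shEnv]
        grind [fupd_same, fupd_of_ne]
      · simp only [shEnv]
        grind [fupd_of_ne]
  · funext n
    by_cases hn : n = y
    · subst hn
      have := fupd_same (fupd E u (E u).next) n (E u).carried
      simp only [linEnv, bindLinear, List.zip_cons_cons, List.zip_nil_left, List.lookup_cons_self]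
      grind
    · rw [bindLinear_of_notMem _ _ (by simpa using hn)]
      simp only [linEnv]
      grind [fupd_of_ne]

/-- Only the linear names are divided between the components; the shared ones belong to both. -/
theorem inv_par (h : SJ E Ξ V (.par P Q)) :
    ∃ V₁ V₂, SJ E Ξ V₁ P ∧ SJ E Ξ V₂ Q ∧ V₁ ⊆ V ∧ V₂ ⊆ V ∧
      (∀ n ∈ V, (E n).isShared = false → (n ∈ V₁ ↔ n ∉ V₂)) := by
  obtain ⟨Δ₁, Δ₂, hs, h₁, h₂⟩ := Typed.inv_par h
  have hd : ∀ n, Δ₁ n ≠ none ∨ Δ₂ n ≠ none → n ∈ V ∧ (E n).isShared = false := by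
    intro n hn
    have : linEnv E V n ≠ none := by have := hs n; grind
    rw [ne_eq, linEnv_eq_none] at this
    simpa using this
  refine ⟨{n | n ∈ V ∧ ((E n).isShared = true ∨ Δ₁ n ≠ none)},
    {n | n ∈ V ∧ ((E n).isShared = true ∨ Δ₂ n ≠ none)}, ?_, ?_, fun n hn => hn.1,
    fun n hn => hn.1, ?_⟩
  · refine of_typed h₁ ?_ ?_
    · exact shEnv_congr (by simp +contextual) (by simp)
    · funext n
      have := hs n
      have := hd n
      simp only [linEnv, Set.mem_ofPred_eq] at *
      grind
  · refine of_typed h₂ ?_ ?_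
    · exact shEnv_congr (by simp +contextual) (by simp)
    · funext n
      have := hs n
      have := hd n
      simp only [linEnv, Set.mem_ofPred_eq] at *
      grind
  · intro n hn hsh
    have := hs n
    simp only [linEnv, Set.mem_ofPred_eq] at *
    grind

theorem inv_res {n : Name} {C : Ty} (h : SJ E Ξ V (.res n C Q)) (hC : C.isShared = true)
    (hn : n ∉ V) (hn' : n.dual ∉ V) (hnn : n ≠ n.dual) :
    SJ (fupd (fupd E n.dual C.dual) n C) Ξ (insert n V) Q := by
  have := Typed.inv_res h hC (linEnv_eq_none.2 fun h => absurd h hn)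
  have hd : ∀ m, m = n.dual → m ∉ V ∧ m ≠ n := by rintro _ rfl; exact ⟨hn', hnn.symm⟩
  refine of_typed this ?_ ?_
  · funext m
    have := hd m
    simp only [shEnv, fupd, Env.upd, Set.mem_insert_iff]
    grind
  · funext m
    have := hd m
    simp only [linEnv, fupd, Set.mem_insert_iff]
    grind

theorem inv_resS {n : Name} {C : Ty} (h : SJ E Ξ V (.res n C Q)) (hC : C.isShared = false)
    (hn : n ∉ V) (hn' : n.dual ∉ V) (hnn : n ≠ n.dual) :
    SJ (fupd (fupd E n.dual C.dual) n C) Ξ (insert n (insert n.dual V)) Q := by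
  have := Typed.inv_resS h hC (linEnv_eq_none.2 fun h => absurd h hn)
    (linEnv_eq_none.2 fun h => absurd h hn')
  have hC' := (Ty.dual_isShared C).trans hC
  refine of_typed this ?_ ?_
  · funext m
    simp only [shEnv, fupd, Env.upd, Set.mem_insert_iff]
    grind
  · funext m
    simp only [linEnv, fupd, Env.upd, Set.mem_insert_iff]
    grind

/-- Inside of a recursion the names are those of `V₀`, where names of type `end` may have been
removed. The linear ones are free in the body, and `X` is assigned their types, up to
unfolding. -/
theorem inv_mu {X : ℕ} (h : SJ E Ξ V (.mu X Q)) :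
    ∃ (Δ₀ : Env) (V₀ : Set Name), V₀ ⊆ V ∧ SJ E (Function.update Ξ X (some Δ₀)) V₀ Q ∧
      (∀ n ∈ V₀, (E n).isShared = false → n ∈ Q.fn) ∧
      (∀ n, Δ₀ n ≠ none ↔ n ∈ V₀ ∧ (E n).isShared = false) ∧
      (∀ n S, Δ₀ n = some S → S.unfold = (E n).unfold) := by
  obtain ⟨Δ₀, he, hd, ht⟩ := Typed.inv_mu h
  have key : ∀ n S, Δ₀ n = some S →
      (n ∈ V ∧ (E n).isShared = false) ∧ S.unfold = (E n).unfold := by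
    intro n S hn
    rcases he n with he | ⟨he, -⟩
    · rw [hn] at he
      have : linEnv E V n ≠ none := by intro h; simp [h] at he
      rw [ne_eq, linEnv_eq_none] at this
      simp only [Classical.not_imp, Bool.not_eq_true] at this
      refine ⟨this, ?_⟩
      simp only [linEnv, this, and_self, ↓reduceIte, Option.map_some, Option.some.injEq] at he
      exact he.symm
    · simp [hn] at he
  refine ⟨Δ₀, {n | n ∈ V ∧ ((E n).isShared = true ∨ Δ₀ n ≠ none)}, fun n hn => hn.1, ?_, ?_, ?_,
    fun n S hn => (key n S hn).2⟩
  · have hsh : shEnv E V = shEnv E {n | n ∈ V ∧ ((E n).isShared = true ∨ Δ₀ n ≠ none)} :=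
      shEnv_congr (by simp +contextual) (by simp)
    rw [hsh] at ht
    refine ht.unf fun n => ?_
    rcases hn : Δ₀ n with _ | S
    · have : linEnv E {n | n ∈ V ∧ ((E n).isShared = true ∨ Δ₀ n ≠ none)} n = none :=
        linEnv_eq_none.2 fun h => by simpa [hn] using h.2
      rw [this]
    · obtain ⟨⟨h₁, h₂⟩, h₃⟩ := key n S hn
      have : linEnv E {n | n ∈ V ∧ ((E n).isShared = true ∨ Δ₀ n ≠ none)} n = some (E n) :=
        linEnv_eq_some.2 ⟨⟨h₁, by simp [hn]⟩, h₂, rfl⟩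
      rw [this]; simp [h₃]
  · rintro n ⟨-, h₁⟩ h₂
    exact hd n (by simpa [h₂] using h₁)
  · intro n
    constructor
    · intro hn
      obtain ⟨S, hS⟩ := Option.ne_none_iff_exists'.1 hn
      exact ⟨⟨(key n S hS).1.1, .inr hn⟩, (key n S hS).1.2⟩
    · rintro ⟨⟨-, h₁⟩, h₂⟩
      simpa [h₂] using h₁

theorem inv_pvar {Y : ℕ} (hwf : ∀ n ∈ V, (E n).WF) (h : SJ E Ξ V (.pvar Y)) :
    ∃ Δ₀, Ξ Y = some Δ₀ ∧
      (∀ n, Δ₀ n ≠ none → n ∈ V ∧ (E n).isShared = false) ∧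
      (∀ n ∈ V, (E n).isShared = false → Δ₀ n = none → E n = .endT) := by
  obtain ⟨Δ₀, h₀, he⟩ := Typed.inv_pvar h
  refine ⟨Δ₀, h₀, fun n hn => ?_, fun n hn hs hn₀ => ?_⟩
  · have : linEnv E V n ≠ none := by
      intro h
      rcases he n with he | ⟨he, -⟩
      · rw [h] at he; simp at he; exact hn he
      · exact hn he
    rw [ne_eq, linEnv_eq_none] at this
    simpa using this
  · have hl : linEnv E V n = some (E n) := linEnv_eq_some.2 ⟨hn, hs, rfl⟩
    rcases he n with he | ⟨-, he⟩
    · rw [hl, hn₀] at he; simp at he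
    · rw [hl] at he
      exact (hwf n hn).unfold_eq_endT.1 (by simpa using he)

end SJ

/-! ### Typing rules for a total type assignment -/

/-- `P` is well typed under `Γ` when the linear names are those of `L`, with their types
under `T`. -/
def LinTyped (T : Name → Ty) (Ξ : ℕ → Option Env) (Γ : Env) (L : Set Name) (P : Proc) : Prop :=
  Typed Γ Ξ (linEnv T L) P

/-- The shared environment `Γ` agrees with `T` on the name `n`. -/
def Agrees (T : Name → Ty) (Γ : Env) (n : Name) : Prop :=
  Γ n = if (T n).isShared then some (T n) else none

/-- `C` offers an action carrying `C̃`, and no other action or the same action forever. -/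
def Ty.Minimal (C : Ty) (o : Bool) (Cs : List Ty) : Prop :=
  C = .act o Cs .endT ∨ C = .mu (.act o Cs .tvar) ∨ C = .shared Cs

theorem Agrees.none {T : Name → Ty} {Γ : Env} {n : Name} (h : Agrees T Γ n)
    (hs : (T n).isShared = false) : Γ n = none := by
  rw [h, hs]; rfl

theorem Agrees.some {T : Name → Ty} {Γ : Env} {n : Name} (h : Agrees T Γ n)
    (hs : (T n).isShared = true) : Γ n = some (T n) := by
  rw [h, hs]; rfl

theorem lookup_zip_map {T : Name → Ty} {n : Name} : ∀ {ys : List Name}, n ∈ ys →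
    (ys.zip (ys.map T)).lookup n = some (T n)
  | y :: ys, h => by
      by_cases hn : n = y
      · subst hn; simp
      · rw [List.map_cons, List.zip_cons_cons, List.lookup_cons, beq_false_of_ne hn]
        exact lookup_zip_map ((List.mem_cons.1 h).resolve_left hn)

theorem agrees_bindShared_of_mem {T : Name → Ty} {Γ : Env} {ys : List Name} {n : Name}
    (h : n ∈ ys) : Agrees T (bindShared Γ ys (ys.map T)) n := by
  simp only [Agrees, bindShared, lookup_zip_map h]

theorem agrees_bindShared {T : Name → Ty} {Γ : Env} {ys : List Name} {n : Name}
    (h : n ∈ ys ∨ Agrees T Γ n) : Agrees T (bindShared Γ ys (ys.map T)) n := by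
  by_cases hn : n ∈ ys
  · exact agrees_bindShared_of_mem hn
  · rw [Agrees, bindShared_of_notMem _ _ hn]
    exact h.resolve_left hn

theorem Vals.of_linEnv {T : Name → Ty} {Γ : Env} : ∀ {vs : List Name}, vs.Nodup →
    (∀ v ∈ vs, Agrees T Γ v) → Vals Γ (linEnv T {n | n ∈ vs}) vs (vs.map T)
  | [], _, _ => by
      have : linEnv T {n | n ∈ []} = empty := by funext n; simp [linEnv, empty]
      rw [this]; exact .nil
  | v :: vs, hnd, h => by
      rw [List.nodup_cons] at hnd
      have ih := Vals.of_linEnv hnd.2 fun w hw => h w (List.mem_cons_of_mem _ hw)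
      by_cases hs : (T v).isShared = true
      · refine .shared ((h v List.mem_cons_self).some hs) hs ?_
        convert ih using 1
        refine linEnv_congr (fun n => ?_) (fun _ _ _ => rfl)
        simp only [Set.mem_ofPred_eq, List.mem_cons]
        grind
      · rw [Bool.not_eq_true] at hs
        refine .session (Δ' := empty) (linEnv_eq_some.2 ⟨List.mem_cons_self, hs, rfl⟩) rfl hs ?_
        convert ih using 1
        funext n
        have := hnd.1
        simp only [Env.upd, linEnv, Set.mem_ofPred_eq, List.mem_cons]
        grind

namespace LinTyped

variable {T T' : Name → Ty} {Ξ : ℕ → Option Env} {Γ : Env} {L L' L₁ L₂ : Set Name} {P Q : Proc}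
  {u : Name}

theorem congr (h : LinTyped T Ξ Γ L P)
    (hL : ∀ n, n ∈ L ∧ (T n).isShared = false ↔ n ∈ L' ∧ (T' n).isShared = false)
    (hT : ∀ n ∈ L, (T n).isShared = false → T n = T' n) : LinTyped T' Ξ Γ L' P := by
  rw [LinTyped, ← linEnv_congr hL hT]; exact h

theorem congr_set (h : LinTyped T Ξ Γ L P)
    (hL : ∀ n, (T n).isShared = false → (n ∈ L ↔ n ∈ L')) : LinTyped T Ξ Γ L' P :=
  h.congr (by grind) (fun _ _ _ => rfl)

theorem weaken_list (xs : List Name) (h : LinTyped T Ξ Γ L P)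
    (hx : ∀ n ∈ xs, n ∈ L ∨ (T n).isShared = true ∨ (T n = .endT ∧ Γ n = none)) :
    LinTyped T Ξ Γ (L ∪ {n | n ∈ xs}) P := by
  induction xs with
  | nil => exact h.congr_set (by simp)
  | cons x xs ih =>
    have ih := ih fun n hn => hx n (List.mem_cons_of_mem _ hn)
    by_cases hxL : x ∈ L ∪ {n | n ∈ xs} ∨ (T x).isShared = true
    · refine ih.congr_set fun n hn => ?_
      simp only [Set.mem_union, Set.mem_ofPred_eq, List.mem_cons] at hxL ⊢
      grind
    · obtain ⟨h₁, h₂⟩ : T x = .endT ∧ Γ x = none := by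
        have := hx x List.mem_cons_self
        simp only [Set.mem_union] at hxL
        grind
      refine (Typed.ended ih h₂ (linEnv_eq_none.2 fun h => absurd (.inl h) hxL)).unf ?_
      intro n
      congr 1
      simp only [Env.upd, linEnv, Set.mem_union, Set.mem_ofPred_eq, List.mem_cons]
      have : (T x).isShared = false := by rw [h₁]; rfl
      grind

/-- Names of type `end` can be added. -/
theorem weaken (xs : List Name) (h : LinTyped T Ξ Γ L P)
    (hL : ∀ n, (T n).isShared = false → n ∈ L → n ∈ L')
    (hx : ∀ n ∈ L', (T n).isShared = false → n ∈ L ∨ (n ∈ xs ∧ T n = .endT ∧ Γ n = none)) :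
    LinTyped T Ξ Γ L' P := by
  classical
  refine (h.weaken_list (xs.filter fun n => n ∈ L' ∧ T n = .endT ∧ Γ n = none) ?_).congr_set ?_
  · intro n hn
    simp only [List.mem_filter, decide_eq_true_eq] at hn
    exact .inr (.inr hn.2.2)
  · intro n hn
    have := hL n hn
    have := hx n
    simp only [Set.mem_union, Set.mem_ofPred_eq, List.mem_filter, decide_eq_true_eq]
    grind

/-- An output on a name of minimal type: the continuation keeps the names of `L` except for the
values sent, and except for the subject if it performs no action but this one. -/
theorem out {vs : List Name} {Cs : List Ty} (hCs : vs.map T = Cs) (hu : (T u).Minimal true Cs)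
    (huL : (T u).isShared = false → u ∈ L ∧ u ∉ vs) (hΓu : Agrees T Γ u) (hvs : vs.Nodup)
    (hΓ : ∀ v ∈ vs, Agrees T Γ v) (hvL : ∀ v ∈ vs, (T v).isShared = false → v ∈ L)
    (hL' : ∀ n, (T n).isShared = false → (n ∈ L' ↔ n ∈ L ∧ n ∉ vs ∧ (n = u → (T u).tr = true)))
    (h : LinTyped T Ξ Γ L' P) : LinTyped T Ξ Γ L (.out u vs P) := by
  subst hCs
  have hv := Vals.of_linEnv hvs hΓ
  rcases hu with hu | hu | hu
  · have hs : (T u).isShared = false := by rw [hu]; rfl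
    have ht : (T u).tr = false := by rw [hu]; rfl
    refine Typed.send (Δ₁ := linEnv T (L \ {n | n ∈ vs})) ?_
      (linEnv_eq_some.2 ⟨(⟨(huL hs).1, (huL hs).2⟩ : u ∈ L \ {n | n ∈ vs}), hs, hu⟩) ?_ hv
    · intro n
      have := hvL n
      simp only [linEnv, Set.mem_sdiff, Set.mem_ofPred_eq]
      grind
    -- After its only action the subject has type `end`.
    · refine (Typed.ended h (hΓu.none hs) (linEnv_eq_none.2 fun hn => ?_)).unf fun n => ?_
      · have := ((hL' u hs).1 hn).2.2 rfl
        simp [ht] at this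
      · congr 1
        have := hL' n
        simp only [Env.upd, linEnv, Set.mem_sdiff, Set.mem_ofPred_eq]
        grind
  · have hs : (T u).isShared = false := by rw [hu]; rfl
    have ht : (T u).tr = true := by rw [hu]; rfl
    -- The type of the subject is unfolded to perform the action, which leads back to it.
    refine Typed.unf (Δ := (linEnv T L).upd u (some (.act true (vs.map T) (T u)))) (Typed.send
      (Δ₁ := (linEnv T (L \ {n | n ∈ vs})).upd u (some (.act true (vs.map T) (T u)))) (S := T u)
      ?_ ?_ ?_ hv) ?_
    · intro n
      have := hvL n
      have := huL hs
      simp only [Env.upd, linEnv, Set.mem_sdiff, Set.mem_ofPred_eq]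
      grind
    · simp [Env.upd]
    · refine h.unf fun n => ?_
      congr 1
      have := hL' n
      have := huL hs
      simp only [Env.upd, linEnv, Set.mem_sdiff, Set.mem_ofPred_eq]
      grind
    · intro n
      by_cases hn : n = u
      · subst hn
        have : linEnv T L n = some (T n) := linEnv_eq_some.2 ⟨(huL hs).1, hs, rfl⟩
        rw [this]
        simp [Env.upd, hu, Ty.unfold, Ty.subst]
      · simp [Env.upd, hn]
  · have hs : (T u).isShared = true := by rw [hu]; rfl
    refine Typed.req (Δ₁ := linEnv T L') (by rw [hΓu.some hs, hu]) ?_ h hv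
    intro n
    have := hvL n
    have := hL' n
    simp only [linEnv, Set.mem_ofPred_eq]
    grind

/-- An input on a name of minimal type: the continuation gets the values received, and keeps the
names of `L`, except for the subject if it performs no action but this one. -/
theorem inp {ys : List Name} {Cs : List Ty} (hCs : ys.map T = Cs) (hu : (T u).Minimal false Cs)
    (huL : (T u).isShared = false → u ∈ L) (hΓu : Agrees T Γ u) (hys : ys.Nodup) (huy : u ∉ ys)
    (hyL : ∀ y ∈ ys, (T y).isShared = false → y ∉ L)
    (hL' : ∀ n, (T n).isShared = false →
      (n ∈ L' ↔ n ∈ ys ∨ (n ∈ L ∧ (n = u → (T u).tr = true))))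
    (h : LinTyped T Ξ (bindShared Γ ys Cs) L' P) : LinTyped T Ξ Γ L (.inp u ys P) := by
  subst hCs
  have hbL : ∀ {Δ : Env} {n : Name}, n ∈ ys → bindLinear Δ ys (ys.map T) n =
      if (T n).isShared then none else some (T n) := by
    intro Δ n hn
    simp only [bindLinear, lookup_zip_map hn]
  have hyn : ∀ y ∈ ys, linEnv T L y = none := by
    intro y hy
    have := hyL y hy
    rw [linEnv_eq_none]
    grind
  rcases hu with hu | hu | hu
  · have hs : (T u).isShared = false := by rw [hu]; rfl
    have ht : (T u).tr = false := by rw [hu]; rfl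
    refine Typed.rcv (linEnv_eq_some.2 ⟨huL hs, hs, hu⟩) hys (by simp) hyn ?_
    refine (Typed.ended (u := u) h ?_ ?_).unf fun n => ?_
    · rw [bindShared_of_notMem _ _ huy]; exact hΓu.none hs
    · refine linEnv_eq_none.2 fun hn => ?_
      have := (hL' u hs).1 hn
      grind
    · congr 1
      have := hL' n
      by_cases hn : n ∈ ys
      · rw [hbL hn]
        simp only [Env.upd, linEnv]
        grind
      · rw [bindLinear_of_notMem _ _ hn]
        simp only [Env.upd, linEnv]
        grind
  · have hs : (T u).isShared = false := by rw [hu]; rfl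
    have ht : (T u).tr = true := by rw [hu]; rfl
    refine Typed.unf (Δ := (linEnv T L).upd u (some (.act false (ys.map T) (T u)))) (Typed.rcv
      (Cs := ys.map T) (S := T u) (by simp [Env.upd]) hys (by simp) ?_ ?_) ?_
    · intro y hy
      have : y ≠ u := by rintro rfl; exact huy hy
      simp [Env.upd, this, hyn y hy]
    · refine h.unf fun n => ?_
      congr 1
      have := hL' n
      have := huL hs
      by_cases hn : n ∈ ys
      · rw [hbL hn]
        simp only [linEnv]
        grind
      · rw [bindLinear_of_notMem _ _ hn]
        simp only [Env.upd, linEnv]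
        grind
    · intro n
      by_cases hn : n = u
      · subst hn
        have : linEnv T L n = some (T n) := linEnv_eq_some.2 ⟨huL hs, hs, rfl⟩
        rw [this]
        simp [Env.upd, hu, Ty.unfold, Ty.subst]
      · simp [Env.upd, hn]
  · have hs : (T u).isShared = true := by rw [hu]; rfl
    refine Typed.acc (by rw [hΓu.some hs, hu]) hys (by simp) hyn (h.unf fun n => ?_)
    congr 1
    have := hL' n
    by_cases hn : n ∈ ys
    · rw [hbL hn]
      simp only [linEnv]
      grind
    · rw [bindLinear_of_notMem _ _ hn]
      simp only [linEnv]
      grind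

theorem par (hP : LinTyped T Ξ Γ L₁ P) (hQ : LinTyped T Ξ Γ L₂ Q)
    (hL : ∀ n, (T n).isShared = false →
      (n ∈ L ↔ n ∈ L₁ ∨ n ∈ L₂) ∧ (n ∈ L₁ → n ∉ L₂)) : LinTyped T Ξ Γ L (.par P Q) := by
  refine Typed.par (fun n => ?_) hP hQ
  have := hL n
  simp only [linEnv]
  grind

theorem nil (hL : ∀ n ∈ L, (T n).isShared = true) : LinTyped T Ξ Γ L .nil := by
  have : linEnv T L = empty := by
    funext n; exact linEnv_eq_none.2 fun h => hL n h
  rw [LinTyped, this]; exact .nil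

theorem mu {X : ℕ} (hfn : ∀ n ∈ L, (T n).isShared = false → n ∈ P.fn)
    (h : LinTyped T (Function.update Ξ X (some (linEnv T L))) Γ L P) :
    LinTyped T Ξ Γ L (.mu X P) := by
  refine Typed.recur (fun n hn => ?_) h
  rw [ne_eq, linEnv_eq_none] at hn
  grind

theorem pvar {X : ℕ} (hX : Ξ X = some (linEnv T L'))
    (hL : ∀ n, (T n).isShared = false → (n ∈ L ↔ n ∈ L')) : LinTyped T Ξ Γ L (.pvar X) := by
  refine Typed.rvar ?_
  rw [hX, linEnv_congr (L := L) (T' := T) (L' := L') (by grind) (fun _ _ _ => rfl)]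

theorem res {n : Name} {C : Ty} (hC : C.isShared = true) (hn : T n = C)
    (h : LinTyped T Ξ (Γ.upd n (some C)) L P) : LinTyped T Ξ Γ L (.res n C P) :=
  Typed.res hC (linEnv_eq_none.2 fun _ => hn ▸ hC) h

theorem resS {n : Name} {C : Ty} (hC : C.isShared = false) (hn : T n = C)
    (hn' : T n.dual = C.dual) (hnL : n ∉ L) (hnL' : n.dual ∉ L)
    (h : LinTyped T Ξ ((Γ.upd n none).upd n.dual none) (insert n (insert n.dual L)) P) :
    LinTyped T Ξ Γ L (.res n C P) := by
  refine Typed.resS hC (linEnv_eq_none.2 (absurd · hnL)) (linEnv_eq_none.2 (absurd · hnL'))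
    (h.unf fun m => ?_)
  congr 1
  have := Ty.dual_isShared C
  simp only [linEnv, Env.upd, Set.mem_insert_iff]
  grind

end LinTyped

/-- The names `b_i, b_{i+1}, …` bound by `resAll`, with their duals. -/
def resSet (b i l : ℕ) : Set Name := {n | ∃ p j, j < l ∧ n = .ch b p (i + j)}

/-- Restricting a sequence of consecutive names. The restriction of a shared name adds the name to
the shared environment, but not its dual: hence the condition under which `Γ'` agrees with `T`. -/
theorem LinTyped.resAll {T : Name → Ty} {Ξ : ℕ → Option Env} {b : ℕ} {P : Proc} :
    ∀ {Ms : List Ty} {Γ : Env} {i : ℕ} {L : Set Name},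
    (∀ j M, Ms[j]? = some M → T (.ch b true (i + j)) = M ∧ T (.ch b false (i + j)) = M.dual) →
    (∀ p j, j < Ms.length → Name.ch b p (i + j) ∉ L) →
    (∀ Γ' : Env, (∀ n, n ∉ resSet b i Ms.length → Γ' n = Γ n) →
      (∀ p j, j < Ms.length → (p = true ∨ (T (.ch b p (i + j))).isShared = false) →
        Agrees T Γ' (.ch b p (i + j))) → LinTyped T Ξ Γ' (L ∪ resSet b i Ms.length) P) →
    LinTyped T Ξ Γ L (resAll b i Ms P)
  | [], Γ, i, L, _, _, h => by
      refine (h Γ (fun _ _ => rfl) (by simp)).congr_set fun n _ => ?_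
      simp [resSet]
  | M :: Ms, Γ, i, L, hT, hL, h => by
      have hs : resSet b i (M :: Ms).length =
          resSet b (i + 1) Ms.length ∪ {.ch b true i, .ch b false i} := by
        ext n
        simp only [resSet, List.length_cons, Set.mem_ofPred_eq, Set.mem_union, Set.mem_insert_iff,
          Set.mem_singleton_iff]
        constructor
        · rintro ⟨p, j, hj, rfl⟩
          rcases j with _ | j
          · cases p <;> simp
          · exact .inl ⟨p, j, by omega, by congr 1; omega⟩
        · rintro (⟨p, j, hj, rfl⟩ | rfl | rfl)
          · exact ⟨p, j + 1, by omega, by congr 1; omega⟩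
          · exact ⟨true, 0, by omega, by simp⟩
          · exact ⟨false, 0, by omega, by simp⟩
      have hM := hT 0 M (by simp)
      rw [add_zero] at hM
      have hT' : ∀ j M, Ms[j]? = some M →
          T (.ch b true (i + 1 + j)) = M ∧ T (.ch b false (i + 1 + j)) = M.dual := by
        intro j M' hj
        have := hT (j + 1) M' (by simpa using hj)
        rwa [show i + (j + 1) = i + 1 + j by omega] at this
      have hL' : ∀ p j, j < Ms.length → Name.ch b p (i + 1 + j) ∉ L := by
        intro p j hj
        have := hL p (j + 1) (by simpa using hj)
        rwa [show i + (j + 1) = i + 1 + j by omega] at this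
      have hni : ∀ p, Name.ch b p i ∉ resSet b (i + 1) Ms.length := by
        rintro p ⟨p', j, hj, he⟩
        injection he; omega
      have hi0 : ∀ p, Name.ch b p i ∉ L := fun p => by simpa using hL p 0 (by simp)
      by_cases hC : M.isShared = true
      · refine LinTyped.res hC hM.1 (LinTyped.resAll hT' hL' fun Γ' h₁ h₂ => ?_)
        refine (h Γ' ?_ ?_).congr_set ?_
        · intro n hn
          rw [hs] at hn
          simp only [Set.mem_union, Set.mem_insert_iff, Set.mem_singleton_iff, not_or] at hn
          rw [h₁ n hn.1]
          simp [Env.upd, hn.2.1]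
        · intro p j hj hp
          rcases j with _ | j
          · rw [add_zero] at hp ⊢
            obtain rfl : p = true := by
              cases p
              · rw [hM.2, Ty.dual_isShared, hC] at hp; simp at hp
              · rfl
            rw [Agrees, h₁ _ (hni _), hM.1, hC]
            simp [Env.upd]
          · rw [show i + (j + 1) = i + 1 + j by omega] at hp ⊢
            exact h₂ p j (by simpa using hj) hp
        · intro n hn
          rw [hs]
          have h₁ : n ≠ .ch b true i := by rintro rfl; rw [hM.1, hC] at hn; simp at hn
          have h₂ : n ≠ .ch b false i := by
            rintro rfl; rw [hM.2, Ty.dual_isShared, hC] at hn; simp at hn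
          simp [h₁, h₂]
      · rw [Bool.not_eq_true] at hC
        refine LinTyped.resS hC hM.1 hM.2 (hi0 _) (hi0 _)
          (LinTyped.resAll hT' ?_ fun Γ' h₁ h₂ => ?_)
        · intro p j hj hn
          simp only [Name.dual, Set.mem_insert_iff, Name.ch.injEq, hL' p j hj, or_false] at hn
          omega
        refine (h Γ' ?_ ?_).congr_set ?_
        · intro n hn
          rw [hs] at hn
          simp only [Set.mem_union, Set.mem_insert_iff, Set.mem_singleton_iff, not_or] at hn
          rw [h₁ n hn.1]
          simp [Env.upd, hn.2.1, hn.2.2, Name.dual]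
        · intro p j hj hp
          rcases j with _ | j
          · rw [add_zero] at hp ⊢
            have hTp : (T (.ch b p i)).isShared = false := by
              cases p
              · rw [hM.2, Ty.dual_isShared, hC]
              · rw [hM.1, hC]
            rw [Agrees, h₁ _ (hni _), hTp]
            cases p <;> simp [Env.upd, Name.dual]
          · rw [show i + (j + 1) = i + 1 + j by omega] at hp ⊢
            exact h₂ p j (by simpa using hj) hp
        · intro n hn
          rw [hs]
          simp only [Name.dual, Set.mem_union, Set.mem_insert_iff, Set.mem_singleton_iff]
          simp only [Bool.not_true]
          tauto

/-! ### Broken-down names -/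

theorem mem_bname {b i : ℕ} {p : Bool} {C : Ty} {n : Name} :
    n ∈ bname (.ch b p i) C ↔ ∃ j < C.G.length, n = .ch b p (i + j) := by
  simp [bname, eq_comm]

theorem nodup_bname {b i : ℕ} {p : Bool} {C : Ty} : (bname (.ch b p i) C).Nodup := by
  simp only [bname]
  refine List.Nodup.map (fun j j' h => ?_) List.nodup_range
  simpa using h

theorem map_bname_eq {T : Name → Ty} {b i : ℕ} {p : Bool} {C : Ty} :
    (bname (.ch b p i) C).map T = C.G ↔ ∀ j M, C.G[j]? = some M → T (.ch b p (i + j)) = M := by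
  constructor
  · intro h j M hj
    have hlt : j < C.G.length := (List.getElem?_eq_some_iff.1 hj).1
    rw [← h] at hj
    simpa [bname, hlt] using hj
  · intro h
    apply List.ext_getElem?
    intro j
    by_cases hj : j < C.G.length
    · rw [List.getElem?_eq_getElem hj]
      simp [bname, hj, h j _ (List.getElem?_eq_getElem hj)]
    · simp [bname, hj]

theorem mem_fnb {Q : Proc} {x : List Name} {n : Name} :
    n ∈ fnb Q x ↔ n ∈ x ∧ ∃ m ∈ Q.fn, m.withIdx 0 = n.withIdx 0 := by
  simp [fnb, Name.sameBase]

/-- The names of `V` have the source types `E`; the rest of the breakdown of `s ∈ V` consists of the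
`|G(E s)|` names from `ρ s` on, and `T` assigns to them the components of `G(E s)`. Types `end`
are exempt: an exhausted name has no broken-down name left. -/
structure Refines (E : Name → Ty) (ρ : Name → Name) (T : Name → Ty) (V : Set Name) : Prop where
  wf : ∀ s ∈ V, (E s).WF
  name : ∀ s ∈ V, ∃ b p i j, s = .ch b p i ∧ ρ s = .ch b p j
  inj : ∀ s ∈ V, ∀ t ∈ V, s.withIdx 0 = t.withIdx 0 → s = t
  one : ∀ s ∈ V, (E s).tr = true → ∃ b p, ρ s = .ch b p 1
  ty : ∀ s ∈ V, E s ≠ .endT → (bname (ρ s) (E s)).map T = (E s).G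

namespace Refines

variable {E : Name → Ty} {ρ : Name → Name} {T : Name → Ty} {V : Set Name} {u s t n : Name}
  {o : Bool}

theorem mono {V' : Set Name} (h : Refines E ρ T V) (hV : V' ⊆ V) : Refines E ρ T V' :=
  ⟨fun s hs => h.wf s (hV hs), fun s hs => h.name s (hV hs),
    fun s hs t ht => h.inj s (hV hs) t (hV ht), fun s hs => h.one s (hV hs),
    fun s hs => h.ty s (hV hs)⟩

theorem base_of_mem (h : Refines E ρ T V) (hs : s ∈ V) {C : Ty} (hn : n ∈ bname (ρ s) C) :
    n.withIdx 0 = s.withIdx 0 := by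
  obtain ⟨b, p, i, j, rfl, h₁⟩ := h.name s hs
  rw [h₁, mem_bname] at hn
  obtain ⟨j', -, rfl⟩ := hn
  rfl

/-- The breakdowns of different names are disjoint, since breaking down a name keeps its base. -/
theorem eq_of_mem (h : Refines E ρ T V) (hs : s ∈ V) (ht : t ∈ V) {C D : Ty}
    (hn : n ∈ bname (ρ s) C) (hn' : n ∈ bname (ρ t) D) : s = t :=
  h.inj s hs t ht ((h.base_of_mem hs hn).symm.trans (h.base_of_mem ht hn'))

theorem nodup (h : Refines E ρ T V) (hs : s ∈ V) (C : Ty) : (bname (ρ s) C).Nodup := by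
  obtain ⟨b, p, i, j, rfl, h₁⟩ := h.name s hs
  rw [h₁]; exact nodup_bname

theorem ch_of_mem (h : Refines E ρ T V) (hs : s ∈ V) {C : Ty} (hn : n ∈ bname (ρ s) C) :
    ∃ b p i j, s = .ch b p i ∧ n = .ch b p j := by
  obtain ⟨b, p, i, j, rfl, h₁⟩ := h.name s hs
  rw [h₁, mem_bname] at hn
  obtain ⟨j', -, rfl⟩ := hn
  exact ⟨_, _, _, _, rfl, rfl⟩

theorem mem_G (h : Refines E ρ T V) (hs : s ∈ V) (hne : E s ≠ .endT) (hn : n ∈ bname (ρ s) (E s)) :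
    T n ∈ (E s).G := by
  rw [← h.ty s hs hne]; exact List.mem_map_of_mem hn

theorem isShared_of_mem (h : Refines E ρ T V) (hs : s ∈ V) (hne : E s ≠ .endT)
    (hn : n ∈ bname (ρ s) (E s)) : (T n).isShared = (E s).isShared :=
  (h.wf s hs).isShared_of_mem_G (h.mem_G hs hne hn)

theorem mem_fnb_iff (h : Refines E ρ T V) {Q : Proc} (hQ : ∀ m ∈ Q.fn, m ∈ V) (hs : s ∈ V) {C : Ty}
    (hn : n ∈ bname (ρ s) C) {x : List Name} : n ∈ fnb Q x ↔ n ∈ x ∧ s ∈ Q.fn := by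
  rw [mem_fnb]
  constructor
  · rintro ⟨h₁, m, hm, hmn⟩
    rw [h.base_of_mem hs hn] at hmn
    exact ⟨h₁, h.inj m (hQ m hm) s hs hmn ▸ hm⟩
  · rintro ⟨h₁, h₂⟩
    exact ⟨h₁, s, h₂, (h.base_of_mem hs hn).symm⟩

/-- The name `l` that performs the first action of the breakdown of `u`. -/
theorem subj (h : Refines E ρ T V) (hu : u ∈ V) (ho : (E u).Offers o) (hne : E u ≠ .endT) :
    subjName (E u) (ρ u) ∈ bname (ρ u) (E u) ∧
      (T (subjName (E u) (ρ u))).Minimal o (E u).carried.G ∧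
      (T (subjName (E u) (ρ u))).tr = (E u).tr ∧
      ((E u).lin = true → subjName (E u) (ρ u) = ρ u) := by
  have hwf := h.wf u hu
  have hty := h.ty u hu hne
  obtain ⟨b, p, i, j, -, hρ⟩ := h.name u hu
  by_cases ht : (E u).tr = true
  · have hs : (E u).isShared = false := by
      cases hE : E u <;> simp_all [Ty.tr, Ty.isShared]
    have hun : (E u).unfold = .act o [(E u).carried] (E u).next := by
      refine ho.resolve_right fun h => ?_
      rw [h] at hs; simp [Ty.isShared] at hs
    obtain ⟨hf, hG⟩ := hwf.G_f ht hun
    obtain ⟨b', p', hρ'⟩ := h.one u hu ht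
    obtain rfl : j = 1 := by rw [hρ] at hρ'; injection hρ'
    have hl : subjName (E u) (ρ u) = .ch b p (1 + ((E u).f - 1)) := by
      rw [subjName, if_pos ht, hρ, Name.withIdx]; congr 1; omega
    rw [hρ, map_bname_eq] at hty
    have hTl := hty _ _ hG
    rw [hl, hTl]
    refine ⟨?_, .inr (.inl rfl), by simp [Ty.tr, ht], by simp [Ty.lin, ht]⟩
    rw [hρ, mem_bname]
    exact ⟨_, (List.getElem?_eq_some_iff.1 hG).1, rfl⟩
  · rw [Bool.not_eq_true] at ht
    have hl : subjName (E u) (ρ u) = .ch b p (j + 0) := by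
      rw [subjName, if_neg (by simp [ht]), hρ]; simp
    have hlen : 0 < (E u).G.length := List.length_pos_iff.2 hwf.G_ne_nil
    rw [hρ, map_bname_eq] at hty
    have hmem : subjName (E u) (ρ u) ∈ bname (ρ u) (E u) := by
      rw [hl, hρ, mem_bname]; exact ⟨0, hlen, rfl⟩
    refine ⟨hmem, ?_⟩
    rw [hl]
    rcases hs : (E u).isShared with _ | _
    · obtain ⟨o', D, S, hE, -, hG⟩ := hwf.G_of_lin (by simp [Ty.lin, hs, ht]) hne
      have hTl := hty 0 (.act o' D.G .endT) (by rw [hG]; rfl)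
      rw [hTl]
      refine ⟨?_, by simp [Ty.tr, ht], fun _ => by rw [hρ]; simp⟩
      rcases ho with ho | ho
      · rw [hE] at ho
        simp only [Ty.unfold, Ty.act.injEq, Ty.carried, List.headD] at ho
        rw [hE]
        exact .inl (by simp [Ty.carried, Ty.unfold, ho.1])
      · rw [ho] at hs; simp [Ty.isShared] at hs
    · obtain ⟨D, hE, hG⟩ := hwf.G_of_shared hs
      have hTl := hty 0 (.shared D.G) (by rw [hG]; rfl)
      rw [hTl]
      refine ⟨.inr (.inr ?_), by simp [Ty.tr, ht], by simp [Ty.lin, hs]⟩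
      rw [hE]; simp [Ty.carried, Ty.unfold]

theorem next_of_not_lin (h : Refines E ρ T V) (hu : u ∈ V) (hl : (E u).lin = false) :
    nextName (E u) (ρ u) = ρ u ∧ (E u).next.G = (E u).G ∧ (E u).next ≠ .endT := by
  have hwf := h.wf u hu
  refine ⟨by simp [nextName, hl], ?_⟩
  rcases hs : (E u).isShared with _ | _
  · have ht : (E u).tr = true := by simpa [Ty.lin, hs] using hl
    refine ⟨hwf.next_G_of_tr ht, fun he => ?_⟩
    have := hwf.next_tr
    rw [he, ht] at this
    simp [Ty.tr] at this
  · rw [hwf.next_of_shared hs]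
    refine ⟨rfl, fun he => ?_⟩
    rw [he] at hs; simp [Ty.isShared] at hs

theorem next_of_lin (h : Refines E ρ T V) (hu : u ∈ V) (hl : (E u).lin = true) (hne : E u ≠ .endT) :
    bname (ρ u) (E u) = ρ u ::
      (if (E u).next.isEnd then [] else bname (nextName (E u) (ρ u)) (E u).next) ∧
      (E u).next.lin = true := by
  obtain ⟨b, p, i, j, -, hρ⟩ := h.name u hu
  obtain ⟨o', D, S, hE, hS, hG⟩ := (h.wf u hu).G_of_lin hl hne
  have hn : (E u).next = S := by rw [hE]; rfl
  rw [hn]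
  refine ⟨?_, hS⟩
  simp only [nextName, hl, if_true, hρ, Name.succIdx, bname, hG, List.length_cons]
  split_ifs with hSe
  · simp
  · rw [List.range_succ_eq_map]
    simp [Function.comp_def, Nat.add_comm, Nat.add_left_comm]

/-- An action of a finite type uses up the first name of the breakdown; otherwise the breakdown is
kept. -/
theorem mem_bname_iff (h : Refines E ρ T V) (hu : u ∈ V) (hne : E u ≠ .endT) :
    n ∈ bname (ρ u) (E u) ↔ (n = ρ u ∧ (E u).lin = true) ∨
      ((E u).next ≠ .endT ∧ n ∈ bname (nextName (E u) (ρ u)) (E u).next) := by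
  obtain ⟨b, p, i, j, -, hρ⟩ := h.name u hu
  rcases hl : (E u).lin with _ | _
  · obtain ⟨h₁, h₂, h₃⟩ := h.next_of_not_lin hu hl
    rw [h₁, hρ, mem_bname, mem_bname, h₂]
    simp [h₃]
  · rw [(h.next_of_lin hu hl hne).1]
    simp only [← Ty.isEnd_iff (C := (E u).next), ne_eq]
    split_ifs with he <;> simp [he]

theorem notMem_bname_next (h : Refines E ρ T V) (hu : u ∈ V) (hl : (E u).lin = true) {C : Ty} :
    ρ u ∉ bname (nextName (E u) (ρ u)) C := by
  obtain ⟨b, p, i, j, -, hρ⟩ := h.name u hu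
  rw [nextName, hl, if_pos rfl, hρ, Name.succIdx, mem_bname]
  rintro ⟨j', -, hj⟩
  injection hj; omega

/-- The invariant after an action with subject `u`. -/
theorem step (h : Refines E ρ T V) (hu : u ∈ V) (hne : E u ≠ .endT) :
    Refines (fupd E u (E u).next) (fupd ρ u (nextName (E u) (ρ u))) T V := by
  constructor
  · intro s hs
    by_cases hsu : s = u
    · subst hsu; rw [fupd_same]; exact (h.wf s hs).next
    · rw [fupd_of_ne _ _ hsu]; exact h.wf s hs
  · intro s hs
    by_cases hsu : s = u
    · subst hsu
      obtain ⟨b, p, i, j, h₁, hρ⟩ := h.name s hs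
      rw [fupd_same, nextName, hρ]
      split_ifs
      · exact ⟨_, _, _, _, h₁, rfl⟩
      · exact ⟨_, _, _, _, h₁, rfl⟩
    · rw [fupd_of_ne _ _ hsu]; exact h.name s hs
  · exact h.inj
  · intro s hs ht
    by_cases hsu : s = u
    · subst hsu
      rw [fupd_same, (h.wf s hs).next_tr] at ht
      rw [fupd_same, nextName, if_neg (by simp [Ty.lin, ht])]
      exact h.one s hs ht
    · rw [fupd_of_ne _ _ hsu] at ht ⊢; exact h.one s hs ht
  · intro s hs hne'
    by_cases hsu : s = u
    · subst hsu
      rw [fupd_same] at hne'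
      rw [fupd_same, fupd_same]
      obtain ⟨b, p, i, j, -, hρ⟩ := h.name s hs
      have hty := h.ty s hs hne
      rcases hl : (E s).lin with _ | _
      · obtain ⟨h₁, h₂, h₃⟩ := h.next_of_not_lin hs hl
        rw [h₁, h₂, ← hty, hρ]
        simp [bname, h₂]
      · rw [(h.next_of_lin hs hl hne).1, if_neg (by rwa [Ty.isEnd_iff])] at hty
        obtain ⟨o', D, S, hE, hS, hG⟩ := (h.wf s hs).G_of_lin hl hne
        have hn : (E s).next = S := by rw [hE]; rfl
        rw [hG, if_neg (by rw [Ty.isEnd_iff, ← hn]; exact hne'), List.map_cons] at hty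
        rw [(List.cons.inj hty).2, hn]
    · rw [fupd_of_ne _ _ hsu] at hne' ⊢
      rw [fupd_of_ne _ _ hsu]
      exact h.ty s hs hne'

theorem congr {T' : Name → Ty} (h : Refines E ρ T V)
    (hT : ∀ b p i j, Name.ch b p i ∈ V → T' (.ch b p j) = T (.ch b p j)) : Refines E ρ T' V := by
  refine ⟨h.wf, h.name, h.inj, h.one, fun s hs hne => ?_⟩
  rw [← h.ty s hs hne]
  refine List.map_congr_left fun n hn => ?_
  obtain ⟨b, p, i, j, h₁, rfl⟩ := h.ch_of_mem hs hn
  exact hT b p i j (h₁ ▸ hs)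

/-- The invariant after binding the unindexed name `s`, whose breakdown starts with index `1`. -/
theorem insert {b : ℕ} {p : Bool} {C : Ty} (h : Refines E ρ T V)
    (hb : ∀ i, Name.ch b p i ∉ V) (hC : C.WF) (hT : (bname (.ch b p 1) C).map T = C.G) :
    Refines (fupd E (.ch b p 0) C) (fupd ρ (.ch b p 0) (.ch b p 1)) T (insert (.ch b p 0) V) := by
  have hne : ∀ s ∈ V, s ≠ .ch b p 0 := by rintro s hs rfl; exact hb 0 hs
  have hne' : ∀ s ∈ V, s.withIdx 0 ≠ .ch b p 0 := by
    intro s hs he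
    obtain ⟨b', p', i, j, rfl, -⟩ := h.name s hs
    simp only [Name.withIdx, Name.ch.injEq, and_true] at he
    exact hb i (he.1 ▸ he.2 ▸ hs)
  constructor
  · rintro s (rfl | hs)
    · rwa [fupd_same]
    · rw [fupd_of_ne _ _ (hne s hs)]; exact h.wf s hs
  · rintro s (rfl | hs)
    · rw [fupd_same]; exact ⟨_, _, _, _, rfl, rfl⟩
    · rw [fupd_of_ne _ _ (hne s hs)]; exact h.name s hs
  · rintro s (rfl | hs) t (rfl | ht) hst
    · rfl
    · exact absurd hst.symm (hne' t ht)
    · exact absurd hst (hne' s hs)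
    · exact h.inj s hs t ht hst
  · rintro s (rfl | hs) ht
    · rw [fupd_same]; exact ⟨_, _, rfl⟩
    · rw [fupd_of_ne _ _ (hne s hs)] at ht ⊢; exact h.one s hs ht
  · rintro s (rfl | hs) hs'
    · rwa [fupd_same, fupd_same]
    · rw [fupd_of_ne _ _ (hne s hs)] at hs' ⊢
      rw [fupd_of_ne _ _ (hne s hs)]
      exact h.ty s hs hs'

end Refines

/-- `T`, but with the components of `G(C)` and their duals for the breakdown of the endpoints with
base name `b`. -/
def extendTy (T : Name → Ty) (b : ℕ) (C : Ty) : Name → Ty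
  | .ch b' p i =>
      if b' = b then
        if p then C.G.getD (i - 1) .endT else (C.G.getD (i - 1) .endT).dual
      else T (.ch b' p i)
  | n => T n

theorem extendTy_of_ne {T : Name → Ty} {b b' : ℕ} {C : Ty} (h : b' ≠ b) (p : Bool) (i : ℕ) :
    extendTy T b C (.ch b' p i) = T (.ch b' p i) := by
  simp [extendTy, h]

theorem extendTy_ch {T : Name → Ty} {b : ℕ} {C : Ty} {j : ℕ} {M : Ty} (h : C.G[j]? = some M) :
    extendTy T b C (.ch b true (1 + j)) = M ∧ extendTy T b C (.ch b false (1 + j)) = M.dual := by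
  simp [extendTy, List.getD_eq_getElem?_getD, h]

theorem map_extendTy_true {T : Name → Ty} {b : ℕ} {C : Ty} :
    (bname (.ch b true 1) C).map (extendTy T b C) = C.G :=
  map_bname_eq.2 fun _ _ hj => (extendTy_ch hj).1

theorem map_extendTy_false {T : Name → Ty} {b : ℕ} {C : Ty} :
    (bname (.ch b false 1) C.dual).map (extendTy T b C) = C.dual.G := by
  refine map_bname_eq.2 fun j M hj => ?_
  rw [Ty.dual_G, List.getElem?_map] at hj
  obtain ⟨M', hM', rfl⟩ := Option.map_eq_some_iff.1 hj
  exact (extendTy_ch hM').2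

/-! ### Propagators -/

/-- The type of a propagator that carries values of the types `M̃`. -/
def PKind.ty : PKind → List Ty → Ty
  | .plain, M => .act false M .endT
  | .recSession, M => .mu (.act false M .tvar)
  | .recShared, M => .shared M

/-- The propagators of the kinds `ks`, numbered from `k` on, with the dual endpoints of those after
the first that are session names. -/
def propSet (k : ℕ) (ks : List PKind) : Set Name :=
  {n | ∃ j κ, ks[j]? = some κ ∧
    (n = κ.name (k + j) ∨ (0 < j ∧ κ ≠ .recShared ∧ n = (κ.name (k + j)).dual))}

/-- `T` assigns to the propagators types that fit their kinds, and dual types to dual endpoints. -/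
def PropTyped (T : Name → Ty) (k : ℕ) (ks : List PKind) : Prop :=
  ∀ (j : ℕ) (κ : PKind), ks[j]? = some κ →
    (∃ M, T (κ.name (k + j)) = κ.ty M) ∧ T (κ.name (k + j)).dual = (T (κ.name (k + j))).dual

theorem PKind.exists_name (κ : PKind) (k : ℕ) : ∃ r, κ.name k = .prop r k true := by
  cases κ <;> exact ⟨_, rfl⟩

theorem PKind.ty_isShared (κ : PKind) (M : List Ty) :
    (κ.ty M).isShared = decide (κ = .recShared) := by
  cases κ <;> rfl

theorem propSet_singleton (k : ℕ) (κ : PKind) : propSet k [κ] = {κ.name k} := by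
  ext n
  simp only [propSet, Set.mem_ofPred_eq, Set.mem_singleton_iff]
  constructor
  · rintro ⟨_ | j, κ', h, h'⟩
    · simp at h; subst h; simpa using h'
    · simp at h
  · rintro rfl; exact ⟨0, κ, by simp, by simp⟩

theorem mem_propSet_append {k : ℕ} {l₁ l₂ : List PKind} {κ : PKind} {n : Name} (h₁ : l₁ ≠ []) :
    n ∈ propSet k (l₁ ++ κ :: l₂) ↔ n ∈ propSet k l₁ ∨ n ∈ propSet (k + l₁.length) (κ :: l₂) ∨
      (κ ≠ .recShared ∧ n = (κ.name (k + l₁.length)).dual) := by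
  have hpos := List.length_pos_iff.2 h₁
  constructor
  · rintro ⟨j, κ', hj, h⟩
    by_cases hlt : j < l₁.length
    · rw [List.getElem?_append_left hlt] at hj
      exact .inl ⟨j, κ', hj, h⟩
    · rw [List.getElem?_append_right (by omega)] at hj
      by_cases hj0 : j = l₁.length
      · subst hj0
        simp only [Nat.sub_self, List.getElem?_cons_zero, Option.some.injEq] at hj
        subst hj
        rcases h with rfl | ⟨-, h₂, rfl⟩
        · exact .inr (.inl ⟨0, κ, rfl, .inl rfl⟩)
        · exact .inr (.inr ⟨h₂, rfl⟩)
      · refine .inr (.inl ⟨j - l₁.length, κ', hj, ?_⟩)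
        rw [show k + l₁.length + (j - l₁.length) = k + j by omega]
        exact h.imp id fun h => ⟨by omega, h.2⟩
  · rintro (⟨j, κ', hj, h⟩ | ⟨j, κ', hj, h⟩ | ⟨h₂, rfl⟩)
    · have hlt := (List.getElem?_eq_some_iff.1 hj).1
      exact ⟨j, κ', by rwa [List.getElem?_append_left hlt], h⟩
    · refine ⟨l₁.length + j, κ', ?_, ?_⟩
      · rw [List.getElem?_append_right (by omega), Nat.add_sub_cancel_left]; exact hj
      · rw [← Nat.add_assoc]
        exact h.imp id fun h => ⟨by omega, h.2⟩
    · refine ⟨l₁.length, κ, ?_, .inr ⟨hpos, h₂, rfl⟩⟩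
      rw [List.getElem?_append_right le_rfl]; simp

theorem mem_propSet_cons {k : ℕ} {l₂ : List PKind} {κ' κ : PKind} {n : Name} :
    n ∈ propSet k (κ' :: κ :: l₂) ↔ n = κ'.name k ∨ n ∈ propSet (k + 1) (κ :: l₂) ∨
      (κ ≠ .recShared ∧ n = (κ.name (k + 1)).dual) := by
  have := mem_propSet_append (k := k) (l₁ := [κ']) (l₂ := l₂) (κ := κ) (n := n) (by simp)
  rw [propSet_singleton] at this
  simpa using this

theorem PropTyped.append {T : Name → Ty} {k : ℕ} {l₁ l₂ : List PKind} (h₁ : PropTyped T k l₁)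
    (h₂ : PropTyped T (k + l₁.length) l₂) : PropTyped T k (l₁ ++ l₂) := by
  intro j κ hj
  by_cases hlt : j < l₁.length
  · rw [List.getElem?_append_left hlt] at hj
    exact h₁ j κ hj
  · rw [List.getElem?_append_right (by omega)] at hj
    have := h₂ _ κ hj
    rwa [show k + l₁.length + (j - l₁.length) = k + j by omega] at this

theorem PropTyped.congr {T T' : Name → Ty} {k : ℕ} {ks : List PKind} (h : PropTyped T k ks)
    (hT : ∀ r j p, k ≤ j → j < k + ks.length → T' (.prop r j p) = T (.prop r j p)) :
    PropTyped T' k ks := by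
  intro j κ hj
  have hlt := (List.getElem?_eq_some_iff.1 hj).1
  have := h j κ hj
  obtain ⟨r, hr⟩ := κ.exists_name (k + j)
  rw [hr] at this ⊢
  simp only [Name.dual] at this ⊢
  rwa [hT r _ true (by omega) (by omega), hT r _ _ (by omega) (by omega)]

theorem exists_of_mem_propSet {k : ℕ} {ks : List PKind} {n : Name} (h : n ∈ propSet k ks) :
    ∃ r j p, n = .prop r j p ∧ k ≤ j ∧ j < k + ks.length := by
  obtain ⟨j, κ, hj, h⟩ := h
  have hlt := (List.getElem?_eq_some_iff.1 hj).1
  obtain ⟨r, hr⟩ := κ.exists_name (k + j)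
  rcases h with rfl | ⟨-, -, rfl⟩
  · exact ⟨r, k + j, true, hr, by omega, by omega⟩
  · exact ⟨r, k + j, false, by rw [hr]; rfl, by omega, by omega⟩

theorem PKind.name_eq_prop {κ : PKind} {k : ℕ} {r p : Bool} {j : ℕ}
    (h : κ.name k = .prop r j p) : j = k ∧ p = true := by
  cases κ <;> simp_all [PKind.name]

/-! ### Typing trios -/

namespace LinTyped

variable {T : Name → Ty} {Ξ : ℕ → Option Env} {Γ : Env} {A L R S : Set Name} {P Q K : Proc}
  {x z : List Name} {k X : ℕ} {lin : Bool}

/-- The input of the tuple `x̃` at the beginning of a trio outside of recursions. -/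
theorem inpPlain (hT : T (.prop false k true) = PKind.plain.ty (x.map T)) (hx : x.Nodup)
    (hxc : .prop false k true ∉ x) (hA : .prop false k true ∉ A)
    (hAx : ∀ n ∈ x, (T n).isShared = false → n ∉ A) (hΓ : Agrees T Γ (.prop false k true))
    (hK : LinTyped T Ξ (bindShared Γ x (x.map T)) (A ∪ {n | n ∈ x}) K) :
    LinTyped T Ξ Γ (insert (.prop false k true) A) (.inp (.prop false k true) x K) := by
  have htr : (T (.prop false k true)).tr = false := by rw [hT]; rfl
  refine LinTyped.inp rfl (.inl hT) (fun _ => .inl rfl) hΓ hx hxc ?_ ?_ hK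
  · rintro y hy hs (rfl | h)
    · exact hxc hy
    · exact hAx y hy hs h
  · intro n hn
    simp only [Set.mem_union, Set.mem_ofPred_eq, Set.mem_insert_iff, htr]
    grind

/-- The output of a tuple `z̃` that activates a trio outside of recursions. -/
theorem outPlain (hT : T (.prop false k false) = .act true (z.map T) .endT) (hz : z.Nodup)
    (hzc : .prop false k false ∉ z) (hΓ : Agrees T Γ (.prop false k false))
    (hΓz : ∀ n ∈ z, Agrees T Γ n) (hzL : ∀ n ∈ z, (T n).isShared = false → n ∈ L)
    (hcL : .prop false k false ∈ L)
    (hK : LinTyped T Ξ Γ {n | n ∈ L ∧ n ≠ .prop false k false ∧ n ∉ z} K) :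
    LinTyped T Ξ Γ L (.out (.prop false k false) z K) := by
  have htr : (T (.prop false k false)).tr = false := by rw [hT]; rfl
  refine LinTyped.out rfl (.inl hT) (fun _ => ⟨hcL, hzc⟩) hΓ hz hΓz hzL ?_ hK
  intro n hn
  simp only [Set.mem_ofPred_eq, htr]
  grind

/-- The input of the tuple `x̃` at the beginning of a trio in the body of a recursion. Off the main
thread the trio makes a copy of itself, which keeps no linear name. -/
theorem inpRec (hΞ : Ξ X = some (linEnv T R))
    (hT : T (.prop true k true) = (if lin then PKind.recSession else .recShared).ty (x.map T))
    (hR : lin = false → ∀ n ∈ R, (T n).isShared = true) (hx : x.Nodup)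
    (hxc : .prop true k true ∉ x) (hS : lin = true → .prop true k true ∈ S)
    (hSx : ∀ n ∈ x, (T n).isShared = false → n ∉ S) (hΓ : Agrees T Γ (.prop true k true))
    (hK : LinTyped T Ξ (bindShared Γ x (x.map T)) (S ∪ {n | n ∈ x}) K) :
    LinTyped T Ξ Γ S (.inp (.prop true k true) x (if lin then K else .par K (.pvar X))) := by
  refine LinTyped.inp (L' := S ∪ {n | n ∈ x}) rfl ?_ ?_ hΓ hx hxc hSx ?_ ?_
  · cases lin
    · exact .inr (.inr hT)
    · exact .inr (.inl hT)
  · intro hs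
    cases lin
    · rw [hT] at hs; simp [PKind.ty, Ty.isShared] at hs
    · exact hS rfl
  · intro n hn
    have : n = .prop true k true → (T (.prop true k true)).tr = true := by
      rintro rfl
      cases lin
      · rw [hT] at hn; simp [PKind.ty, Ty.isShared] at hn
      · rw [hT]; rfl
    simp only [Set.mem_union, Set.mem_ofPred_eq]
    grind
  · cases lin
    · refine LinTyped.par hK (LinTyped.pvar (L := ∅) hΞ fun n hn => ?_) fun n hn => ?_
      · have := hR rfl n
        simp only [Set.mem_empty_iff_false]
        grind
      · simp
    · exact hK

/-- The end of a trio in the body of a recursion: all linear names except for those in `R`, which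
the process variable of the trio keeps, are sent to the next trio. -/
theorem sendRec (hΞ : lin = true → Ξ X = some (linEnv T R))
    (hT : T (.prop true k true) = (if lin then PKind.recSession else .recShared).ty (z.map T))
    (hT' : T (.prop true k false) = (T (.prop true k true)).dual) (hz : z.Nodup)
    (hzc : ∀ p, .prop true k p ∉ z)
    (hΓ : Agrees T Γ (.prop true k (!lin)))
    (hΓz : ∀ n ∈ z, Agrees T Γ n) (hR : lin = true → .prop true k false ∈ R)
    (hRz : ∀ n ∈ z, n ∉ R)
    (hL : ∀ n, (T n).isShared = false → (n ∈ L ↔ (lin = true ∧ n ∈ R) ∨ n ∈ z)) :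
    LinTyped T Ξ Γ L (_root_.sendRec lin X k z) := by
  cases lin
  · have hs : (T (.prop true k true)).isShared = true := by rw [hT]; rfl
    refine LinTyped.out (L' := ∅) rfl (.inr (.inr hT)) (by simp [hs]) hΓ hz hΓz
      (fun n hn hs => (hL n hs).2 (.inr hn)) ?_ (LinTyped.nil (by simp))
    intro n hn
    have := hL n hn
    simp only [Set.mem_empty_iff_false]
    grind
  · have hT2 : T (.prop true k false) = .mu (.act true (z.map T) .tvar) := by rw [hT', hT]; rfl
    refine LinTyped.out (L' := R) rfl (.inr (.inl hT2))
      (fun hs => ⟨(hL _ hs).2 (.inl ⟨rfl, hR rfl⟩), hzc _⟩) hΓ hz hΓz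
      (fun n hn hs => (hL n hs).2 (.inr hn)) ?_ (LinTyped.pvar (hΞ rfl) fun _ _ => Iff.rfl)
    intro n hn
    have := hL n hn
    have := hRz n
    have ht : (T (.prop true k false)).tr = true := by rw [hT2]; rfl
    simp only [ht]
    grind

/-- A trio in the body of a recursion is typed with the linear names `R` from one round to the next,
where it has the names `x̃` in addition. -/
theorem trioRec
    (hT : T (.prop true k true) = (if lin then PKind.recSession else .recShared).ty (x.map T))
    (hR : lin = false → ∀ n ∈ R, (T n).isShared = true) (hx : x.Nodup)
    (hxc : .prop true k true ∉ x) (hS : .prop true k true ∈ R)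
    (hRx : ∀ n ∈ R, n ∉ x) (hΓ : Agrees T Γ (.prop true k true))
    (hfn : ∀ n ∈ R, (T n).isShared = false → n = .prop true k true ∨ n ∈ K.fn)
    (hK : LinTyped T (Function.update Ξ X (some (linEnv T R))) (bindShared Γ x (x.map T))
      (R ∪ {n | n ∈ x}) K) :
    LinTyped T Ξ Γ R (_root_.trioRec lin X k x K) := by
  refine LinTyped.mu ?_ (LinTyped.inpRec (R := R) (by simp) hT hR hx hxc (fun _ => hS)
    (fun n hn _ hn' => hRx n hn' hn) hΓ hK)
  intro n hn hs
  rw [Proc.fn, List.mem_cons]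
  refine (hfn n hn hs).imp id fun h => ?_
  rw [List.mem_filter]
  refine ⟨?_, by simpa using hRx n hn⟩
  cases lin
  · rw [if_neg (by simp), Proc.fn, List.mem_append]; exact .inl h
  · rw [if_pos rfl]; exact h

end LinTyped

/-! ### Combining typed components -/

/-- The broken-down process `P`, whose first propagator is of kind `κ` and carries `x̃`, is well
typed for some assignment of types to the propagators numbered from `k` on, of kinds `ks`, and to
the names bound in the source process (with bases `bd`). Its linear names are those of `A` and the
propagators, and it may use the names of `S` with their types under `T`. -/
def Outcome (T : Name → Ty) (bd : List ℕ) (k : ℕ) (ks : List PKind) (κ : PKind) (x : List Name)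
    (A S : Set Name) (P : Proc) : Prop :=
  ∃ T' : Name → Ty, (∀ b ∉ bd, ∀ p i, T' (.ch b p i) = T (.ch b p i)) ∧ (∀ n ∈ S, T' n = T n) ∧
    PropTyped T' k ks ∧ T' (κ.name k) = κ.ty (x.map T') ∧
    ∀ Γ : Env, (∀ n, n ∈ A ∨ n ∈ propSet k ks ∨ n ∈ S → Agrees T' Γ n) →
      LinTyped T' (fun _ => none) Γ (A ∪ propSet k ks) P

/-- `T`, except that the propagators with number `k` are of kind `κ` and carry `M̃`. -/
def consTy (k : ℕ) (κ : PKind) (M : List Ty) (T : Name → Ty) : Name → Ty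
  | .prop r j p => if j = k then (if p then κ.ty M else (κ.ty M).dual) else T (.prop r j p)
  | n => T n

/-- `T₁` for the propagators with numbers below `l`, and `T₂` for the others. -/
def mergeTy (l : ℕ) (T₁ T₂ : Name → Ty) : Name → Ty
  | .prop r j p => if j < l then T₁ (.prop r j p) else T₂ (.prop r j p)
  | n => T₁ n

theorem consTy_of_ne {k : ℕ} {κ : PKind} {M : List Ty} {T : Name → Ty} {n : Name}
    (h : ∀ r p, n ≠ .prop r k p) : consTy k κ M T n = T n := by
  cases n with
  | prop r j p =>
    have : j ≠ k := by rintro rfl; exact h r p rfl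
    simp [consTy, this]
  | _ => rfl

theorem consTy_name {k : ℕ} {κ κ' : PKind} {M : List Ty} {T : Name → Ty} :
    consTy k κ M T (κ'.name k) = κ.ty M ∧ consTy k κ M T (κ'.name k).dual = (κ.ty M).dual := by
  cases κ' <;> simp [consTy, PKind.name, Name.dual]

theorem map_eq_of_ch {T T' : Name → Ty} {x : List Name} (hx : ∀ n ∈ x, ∃ b p i, n = .ch b p i)
    (h : ∀ b p i, Name.ch b p i ∈ x → T' (.ch b p i) = T (.ch b p i)) : x.map T' = x.map T := by
  refine List.map_congr_left fun n hn => ?_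
  obtain ⟨b, p, i, rfl⟩ := hx n hn
  exact h b p i hn

/-- Adding a trio in front of a component. -/
theorem Outcome.cons {T T₀ : Name → Ty} {bd bd₀ : List ℕ} {k : ℕ} {ks : List PKind}
    {κ κ₁ : PKind} {x z : List Name} {A A₁ S : Set Name} {P trio : Proc}
    (h : Outcome T₀ bd₀ (k + 1) (κ₁ :: ks) κ₁ z A₁ S P)
    (hbd : ∀ b ∉ bd, b ∉ bd₀ ∧ ∀ p i, T₀ (.ch b p i) = T (.ch b p i))
    (hS : ∀ n ∈ S, (∃ X p, n = .propX X p) ∧ T₀ n = T n)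
    (hz : ∀ n ∈ z, ∃ b p i, n = .ch b p i) (hx : ∀ n ∈ x, ∃ b p i, n = .ch b p i)
    (hAch : ∀ n ∈ A, ∃ b p i, n = .ch b p i)
    (hA₁ : A₁ ⊆ A)
    (htrio : ∀ (T' : Name → Ty) (Γ : Env), (∀ b ∉ bd₀, ∀ p i, T' (.ch b p i) = T₀ (.ch b p i)) →
      (∀ n ∈ S, T' n = T₀ n) → T' (κ.name k) = κ.ty (x.map T') →
      T' (κ.name k).dual = (κ.ty (x.map T')).dual →
      T' (κ₁.name (k + 1)) = κ₁.ty (z.map T') →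
      T' (κ₁.name (k + 1)).dual = (κ₁.ty (z.map T')).dual →
      (∀ n, n ∈ A ∨ n = κ.name k ∨ (n = κ₁.name (k + 1) ∧ κ₁ = .recShared) ∨
        (n = (κ₁.name (k + 1)).dual ∧ κ₁ ≠ .recShared) ∨ n ∈ S → Agrees T' Γ n) →
      LinTyped T' (fun _ => none) Γ ((A \ A₁) ∪ {κ.name k, (κ₁.name (k + 1)).dual}) trio) :
    Outcome T bd k (κ :: κ₁ :: ks) κ x A S (.par trio P) := by
  obtain ⟨T₁, hch, hS₁, hp, hhead, hty⟩ := h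
  set T' := consTy k κ (x.map T₁) T₁
  have hname : T' (κ.name k) = κ.ty (x.map T₁) ∧ T' (κ.name k).dual = (κ.ty (x.map T₁)).dual :=
    consTy_name
  have hne : ∀ {n : Name}, (∀ r p, n ≠ .prop r k p) → T' n = T₁ n := fun h => consTy_of_ne h
  have hch' : ∀ b p i, T' (.ch b p i) = T₁ (.ch b p i) := fun b p i => rfl
  have hx' : x.map T' = x.map T₁ := map_eq_of_ch hx fun b p i _ => rfl
  have hz' : z.map T' = z.map T₁ := map_eq_of_ch hz fun b p i _ => rfl
  have hk1 : T' (κ₁.name (k + 1)) = T₁ (κ₁.name (k + 1)) ∧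
      T' (κ₁.name (k + 1)).dual = T₁ (κ₁.name (k + 1)).dual := by
    obtain ⟨r, hr⟩ := κ₁.exists_name (k + 1)
    rw [hr]
    exact ⟨hne (by simp), hne (by simp [Name.dual])⟩
  have hd := (hp 0 κ₁ rfl).2
  rw [add_zero] at hd
  have hps : ∀ n ∈ propSet (k + 1) (κ₁ :: ks), T' n = T₁ n := by
    intro n hn
    obtain ⟨r, j, p, rfl, h₁, h₂⟩ := exists_of_mem_propSet hn
    refine hne fun r p h => ?_
    injection h; omega
  have hSeq : ∀ n ∈ S, T' n = T₁ n := by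
    intro n hn
    obtain ⟨⟨X, p, rfl⟩, -⟩ := hS n hn
    rfl
  refine ⟨T', ?_, ?_, ?_, ?_, ?_⟩
  · intro b hb p i
    rw [hch', hch b (hbd b hb).1, (hbd b hb).2]
  · intro n hn
    rw [hSeq n hn, hS₁ n hn, (hS n hn).2]
  · refine PropTyped.append (l₁ := [κ]) ?_ (hp.congr ?_)
    · intro j κ' hj
      rcases j with _ | j
      · simp only [List.getElem?_cons_zero, Option.some.injEq] at hj
        subst hj
        rw [add_zero, hname.1, hname.2]
        exact ⟨⟨_, rfl⟩, rfl⟩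
      · simp at hj
    · intro r j p h₁ h₂
      refine hne fun r p h => ?_
      injection h with _ h
      rw [h] at h₁
      exact absurd h₁ (by simp)
  · rw [hx', hname.1]
  · intro Γ hΓ
    have hty' : LinTyped T' (fun _ => none) Γ (A₁ ∪ propSet (k + 1) (κ₁ :: ks)) P := by
      have heq : ∀ n, n ∈ A₁ ∨ n ∈ propSet (k + 1) (κ₁ :: ks) ∨ n ∈ S → T' n = T₁ n := by
        rintro n (hn | hn | hn)
        · obtain ⟨b, p, i, rfl⟩ := hAch n (hA₁ hn); rfl
        · exact hps n hn
        · exact hSeq n hn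
      refine (hty Γ fun n hn => ?_).congr ?_ ?_
      · have := hΓ n (by
          rw [mem_propSet_cons]
          rcases hn with hn | hn | hn
          · exact .inl (hA₁ hn)
          · exact .inr (.inl (.inr (.inl hn)))
          · exact .inr (.inr hn))
        rwa [Agrees, heq n hn] at this
      · intro n
        constructor
        · rintro ⟨h₁, h₂⟩
          exact ⟨h₁, by rwa [heq n (h₁.imp id .inl)]⟩
        · rintro ⟨h₁, h₂⟩
          exact ⟨h₁, by rwa [heq n (h₁.imp id .inl)] at h₂⟩
      · intro n hn _
        exact (heq n (hn.imp id .inl)).symm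
    refine LinTyped.par (htrio T' Γ ?_ ?_ ?_ ?_ ?_ ?_ ?_) hty' ?_
    · intro b hb p i; rw [hch', hch b hb]
    · intro n hn; rw [hSeq n hn, hS₁ n hn]
    · rw [hx', hname.1]
    · rw [hx', hname.2]
    · rw [hk1.1, hhead, hz']
    · rw [hk1.2, hd, hhead, hz']
    · intro n hn
      refine hΓ n ?_
      rw [mem_propSet_cons]
      rcases hn with hn | hn | ⟨rfl, hκ⟩ | ⟨rfl, hκ⟩ | hn
      · exact .inl hn
      · exact .inr (.inl (.inl hn))
      · exact .inr (.inl (.inr (.inl ⟨0, κ₁, rfl, .inl rfl⟩)))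
      · exact .inr (.inl (.inr (.inr ⟨hκ, rfl⟩)))
      · exact .inr (.inr hn)
    · intro n hn
      have hκ₁ : n = (κ₁.name (k + 1)).dual → κ₁ ≠ .recShared := by
        rintro rfl hκ
        rw [hk1.2, hd, hhead, Ty.dual_isShared, PKind.ty_isShared] at hn
        simp [hκ] at hn
      simp only [Set.mem_union, mem_propSet_cons, Set.mem_insert_iff, Set.mem_singleton_iff]
      have h2 := @hA₁ n
      have h3 : n ∈ A → n ∉ propSet (k + 1) (κ₁ :: ks) ∧ n ≠ κ.name k ∧
          n ≠ (κ₁.name (k + 1)).dual := by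
        intro hnA
        obtain ⟨b, p, i, rfl⟩ := hAch n hnA
        refine ⟨fun h => ?_, ?_, ?_⟩
        · obtain ⟨r, j, p, h, -⟩ := exists_of_mem_propSet h; cases h
        · obtain ⟨r, hr⟩ := κ.exists_name k; rw [hr]; simp
        · obtain ⟨r, hr⟩ := κ₁.exists_name (k + 1); rw [hr]; simp [Name.dual]
      have h4 : n ∈ propSet (k + 1) (κ₁ :: ks) → n ≠ κ.name k ∧ n ≠ (κ₁.name (k + 1)).dual := by
        intro h
        refine ⟨?_, ?_⟩
        · obtain ⟨r, j, p, rfl, h₁, -⟩ := exists_of_mem_propSet h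
          intro h'
          have := (PKind.name_eq_prop h'.symm).1
          omega
        · rintro rfl
          obtain ⟨j, κ', hj, h'⟩ := h
          rcases h' with h' | ⟨h₀, -, h'⟩
          · obtain ⟨r, hr⟩ := κ'.exists_name (k + 1 + j)
            obtain ⟨r', hr'⟩ := κ₁.exists_name (k + 1)
            rw [hr, hr'] at h'; simp [Name.dual] at h'
          · obtain ⟨r, hr⟩ := κ'.exists_name (k + 1 + j)
            obtain ⟨r', hr'⟩ := κ₁.exists_name (k + 1)
            rw [hr, hr'] at h'; simp [Name.dual] at h'; omega
      clear hΓ hty hch hS₁ hp hhead hname hch' hx' hz' hk1 hd hps hSeq htrio hAch hx hz hS hbd hne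
      clear_value T'
      simp only [Set.mem_sdiff]
      by_cases hnA : n ∈ A
      · have h3 := h3 hnA
        clear h4
        grind
      · have h2 : n ∉ A₁ := fun h => hnA (h2 h)
        clear h3
        grind

theorem name_ne_ch {κ : PKind} {k b i : ℕ} {p : Bool} :
    Name.ch b p i ≠ κ.name k ∧ Name.ch b p i ≠ (κ.name k).dual := by
  obtain ⟨r, hr⟩ := κ.exists_name k
  rw [hr]; simp [Name.dual]

theorem ch_notMem_propSet {ks : List PKind} {k b i : ℕ} {p : Bool} :
    Name.ch b p i ∉ propSet k ks := by
  intro h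
  obtain ⟨r, j, p, h, -⟩ := exists_of_mem_propSet h
  cases h

theorem number_of_mem_propSet {ks : List PKind} {k l : ℕ} {κ : PKind}
    (h : κ.name l ∈ propSet k ks ∨ (κ.name l).dual ∈ propSet k ks) : k ≤ l ∧ l < k + ks.length := by
  obtain ⟨r, hr⟩ := κ.exists_name l
  rw [hr] at h
  rcases h with h | h
  · obtain ⟨r, j, p, h, h₁⟩ := exists_of_mem_propSet h
    injection h with _ h; rwa [h]
  · obtain ⟨r, j, p, h, h₁⟩ := exists_of_mem_propSet h
    injection h with _ h; rwa [h]

theorem dual_name_notMem_propSet {ks : List PKind} {k : ℕ} {κ : PKind} :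
    (κ.name k).dual ∉ propSet k ks := by
  rintro ⟨j, κ', hj, h⟩
  obtain ⟨r, hr⟩ := κ'.exists_name (k + j)
  obtain ⟨r', hr'⟩ := κ.exists_name k
  rw [hr, hr'] at h
  rcases h with h | ⟨h₀, -, h⟩
  · simp [Name.dual] at h
  · simp [Name.dual] at h; omega

theorem PropTyped.dual_shared {T : Name → Ty} {k : ℕ} {κ : PKind} {ks : List PKind}
    {x : List Name} (h : PropTyped T k (κ :: ks)) (hx : T (κ.name k) = κ.ty (x.map T)) :
    T (κ.name k).dual = (κ.ty (x.map T)).dual := by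
  have := (h 0 κ rfl).2
  rwa [add_zero, hx] at this

/-- Adding a trio that activates two components. -/
theorem Outcome.par {T : Name → Ty} {bd bd₁ bd₂ : List ℕ} {k k₂ : ℕ} {ks₁ ks₂ : List PKind}
    {κ κ₁ κ₂ : PKind} {x z₁ z₂ : List Name} {A A₁ A₂ S : Set Name} {P₁ P₂ trio : Proc}
    (h₁ : Outcome T bd₁ (k + 1) (κ₁ :: ks₁) κ₁ z₁ A₁ S P₁)
    (h₂ : Outcome T bd₂ k₂ (κ₂ :: ks₂) κ₂ z₂ A₂ S P₂)
    (hk₂ : k₂ = k + 1 + (κ₁ :: ks₁).length)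
    (hbd : ∀ b, b ∈ bd₁ ∨ b ∈ bd₂ → b ∈ bd)
    (hS : ∀ n ∈ S, ∃ X p, n = .propX X p)
    (hz₁ : ∀ n ∈ z₁, ∃ b p i, n = .ch b p i)
    (hz₂ : ∀ n ∈ z₂, ∃ b p i, n = .ch b p i ∧ b ∉ bd)
    (hx : ∀ n ∈ x, ∃ b p i, n = .ch b p i)
    (hAch : ∀ n ∈ A, ∃ b p i, n = .ch b p i ∧ b ∉ bd)
    (hA₁ : A₁ ⊆ A) (hA₂ : A₂ ⊆ A) (hA : ∀ n ∈ A₁, (T n).isShared = false → n ∉ A₂)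
    (htrio : ∀ (T' : Name → Ty) (Γ : Env), (∀ b ∉ bd, ∀ p i, T' (.ch b p i) = T (.ch b p i)) →
      (∀ n ∈ S, T' n = T n) → T' (κ.name k) = κ.ty (x.map T') →
      T' (κ.name k).dual = (κ.ty (x.map T')).dual →
      T' (κ₁.name (k + 1)) = κ₁.ty (z₁.map T') →
      T' (κ₁.name (k + 1)).dual = (κ₁.ty (z₁.map T')).dual →
      T' (κ₂.name k₂) = κ₂.ty (z₂.map T') →
      T' (κ₂.name k₂).dual = (κ₂.ty (z₂.map T')).dual →
      (∀ n, n ∈ A ∨ n = κ.name k ∨ (n = κ₁.name (k + 1) ∧ κ₁ = .recShared) ∨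
        (n = (κ₁.name (k + 1)).dual ∧ κ₁ ≠ .recShared) ∨
        (n = κ₂.name k₂ ∧ κ₂ = .recShared) ∨
        (n = (κ₂.name k₂).dual ∧ κ₂ ≠ .recShared) ∨ n ∈ S → Agrees T' Γ n) →
      LinTyped T' (fun _ => none) Γ ((A \ (A₁ ∪ A₂)) ∪
        {κ.name k, (κ₁.name (k + 1)).dual, (κ₂.name k₂).dual}) trio) :
    Outcome T bd k (κ :: ((κ₁ :: ks₁) ++ κ₂ :: ks₂)) κ x A S (.par trio (.par P₁ P₂)) := by
  obtain ⟨T₁, hch₁, hS₁, hp₁, hhead₁, hty₁⟩ := h₁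
  obtain ⟨T₂, hch₂, hS₂, hp₂, hhead₂, hty₂⟩ := h₂
  have hd₁ := hp₁.dual_shared hhead₁
  have hd₂ := hp₂.dual_shared hhead₂
  set T' := consTy k κ (x.map T₁) (mergeTy k₂ T₁ T₂) with hT'
  have hname : T' (κ.name k) = κ.ty (x.map T₁) ∧ T' (κ.name k).dual = (κ.ty (x.map T₁)).dual :=
    consTy_name
  have hch : ∀ b p i, T' (.ch b p i) = T₁ (.ch b p i) := fun _ _ _ => rfl
  have hch' : ∀ b ∉ bd, ∀ p i, T' (.ch b p i) = T₂ (.ch b p i) := by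
    intro b hb p i
    rw [hch, hch₁ b fun h => hb (hbd b (.inl h)), hch₂ b fun h => hb (hbd b (.inr h))]
  have hlo : ∀ r j p, k + 1 ≤ j → j < k₂ → T' (.prop r j p) = T₁ (.prop r j p) := by
    intro r j p h₁ h₂
    have : j ≠ k := by omega
    simp [hT', consTy, mergeTy, this, h₂]
  have hhi : ∀ r j p, k₂ ≤ j → T' (.prop r j p) = T₂ (.prop r j p) := by
    intro r j p h₁
    have hne : j ≠ k := by omega
    have hlt : ¬ j < k₂ := by omega
    simp only [hT', consTy, mergeTy, if_neg hne, if_neg hlt]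
  have hx' : x.map T' = x.map T₁ := map_eq_of_ch hx fun b p i _ => rfl
  have hz₁' : z₁.map T' = z₁.map T₁ := map_eq_of_ch hz₁ fun b p i _ => rfl
  have hz₂' : z₂.map T' = z₂.map T₂ := by
    refine map_eq_of_ch (fun n hn => ?_) fun b p i h => ?_
    · obtain ⟨b, p, i, h, -⟩ := hz₂ n hn; exact ⟨b, p, i, h⟩
    · obtain ⟨b', p', i', h, hb⟩ := hz₂ _ h
      obtain ⟨rfl, rfl, rfl⟩ : b = b' ∧ p = p' ∧ i = i' := by injection h; tauto
      exact hch' b hb p i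
  have hk₁ : T' (κ₁.name (k + 1)) = T₁ (κ₁.name (k + 1)) ∧
      T' (κ₁.name (k + 1)).dual = T₁ (κ₁.name (k + 1)).dual := by
    obtain ⟨r, hr⟩ := κ₁.exists_name (k + 1)
    rw [hr]
    refine ⟨hlo _ _ _ le_rfl ?_, hlo _ _ _ le_rfl ?_⟩ <;>
      (rw [hk₂, List.length_cons]; omega)
  have hk₂' : T' (κ₂.name k₂) = T₂ (κ₂.name k₂) ∧
      T' (κ₂.name k₂).dual = T₂ (κ₂.name k₂).dual := by
    obtain ⟨r, hr⟩ := κ₂.exists_name k₂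
    rw [hr]
    exact ⟨hhi _ _ _ le_rfl, hhi _ _ _ le_rfl⟩
  have hps₁ : ∀ n ∈ propSet (k + 1) (κ₁ :: ks₁), T' n = T₁ n := by
    intro n hn
    obtain ⟨r, j, p, rfl, h₁, h₂⟩ := exists_of_mem_propSet hn
    exact hlo _ _ _ h₁ (by omega)
  have hps₂ : ∀ n ∈ propSet k₂ (κ₂ :: ks₂), T' n = T₂ n := by
    intro n hn
    obtain ⟨r, j, p, rfl, h₁, h₂⟩ := exists_of_mem_propSet hn
    exact hhi _ _ _ h₁
  have hSeq₁ : ∀ n ∈ S, T' n = T₁ n := by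
    intro n hn
    obtain ⟨X, p, rfl⟩ := hS n hn
    rfl
  have hSeq₂ : ∀ n ∈ S, T' n = T₂ n := by
    intro n hn
    rw [hSeq₁ n hn, hS₁ n hn, hS₂ n hn]
  have hAeq : ∀ n ∈ A, T' n = T₁ n ∧ T' n = T₂ n ∧ T' n = T n := by
    intro n hn
    obtain ⟨b, p, i, rfl, hb⟩ := hAch n hn
    refine ⟨rfl, hch' b hb p i, ?_⟩
    rw [hch, hch₁ b fun h => hb (hbd b (.inl h))]
  have hmem : ∀ n, n ∈ propSet k (κ :: ((κ₁ :: ks₁) ++ κ₂ :: ks₂)) ↔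
      n = κ.name k ∨ (n ∈ propSet (k + 1) (κ₁ :: ks₁) ∨ n ∈ propSet k₂ (κ₂ :: ks₂) ∨
        (κ₂ ≠ .recShared ∧ n = (κ₂.name k₂).dual)) ∨
        (κ₁ ≠ .recShared ∧ n = (κ₁.name (k + 1)).dual) := by
    intro n
    rw [List.cons_append, mem_propSet_cons, ← List.cons_append, mem_propSet_append (by simp), hk₂]
  refine ⟨T', ?_, ?_, ?_, ?_, ?_⟩
  · intro b hb p i
    rw [hch, hch₁ b fun h => hb (hbd b (.inl h))]
  · intro n hn
    rw [hSeq₁ n hn, hS₁ n hn]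
  · refine PropTyped.append (l₁ := [κ]) ?_ (PropTyped.append (hp₁.congr ?_) ?_)
    · intro j κ' hj
      rcases j with _ | j
      · simp only [List.getElem?_cons_zero, Option.some.injEq] at hj
        subst hj
        rw [add_zero, hname.1, hname.2]
        exact ⟨⟨_, rfl⟩, rfl⟩
      · simp at hj
    · intro r j p h₁ h₂
      exact hlo _ _ _ h₁ (hk₂ ▸ h₂)
    · have h := hp₂.congr fun r j p h₁ _ => hhi _ _ _ h₁
      rwa [hk₂] at h
  · rw [hx', hname.1]
  · intro Γ hΓ
    have hty₁' : LinTyped T' (fun _ => none) Γ (A₁ ∪ propSet (k + 1) (κ₁ :: ks₁)) P₁ := by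
      have heq : ∀ n, n ∈ A₁ ∨ n ∈ propSet (k + 1) (κ₁ :: ks₁) ∨ n ∈ S → T' n = T₁ n := by
        rintro n (hn | hn | hn)
        · exact (hAeq n (hA₁ hn)).1
        · exact hps₁ n hn
        · exact hSeq₁ n hn
      refine (hty₁ Γ fun n hn => ?_).congr ?_ ?_
      · have := hΓ n (by
          rw [hmem]
          rcases hn with hn | hn | hn
          · exact .inl (hA₁ hn)
          · exact .inr (.inl (.inr (.inl (.inl hn))))
          · exact .inr (.inr hn))
        rwa [Agrees, heq n hn] at this
      · intro n
        refine and_congr_right fun h => ?_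
        rw [heq n (h.imp id .inl)]
      · intro n hn _
        exact (heq n (hn.imp id .inl)).symm
    have hty₂' : LinTyped T' (fun _ => none) Γ (A₂ ∪ propSet k₂ (κ₂ :: ks₂)) P₂ := by
      have heq : ∀ n, n ∈ A₂ ∨ n ∈ propSet k₂ (κ₂ :: ks₂) ∨ n ∈ S → T' n = T₂ n := by
        rintro n (hn | hn | hn)
        · exact (hAeq n (hA₂ hn)).2.1
        · exact hps₂ n hn
        · exact hSeq₂ n hn
      refine (hty₂ Γ fun n hn => ?_).congr ?_ ?_
      · have := hΓ n (by
          rw [hmem]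
          rcases hn with hn | hn | hn
          · exact .inl (hA₂ hn)
          · exact .inr (.inl (.inr (.inl (.inr (.inl hn)))))
          · exact .inr (.inr hn))
        rwa [Agrees, heq n hn] at this
      · intro n
        refine and_congr_right fun h => ?_
        rw [heq n (h.imp id .inl)]
      · intro n hn _
        exact (heq n (hn.imp id .inl)).symm
    have hs₁ : ∀ n, (T' n).isShared = false → n = (κ₁.name (k + 1)).dual → κ₁ ≠ .recShared := by
      rintro n hn rfl hκ
      rw [hk₁.2, hd₁, Ty.dual_isShared, PKind.ty_isShared] at hn
      simp [hκ] at hn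
    have hs₂ : ∀ n, (T' n).isShared = false → n = (κ₂.name k₂).dual → κ₂ ≠ .recShared := by
      rintro n hn rfl hκ
      rw [hk₂'.2, hd₂, Ty.dual_isShared, PKind.ty_isShared] at hn
      simp [hκ] at hn
    have hA₁₂ : ∀ n, (T' n).isShared = false → n ∈ A₁ → n ∉ A₂ := by
      intro n hn hn₁
      rw [(hAeq n (hA₁ hn₁)).2.2] at hn
      exact hA n hn₁ hn
    refine LinTyped.par (htrio T' Γ ?_ ?_ ?_ ?_ ?_ ?_ ?_ ?_ ?_)
      (L₂ := A₁ ∪ propSet (k + 1) (κ₁ :: ks₁) ∪ (A₂ ∪ propSet k₂ (κ₂ :: ks₂)))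
      (LinTyped.par hty₁' hty₂' ?_) ?_
    · intro b hb p i; rw [hch, hch₁ b fun h => hb (hbd b (.inl h))]
    · intro n hn; rw [hSeq₁ n hn, hS₁ n hn]
    · rw [hx', hname.1]
    · rw [hx', hname.2]
    · rw [hk₁.1, hhead₁, hz₁']
    · rw [hk₁.2, hd₁, hz₁']
    · rw [hk₂'.1, hhead₂, hz₂']
    · rw [hk₂'.2, hd₂, hz₂']
    · intro n hn
      refine hΓ n ?_
      rw [hmem]
      rcases hn with hn | hn | ⟨rfl, hκ⟩ | ⟨rfl, hκ⟩ | ⟨rfl, hκ⟩ | ⟨rfl, hκ⟩ | hn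
      · exact .inl hn
      · exact .inr (.inl (.inl hn))
      · exact .inr (.inl (.inr (.inl (.inl ⟨0, κ₁, rfl, .inl rfl⟩))))
      · exact .inr (.inl (.inr (.inr ⟨hκ, rfl⟩)))
      · exact .inr (.inl (.inr (.inl (.inr (.inl ⟨0, κ₂, rfl, .inl rfl⟩)))))
      · exact .inr (.inl (.inr (.inl (.inr (.inr ⟨hκ, rfl⟩)))))
      · exact .inr (.inr hn)
    · intro n hn
      refine ⟨by simp only [Set.mem_union], ?_⟩
      have h₁ := hA₁₂ n hn
      rintro (h | h) (h' | h')
      · exact h₁ h h'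
      · obtain ⟨b, p, i, rfl, -⟩ := hAch n (hA₁ h)
        exact ch_notMem_propSet h'
      · obtain ⟨b, p, i, rfl, -⟩ := hAch n (hA₂ h')
        exact ch_notMem_propSet h
      · obtain ⟨r, j, p, rfl, h₁, h₂⟩ := exists_of_mem_propSet h
        obtain ⟨r', j', p', h, h₁', h₂'⟩ := exists_of_mem_propSet h'
        injection h
        omega
    · intro n hn
      have hs₁ := hs₁ n hn
      have hs₂ := hs₂ n hn
      simp only [Set.mem_union, hmem, Set.mem_insert_iff, Set.mem_singleton_iff, Set.mem_sdiff]
      have hsub₁ := @hA₁ n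
      have hsub₂ := @hA₂ n
      have h3 : n ∈ A → n ∉ propSet (k + 1) (κ₁ :: ks₁) ∧ n ∉ propSet k₂ (κ₂ :: ks₂) ∧
          n ≠ κ.name k ∧ n ≠ (κ₁.name (k + 1)).dual ∧ n ≠ (κ₂.name k₂).dual := by
        intro hnA
        obtain ⟨b, p, i, rfl, -⟩ := hAch n hnA
        exact ⟨ch_notMem_propSet, ch_notMem_propSet, name_ne_ch.1, name_ne_ch.2, name_ne_ch.2⟩
      have h4 : n ∈ propSet (k + 1) (κ₁ :: ks₁) → n ≠ κ.name k ∧ n ≠ (κ₁.name (k + 1)).dual ∧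
          n ≠ (κ₂.name k₂).dual := by
        intro h
        refine ⟨?_, ?_, ?_⟩ <;> rintro rfl
        · have := (number_of_mem_propSet (.inl h)).1; omega
        · exact dual_name_notMem_propSet h
        · have := (number_of_mem_propSet (.inr h)).2; omega
      have h5 : n ∈ propSet k₂ (κ₂ :: ks₂) → n ≠ κ.name k ∧ n ≠ (κ₁.name (k + 1)).dual ∧
          n ≠ (κ₂.name k₂).dual := by
        intro h
        refine ⟨?_, ?_, ?_⟩ <;> rintro rfl
        · have := (number_of_mem_propSet (.inl h)).1; omega
        · have := (number_of_mem_propSet (.inr h)).1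
          rw [hk₂, List.length_cons] at this
          omega
        · exact dual_name_notMem_propSet h
      clear hΓ hty₁ hty₂ hty₁' hty₂' hch₁ hch₂ hS₁ hS₂ hp₁ hp₂ hhead₁ hhead₂ hname hch' hx' hz₁'
        hz₂' hk₁ hk₂' hd₁ hd₂ hps₁ hps₂ hSeq₁ hSeq₂ htrio hAch hx hz₁ hz₂ hS hbd hch hlo hhi hmem
        hAeq hA₁₂
      clear_value T'
      by_cases hnA : n ∈ A
      · have h3 := h3 hnA
        clear h4 h5
        grind
      · have hsub₁ : n ∉ A₁ := fun h => hnA (hsub₁ h)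
        have hsub₂ : n ∉ A₂ := fun h => hnA (hsub₂ h)
        clear h3
        grind

/-- A component that consists of a single trio. -/
theorem Outcome.single {T : Name → Ty} {bd : List ℕ} {k : ℕ} {κ : PKind} {x : List Name}
    {A S : Set Name} {trio : Proc} (hS : ∀ n ∈ S, ∃ X p, n = .propX X p)
    (hx : ∀ n ∈ x, ∃ b p i, n = .ch b p i)
    (htrio : ∀ (T' : Name → Ty) (Γ : Env), (∀ b p i, T' (.ch b p i) = T (.ch b p i)) →
      (∀ n ∈ S, T' n = T n) → T' (κ.name k) = κ.ty (x.map T') →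
      (∀ n, n ∈ A ∨ n = κ.name k ∨ n ∈ S → Agrees T' Γ n) →
      LinTyped T' (fun _ => none) Γ (A ∪ {κ.name k}) trio) :
    Outcome T bd k [κ] κ x A S trio := by
  have hx' : x.map (consTy k κ (x.map T) T) = x.map T := map_eq_of_ch hx fun b p i _ => rfl
  have hSeq : ∀ n ∈ S, consTy k κ (x.map T) T n = T n := by
    intro n hn
    obtain ⟨X, p, rfl⟩ := hS n hn
    rfl
  refine ⟨consTy k κ (x.map T) T, fun _ _ _ _ => rfl, hSeq, ?_, ?_, ?_⟩
  · intro j κ' hj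
    rcases j with _ | j
    · simp only [List.getElem?_cons_zero, Option.some.injEq] at hj
      subst hj
      rw [add_zero, consTy_name.1, consTy_name.2]
      exact ⟨⟨_, rfl⟩, rfl⟩
    · simp at hj
  · rw [hx', consTy_name.1]
  · intro Γ hΓ
    rw [propSet_singleton] at hΓ ⊢
    exact htrio _ Γ (fun _ _ _ => rfl) hSeq (by rw [hx', consTy_name.1]) hΓ

/-! ### What a component receives -/

namespace SJ

variable {E : Name → Ty} {Ξ : ℕ → Option Env} {V : Set Name} {P : Proc}

/-- A linear name of the body of a recursion on `X` is free, or `X` gets it, unless it has type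
`end`. -/
theorem end_or_passed {X : ℕ} {Δ₀ : Env} {n : Name} (hwf : ∀ n ∈ V, (E n).WF)
    (h : SJ E (Function.update (fun _ => none) X (some Δ₀)) V P) (hn : n ∈ V)
    (hs : (E n).isShared = false) (hb : ∃ b p i, n = .ch b p i ∧ b ∉ P.bound) (hne : E n ≠ .endT) :
    n ∈ P.fn ∨ (P.frv X = true ∧ Δ₀ n ≠ none) := by
  obtain ⟨b, p, i, rfl, hb⟩ := hb
  by_cases hfn : Name.ch b p i ∈ P.fn
  · exact .inl hfn
  · rcases Typed.end_or_passed h (linEnv_eq_some.2 ⟨hn, hs, rfl⟩) hb hfn with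
      h₁ | ⟨Y, Δ', h₁, h₂, h₃⟩
    · exact absurd ((hwf _ hn).unfold_eq_endT.1 h₁) hne
    · by_cases hY : Y = X
      · subst hY
        rw [Function.update_self, Option.some.injEq] at h₂
        exact .inr ⟨h₁, h₂ ▸ h₃⟩
      · simp [hY] at h₂

/-- The names that `X` gets are available wherever `X` is free. -/
theorem mem_of_passed {X : ℕ} {Δ₀ : Env} {n : Name}
    (h : SJ E (Function.update (fun _ => none) X (some Δ₀)) V P) (hX : P.frv X = true)
    (hn : Δ₀ n ≠ none) (hb : ∃ b p i, n = .ch b p i ∧ b ∉ P.bound)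
    (hs : (E n).isShared = false) : n ∈ V := by
  obtain ⟨b, p, i, rfl, hb⟩ := hb
  obtain ⟨S', hS'⟩ := Option.ne_none_iff_exists'.1 hn
  obtain ⟨S, hS, -⟩ := Typed.reduces_of_frv h hX (Function.update_self ..) hS' hb
    (shEnv_eq_none.2 fun _ => hs)
  exact (linEnv_eq_some.1 hS).1

/-- No name of type `end` is free in a source process: it cannot be a subject, and the carried
types are different from `end`. -/
theorem ne_endT_of_mem_fn {P : Proc} : ∀ {E : Name → Ty} {Ξ : ℕ → Option Env} {V : Set Name},
    P.Source → P.bound.Nodup → (∀ b ∈ P.bound, ∀ p i, Name.ch b p i ∉ V) →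
    (∀ n ∈ V, (E n).WF) → SJ E Ξ V P → ∀ n ∈ P.fn, E n ≠ .endT := by
  induction P with
  | nil => intro E Ξ V _ _ _ _ _ n hn; simp [Proc.fn] at hn
  | pvar Y => intro E Ξ V _ _ _ _ _ n hn; simp [Proc.fn] at hn
  | out u vs Q ih =>
    rintro E Ξ V ⟨⟨v, rfl⟩, hQ⟩ hnd hb hwf h n hn
    obtain ⟨hu, hv, -, hu', hv', -, -, h⟩ := h.inv_out hwf
    by_cases hnu : n = u
    · exact hnu ▸ hu'
    by_cases hnv : n = v
    · exact hnv ▸ hv'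
    rw [← fupd_of_ne E (E u).next hnu]
    refine ih hQ hnd (fun b hb' p i hm => hb b hb' p i hm.1) ?_ h n
      (by simpa [Proc.fn, hnu, hnv] using hn)
    rintro m ⟨hm, -⟩
    by_cases hmu : m = u
    · rw [hmu, fupd_same]; exact (hwf u hu).next
    · rw [fupd_of_ne _ _ hmu]; exact hwf m hm
  | inp u ys Q ih =>
    rintro E Ξ V ⟨⟨b, rfl⟩, hQ⟩ hnd hb hwf h n hn
    simp only [Proc.bound, Proc.nameBase, List.flatMap_cons, List.flatMap_nil, List.append_nil,
      List.cons_append, List.nil_append, List.nodup_cons, List.mem_cons, forall_eq_or_imp]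
      at hnd hb
    obtain ⟨hu, -, hu', h⟩ := h.inv_inp hwf (hb.1 _ _)
    by_cases hnu : n = u
    · exact hnu ▸ hu'
    have hn' : n ∈ Q.fn ∧ n ≠ .ch b true 0 := by simpa [Proc.fn, hnu] using hn
    rw [← fupd_of_ne E (E u).next hnu, ← fupd_of_ne (fupd E u (E u).next) (E u).carried hn'.2]
    refine ih hQ hnd.2 ?_ ?_ h n hn'.1
    · rintro b' hb' p i (h | h)
      · injection h with h; exact hnd.1 (h ▸ hb')
      · exact hb.2 b' hb' p i h
    · rintro m (rfl | hm)
      · rw [fupd_same]; exact ((hwf u hu).carried hu').1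
      · have : m ≠ .ch b true 0 := by rintro rfl; exact hb.1 _ _ hm
        rw [fupd_of_ne _ _ this]
        by_cases hmu : m = u
        · rw [hmu, fupd_same]; exact (hwf u hu).next
        · rw [fupd_of_ne _ _ hmu]; exact hwf m hm
  | res a C Q ih =>
    rintro E Ξ V ⟨⟨b, rfl⟩, hC, hQ⟩ hnd hb hwf h n hn
    simp only [Proc.bound, Proc.nameBase, List.cons_append, List.nil_append, List.nodup_cons,
      List.mem_cons, forall_eq_or_imp] at hnd hb
    have hn' : n ∈ Q.fn ∧ n ≠ .ch b true 0 ∧ n ≠ .ch b false 0 := by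
      simpa [Proc.fn, Name.dual] using hn
    have hE : fupd (fupd E (.ch b false 0) C.dual) (.ch b true 0) C n = E n := by
      rw [fupd_of_ne _ _ hn'.2.1, fupd_of_ne _ _ hn'.2.2]
    have hwf' : ∀ m ∈ insert (Name.ch b true 0) (insert (Name.ch b false 0) V),
        (fupd (fupd E (.ch b false 0) C.dual) (.ch b true 0) C m).WF := by
      rintro m (rfl | rfl | hm)
      · rw [fupd_same]; exact hC
      · rw [fupd_of_ne _ _ (by simp), fupd_same]; exact hC.dual
      · have h₁ : m ≠ .ch b true 0 := by rintro rfl; exact hb.1 _ _ hm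
        have h₂ : m ≠ .ch b false 0 := by rintro rfl; exact hb.1 _ _ hm
        rw [fupd_of_ne _ _ h₁, fupd_of_ne _ _ h₂]; exact hwf m hm
    have hb' : ∀ b' ∈ Q.bound, ∀ p i,
        Name.ch b' p i ∉ insert (Name.ch b true 0) (insert (Name.ch b false 0) V) := by
      rintro b' hb' p i (h | h | h)
      · injection h with h; exact hnd.1 (h ▸ hb')
      · injection h with h; exact hnd.1 (h ▸ hb')
      · exact hb.2 b' hb' p i h
    rw [← hE]
    rcases hs : C.isShared with _ | _
    · exact ih hQ hnd.2 hb' hwf'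
        (h.inv_resS hs (hb.1 _ _) (hb.1 _ _) (by simp [Name.dual])) n hn'.1
    · have hsub : insert (Name.ch b true 0) V ⊆
          insert (Name.ch b true 0) (insert (Name.ch b false 0) V) :=
        Set.insert_subset_insert (Set.subset_insert _ _)
      exact ih hQ hnd.2 (fun b hb p i h => hb' b hb p i (hsub h)) (fun m hm => hwf' m (hsub hm))
        (h.inv_res hs (hb.1 _ _) (hb.1 _ _) (by simp [Name.dual])) n hn'.1
  | par P Q ihP ihQ =>
    rintro E Ξ V ⟨hP, hQ⟩ hnd hb hwf h n hn
    obtain ⟨V₁, V₂, h₁, h₂, hV₁, hV₂, -⟩ := h.inv_par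
    rw [Proc.bound, List.nodup_append] at hnd
    simp only [Proc.bound, List.mem_append] at hb
    rcases List.mem_append.1 hn with hn | hn
    · exact ihP hP hnd.1 (fun b hb' p i hm => hb b (.inl hb') p i (hV₁ hm))
        (fun m hm => hwf m (hV₁ hm)) h₁ n hn
    · exact ihQ hQ hnd.2.1 (fun b hb' p i hm => hb b (.inr hb') p i (hV₂ hm))
        (fun m hm => hwf m (hV₂ hm)) h₂ n hn
  | mu X Q ih =>
    intro E Ξ V hQ hnd hb hwf h n hn
    obtain ⟨Δ₀, V₀, hV₀, h, -⟩ := h.inv_mu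
    exact ih hQ hnd (fun b hb' p i hm => hb b hb' p i (hV₀ hm)) (fun m hm => hwf m (hV₀ hm)) h n hn

end SJ

theorem mem_carry {X : ℕ} {m : List Name} {Q : Proc} {x : List Name} {n : Name} :
    n ∈ carry X m Q x ↔ (Q.frv X = true ∧ n ∈ m) ∨ n ∈ fnb Q x := by
  unfold carry
  split_ifs with h
  · simp [h]; tauto
  · simp [h]

theorem nodup_carry {X : ℕ} {m : List Name} {Q : Proc} {x : List Name} (hm : m.Nodup)
    (hx : x.Nodup) : (carry X m Q x).Nodup := by
  unfold carry
  split_ifs with h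
  · refine hm.append ((hx.filter _).filter _) ?_
    intro n hn hn'
    simp [hn] at hn'
  · exact hx.filter _

/-- The names `m̃` of a recursion on `X` are preserved: if `X` is free in `Q`, the linear names
`Δ₀` assigned to it are tail recursive names of `V`, and `m̃` contains their breakdowns and, apart
from them, only shared names. -/
structure Keeps (X : ℕ) (m : List Name) (Δ₀ : Env) (E : Name → Ty) (ρ : Name → Name) (T : Name → Ty)
    (V : Set Name) (Q : Proc) : Prop where
  tr : Q.frv X = true → ∀ d, Δ₀ d ≠ none → d ∈ V ∧ (E d).isShared = false ∧ (E d).tr = true ∧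
    ∀ n ∈ bname (ρ d) (E d), n ∈ m
  mem : Q.frv X = true → ∀ n ∈ m, (T n).isShared = true ∨
    ∃ d, Δ₀ d ≠ none ∧ n ∈ bname (ρ d) (E d)

/-- The tuple `x̃` passed to the component for `Q` contains the breakdowns of the free names of `Q`
and, if necessary, `m̃`; its linear names belong to names of `V`. -/
structure Carries (X : ℕ) (m : List Name) (E : Name → Ty) (ρ : Name → Name) (T : Name → Ty)
    (V : Set Name) (x : List Name) (Q : Proc) : Prop where
  nodup : x.Nodup
  fresh : ∀ n ∈ x, ∃ b p i, n = .ch b p i ∧ b ∉ Q.bound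
  fn : ∀ s ∈ Q.fn, s ∈ V → ∀ n ∈ bname (ρ s) (E s), n ∈ x
  keep : Q.frv X = true → ∀ n ∈ m, n ∈ x
  used : ∀ n ∈ x, (T n).isShared = true ∨
    ∃ s ∈ V, n ∈ bname (ρ s) (E s) ∧ (E s = .endT → T n = .endT)

/-- A component passes on to `Q` the names that `Q` needs; the linear names that it does not pass
on belong to names without use in `Q`. -/
theorem Carries.pass {X : ℕ} {m : List Name} {Δ₀ : Env} {E : Name → Ty} {ρ : Name → Name}
    {T : Name → Ty} {W V : Set Name} {x : List Name} {Q : Proc} (hR : Refines E ρ T W)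
    (hV : V ⊆ W) (hQ : SJ E (Function.update (fun _ => none) X (some Δ₀)) V Q) (hsrc : Q.Source)
    (hnd : Q.bound.Nodup) (hb : ∀ b ∈ Q.bound, ∀ p i, Name.ch b p i ∉ W) (hm : m.Nodup)
    (hK : Keeps X m Δ₀ E ρ T W Q) (hx : Carries X m E ρ T W x Q) :
    Keeps X m Δ₀ E ρ T V Q ∧ Carries X m E ρ T V (carry X m Q x) Q ∧
      (∀ n ∈ carry X m Q x, n ∈ x) ∧
      (∀ n ∈ carry X m Q x, (T n).isShared = false →
        ∃ s ∈ V, E s ≠ .endT ∧ n ∈ bname (ρ s) (E s)) ∧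
      ∀ n ∈ x, (T n).isShared = false → n ∈ carry X m Q x ∨ T n = .endT ∨
        ∃ s ∈ W, s ∉ V ∧ E s ≠ .endT ∧ n ∈ bname (ρ s) (E s) := by
  have hfresh : ∀ s ∈ W, ∃ b p i, s = .ch b p i ∧ b ∉ Q.bound := by
    intro s hs
    obtain ⟨b, p, i, j, rfl, -⟩ := hR.name s hs
    exact ⟨b, p, i, rfl, fun h => hb b h p i hs⟩
  have hwf : ∀ s ∈ V, (E s).WF := fun s hs => hR.wf s (hV hs)
  have hQW : ∀ m ∈ Q.fn, m ∈ W := fun m hm => hV (hQ.mem_of_mem_fn hm)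
  have hsub : ∀ n ∈ carry X m Q x, n ∈ x := by
    intro n hn
    rcases mem_carry.1 hn with ⟨h₁, h₂⟩ | h
    · exact hx.keep h₁ n h₂
    · exact (mem_fnb.1 h).1
  have hDV : Q.frv X = true → ∀ d, Δ₀ d ≠ none → d ∈ V := fun h d hd =>
    hQ.mem_of_passed h hd (hfresh d (hK.tr h d hd).1) (hK.tr h d hd).2.1
  have hused : ∀ n ∈ carry X m Q x, (T n).isShared = false →
      ∃ s ∈ V, E s ≠ .endT ∧ n ∈ bname (ρ s) (E s) := by
    intro n hn hsh
    rcases hx.used n (hsub n hn) with h | ⟨s, hs, hns, -⟩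
    · rw [hsh] at h; simp at h
    · rcases mem_carry.1 hn with ⟨h₁, h₂⟩ | h
      · rcases hK.mem h₁ n h₂ with h | ⟨d, hd, hnd⟩
        · rw [hsh] at h; simp at h
        · have ht := (hK.tr h₁ d hd).2.2.1
          exact ⟨d, hDV h₁ d hd, fun he => by rw [he] at ht; simp [Ty.tr] at ht, hnd⟩
      · have := ((hR.mem_fnb_iff hQW hs hns).1 h).2
        exact ⟨s, hQ.mem_of_mem_fn this, hQ.ne_endT_of_mem_fn hsrc hnd
          (fun b hb' p i h => hb b hb' p i (hV h)) hwf s this, hns⟩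
  refine ⟨⟨fun h d hd => ⟨hDV h d hd, (hK.tr h d hd).2⟩, hK.mem⟩, ⟨nodup_carry hm hx.nodup,
    fun n hn => hx.fresh n (hsub n hn), ?_, fun h n hn => mem_carry.2 (.inl ⟨h, hn⟩), ?_⟩, hsub,
    hused, ?_⟩
  · intro s hs hsV n hn
    exact mem_carry.2 (.inr ((hR.mem_fnb_iff hQW (hQW s hs) hn).2 ⟨hx.fn s hs (hV hsV) n hn, hs⟩))
  · intro n hn
    rcases hsh : (T n).isShared with _ | _
    · obtain ⟨s, h₁, h₂, h₃⟩ := hused n hn hsh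
      exact .inr ⟨s, h₁, h₃, fun h => absurd h h₂⟩
    · exact .inl rfl
  · intro n hn hsh
    rcases hx.used n hn with h | ⟨s, hs, hns, he⟩
    · rw [hsh] at h; simp at h
    · by_cases hne : E s = .endT
      · exact .inr (.inl (he hne))
      by_cases hsV : s ∈ V
      · left
        have hsE : (E s).isShared = false := by rw [← hR.isShared_of_mem hs hne hns, hsh]
        rcases hQ.end_or_passed hwf hsV hsE (hfresh s hs) hne with h | h
        · exact mem_carry.2 (.inr ((hR.mem_fnb_iff hQW hs hns).2 ⟨hn, h⟩))
        · exact mem_carry.2 (.inl ⟨h.1, (hK.tr h.1 s h.2).2.2.2 n hns⟩)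
      · exact .inr (.inr ⟨s, hs, hsV, hne, hns⟩)

section

variable {X : ℕ} {m : List Name} {Δ₀ : Env} {E E' : Name → Ty} {ρ ρ' : Name → Name}
  {T T' : Name → Ty} {V : Set Name} {x x' : List Name} {P Q : Proc} {u : Name}

theorem Keeps.congr (h : Keeps X m Δ₀ E ρ T V Q) (hE : ∀ s ∈ V, E' s = E s ∧ ρ' s = ρ s)
    (hT : ∀ n ∈ m, T' n = T n) : Keeps X m Δ₀ E' ρ' T' V Q := by
  constructor
  · intro hf d hd
    have := h.tr hf d hd
    rwa [(hE d this.1).1, (hE d this.1).2]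
  · intro hf n hn
    rw [hT n hn]
    refine (h.mem hf n hn).imp id fun ⟨d, hd, hnd⟩ => ⟨d, hd, ?_⟩
    have := h.tr hf d hd
    rwa [(hE d this.1).1, (hE d this.1).2]

theorem Carries.congr (h : Carries X m E ρ T V x Q) (hE : ∀ s ∈ V, E' s = E s ∧ ρ' s = ρ s)
    (hT : ∀ n ∈ x, T' n = T n) : Carries X m E' ρ' T' V x Q := by
  refine ⟨h.nodup, h.fresh, fun s hs hsV => ?_, h.keep, fun n hn => ?_⟩
  · rw [(hE s hsV).1, (hE s hsV).2]; exact h.fn s hs hsV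
  · rw [hT n hn]
    refine (h.used n hn).imp id fun ⟨s, hs, h⟩ => ⟨s, hs, ?_⟩
    rwa [(hE s hs).1, (hE s hs).2]

theorem Carries.perm (h : Carries X m E ρ T V x Q) (hx : x.Perm x') :
    Carries X m E ρ T V x' Q :=
  ⟨hx.nodup_iff.1 h.nodup, fun n hn => h.fresh n (hx.mem_iff.2 hn),
    fun s hs hsV n hn => hx.mem_iff.1 (h.fn s hs hsV n hn),
    fun hf n hn => hx.mem_iff.1 (h.keep hf n hn), fun n hn => h.used n (hx.mem_iff.2 hn)⟩

theorem Keeps.insert {y : Name} (h : Keeps X m Δ₀ E ρ T V Q) : Keeps X m Δ₀ E ρ T (insert y V) Q :=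
  ⟨fun hf d hd => ⟨.inr (h.tr hf d hd).1, (h.tr hf d hd).2⟩, h.mem⟩

theorem Carries.insert {b : ℕ} {p : Bool} {C : Ty} (h : Carries X m E ρ T V x Q)
    (hbV : ∀ i, Name.ch b p i ∉ V) (hbx : ∀ i, Name.ch b p i ∉ x) (hbQ : b ∉ Q.bound)
    (hT : (bname (.ch b p 1) C).map T = C.G) :
    Carries X m (fupd E (.ch b p 0) C) (fupd ρ (.ch b p 0) (.ch b p 1)) T (insert (.ch b p 0) V)
      (x ++ bname (.ch b p 1) C) Q := by
  have hne : ∀ s ∈ V, s ≠ .ch b p 0 := by rintro s hs rfl; exact hbV 0 hs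
  refine ⟨h.nodup.append nodup_bname ?_, ?_, ?_, ?_, ?_⟩
  · intro n hn hn'
    obtain ⟨j, -, rfl⟩ := mem_bname.1 hn'
    exact hbx _ hn
  · intro n hn
    rcases List.mem_append.1 hn with hn | hn
    · exact h.fresh n hn
    · obtain ⟨j, -, rfl⟩ := mem_bname.1 hn
      exact ⟨_, _, _, rfl, hbQ⟩
  · rintro s hs (rfl | hsV) n hn
    · rw [fupd_same, fupd_same] at hn
      exact List.mem_append_right _ hn
    · rw [fupd_of_ne _ _ (hne s hsV), fupd_of_ne _ _ (hne s hsV)] at hn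
      exact List.mem_append_left _ (h.fn s hs hsV n hn)
  · exact fun hf n hn => List.mem_append_left _ (h.keep hf n hn)
  · intro n hn
    rcases List.mem_append.1 hn with hn | hn
    · refine (h.used n hn).imp id fun ⟨s, hs, h⟩ => ⟨s, .inr hs, ?_⟩
      rwa [fupd_of_ne _ _ (hne s hs), fupd_of_ne _ _ (hne s hs)]
    · refine .inr ⟨_, .inl rfl, ?_⟩
      rw [fupd_same, fupd_same]
      refine ⟨hn, ?_⟩
      rintro rfl
      have := List.mem_map_of_mem (f := T) hn
      rw [hT] at this
      simpa [Ty.G] using this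

/-- An action with subject `u` keeps the breakdowns of the names that are not of finite type. -/
theorem Refines.bname_step (hR : Refines E ρ T V) {d : Name} (hd : d ∈ V)
    (hl : (E d).lin = false) :
    bname (fupd ρ u (nextName (E u) (ρ u)) d) (fupd E u (E u).next d) = bname (ρ d) (E d) := by
  by_cases hdu : d = u
  · subst hdu
    obtain ⟨b, p, i, j, -, hρ⟩ := hR.name d hd
    obtain ⟨h₁, h₂, -⟩ := hR.next_of_not_lin hd hl
    rw [fupd_same, fupd_same, h₁, hρ, bname, bname, h₂]
  · rw [fupd_of_ne _ _ hdu, fupd_of_ne _ _ hdu]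

/-- The names `m̃` survive an action, since those that are linear have tail-recursive types. -/
theorem Keeps.step (hR : Refines E ρ T V) (h : Keeps X m Δ₀ E ρ T V P) (hu : u ∈ V)
    (hf : Q.frv X = true → P.frv X = true) :
    Keeps X m Δ₀ (fupd E u (E u).next) (fupd ρ u (nextName (E u) (ρ u))) T V Q := by
  have hl : ∀ {C : Ty}, C.tr = true → C.lin = false := fun h => by simp [Ty.lin, h]
  constructor
  · intro hX d hd
    obtain ⟨h₁, h₂, h₃, h₄⟩ := h.tr (hf hX) d hd
    rw [hR.bname_step h₁ (hl h₃), fupd_isShared (hR.wf u hu)]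
    refine ⟨h₁, h₂, ?_, h₄⟩
    by_cases hdu : d = u
    · subst hdu; rw [fupd_same, (hR.wf d hu).next_tr]; exact h₃
    · rw [fupd_of_ne _ _ hdu]; exact h₃
  · intro hX n hn
    refine (h.mem (hf hX) n hn).imp id fun ⟨d, hd, hnd⟩ => ⟨d, hd, ?_⟩
    obtain ⟨h₁, h₂, h₃, h₄⟩ := h.tr (hf hX) d hd
    rwa [hR.bname_step h₁ (hl h₃)]

theorem mem_dropSubj {C : Ty} {n : Name} :
    n ∈ dropSubj C u x ↔ n ∈ x ∧ (C.lin = true → n ≠ u) := by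
  unfold dropSubj
  split_ifs with h <;> simp [h]

theorem Refines.self_mem (hR : Refines E ρ T V) (hu : u ∈ V) (hl : (E u).lin = true)
    (hne : E u ≠ .endT) : ρ u ∈ bname (ρ u) (E u) ∧ (T (ρ u)).isShared = false := by
  have h := (hR.mem_bname_iff hu hne (n := ρ u)).2 (.inl ⟨rfl, hl⟩)
  refine ⟨h, ?_⟩
  rw [hR.isShared_of_mem hu hne h]
  simp only [Ty.lin, Bool.and_eq_true, Bool.not_eq_true'] at hl
  exact hl.1

/-- The tuple `x̃`, without the name that an action with subject `u` uses up, is sufficient for the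
continuation. -/
theorem Carries.step (hR : Refines E ρ T V) (h : Carries X m E ρ T V x P)
    (hK : Keeps X m Δ₀ E ρ T V P) (hu : u ∈ V) (hne : E u ≠ .endT)
    (hne' : u ∈ Q.fn → (E u).next ≠ .endT)
    (hf : Q.frv X = true → P.frv X = true) (hfn : ∀ s ∈ Q.fn, s ∈ V → s ∈ P.fn)
    (hbd : ∀ b ∈ Q.bound, b ∈ P.bound) :
    Carries X m (fupd E u (E u).next) (fupd ρ u (nextName (E u) (ρ u))) T V
      (dropSubj (E u) (ρ u) x) Q := by
  refine ⟨?_, ?_, ?_, ?_, ?_⟩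
  · unfold dropSubj
    split_ifs
    · exact h.nodup.filter _
    · exact h.nodup
  · intro n hn
    obtain ⟨b, p, i, h, hb⟩ := h.fresh n (mem_dropSubj.1 hn).1
    exact ⟨b, p, i, h, fun h => hb (hbd b h)⟩
  · intro s hs hsV n hn
    rw [mem_dropSubj]
    by_cases hsu : s = u
    · subst hsu
      rw [fupd_same, fupd_same] at hn
      refine ⟨h.fn s (hfn s hs hsV) hsV n ((hR.mem_bname_iff hsV hne).2 (.inr ⟨hne' hs, hn⟩)), ?_⟩
      rintro hl rfl
      exact hR.notMem_bname_next hsV hl hn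
    · rw [fupd_of_ne _ _ hsu, fupd_of_ne _ _ hsu] at hn
      refine ⟨h.fn s (hfn s hs hsV) hsV n hn, ?_⟩
      rintro hl rfl
      exact hsu (hR.eq_of_mem hsV hu hn (hR.self_mem hu hl hne).1)
  · intro hX n hn
    refine mem_dropSubj.2 ⟨h.keep (hf hX) n hn, ?_⟩
    rintro hl rfl
    obtain ⟨h₁, h₂⟩ := hR.self_mem hu hl hne
    rcases hK.mem (hf hX) _ hn with h | ⟨d, hd, hnd⟩
    · rw [h₂] at h; simp at h
    · obtain ⟨hdV, -, ht, -⟩ := hK.tr (hf hX) d hd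
      rw [hR.eq_of_mem hdV hu hnd h₁] at ht
      simp [Ty.lin, ht] at hl
  · intro n hn
    obtain ⟨hn, hnu⟩ := mem_dropSubj.1 hn
    refine (h.used n hn).imp id fun ⟨s, hs, hns, he⟩ => ⟨s, hs, ?_⟩
    by_cases hsu : s = u
    · subst hsu
      rw [fupd_same, fupd_same]
      rcases (hR.mem_bname_iff hs hne).1 hns with ⟨h₁, h₂⟩ | ⟨h₁, h₂⟩
      · exact absurd h₁ (hnu h₂)
      · exact ⟨h₂, fun h => absurd h h₁⟩
    · rw [fupd_of_ne _ _ hsu, fupd_of_ne _ _ hsu]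
      exact ⟨hns, he⟩

end

/-! ### The state of the breakdown of a recursion -/

/-- What is known about a part `P` of the body of a recursion on `X` when it is broken down: it is
well typed, and its component receives what it needs. Off the main thread (`lin = false`) no linear
name may be passed to the next round of the recursion. -/
structure RecState (X : ℕ) (m : List Name) (Δ₀ : Env) (lin : Bool) (E : Name → Ty) (ρ : Name → Name)
    (T : Name → Ty) (V : Set Name) (x : List Name) (P : Proc) : Prop where
  source : P.Source
  muFree : P.MuFree
  nodup : P.bound.Nodup
  fresh : ∀ b ∈ P.bound, ∀ p i, Name.ch b p i ∉ V
  refines : Refines E ρ T V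
  typed : SJ E (Function.update (fun _ => none) X (some Δ₀)) V P
  keeps : Keeps X m Δ₀ E ρ T V P
  carries : Carries X m E ρ T V x P
  nodup_m : m.Nodup
  fresh_m : ∀ n ∈ m, ∃ b p i, n = .ch b p i ∧ b ∉ P.bound
  off : lin = false → P.frv X = true → ∀ n, Δ₀ n = none

namespace RecState

variable {X : ℕ} {m : List Name} {Δ₀ : Env} {lin : Bool} {E : Name → Ty} {ρ : Name → Name}
  {T T' : Name → Ty} {V : Set Name} {x : List Name} {P Q Q₁ Q₂ : Proc} {u v : Name} {b : ℕ} {C : Ty}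

theorem congr (h : RecState X m Δ₀ lin E ρ T V x P)
    (hT : ∀ b ∉ P.bound, ∀ p i, T' (.ch b p i) = T (.ch b p i)) :
    RecState X m Δ₀ lin E ρ T' V x P := by
  refine { h with refines := ?_, keeps := ?_, carries := ?_ }
  · exact h.refines.congr fun b p i j hV => hT b (fun hb => h.fresh b hb p i hV) p j
  · refine h.keeps.congr (fun _ _ => ⟨rfl, rfl⟩) fun n hn => ?_
    obtain ⟨b, p, i, rfl, hb⟩ := h.fresh_m n hn
    exact hT b hb p i
  · refine h.carries.congr (fun _ _ => ⟨rfl, rfl⟩) fun n hn => ?_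
    obtain ⟨b, p, i, rfl, hb⟩ := h.carries.fresh n hn
    exact hT b hb p i

theorem ne_endT (h : RecState X m Δ₀ lin E ρ T V x P) {n : Name} (hn : n ∈ P.fn) : E n ≠ .endT :=
  h.typed.ne_endT_of_mem_fn h.source h.nodup h.fresh h.refines.wf n hn

theorem mem_of_mem_fn (h : RecState X m Δ₀ lin E ρ T V x P) {n : Name} (hn : n ∈ P.fn) : n ∈ V :=
  h.typed.mem_of_mem_fn hn

/-- The subject of a prefix, with its components, is among the names received. -/
theorem subj (h : RecState X m Δ₀ lin E ρ T V x P) (hu : u ∈ P.fn) {o : Bool}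
    (ho : (E u).Offers o) :
    subjName (E u) (ρ u) ∈ x ∧ subjName (E u) (ρ u) ∈ bname (ρ u) (E u) ∧
      (T (subjName (E u) (ρ u))).Minimal o (E u).carried.G ∧
      (T (subjName (E u) (ρ u))).tr = (E u).tr ∧
      ((E u).lin = true → subjName (E u) (ρ u) = ρ u) := by
  have huV := h.mem_of_mem_fn hu
  obtain ⟨h₁, h₂, h₃, h₄⟩ := h.refines.subj huV ho (h.ne_endT hu)
  exact ⟨h.carries.fn u hu huV _ h₁, h₁, h₂, h₃, h₄⟩

/-- A linear name used up by an action with subject `u` is the one that performs the action. -/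
theorem eq_subj_iff (h : RecState X m Δ₀ lin E ρ T V x P) (hu : u ∈ P.fn) {o : Bool}
    (ho : (E u).Offers o) {n : Name} (hs : (T n).isShared = false) :
    (n = subjName (E u) (ρ u) ∧ (T (subjName (E u) (ρ u))).tr = false) ↔
      ((E u).lin = true ∧ n = ρ u) := by
  have huV := h.mem_of_mem_fn hu
  obtain ⟨-, h₁, -, h₃, h₄⟩ := h.subj hu ho
  have hsh := h.refines.isShared_of_mem huV (h.ne_endT hu) h₁
  rw [h₃]
  constructor
  · rintro ⟨rfl, ht⟩
    have hl : (E u).lin = true := by rw [Ty.lin, ← hsh, hs, ht]; rfl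
    exact ⟨hl, h₄ hl⟩
  · rintro ⟨hl, rfl⟩
    refine ⟨(h₄ hl).symm, ?_⟩
    simp only [Ty.lin, Bool.and_eq_true, Bool.not_eq_true'] at hl
    exact hl.2

/-- The tuple passed on is sufficient for the continuation. The trio has received the subject `l`
of its output and the values `ṽ`; a linear name is passed on, or it is sent or used up by the
output, or it has type `end`. -/
theorem out (h : RecState X m Δ₀ lin E ρ T V x (.out u [v] Q)) :
    let z := carry X m Q (dropSubj (E u) (ρ u) x)
    let l := subjName (E u) (ρ u)
    let vs := bname (ρ v) (E v)
    (∃ V', RecState X m Δ₀ lin (fupd E u (E u).next) (fupd ρ u (nextName (E u) (ρ u))) T V' z Q) ∧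
      l ∈ x ∧ (T l).Minimal true (vs.map T) ∧ vs.Nodup ∧ (∀ n ∈ vs, n ∈ x) ∧
      ((T l).isShared = false → l ∉ vs) ∧ (∀ n ∈ z, n ∈ x) ∧
      (∀ n ∈ z, (T n).isShared = false → n ∉ vs ∧ (n = l → (T l).tr = true)) ∧
      (∀ n ∈ x, (T n).isShared = false →
        n ∈ z ∨ T n = .endT ∨ n ∈ vs ∨ (n = l ∧ (T l).tr = false)) := by
  intro z l vs
  obtain ⟨hu, hv, ho, hune, hvne, hG, huv, ht⟩ := h.typed.inv_out h.refines.wf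
  set V' : Set Name := {n | n ∈ V ∧ (n = v → (E v).isShared = true)}
  have hufn : u ∈ (Proc.out u [v] Q).fn := by simp [Proc.fn]
  have hvfn : v ∈ (Proc.out u [v] Q).fn := by simp [Proc.fn]
  have hV' : V' ⊆ V := fun n hn => hn.1
  have hb : ∀ b ∈ Q.bound, ∀ p i, Name.ch b p i ∉ V := h.fresh
  have hR := h.refines.step hu hune
  have hne' : ∀ s ∈ Q.fn, fupd E u (E u).next s ≠ .endT :=
    ht.ne_endT_of_mem_fn h.source.2 h.nodup (fun b hb' p i hm => hb b hb' p i hm.1)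
      (hR.mono hV').wf
  have hK : Keeps X m Δ₀ (fupd E u (E u).next) (fupd ρ u (nextName (E u) (ρ u))) T V Q :=
    h.keeps.step h.refines hu id
  have hC := h.carries.step (Q := Q) h.refines h.keeps hu hune
    (fun hu => by have := hne' u hu; rwa [fupd_same] at this) id
    (fun s hs _ => by simp [Proc.fn, hs]) (fun b hb => hb)
  obtain ⟨h₁, h₂, h₃, h₄, h₅⟩ := hC.pass hR hV' ht h.source.2 h.nodup hb h.nodup_m hK
  obtain ⟨s₁, s₂, s₃, s₄, s₅⟩ := h.subj hufn ho
  have hvT := h.refines.ty v hv hvne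
  have hsne : ∀ {s : Name}, fupd E u (E u).next s ≠ .endT →
      E s ≠ .endT := by
    intro s hs
    by_cases hsu : s = u
    · exact hsu ▸ hune
    · rwa [fupd_of_ne _ _ hsu] at hs
  have hsb : ∀ {s n : Name}, s ∈ V → fupd E u (E u).next s ≠ .endT →
      n ∈ bname (fupd ρ u (nextName (E u) (ρ u)) s) (fupd E u (E u).next s) →
      n ∈ bname (ρ s) (E s) := by
    intro s n hs hne hn
    by_cases hsu : s = u
    · subst hsu
      rw [fupd_same] at hne
      rw [fupd_same, fupd_same] at hn
      exact (h.refines.mem_bname_iff hs hune).2 (.inr ⟨hne, hn⟩)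
    · rwa [fupd_of_ne _ _ hsu, fupd_of_ne _ _ hsu] at hn
  refine ⟨⟨V', ⟨h.source.2, h.muFree, h.nodup, fun b hb' p i hm => hb b hb' p i hm.1, hR.mono hV',
    ht, h₁, h₂, h.nodup_m, h.fresh_m, h.off⟩⟩, s₁, ?_, h.refines.nodup hv _,
    h.carries.fn v hvfn hv, ?_, fun n hn => (mem_dropSubj.1 (h₃ n hn)).1, ?_, ?_⟩
  · rw [hvT, hG]; exact s₃
  · intro hs hl
    obtain rfl := h.refines.eq_of_mem hu hv s₂ hl
    rw [h.refines.isShared_of_mem hu hune hl, huv rfl] at hs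
    simp at hs
  · intro n hn hs
    obtain ⟨s, hsV, hne, hns⟩ := h₄ n hn hs
    have hnE := hsb hsV.1 hne hns
    refine ⟨fun hnv => ?_, fun hl => ?_⟩
    · obtain rfl := h.refines.eq_of_mem hsV.1 hv hnE hnv
      rw [h.refines.isShared_of_mem hsV.1 hvne hnv, hsV.2 rfl] at hs
      simp at hs
    · by_contra htr
      rw [Bool.not_eq_true] at htr
      obtain ⟨h₆, h₇⟩ := (h.eq_subj_iff hufn ho hs).1 ⟨hl, htr⟩
      exact (mem_dropSubj.1 (h₃ n hn)).2 h₆ h₇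
  · intro n hn hs
    by_cases hnu : (E u).lin = true ∧ n = ρ u
    · exact .inr (.inr (.inr ((h.eq_subj_iff hufn ho hs).2 hnu)))
    · rcases h₅ n (mem_dropSubj.2 ⟨hn, fun h₁ h₂ => hnu ⟨h₁, h₂⟩⟩) hs with
        h | h | ⟨s, hsV, hsV', hse, hsn⟩
      · exact .inl h
      · exact .inr (.inl h)
      · have hsv : s = v := by
          by_contra hsv
          exact hsV' ⟨hsV, fun h => absurd h hsv⟩
        subst hsv
        exact .inr (.inr (.inl (hsb hsV hse hsn)))

/-- The tuple passed on is sufficient for the continuation. The trio has received the subject `l`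
of its input; a linear name is passed on, or it is used up by the input, or it has type `end`. -/
theorem inp (h : RecState X m Δ₀ lin E ρ T V x (.inp u [.ch b true 0] Q))
    (hT : (bname (.ch b true 1) (E u).carried).map T = (E u).carried.G) :
    let yt := bname (.ch b true 1) (E u).carried
    let z := carry X m Q (dropSubj (E u) (ρ u) x ++ yt)
    let l := subjName (E u) (ρ u)
    (∃ V', RecState X m Δ₀ lin (fupd (fupd E u (E u).next) (.ch b true 0) (E u).carried)
      (fupd (fupd ρ u (nextName (E u) (ρ u))) (.ch b true 0) (.ch b true 1)) T V' z Q) ∧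
      l ∈ x ∧ (T l).Minimal false (yt.map T) ∧ (∀ n ∈ yt, n ∉ x) ∧
      (∀ n ∈ z, n ∈ x ∨ n ∈ yt) ∧
      (∀ n ∈ z, (T n).isShared = false → n = l → (T l).tr = true) ∧
      (∀ n, n ∈ x ∨ n ∈ yt → (T n).isShared = false →
        n ∈ z ∨ T n = .endT ∨ (n = l ∧ (T l).tr = false)) := by
  intro yt z l
  have hnd := h.nodup
  have hfr := h.fresh
  simp only [Proc.bound, Proc.nameBase, List.flatMap_cons, List.flatMap_nil, List.append_nil,
    List.cons_append, List.nil_append, List.nodup_cons, List.mem_cons, forall_eq_or_imp]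
    at hnd hfr
  obtain ⟨hu, ho, hune, ht⟩ := h.typed.inv_inp h.refines.wf (hfr.1 _ _)
  have hufn : u ∈ (Proc.inp u [.ch b true 0] Q).fn := by simp [Proc.fn]
  have hyx : ∀ p i, Name.ch b p i ∉ x := by
    intro p i hx
    obtain ⟨b', p', i', he, hb'⟩ := h.carries.fresh _ hx
    injection he with he
    exact hb' (by simp [Proc.bound, Proc.nameBase, he])
  have hyu : Name.ch b true 0 ≠ u := by rintro rfl; exact hfr.1 _ _ hu
  have hfn : ∀ s ∈ Q.fn, s ∈ V → s ∈ (Proc.inp u [.ch b true 0] Q).fn := by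
    intro s hs hsV
    have : s ≠ .ch b true 0 := by rintro rfl; exact hfr.1 _ _ hsV
    simp [Proc.fn, hs, this]
  have hR₀ := h.refines.step hu hune
  have hR := hR₀.insert (fun i => hfr.1 true i) ((h.refines.wf u hu).carried hune).1 hT
  have hb : ∀ b' ∈ Q.bound, ∀ p i, Name.ch b' p i ∉ insert (Name.ch b true 0) V := by
    rintro b' hb' p i (h | h)
    · injection h with h; exact hnd.1 (h ▸ hb')
    · exact hfr.2 b' hb' p i h
  have hne' := ht.ne_endT_of_mem_fn h.source.2 hnd.2 hb hR.wf
  have hneV : ∀ s ∈ V, s ≠ .ch b true 0 := by rintro s hs rfl; exact hfr.1 _ _ hs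
  have hK₀ : Keeps X m Δ₀ (fupd E u (E u).next) (fupd ρ u (nextName (E u) (ρ u))) T V Q :=
    h.keeps.step h.refines hu id
  have hK := (hK₀.congr (T' := T) (E' := fupd (fupd E u (E u).next) (.ch b true 0) (E u).carried)
    (ρ' := fupd (fupd ρ u (nextName (E u) (ρ u))) (.ch b true 0) (.ch b true 1))
    (fun s hs => ⟨fupd_of_ne _ _ (hneV s hs), fupd_of_ne _ _ (hneV s hs)⟩)
    (fun _ _ => rfl)).insert (y := .ch b true 0)
  have hC₀ := h.carries.step (Q := Q) h.refines h.keeps hu hune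
    (fun huQ => by have := hne' u huQ; rwa [fupd_of_ne _ _ hyu.symm, fupd_same] at this) id hfn
    (fun b' hb' => by simp [Proc.bound, hb'])
  have hC := hC₀.insert (b := b) (p := true) (C := (E u).carried) (fun i => hfr.1 true i)
    (fun i hi => hyx _ _ (mem_dropSubj.1 hi).1) hnd.1 hT
  obtain ⟨h₁, h₂, h₃, h₄, h₅⟩ := hC.pass hR subset_rfl ht h.source.2 hnd.2 hb h.nodup_m hK
  obtain ⟨s₁, s₂, s₃, s₄, s₅⟩ := h.subj hufn ho
  have hytx : ∀ n ∈ yt, n ∉ x := by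
    intro n hn hx
    obtain ⟨j, -, rfl⟩ := mem_bname.1 hn
    exact hyx _ _ hx
  refine ⟨⟨_, ⟨h.source.2, h.muFree, hnd.2, hb, hR, ht, h₁, h₂, h.nodup_m, fun n hn => ?_, h.off⟩⟩,
    s₁, ?_, hytx, fun n hn => ?_, ?_, ?_⟩
  · obtain ⟨b', p, i, h, hb'⟩ := h.fresh_m n hn
    exact ⟨b', p, i, h, fun h => hb' (by simp [Proc.bound, h])⟩
  · rw [hT]; exact s₃
  · exact (List.mem_append.1 (h₃ n hn)).imp (fun h => (mem_dropSubj.1 h).1) id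
  · intro n hn hs hl
    by_contra htr
    rw [Bool.not_eq_true] at htr
    obtain ⟨h₆, h₇⟩ := (h.eq_subj_iff hufn ho hs).1 ⟨hl, htr⟩
    rcases List.mem_append.1 (h₃ n hn) with h₈ | h₈
    · exact (mem_dropSubj.1 h₈).2 h₆ h₇
    · exact hytx n h₈ (hl ▸ s₁)
  · intro n hn hs
    by_cases hnu : (E u).lin = true ∧ n = ρ u
    · exact .inr (.inr ((h.eq_subj_iff hufn ho hs).2 hnu))
    · have hn' : n ∈ dropSubj (E u) (ρ u) x ++ yt := List.mem_append.2
        (hn.imp (fun h => mem_dropSubj.2 ⟨h, fun h₁ h₂ => hnu ⟨h₁, h₂⟩⟩) id)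
      rcases h₅ n hn' hs with h | h | ⟨s, h₁, h₂, -⟩
      · exact .inl h
      · exact .inr (.inl h)
      · exact absurd h₁ h₂

/-- The tuple received, together with the breakdowns of the restricted endpoints, is sufficient for
the body of the restriction. -/
theorem res (h : RecState X m Δ₀ lin E ρ T V x (.res (.ch b true 0) C Q))
    (hT : (bname (.ch b true 1) C).map T = C.G)
    (hT' : (bname (.ch b false 1) C.dual).map T = C.dual.G) :
    (∃ V', RecState X m Δ₀ lin (fupd (fupd E (.ch b false 0) C.dual) (.ch b true 0) C)
      (fupd (fupd ρ (.ch b false 0) (.ch b false 1)) (.ch b true 0) (.ch b true 1)) T V'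
      (x ++ resNames (.ch b true 0) C) Q) ∧ ∀ p i, Name.ch b p i ∉ x := by
  have hnd := h.nodup
  have hfr := h.fresh
  simp only [Proc.bound, Proc.nameBase, List.cons_append, List.nil_append, List.nodup_cons,
    List.mem_cons, forall_eq_or_imp] at hnd hfr
  have hyx : ∀ p i, Name.ch b p i ∉ x := by
    intro p i hx
    obtain ⟨b', p', i', he, hb'⟩ := h.carries.fresh _ hx
    injection he with he
    exact hb' (by simp [Proc.bound, Proc.nameBase, he])
  have hneV : ∀ p, ∀ s ∈ V, s ≠ .ch b p 0 := by rintro p s hs rfl; exact hfr.1 _ _ hs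
  have hCwf := h.source.2.1
  have hR := (h.refines.insert (fun i => hfr.1 false i) hCwf.dual hT').insert (b := b) (p := true)
    (C := C) (fun i hi => by simp [hfr.1] at hi) hCwf hT
  have hb : ∀ b' ∈ Q.bound, ∀ p i,
      Name.ch b' p i ∉ insert (Name.ch b true 0) (insert (Name.ch b false 0) V) := by
    rintro b' hb' p i (h | h | h)
    · injection h with h; exact hnd.1 (h ▸ hb')
    · injection h with h; exact hnd.1 (h ▸ hb')
    · exact hfr.2 b' hb' p i h
  have hQC : Carries X m E ρ T V x Q := by
    refine ⟨h.carries.nodup, fun n hn => ?_, fun s hs hsV => ?_, h.carries.keep, h.carries.used⟩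
    · obtain ⟨b', p, i, h, hb'⟩ := h.carries.fresh n hn
      exact ⟨b', p, i, h, fun h => hb' (by simp [Proc.bound, h])⟩
    · refine h.carries.fn s ?_ hsV
      have h₁ := hneV true s hsV
      have h₂ := hneV false s hsV
      simp [Proc.fn, hs, h₁, h₂, Name.dual]
  have hQK : Keeps X m Δ₀ E ρ T V Q := ⟨h.keeps.tr, h.keeps.mem⟩
  have hmf : ∀ n ∈ m, ∃ b p i, n = .ch b p i ∧ b ∉ Q.bound := by
    intro n hn
    obtain ⟨b', p, i, h, hb'⟩ := h.fresh_m n hn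
    exact ⟨b', p, i, h, fun h => hb' (by simp [Proc.bound, h])⟩
  have hK : Keeps X m Δ₀ (fupd (fupd E (.ch b false 0) C.dual) (.ch b true 0) C)
      (fupd (fupd ρ (.ch b false 0) (.ch b false 1)) (.ch b true 0) (.ch b true 1)) T V Q := by
    refine hQK.congr (fun s hs => ?_) fun _ _ => rfl
    have h₁ := hneV true s hs
    have h₂ := hneV false s hs
    simp [fupd, h₁, h₂]
  refine ⟨?_, hyx⟩
  rcases hs : C.isShared with _ | _
  · have ht := h.typed.inv_resS hs (hfr.1 _ _) (hfr.1 _ _) (by simp [Name.dual])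
    refine ⟨_, ⟨h.source.2.2, h.muFree, hnd.2, hb, hR, ht, hK.insert.insert, ?_, h.nodup_m, hmf,
      h.off⟩⟩
    have := (hQC.insert (b := b) (p := false) (C := C.dual) (fun i => hfr.1 false i)
      (fun i => hyx _ _) hnd.1 hT').insert (b := b) (p := true) (C := C)
      (fun i hi => by simp [hfr.1] at hi) (fun i hi => ?_) hnd.1 hT
    · refine this.perm ?_
      simp only [resNames, hs, Bool.false_eq_true, if_false, Name.withIdx, Name.dual, Bool.not_true,
        List.append_assoc]
      exact List.Perm.append_left _ List.perm_append_comm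
    · rcases List.mem_append.1 hi with h | h
      · exact hyx _ _ h
      · obtain ⟨j, -, h⟩ := mem_bname.1 h
        simp at h
  · have ht := h.typed.inv_res hs (hfr.1 _ _) (hfr.1 _ _) (by simp [Name.dual])
    have hsub : insert (Name.ch b true 0) V ⊆
        insert (Name.ch b true 0) (insert (Name.ch b false 0) V) :=
      Set.insert_subset_insert (Set.subset_insert _ _)
    refine ⟨_, ⟨h.source.2.2, h.muFree, hnd.2, fun b hb' p i hi => hb b hb' p i (hsub hi),
      hR.mono hsub, ht, hK.insert, ?_, h.nodup_m, hmf, h.off⟩⟩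
    simp only [resNames, hs, if_true, Name.withIdx]
    refine ((hQC.congr (E' := fupd E (.ch b false 0) C.dual)
      (ρ' := fupd ρ (.ch b false 0) (.ch b false 1)) (T' := T) (fun s hs => ?_)
      fun _ _ => rfl).insert (fun i => hfr.1 true i) (fun i => hyx _ _) hnd.1 hT)
    have h₂ := hneV false s hs
    simp [fupd, h₂]

/-- The tuples passed on are sufficient for the two components, and every linear name is in exactly
one of them, unless it has type `end`. -/
theorem par (h : RecState X m Δ₀ lin E ρ T V x (.par Q₁ Q₂)) :
    let z₁ := carry X m Q₁ x
    let z₂ := carry X m Q₂ x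
    (∃ V', RecState X m Δ₀ (lin && mainLeft X Q₁ Q₂) E ρ T V' z₁ Q₁) ∧
      (∃ V', RecState X m Δ₀ (lin && !mainLeft X Q₁ Q₂) E ρ T V' z₂ Q₂) ∧
      (∀ n ∈ z₁, n ∈ x) ∧ (∀ n ∈ z₂, n ∈ x) ∧
      (∀ n ∈ z₁, (T n).isShared = false → n ∉ z₂) ∧
      (∀ n ∈ x, (T n).isShared = false → n ∈ z₁ ∨ n ∈ z₂ ∨ T n = .endT) := by
  intro z₁ z₂
  obtain ⟨V₁, V₂, t₁, t₂, hV₁, hV₂, hV⟩ := h.typed.inv_par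
  have hnd := h.nodup
  have hfr := h.fresh
  rw [Proc.bound, List.nodup_append] at hnd
  simp only [Proc.bound, List.mem_append] at hfr
  have hK₁ : Keeps X m Δ₀ E ρ T V Q₁ :=
    ⟨fun hf => h.keeps.tr (by simp [Proc.frv, hf]), fun hf => h.keeps.mem (by simp [Proc.frv, hf])⟩
  have hK₂ : Keeps X m Δ₀ E ρ T V Q₂ :=
    ⟨fun hf => h.keeps.tr (by simp [Proc.frv, hf]), fun hf => h.keeps.mem (by simp [Proc.frv, hf])⟩
  have hC₁ : Carries X m E ρ T V x Q₁ := by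
    refine ⟨h.carries.nodup, fun n hn => ?_, fun s hs hsV => ?_, fun hf => ?_, h.carries.used⟩
    · obtain ⟨b', p, i, h, hb'⟩ := h.carries.fresh n hn
      exact ⟨b', p, i, h, fun h => hb' (by simp [Proc.bound, h])⟩
    · exact h.carries.fn s (by simp [Proc.fn, hs]) hsV
    · exact h.carries.keep (by simp [Proc.frv, hf])
  have hC₂ : Carries X m E ρ T V x Q₂ := by
    refine ⟨h.carries.nodup, fun n hn => ?_, fun s hs hsV => ?_, fun hf => ?_, h.carries.used⟩
    · obtain ⟨b', p, i, h, hb'⟩ := h.carries.fresh n hn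
      exact ⟨b', p, i, h, fun h => hb' (by simp [Proc.bound, h])⟩
    · exact h.carries.fn s (by simp [Proc.fn, hs]) hsV
    · exact h.carries.keep (by simp [Proc.frv, hf])
  have hm₁ : ∀ n ∈ m, ∃ b p i, n = .ch b p i ∧ b ∉ Q₁.bound := by
    intro n hn
    obtain ⟨b', p, i, h, hb'⟩ := h.fresh_m n hn
    exact ⟨b', p, i, h, fun h => hb' (by simp [Proc.bound, h])⟩
  have hm₂ : ∀ n ∈ m, ∃ b p i, n = .ch b p i ∧ b ∉ Q₂.bound := by
    intro n hn
    obtain ⟨b', p, i, h, hb'⟩ := h.fresh_m n hn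
    exact ⟨b', p, i, h, fun h => hb' (by simp [Proc.bound, h])⟩
  obtain ⟨a₁, a₂, a₃, a₄, a₅⟩ := hC₁.pass h.refines hV₁ t₁ h.source.1 hnd.1
    (fun b hb => hfr b (.inl hb)) h.nodup_m hK₁
  obtain ⟨b₁, b₂, b₃, b₄, b₅⟩ := hC₂.pass h.refines hV₂ t₂ h.source.2 hnd.2.1
    (fun b hb => hfr b (.inr hb)) h.nodup_m hK₂
  -- If `X` is free on both sides, then the linear names that it gets are on both sides as well.
  have hboth : Q₁.frv X = true → Q₂.frv X = true → ∀ n, Δ₀ n = none := by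
    intro f₁ f₂ n
    by_contra hn
    obtain ⟨h₁, h₂, -⟩ := a₁.tr f₁ n hn
    exact (hV n (hV₁ h₁) h₂).1 h₁ (b₁.tr f₂ n hn).1
  refine ⟨⟨V₁, ⟨h.source.1, h.muFree.1, hnd.1, fun b hb p i hi => hfr b (.inl hb) p i (hV₁ hi),
    h.refines.mono hV₁, t₁, a₁, a₂, h.nodup_m, hm₁, ?_⟩⟩,
    ⟨V₂, ⟨h.source.2, h.muFree.2, hnd.2.1, fun b hb p i hi => hfr b (.inr hb) p i (hV₂ hi),
    h.refines.mono hV₂, t₂, b₁, b₂, h.nodup_m, hm₂, ?_⟩⟩, a₃, b₃, ?_, ?_⟩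
  · intro hl f₁
    refine h.off ?_ (by simp [Proc.frv, f₁])
    simpa [mainLeft, f₁] using hl
  · intro hl f₂
    rcases hlin : lin with _ | _
    · exact h.off hlin (by simp [Proc.frv, f₂])
    · refine hboth ?_ f₂
      simpa [mainLeft, f₂, hlin] using hl
  · intro n hn hs hn'
    obtain ⟨s, h₁, h₂, h₃⟩ := a₄ n hn hs
    obtain ⟨t, h₁', h₂', h₃'⟩ := b₄ n hn' hs
    obtain rfl := h.refines.eq_of_mem (hV₁ h₁) (hV₂ h₁') h₃ h₃'
    refine (hV s (hV₁ h₁) ?_).1 h₁ h₁'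
    rw [← h.refines.isShared_of_mem (hV₁ h₁) h₂ h₃, hs]
  · intro n hn hs
    rcases a₅ n hn hs with h₁ | h₁ | ⟨s, h₁, h₂, h₃, h₄⟩
    · exact .inl h₁
    · exact .inr (.inr h₁)
    rcases b₅ n hn hs with h₁' | h₁' | ⟨t, h₁', h₂', h₃', h₄'⟩
    · exact .inr (.inl h₁')
    · exact .inr (.inr h₁')
    obtain rfl := h.refines.eq_of_mem h₁ h₁' h₄ h₄'
    exact absurd ((hV s h₁ (by rw [← h.refines.isShared_of_mem h₁ h₃ h₄, hs])).2 h₂') h₂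

end RecState

/-! ### Typing the breakdown of a recursion -/

theorem recKind_name (lin : Bool) (k : ℕ) :
    (if lin then PKind.recSession else .recShared).name k = .prop true k true := by
  cases lin <;> rfl

theorem kindsRec_eq_cons (X : ℕ) (lin : Bool) (P : Proc) :
    ∃ ks, kindsRec X lin P = (if lin then .recSession else .recShared) :: ks := by
  cases P <;> exact ⟨_, rfl⟩

namespace RecState

variable {X : ℕ} {m : List Name} {Δ₀ : Env} {lin : Bool} {E : Name → Ty} {ρ : Name → Name}
  {T T' : Name → Ty} {V : Set Name} {x : List Name} {P : Proc}

/-- The linear names that the component for `0` receives have type `end`. -/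
theorem nil (h : RecState X m Δ₀ lin E ρ T V x .nil) {n : Name} (hn : n ∈ x)
    (hs : (T n).isShared = false) : T n = .endT := by
  rcases h.carries.used n hn with h₁ | ⟨s, h₁, h₂, h₃⟩
  · rw [hs] at h₁; simp at h₁
  · by_contra hne
    have hne' : E s ≠ .endT := fun he => hne (h₃ he)
    exact hne' (h.typed.inv_nil h.refines.wf h₁
      (by rw [← h.refines.isShared_of_mem h₁ hne' h₂, hs]))

/-- The last trio of a round has received `m̃`, and nothing else that is linear except for names of
type `end`. -/
theorem pvar {Y : ℕ} (h : RecState X m Δ₀ lin E ρ T V x (.pvar Y)) :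
    (∀ n ∈ m, n ∈ x) ∧ ∀ n ∈ x, (T n).isShared = false → n ∈ m ∨ T n = .endT := by
  obtain ⟨Δ₁, h₁, h₂, h₃⟩ := h.typed.inv_pvar h.refines.wf
  have hY : Y = X := by
    by_contra hY
    simp [hY] at h₁
  subst hY
  rw [Function.update_self, Option.some.injEq] at h₁
  subst h₁
  have hf : (Proc.pvar Y).frv Y = true := by simp [Proc.frv]
  refine ⟨h.carries.keep hf, fun n hn hs => ?_⟩
  rcases h.carries.used n hn with h₄ | ⟨s, h₄, h₅, h₆⟩
  · rw [hs] at h₄; simp at h₄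
  · by_cases hne : E s = .endT
    · exact .inr (h₆ hne)
    · have hsE : (E s).isShared = false := by rw [← h.refines.isShared_of_mem h₄ hne h₅, hs]
      by_cases hD : Δ₀ s = none
      · exact absurd (h₃ s h₄ hsE hD) hne
      · exact .inl ((h.keeps.tr hf s hD).2.2.2 n h₅)

end RecState

/-- Adding a trio in front of a component in the body of a recursion. -/
theorem Outcome.consRec {T T₀ : Name → Ty} {bd bd₀ : List ℕ} {k X : ℕ} {lin : Bool}
    {x z : List Name} {S : Set Name} {P Q trio : Proc}
    (h : Outcome T₀ bd₀ (k + 1) (kindsRec X lin Q) (if lin then .recSession else .recShared) z ∅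
      S P)
    (hbd : ∀ b ∉ bd, b ∉ bd₀ ∧ ∀ p i, T₀ (.ch b p i) = T (.ch b p i))
    (hS : ∀ n ∈ S, (∃ X p, n = .propX X p) ∧ T₀ n = T n)
    (hz : ∀ n ∈ z, ∃ b p i, n = .ch b p i) (hx : ∀ n ∈ x, ∃ b p i, n = .ch b p i)
    (htrio : ∀ (T' : Name → Ty) (Γ : Env), (∀ b ∉ bd₀, ∀ p i, T' (.ch b p i) = T₀ (.ch b p i)) →
      (∀ n ∈ S, T' n = T₀ n) →
      T' (.prop true k true) = (if lin then PKind.recSession else .recShared).ty (x.map T') →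
      T' (.prop true (k + 1) true) = (if lin then PKind.recSession else .recShared).ty (z.map T') →
      T' (.prop true (k + 1) false) = (T' (.prop true (k + 1) true)).dual →
      Agrees T' Γ (.prop true k true) → Agrees T' Γ (.prop true (k + 1) (!lin)) →
      (∀ n ∈ S, Agrees T' Γ n) →
      LinTyped T' (fun _ => none) Γ {.prop true k true, .prop true (k + 1) false} trio) :
    Outcome T bd k ((if lin then .recSession else .recShared) :: kindsRec X lin Q)
      (if lin then .recSession else .recShared) x ∅ S (.par trio P) := by
  obtain ⟨ks, hks⟩ := kindsRec_eq_cons X lin Q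
  rw [hks] at h ⊢
  refine h.cons hbd hS hz hx (by simp) (by simp) ?_
  intro T' Γ h₁ h₂ h₃ h₄ h₅ h₆ h₇
  simp only [recKind_name] at h₃ h₄ h₅ h₆ h₇ ⊢
  rw [Set.empty_sdiff, Set.empty_union]
  refine htrio T' Γ h₁ h₂ h₃ h₅ (by rw [h₅]; exact h₆) (h₇ _ (.inr (.inl rfl))) ?_
    (fun n hn => h₇ n (.inr (.inr (.inr (.inr hn)))))
  cases lin
  · exact h₇ _ (.inr (.inr (.inl ⟨rfl, rfl⟩)))
  · exact h₇ _ (.inr (.inr (.inr (.inl ⟨rfl, by simp⟩))))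

namespace LinTyped

variable {T : Name → Ty} {Ξ : ℕ → Option Env} {Γ : Env} {L : Set Name}
  {x z : List Name} {k X : ℕ} {lin : Bool}

/-- The end of a trio, which may leave names of type `end` behind. -/
theorem passRec
    (hΞ : lin = true → Ξ X = some (linEnv T {.prop true k true, .prop true (k + 1) false}))
    (hT₀ : (T (.prop true k true)).isShared = !lin)
    (hT : T (.prop true (k + 1) true) = (if lin then PKind.recSession else .recShared).ty (z.map T))
    (hT' : T (.prop true (k + 1) false) = (T (.prop true (k + 1) true)).dual) (hz : z.Nodup)
    (hzc : ∀ n ∈ z, ∃ b p i, n = .ch b p i) (hΓ : Agrees T Γ (.prop true (k + 1) (!lin)))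
    (hΓz : ∀ n ∈ z, Agrees T Γ n) (xs : List Name)
    (hL : ∀ n, (T n).isShared = false →
      n = .prop true k true ∨ n = .prop true (k + 1) false ∨ n ∈ z → n ∈ L)
    (hL' : ∀ n ∈ L, (T n).isShared = false →
      n = .prop true k true ∨ n = .prop true (k + 1) false ∨ n ∈ z ∨
        (n ∈ xs ∧ T n = .endT ∧ Γ n = none)) :
    LinTyped T Ξ Γ L (_root_.sendRec lin X (k + 1) z) := by
  have hzp : ∀ r j p, Name.prop r j p ∉ z := by
    intro r j p h
    obtain ⟨_, _, _, h⟩ := hzc _ h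
    cases h
  refine (LinTyped.sendRec (R := {.prop true k true, .prop true (k + 1) false})
    (L := {.prop true k true, .prop true (k + 1) false} ∪ {n | n ∈ z}) hΞ hT hT' hz
    (fun p => hzp _ _ p) hΓ hΓz (fun _ => .inr rfl) ?_ ?_).weaken xs ?_ ?_
  · rintro n hn (rfl | rfl)
    · exact hzp _ _ _ hn
    · exact hzp _ _ _ hn
  · intro n hn
    simp only [Set.mem_union, Set.mem_insert_iff, Set.mem_singleton_iff, Set.mem_ofPred_eq]
    cases lin
    · have h₁ : n ≠ .prop true k true := by rintro rfl; rw [hT₀] at hn; simp at hn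
      have h₂ : n ≠ .prop true (k + 1) false := by
        rintro rfl; rw [hT', hT] at hn; simp [PKind.ty, Ty.dual, Ty.isShared] at hn
      simp [h₁, h₂]
    · simp
  · intro n hs hn
    refine hL n hs ?_
    rcases hn with (h | h) | h
    · exact .inl h
    · exact .inr (.inl h)
    · exact .inr (.inr h)
  · intro n hn hs
    rcases hL' n hn hs with h | h | h | h
    · exact .inl (.inl (.inl h))
    · exact .inl (.inl (.inr h))
    · exact .inl (.inr h)
    · exact .inr h

end LinTyped

theorem mem_fn_resAll {b : ℕ} {P : Proc} {n : Name} (hn : n ∈ P.fn)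
    (hb : ∀ p i, n ≠ .ch b p i) : ∀ {Ms : List Ty} {i : ℕ}, n ∈ (resAll b i Ms P).fn
  | [], i => hn
  | M :: Ms, i => by
      rw [resAll, Proc.fn, List.mem_filter]
      exact ⟨mem_fn_resAll hn hb, by simp [hb, Name.dual]⟩

theorem mem_resNames {b : ℕ} {C : Ty} {n : Name} : n ∈ resNames (.ch b true 0) C ↔
    ∃ p, ∃ j < C.G.length, n = .ch b p (1 + j) ∧ (p = true ∨ C.isShared = false) := by
  unfold resNames
  split_ifs with hs
  · rw [Name.withIdx, mem_bname]
    simp [hs]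
  · rw [Bool.not_eq_true] at hs
    simp only [List.mem_append, Name.dual, Name.withIdx, mem_bname, Ty.dual_G, List.length_map, hs,
      or_true, and_true, Bool.not_true]
    constructor
    · rintro (⟨j, hj, h⟩ | ⟨j, hj, h⟩)
      · exact ⟨_, j, hj, h⟩
      · exact ⟨_, j, hj, h⟩
    · rintro ⟨_ | _, j, hj, h⟩
      · exact .inr ⟨j, hj, h⟩
      · exact .inl ⟨j, hj, h⟩

theorem extendTy_resSet {T T' : Name → Ty} {b : ℕ} {C : Ty} (hC : C.WF)
    (hT : ∀ p i, T' (.ch b p i) = extendTy T b C (.ch b p i)) :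
    (∀ j M, C.G[j]? = some M → T' (.ch b true (1 + j)) = M ∧ T' (.ch b false (1 + j)) = M.dual) ∧
      ∀ n ∈ resSet b 1 C.G.length, (T' n).isShared = C.isShared := by
  have h : ∀ j M, C.G[j]? = some M →
      T' (.ch b true (1 + j)) = M ∧ T' (.ch b false (1 + j)) = M.dual := by
    intro j M hj
    rw [hT, hT]; exact extendTy_ch hj
  refine ⟨h, ?_⟩
  rintro n ⟨p, j, hj, rfl⟩
  have hj' := List.getElem?_eq_getElem hj
  have hM := hC.isShared_of_mem_G (List.mem_of_getElem? hj')
  cases p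
  · rw [(h j _ hj').2, Ty.dual_isShared, hM]
  · rw [(h j _ hj').1, hM]

/-- The breakdown of a part of the body of a recursion is well typed. All its linear names are
propagators: it receives the other ones. -/
theorem outcome_Brec {X : ℕ} {m : List Name} {Δ₀ : Env} {P : Proc} :
    ∀ {lin : Bool} {E : Name → Ty} {ρ : Name → Name} {T : Name → Ty} {V : Set Name} {k : ℕ}
      {x : List Name}, RecState X m Δ₀ lin E ρ T V x P →
      T (.propX X true) = .shared (m.map T) →
      Outcome T P.bound k (kindsRec X lin P) (if lin then .recSession else .recShared) x ∅
        {.propX X true} (Brec X m lin E ρ k x P) := by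
  have hSX : ∀ n ∈ ({.propX X true} : Set Name), ∃ Y p, n = .propX Y p := by
    rintro n rfl; exact ⟨_, _, rfl⟩
  have hch : ∀ {bd : List ℕ} {x : List Name}, (∀ n ∈ x, ∃ b p i, n = Name.ch b p i ∧ b ∉ bd) →
      ∀ n ∈ x, ∃ b p i, n = Name.ch b p i := by
    intro bd x h n hn
    obtain ⟨b, p, i, h, -⟩ := h n hn
    exact ⟨b, p, i, h⟩
  have hprop : ∀ {x : List Name}, (∀ n ∈ x, ∃ b p i, n = Name.ch b p i) →
      ∀ {r j p}, Name.prop r j p ∉ x := by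
    intro x h r j p hn
    obtain ⟨_, _, _, h⟩ := h _ hn
    cases h
  have hsh : ∀ {lin : Bool} {M : List Ty},
      ((if lin then PKind.recSession else .recShared).ty M).isShared = !lin := by
    intro lin M; cases lin <;> rfl
  induction P with
  | nil =>
    intro lin E ρ T V k x h hX
    have hx := hch h.carries.fresh
    refine Outcome.single hSX hx ?_
    intro T' Γ h₁ h₂ h₃ h₄
    rw [recKind_name] at h₃ h₄ ⊢
    have h' := h.congr (T' := T') fun b _ => h₁ b
    rw [Set.empty_union]
    refine LinTyped.trioRec h₃ (fun hl n hn => ?_) h.carries.nodup (hprop hx) rfl ?_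
      (h₄ _ (.inr (.inl rfl))) (fun n hn _ => .inl hn) ?_
    · rw [Set.mem_singleton_iff.1 hn, h₃, hsh, hl]; rfl
    · rintro n rfl; exact hprop hx
    · refine LinTyped.weaken (L := {.prop true k true}) x ?_ (fun n _ hn => .inl hn) ?_
      · cases lin
        · refine LinTyped.nil fun n hn => ?_
          rw [Set.mem_singleton_iff.1 hn, h₃, hsh]; rfl
        · exact LinTyped.pvar (Function.update_self ..) fun _ _ => Iff.rfl
      · rintro n (hn | hn) hs
        · exact .inl hn
        · exact .inr ⟨hn, h'.nil hn hs, (agrees_bindShared_of_mem hn).none hs⟩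
  | pvar Y =>
    intro lin E ρ T V k x h hX
    have hx := hch h.carries.fresh
    have hm := hch h.fresh_m
    refine Outcome.single hSX hx ?_
    intro T' Γ h₁ h₂ h₃ h₄
    rw [recKind_name] at h₃ h₄ ⊢
    have h' := h.congr (T' := T') fun b _ => h₁ b
    obtain ⟨h₅, h₆⟩ := h'.pvar
    have hX' : T' (.propX X true) = .shared (m.map T') := by
      rw [h₂ _ rfl, hX, map_eq_of_ch hm fun b p i _ => h₁ b p i]
    have hXs : (T' (.propX X true)).isShared = true := by rw [hX']; rfl
    rw [Set.empty_union]
    have hR : lin = false → ∀ n ∈ ({.prop true k true} : Set Name), (T' n).isShared = true := by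
      intro hl n hn
      rw [Set.mem_singleton_iff.1 hn, h₃, hsh, hl]; rfl
    refine LinTyped.trioRec h₃ hR h.carries.nodup (hprop hx) rfl ?_
      (h₄ _ (.inr (.inl rfl))) (fun n hn _ => .inl hn) ?_
    · rintro n rfl; exact hprop hx
    · refine LinTyped.weaken (L := {.prop true k true} ∪ {n | n ∈ m}) x ?_ ?_ ?_
      · refine LinTyped.out (L' := {.prop true k true}) rfl (.inr (.inr hX')) (by simp [hXs])
          (agrees_bindShared (.inr (h₄ _ (.inr (.inr rfl))))) h.nodup_m
          (fun n hn => agrees_bindShared_of_mem (h₅ n hn)) (fun n hn _ => .inr hn) ?_ ?_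
        · intro n hs
          have h₇ : n ≠ .propX X true := by rintro rfl; rw [hXs] at hs; simp at hs
          have h₈ : n = .prop true k true → n ∉ m := by rintro rfl; exact hprop hm
          simp only [Set.mem_singleton_iff, Set.mem_union, Set.mem_ofPred_eq, h₇, false_imp_iff,
            and_true]
          tauto
        · cases lin
          · exact LinTyped.nil (hR rfl)
          · exact LinTyped.pvar (Function.update_self ..) fun _ _ => Iff.rfl
      · rintro n - (hn | hn)
        · exact .inl hn
        · exact .inr (h₅ n hn)
      · rintro n (hn | hn) hs
        · exact .inl (.inl hn)
        · rcases h₆ n hn hs with h | h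
          · exact .inl (.inr h)
          · exact .inr ⟨hn, h, (agrees_bindShared_of_mem hn).none hs⟩
  | out u vs Q ih =>
    intro lin E ρ T V k x h hX
    obtain ⟨v, rfl⟩ := h.source.1
    have hx := hch h.carries.fresh
    obtain ⟨⟨V', hQ⟩, -⟩ := h.out
    refine (ih hQ hX).consRec (fun b hb => ⟨hb, fun _ _ => rfl⟩) (fun n hn => ⟨hSX n hn, rfl⟩)
      (hch hQ.carries.fresh) hx ?_
    intro T' Γ t₁ t₂ t₃ t₄ t₅ g₁ g₂ g₃
    obtain ⟨⟨-, -⟩, hl, hmin, hvs, hvx, hlv, hzx, hz, hx'⟩ := (h.congr (T' := T') t₁).out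
    set z := carry X m Q (dropSubj (E u) (ρ u) x)
    set l := subjName (E u) (ρ u)
    have hRx : ∀ n ∈ ({.prop true k true, .prop true (k + 1) false} : Set Name), n ∉ x := by
      rintro n (rfl | rfl) <;> exact hprop hx
    have hΓx : ∀ n ∈ x, Agrees T' (bindShared Γ x (x.map T')) n :=
      fun n hn => agrees_bindShared_of_mem hn
    refine LinTyped.trioRec t₃ ?_ h.carries.nodup (hprop hx) (.inl rfl) hRx g₁ ?_ ?_
    · rintro rfl n (rfl | rfl)
      · rw [t₃, hsh]; rfl
      · rw [t₅, Ty.dual_isShared, t₄, hsh]; rfl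
    · rintro n (rfl | rfl) hs
      · exact .inl rfl
      · right
        rw [t₅, Ty.dual_isShared, t₄, hsh] at hs
        obtain rfl : lin = true := by simpa using hs
        simp [Proc.fn, sendRec]
    · refine LinTyped.out (L' := {n |
          (n ∈ ({.prop true k true, .prop true (k + 1) false} : Set Name) ∨ n ∈ x) ∧
          n ∉ bname (ρ v) (E v) ∧ (n = l → (T' l).tr = true)}) rfl hmin
        (fun hs => ⟨.inr hl, hlv hs⟩) (hΓx l hl) hvs (fun n hn => hΓx n (hvx n hn))
        (fun n hn _ => .inr (hvx n hn)) (fun n _ => Iff.rfl) ?_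
      refine LinTyped.passRec (by simp) (by rw [t₃, hsh]) t₄ t₅ hQ.carries.nodup
        (hch hQ.carries.fresh) (agrees_bindShared (.inr g₂)) (fun n hn => hΓx n (hzx n hn)) x ?_ ?_
      · intro n hs hn
        have hR : n ∈ ({.prop true k true, .prop true (k + 1) false} : Set Name) →
            n ∉ bname (ρ v) (E v) ∧ (n = l → (T' l).tr = true) := by
          intro hn
          refine ⟨fun h => hRx n hn (hvx n h), ?_⟩
          rintro rfl
          exact absurd hl (hRx _ hn)
        rcases hn with hn | hn | hn
        · exact ⟨.inl (.inl hn), hR (.inl hn)⟩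
        · exact ⟨.inl (.inr hn), hR (.inr hn)⟩
        · exact ⟨.inr (hzx n hn), hz n hn hs⟩
      · rintro n ⟨(hn | hn) | hn, hnv, hnl⟩ hs
        · exact .inl hn
        · exact .inr (.inl hn)
        · rcases hx' n hn hs with h | h | h | ⟨h, h₂⟩
          · exact .inr (.inr (.inl h))
          · exact .inr (.inr (.inr ⟨hn, h, (hΓx n hn).none hs⟩))
          · exact absurd h hnv
          · rw [hnl h] at h₂; simp at h₂
  | inp u ys Q ih =>
    intro lin E ρ T V k x h hX
    obtain ⟨b, rfl⟩ := h.source.1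
    have hx := hch h.carries.fresh
    have hm := h.fresh_m
    set C := (E u).carried
    have hT₀ : ∀ b' ∉ (Proc.inp u [.ch b true 0] Q).bound, b' ∉ Q.bound ∧ ∀ p i,
        extendTy T b C (.ch b' p i) = T (.ch b' p i) := by
      intro b' hb'
      simp only [Proc.bound, Proc.nameBase, List.flatMap_cons, List.flatMap_nil, List.append_nil,
        List.cons_append, List.nil_append, List.mem_cons, not_or] at hb'
      exact ⟨hb'.2, extendTy_of_ne hb'.1⟩
    have hbQ : b ∉ Q.bound := by
      have := h.nodup
      simp only [Proc.bound, Proc.nameBase, List.flatMap_cons, List.flatMap_nil, List.append_nil,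
        List.cons_append, List.nil_append, List.nodup_cons] at this
      exact this.1
    obtain ⟨⟨V', hQ⟩, -⟩ := (h.congr (T' := extendTy T b C) fun b hb => (hT₀ b hb).2).inp
      map_extendTy_true
    have hX₀ : extendTy T b C (.propX X true) = .shared (m.map (extendTy T b C)) := by
      rw [map_eq_of_ch (T' := extendTy T b C) (hch hm) fun b p i hn => ?_]
      · exact hX
      · obtain ⟨b', p', i', hbp, hb'⟩ := hm _ hn
        injection hbp with hbp
        exact (hT₀ b (hbp ▸ hb')).2 p i
    refine (ih hQ hX₀).consRec hT₀ (fun n hn => ⟨hSX n hn, by rw [Set.mem_singleton_iff.1 hn]; rfl⟩)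
      (hch hQ.carries.fresh) hx ?_
    intro T' Γ t₁ t₂ t₃ t₄ t₅ g₁ g₂ g₃
    have hyT : (bname (.ch b true 1) C).map T' = C.G := by
      rw [← map_extendTy_true (T := T)]
      refine List.map_congr_left fun n hn => ?_
      obtain ⟨j, -, rfl⟩ := mem_bname.1 hn
      exact t₁ b hbQ _ _
    obtain ⟨⟨-, -⟩, hl, hmin, hyx, hzx, hz, hx'⟩ := (h.congr (T' := T') fun b hb p i => by
      rw [t₁ b (hT₀ b hb).1, (hT₀ b hb).2]).inp hyT
    set yt := bname (.ch b true 1) C with hyt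
    set z := carry X m Q (dropSubj (E u) (ρ u) x ++ yt)
    set l := subjName (E u) (ρ u)
    have hRx : ∀ n ∈ ({.prop true k true, .prop true (k + 1) false} : Set Name), n ∉ x := by
      rintro n (rfl | rfl) <;> exact hprop hx
    have hych : ∀ n ∈ yt, ∃ b p i, n = .ch b p i := by
      intro n hn
      obtain ⟨j, -, rfl⟩ := mem_bname.1 hn
      exact ⟨_, _, _, rfl⟩
    have hRy : ∀ n ∈ ({.prop true k true, .prop true (k + 1) false} : Set Name), n ∉ yt := by
      rintro n (rfl | rfl) <;> exact hprop hych
    have hΓx : ∀ n, n ∈ x ∨ n ∈ yt →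
        Agrees T' (bindShared (bindShared Γ x (x.map T')) yt (yt.map T')) n :=
      fun n hn => agrees_bindShared (hn.symm.imp id agrees_bindShared_of_mem)
    refine LinTyped.trioRec t₃ ?_ h.carries.nodup (hprop hx) (.inl rfl) hRx g₁ ?_ ?_
    · rintro rfl n (rfl | rfl)
      · rw [t₃, hsh]; rfl
      · rw [t₅, Ty.dual_isShared, t₄, hsh]; rfl
    · rintro n (rfl | rfl) hs
      · exact .inl rfl
      · right
        rw [t₅, Ty.dual_isShared, t₄, hsh] at hs
        obtain rfl : lin = true := by simpa using hs
        have : Name.prop true (k + 1) false ∉ yt := hprop hych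
        exact List.mem_cons_of_mem _ (List.mem_filter.2
          ⟨by simp [Proc.fn, sendRec], by rw [decide_eq_true_eq]; exact this⟩)
    · refine LinTyped.inp (L' := {n | n ∈ yt ∨
          ((n ∈ ({.prop true k true, .prop true (k + 1) false} : Set Name)
          ∨ n ∈ x) ∧ (n = l → (T' l).tr = true))}) rfl hmin
        (fun _ => .inr hl) (agrees_bindShared_of_mem hl) nodup_bname (fun h => hyx l h hl) ?_
        (fun n _ => Iff.rfl) ?_
      · rintro n hn - (h | h)
        · exact hRy n h hn
        · exact hyx n hn h
      refine LinTyped.passRec (by simp) (by rw [t₃, hsh]) t₄ t₅ hQ.carries.nodup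
        (hch hQ.carries.fresh) (agrees_bindShared (.inr (agrees_bindShared (.inr g₂))))
        (fun n hn => hΓx n (hzx n hn)) (x ++ yt) ?_ ?_
      · intro n hs hn
        have hR : n ∈ ({.prop true k true, .prop true (k + 1) false} : Set Name) →
            (n = l → (T' l).tr = true) := by
          rintro hn rfl
          exact absurd hl (hRx _ hn)
        rcases hn with hn | hn | hn
        · exact .inr ⟨.inl (.inl hn), hR (.inl hn)⟩
        · exact .inr ⟨.inl (.inr hn), hR (.inr hn)⟩
        · rcases hzx n hn with h | h
          · exact .inr ⟨.inr h, hz n hn hs⟩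
          · exact .inl h
      · intro n hn hs
        have key : n ∈ x ∨ n ∈ yt → (n = l → (T' l).tr = true) →
            n ∈ z ∨ (n ∈ x ++ yt ∧ T' n = .endT ∧
              bindShared (bindShared Γ x (x.map T')) yt (yt.map T') n = none) := by
          intro hn hnl
          rcases hx' n hn hs with h | h | ⟨h, h₂⟩
          · exact .inl h
          · exact .inr ⟨List.mem_append.2 hn, h, (hΓx n hn).none hs⟩
          · rw [hnl h] at h₂; simp at h₂
        rcases hn with hn | ⟨(hn | hn) | hn, hnl⟩
        · refine .inr (.inr (key (.inr hn) ?_))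
          rintro rfl; exact absurd hl (hyx _ hn)
        · exact .inl hn
        · exact .inr (.inl hn)
        · exact .inr (.inr (key (.inl hn) hnl))
  | res a C Q ih =>
    intro lin E ρ T V k x h hX
    obtain ⟨⟨b, rfl⟩, hC, -⟩ := h.source
    have hx := hch h.carries.fresh
    have hm := h.fresh_m
    have hT₀ : ∀ b' ∉ (Proc.res (.ch b true 0) C Q).bound, b' ∉ Q.bound ∧ ∀ p i,
        extendTy T b C (.ch b' p i) = T (.ch b' p i) := by
      intro b' hb'
      simp only [Proc.bound, Proc.nameBase, List.cons_append, List.nil_append, List.mem_cons,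
        not_or] at hb'
      exact ⟨hb'.2, extendTy_of_ne hb'.1⟩
    have hbQ : b ∉ Q.bound := by
      have := h.nodup
      simp only [Proc.bound, Proc.nameBase, List.cons_append, List.nil_append, List.nodup_cons]
        at this
      exact this.1
    obtain ⟨⟨V', hQ⟩, hbx⟩ := (h.congr (T' := extendTy T b C) fun b hb => (hT₀ b hb).2).res
      map_extendTy_true map_extendTy_false
    have hX₀ : extendTy T b C (.propX X true) = .shared (m.map (extendTy T b C)) := by
      rw [map_eq_of_ch (T' := extendTy T b C) (hch hm) fun b p i hn => ?_]
      · exact hX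
      · obtain ⟨b', p', i', hbp, hb'⟩ := hm _ hn
        injection hbp with hbp
        exact (hT₀ b (hbp ▸ hb')).2 p i
    refine (ih hQ hX₀).consRec hT₀ (fun n hn => ⟨hSX n hn, by rw [Set.mem_singleton_iff.1 hn]; rfl⟩)
      (hch hQ.carries.fresh) hx ?_
    intro T' Γ t₁ t₂ t₃ t₄ t₅ g₁ g₂ g₃
    obtain ⟨hres, hres'⟩ := extendTy_resSet hC (t₁ b hbQ)
    set R : Set Name := {.prop true k true, .prop true (k + 1) false} with hRdef
    have hRch : ∀ b p i, Name.ch b p i ∉ R := by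
      intro b p i h
      simp [hRdef] at h
    have hRx : ∀ n ∈ R, n ∉ x := by
      rintro n (rfl | rfl) <;> exact hprop hx
    have hRprop : ∀ n ∈ R, ∀ p i, n ≠ .ch b p i := by
      rintro n (rfl | rfl) <;> simp
    have hRs : lin = false → ∀ n ∈ R, (T' n).isShared = true := by
      rintro rfl n (rfl | rfl)
      · rw [t₃, hsh]; rfl
      · rw [t₅, Ty.dual_isShared, t₄, hsh]; rfl
    refine LinTyped.mu (fun n hn hs => mem_fn_resAll ?_ (hRprop n hn)) (LinTyped.resAll hres
      (fun p j _ => hRch b p _) fun Γ' k₁ k₂ => ?_)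
    · rcases hn with rfl | rfl
      · simp [Proc.fn]
      · rw [t₅, Ty.dual_isShared, t₄, hsh] at hs
        obtain rfl : lin = true := by simpa using hs
        refine List.mem_cons_of_mem _ (List.mem_filter.2 ⟨by simp [Proc.fn, sendRec], ?_⟩)
        simpa using hRx _ (.inr rfl)
    have hΓ' : ∀ {r j p}, Γ' (.prop r j p) = Γ (.prop r j p) := by
      intro r j p
      refine k₁ _ ?_
      rintro ⟨_, _, _, h⟩
      cases h
    have hΓx : ∀ n ∈ x ++ resNames (.ch b true 0) C,
        Agrees T' (bindShared Γ' x (x.map T')) n := by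
      intro n hn
      rcases List.mem_append.1 hn with hn | hn
      · exact agrees_bindShared_of_mem hn
      · obtain ⟨p, j, hj, rfl, hp⟩ := mem_resNames.1 hn
        refine agrees_bindShared (.inr (k₂ p j hj (hp.imp id fun h => ?_)))
        rw [hres' _ ⟨p, j, hj, rfl⟩, h]
    refine LinTyped.inpRec (R := R) (Function.update_self ..) t₃ hRs h.carries.nodup (hprop hx)
      (fun _ => .inl (.inl rfl)) ?_ (by rw [Agrees, hΓ']; exact g₁) ?_
    · rintro n hn - (h | ⟨p, j, hj, rfl⟩)
      · exact hRx n h hn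
      · exact hbx _ _ hn
    refine LinTyped.passRec (by simp [hRdef]) (by rw [t₃, hsh]) t₄ t₅ hQ.carries.nodup
      (hch hQ.carries.fresh) (agrees_bindShared (.inr (by rw [Agrees, hΓ']; exact g₂))) hΓx [] ?_ ?_
    · rintro n hs (hn | hn | hn)
      · exact .inl (.inl (.inl hn))
      · exact .inl (.inl (.inr hn))
      · rcases List.mem_append.1 hn with hn | hn
        · exact .inr hn
        · obtain ⟨p, j, hj, rfl, -⟩ := mem_resNames.1 hn
          exact .inl (.inr ⟨p, j, hj, rfl⟩)
    · rintro n (((hn | hn) | hn) | hn) hs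
      · exact .inl hn
      · exact .inr (.inl hn)
      · refine .inr (.inr (.inl (List.mem_append_right _ ?_)))
        rw [hres' n hn] at hs
        obtain ⟨p, j, hj, rfl⟩ := hn
        exact mem_resNames.2 ⟨p, j, hj, rfl, .inr hs⟩
      · exact .inr (.inr (.inl (List.mem_append_left _ hn)))
  | par Q₁ Q₂ ih₁ ih₂ =>
    intro lin E ρ T V k x h hX
    have hx := hch h.carries.fresh
    obtain ⟨⟨V₁, hQ₁⟩, ⟨V₂, hQ₂⟩, -⟩ := h.par
    have o₁ := ih₁ (k := k + 1) hQ₁ hX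
    have o₂ := ih₂ (k := k + Q₁.sizeRec + 1) hQ₂ hX
    have hlen := length_kindsRec X (lin && mainLeft X Q₁ Q₂) Q₁
    rw [kindsRec, Brec]
    have hl : lin = true → (lin && mainLeft X Q₁ Q₂) = !(lin && !mainLeft X Q₁ Q₂) := by
      rintro rfl; simp
    have hl' : lin = false → (lin && mainLeft X Q₁ Q₂) = false ∧
      (lin && !mainLeft X Q₁ Q₂) = false := by rintro rfl; simp
    generalize (lin && mainLeft X Q₁ Q₂) = l₁ at *
    generalize (lin && !mainLeft X Q₁ Q₂) = l₂ at *
    obtain ⟨ks₁, hks₁⟩ := kindsRec_eq_cons X l₁ Q₁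
    obtain ⟨ks₂, hks₂⟩ := kindsRec_eq_cons X l₂ Q₂
    rw [hks₁] at o₁ hlen ⊢
    rw [hks₂] at o₂ ⊢
    have hxb := h.carries.fresh
    have hzb : ∀ Q, ∀ n ∈ carry X m Q x, ∃ b p i, n = .ch b p i ∧ b ∉ (Proc.par Q₁ Q₂).bound := by
      intro Q n hn
      rcases mem_carry.1 hn with hn | hn
      · exact h.fresh_m n hn.2
      · exact hxb n (mem_fnb.1 hn).1
    refine o₁.par o₂ (by rw [hlen]; omega) (by simp [Proc.bound]) hSX
      (hch (hzb Q₁)) (hzb Q₂) hx (by simp) (by simp) (by simp) (by simp) ?_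
    intro T' Γ t₁ t₂ t₃ _ t₄ t₄' t₅ t₅' g
    simp only [recKind_name] at t₃ t₄ t₄' t₅ t₅' g ⊢
    have hc₁ : Agrees T' Γ (.prop true (k + 1) (!l₁)) := by
      cases l₁
      · exact g _ (.inr (.inr (.inl ⟨rfl, rfl⟩)))
      · exact g _ (.inr (.inr (.inr (.inl ⟨rfl, by simp⟩))))
    have hc₂ : Agrees T' Γ (.prop true (k + Q₁.sizeRec + 1) (!l₂)) := by
      cases l₂
      · exact g _ (.inr (.inr (.inr (.inr (.inl ⟨rfl, rfl⟩)))))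
      · exact g _ (.inr (.inr (.inr (.inr (.inr (.inl ⟨rfl, by simp⟩))))))
    have hc := g _ (.inr (.inl rfl))
    obtain ⟨-, -, hz₁, hz₂, hz₁₂, hz⟩ := (h.congr (T' := T') t₁).par
    simp only [Name.dual, Bool.not_true] at t₄' t₅' ⊢
    set z₁ := carry X m Q₁ x
    set z₂ := carry X m Q₂ x
    rw [Set.empty_union, Set.empty_sdiff, Set.empty_union]
    set R : Set Name := {.prop true k true, .prop true (k + 1) false,
      .prop true (k + Q₁.sizeRec + 1) false} with hRdef
    have hRx : ∀ n ∈ R, n ∉ x := by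
      rintro n (rfl | rfl | rfl) <;> exact hprop hx
    have hsh' : ∀ {lin : Bool} {M : List Ty},
        ((if lin then PKind.recSession else .recShared).ty M).dual.isShared = !lin := by
      intro lin M; rw [Ty.dual_isShared, hsh]
    have hRs : lin = false → ∀ n ∈ R, (T' n).isShared = true := by
      intro hlin
      obtain ⟨rfl, rfl⟩ := hl' hlin
      rintro n (rfl | rfl | rfl)
      · rw [t₃, hsh, hlin]; rfl
      · rw [t₄', hsh']; rfl
      · rw [t₅', hsh']; rfl
    have hΓx : ∀ n ∈ x, Agrees T' (bindShared Γ x (x.map T')) n :=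
      fun n hn => agrees_bindShared_of_mem hn
    refine LinTyped.trioRec t₃ hRs h.carries.nodup (hprop hx) (.inl rfl) hRx hc ?_ ?_
    · rintro n (rfl | rfl | rfl) hs
      · exact .inl rfl
      · right
        rw [t₄', hsh'] at hs
        obtain rfl : l₁ = true := by simpa using hs
        simp [Proc.fn, sendRec]
      · right
        rw [t₅', hsh'] at hs
        obtain rfl : l₂ = true := by simpa using hs
        simp [Proc.fn, sendRec]
    refine LinTyped.weaken
      (L := {n | (l₁ = true ∧ n ∈ R) ∨ n ∈ z₁} ∪ {n | (l₂ = true ∧ n ∈ R) ∨ n ∈ z₂}) x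
      (LinTyped.par (L₁ := {n | (l₁ = true ∧ n ∈ R) ∨ n ∈ z₁})
        (L₂ := {n | (l₂ = true ∧ n ∈ R) ∨ n ∈ z₂}) ?_ ?_ ?_) ?_ ?_
    · refine LinTyped.sendRec (R := R) (by simp) t₄ (by rw [t₄', t₄]) hQ₁.carries.nodup
        (fun p => hprop (hch (hzb Q₁))) (agrees_bindShared (.inr hc₁))
        (fun n hn => hΓx n (hz₁ n hn)) (fun _ => .inr (.inl rfl))
        (fun n hn hn' => hRx n hn' (hz₁ n hn)) (fun n _ => Iff.rfl)
    · refine LinTyped.sendRec (R := R) (by simp) t₅ (by rw [t₅', t₅]) hQ₂.carries.nodup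
        (fun p => hprop (hch (hzb Q₂))) (agrees_bindShared (.inr hc₂))
        (fun n hn => hΓx n (hz₂ n hn)) (fun _ => .inr (.inr rfl))
        (fun n hn hn' => hRx n hn' (hz₂ n hn)) (fun n _ => Iff.rfl)
    · intro n hs
      refine ⟨Iff.rfl, ?_⟩
      rintro (⟨rfl, hn⟩ | hn) (⟨rfl, hn'⟩ | hn')
      · rcases lin with _ | _
        · simpa using hl' rfl
        · simpa using hl rfl
      · exact hRx n hn (hz₂ n hn')
      · exact hRx n hn' (hz₁ n hn)
      · exact hz₁₂ n hn hs hn'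
    · rintro n hs ((⟨-, hn⟩ | hn) | (⟨-, hn⟩ | hn))
      · exact .inl hn
      · exact .inr (hz₁ n hn)
      · exact .inl hn
      · exact .inr (hz₂ n hn)
    · rintro n (hn | hn) hs
      · rcases hlin : lin with _ | _
        · rw [hRs hlin n hn] at hs; simp at hs
        · have := hl hlin
          rcases l₂ with _ | _
          · exact .inl (.inl (.inl ⟨this, hn⟩))
          · exact .inl (.inr (.inl ⟨rfl, hn⟩))
      · rcases hz n hn hs with h | h | h
        · exact .inl (.inl (.inr h))
        · exact .inl (.inr (.inr h))
        · exact .inr ⟨hn, h, (hΓx n hn).none hs⟩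
  | mu Y Q ih => intro lin E ρ T V k x h; exact absurd h.muFree id

/-! ### Breaking down a restriction -/

/-- Restricting the broken-down endpoints of a name. Those that the component does not use have
type `end`. -/
theorem Outcome.resAll {T T₀ : Name → Ty} {bd bd₀ : List ℕ} {k b : ℕ} {ks : List PKind} {κ : PKind}
    {x : List Name} {A A₁ : Set Name} {P : Proc} {C : Ty} (h : Outcome T₀ bd₀ k ks κ x A₁ ∅ P)
    (hC : C.WF) (hT₀ : ∀ p i, T₀ (.ch b p i) = extendTy T b C (.ch b p i)) (hb : b ∉ bd₀)
    (hbd : ∀ b' ∉ bd, b' ∉ bd₀ ∧ ∀ p i, T₀ (.ch b' p i) = T (.ch b' p i))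
    (hA : ∀ n ∈ A, n ∈ A₁) (hA₁ : ∀ n ∈ A₁, n ∈ A ∨ n ∈ resNames (.ch b true 0) C)
    (hAb : ∀ p i, Name.ch b p i ∉ A)
    (hend : C.isShared = false → ∀ n ∈ resNames (.ch b true 0) C, n ∉ A₁ → C = .endT) :
    Outcome T bd k ks κ x A ∅ (_root_.resAll b 1 C.G P) := by
  obtain ⟨T', h₁, -, h₂, h₃, h₄⟩ := h
  obtain ⟨hres, hres'⟩ := extendTy_resSet (T := T) (T' := T') (b := b) hC fun p i => by
    rw [h₁ b hb, hT₀]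
  refine ⟨T', fun b' hb' p i => by rw [h₁ b' (hbd b' hb').1, (hbd b' hb').2], by simp, h₂, h₃,
    fun Γ hΓ => ?_⟩
  have hps : ∀ n ∈ propSet k ks, n ∉ resSet b 1 C.G.length := by
    rintro n hn ⟨p, j, -, rfl⟩
    exact ch_notMem_propSet hn
  have hAr : ∀ n ∈ A, n ∉ resSet b 1 C.G.length := by
    rintro n hn ⟨p, j, -, rfl⟩
    exact hAb _ _ hn
  refine LinTyped.resAll hres ?_ fun Γ' k₁ k₂ => ?_
  · rintro p j - (h | h)
    · exact hAb _ _ h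
    · exact ch_notMem_propSet h
  have hΓr : ∀ n ∈ resNames (.ch b true 0) C, Agrees T' Γ' n := by
    intro n hn
    obtain ⟨p, j, hj, rfl, hp⟩ := mem_resNames.1 hn
    refine k₂ p j hj (hp.imp id fun h => ?_)
    rw [hres' _ ⟨p, j, hj, rfl⟩, h]
  refine (h₄ Γ' ?_).weaken (resNames (.ch b true 0) C) ?_ ?_
  · rintro n (hn | hn | hn)
    · rcases hA₁ n hn with hn | hn
      · rw [Agrees, k₁ n (hAr n hn)]; exact hΓ n (.inl hn)
      · exact hΓr n hn
    · rw [Agrees, k₁ n (hps n hn)]; exact hΓ n (.inr (.inl hn))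
    · exact absurd hn (by simp)
  · rintro n hs (hn | hn)
    · rcases hA₁ n hn with hn | hn
      · exact .inl (.inl hn)
      · obtain ⟨p, j, hj, rfl, hp⟩ := mem_resNames.1 hn
        exact .inr ⟨p, j, hj, rfl⟩
    · exact .inl (.inr hn)
  · rintro n ((hn | hn) | hn) hs
    · exact .inl (.inl (hA n hn))
    · exact .inl (.inr hn)
    · by_cases hn₁ : n ∈ A₁
      · exact .inl (.inl hn₁)
      · have hCs : C.isShared = false := by rw [← hres' n hn, hs]
        have hmem : n ∈ resNames (.ch b true 0) C := by
          obtain ⟨p, j, hj, rfl⟩ := hn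
          exact mem_resNames.2 ⟨p, j, hj, rfl, .inr hCs⟩
        refine .inr ⟨hmem, ?_, (hΓr n hmem).none hs⟩
        obtain rfl := hend hCs n hmem hn₁
        obtain ⟨p, j, hj, rfl⟩ := hn
        obtain rfl : j = 0 := by simpa [Ty.G] using hj
        have := hres 0 .endT (by simp [Ty.G])
        cases p
        · exact this.2
        · exact this.1

/-! ### The state of the breakdown -/

/-- The breakdowns of the free names of `P`. -/
def needed (E : Name → Ty) (ρ : Name → Name) (P : Proc) : Set Name :=
  {n | ∃ s ∈ P.fn, n ∈ bname (ρ s) (E s)}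

/-- What is known about a process outside of recursions when it is broken down: it is well typed,
and its component receives only names that it needs, among them all tail recursive ones. -/
structure State (E : Name → Ty) (ρ : Name → Name) (T : Name → Ty) (V : Set Name) (x : List Name)
    (P : Proc) : Prop where
  source : P.Source
  noNestedRec : P.NoNestedRec
  nodup : P.bound.Nodup
  fresh : ∀ b ∈ P.bound, ∀ p i, Name.ch b p i ∉ V
  refines : Refines E ρ T V
  typed : SJ E (fun _ => none) V P
  nodup_x : x.Nodup
  used : ∀ n ∈ x, n ∈ needed E ρ P
  tr : ∀ s ∈ P.fn, (E s).tr = true → ∀ n ∈ bname (ρ s) (E s), n ∈ x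

/-- Outside of recursions every linear name is free, unless it has type `end`. -/
theorem SJ.mem_fn {E : Name → Ty} {V : Set Name} {P : Proc} (h : SJ E (fun _ => none) V P)
    (hwf : ∀ n ∈ V, (E n).WF) {n : Name} (hn : n ∈ V) (hs : (E n).isShared = false)
    (hb : ∃ b p i, n = .ch b p i ∧ b ∉ P.bound) (hne : E n ≠ .endT) : n ∈ P.fn := by
  obtain ⟨b, p, i, rfl, hb⟩ := hb
  by_contra hfn
  rcases Typed.end_or_passed h (linEnv_eq_some.2 ⟨hn, hs, rfl⟩) hb hfn with h₁ | ⟨Y, Δ', -, h₂, -⟩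
  · exact hne ((hwf _ hn).unfold_eq_endT.1 h₁)
  · cases h₂

namespace State

variable {E : Name → Ty} {ρ : Name → Name} {T T' : Name → Ty} {V : Set Name} {x : List Name}
  {P Q Q₁ Q₂ : Proc} {u v n : Name} {b : ℕ} {C : Ty}

theorem congr (h : State E ρ T V x P)
    (hT : ∀ b ∉ P.bound, ∀ p i, T' (.ch b p i) = T (.ch b p i)) : State E ρ T' V x P :=
  { h with refines := h.refines.congr fun b p i j hV => hT b (fun hb => h.fresh b hb p i hV) p j }

theorem ne_endT (h : State E ρ T V x P) (hn : n ∈ P.fn) : E n ≠ .endT :=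
  h.typed.ne_endT_of_mem_fn h.source h.nodup h.fresh h.refines.wf n hn

theorem mem_of_mem_fn (h : State E ρ T V x P) (hn : n ∈ P.fn) : n ∈ V :=
  h.typed.mem_of_mem_fn hn

theorem needed_fresh (h : State E ρ T V x P) (hn : n ∈ needed E ρ P) :
    ∃ b p i, n = .ch b p i ∧ b ∉ P.bound := by
  obtain ⟨s, hs, hns⟩ := hn
  have hsV := h.mem_of_mem_fn hs
  obtain ⟨b, p, i, j, rfl, rfl⟩ := h.refines.ch_of_mem hsV hns
  exact ⟨b, p, j, rfl, fun hb => h.fresh b hb p i hsV⟩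

theorem subj (h : State E ρ T V x P) (hu : u ∈ P.fn) {o : Bool} (ho : (E u).Offers o) :
    subjName (E u) (ρ u) ∈ needed E ρ P ∧ subjName (E u) (ρ u) ∈ bname (ρ u) (E u) ∧
      (T (subjName (E u) (ρ u))).Minimal o (E u).carried.G ∧
      (T (subjName (E u) (ρ u))).tr = (E u).tr ∧
      ((E u).lin = true → subjName (E u) (ρ u) = ρ u) := by
  obtain ⟨h₁, h₂, h₃, h₄⟩ := h.refines.subj (h.mem_of_mem_fn hu) ho (h.ne_endT hu)
  exact ⟨⟨u, hu, h₁⟩, h₁, h₂, h₃, h₄⟩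

theorem eq_subj_iff (h : State E ρ T V x P) (hu : u ∈ P.fn) {o : Bool} (ho : (E u).Offers o)
    (hs : (T n).isShared = false) :
    (n = subjName (E u) (ρ u) ∧ (T (subjName (E u) (ρ u))).tr = false) ↔
      ((E u).lin = true ∧ n = ρ u) := by
  have huV := h.mem_of_mem_fn hu
  obtain ⟨-, h₁, -, h₃, h₄⟩ := h.subj hu ho
  have hsh := h.refines.isShared_of_mem huV (h.ne_endT hu) h₁
  rw [h₃]
  constructor
  · rintro ⟨rfl, ht⟩
    have hl : (E u).lin = true := by rw [Ty.lin, ← hsh, hs, ht]; rfl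
    exact ⟨hl, h₄ hl⟩
  · rintro ⟨hl, rfl⟩
    refine ⟨(h₄ hl).symm, ?_⟩
    simp only [Ty.lin, Bool.and_eq_true, Bool.not_eq_true'] at hl
    exact hl.2

/-- The tuple passed on is sufficient for the continuation. A name needed by the process is needed
by its continuation, or it is sent or used up by the output; it is passed on if it is needed and
has been received. A tail-recursive subject has been received. -/
theorem out (h : State E ρ T V x (.out u [v] Q)) :
    let E' := fupd E u (E u).next
    let ρ' := fupd ρ u (nextName (E u) (ρ u))
    let z := fnb Q (dropSubj (E u) (ρ u) x)
    let l := subjName (E u) (ρ u)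
    let vs := bname (ρ v) (E v)
    let U := needed E ρ (.out u [v] Q)
    (∃ V', State E' ρ' T V' z Q) ∧
      l ∈ U ∧ (T l).Minimal true (vs.map T) ∧ vs.Nodup ∧ (∀ n ∈ vs, n ∈ U) ∧
      ((T l).isShared = false → l ∉ vs) ∧ (∀ n ∈ z, n ∈ x) ∧
      (∀ n ∈ needed E' ρ' Q, n ∈ U ∧ (n ∈ x → n ∈ z)) ∧
      (∀ n ∈ needed E' ρ' Q, (T n).isShared = false → n ∉ vs ∧ (n = l → (T l).tr = true)) ∧
      (∀ n ∈ U, (T n).isShared = false →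
        n ∈ needed E' ρ' Q ∨ n ∈ vs ∨ (n = l ∧ (T l).tr = false)) ∧
      ((T l).tr = true → l ∈ x) := by
  intro E' ρ' z l vs U
  obtain ⟨hu, hv, ho, hune, hvne, hG, huv, ht⟩ := h.typed.inv_out h.refines.wf
  set V' : Set Name := {n | n ∈ V ∧ (n = v → (E v).isShared = true)}
  have hufn : u ∈ (Proc.out u [v] Q).fn := by simp [Proc.fn]
  have hvfn : v ∈ (Proc.out u [v] Q).fn := by simp [Proc.fn]
  have hQfn : ∀ s ∈ Q.fn, s ∈ (Proc.out u [v] Q).fn := fun s hs => by simp [Proc.fn, hs]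
  have hV' : V' ⊆ V := fun n hn => hn.1
  have hb : ∀ b ∈ Q.bound, ∀ p i, Name.ch b p i ∉ V := h.fresh
  have hR := h.refines.step hu hune
  have hne' : ∀ s ∈ Q.fn, E' s ≠ .endT :=
    ht.ne_endT_of_mem_fn h.source.2 h.nodup (fun b hb' p i hm => hb b hb' p i hm.1)
      (hR.mono hV').wf
  have hQV' : ∀ s ∈ Q.fn, s ∈ V' := fun s hs => ht.mem_of_mem_fn hs
  have hQV : ∀ s ∈ Q.fn, s ∈ V := fun s hs => (hQV' s hs).1
  obtain ⟨s₁, s₂, s₃, s₄, s₅⟩ := h.subj hufn ho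
  -- The names left to `Q` are those of the breakdowns of its names, without the subject if the
  -- action uses it up.
  have hsb : ∀ {s n : Name}, s ∈ Q.fn →
      (n ∈ bname (ρ' s) (E' s) ↔ n ∈ bname (ρ s) (E s) ∧ ((E u).lin = true → n ≠ ρ u)) := by
    intro s n hs
    by_cases hsu : s = u
    · subst hsu
      have hne := hne' s hs
      simp only [E', ρ', fupd_same] at hne ⊢
      rw [h.refines.mem_bname_iff hu hune]
      have := h.refines.notMem_bname_next hu (C := (E s).next)
      constructor
      · intro hn
        exact ⟨.inr ⟨hne, hn⟩, fun hl hnu => this hl (hnu ▸ hn)⟩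
      · rintro ⟨⟨h₁, h₂⟩ | ⟨-, h₂⟩, h₃⟩
        · exact absurd h₁ (h₃ h₂)
        · exact h₂
    · simp only [E', ρ', fupd_of_ne _ _ hsu]
      refine ⟨fun hn => ⟨hn, fun hl hnu => hsu ?_⟩, fun hn => hn.1⟩
      subst hnu
      exact h.refines.eq_of_mem (hQV s hs) hu hn (h.refines.self_mem hu hl hune).1
  have hU : ∀ n ∈ needed E' ρ' Q, n ∈ U ∧ (n ∈ x → n ∈ z) := by
    rintro n ⟨s, hs, hn⟩
    obtain ⟨hn, hl⟩ := (hsb hs).1 hn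
    exact ⟨⟨s, hQfn s hs, hn⟩, fun hx =>
      (h.refines.mem_fnb_iff hQV (hQV s hs) hn).2 ⟨mem_dropSubj.2 ⟨hx, hl⟩, hs⟩⟩
  have hzx : ∀ n ∈ z, n ∈ x := fun n hn => (mem_dropSubj.1 (mem_fnb.1 hn).1).1
  refine ⟨⟨V', ⟨h.source.2, h.noNestedRec, h.nodup, fun b hb' p i hm => hb b hb' p i hm.1,
    hR.mono hV', ht, ?_, fun n hn => ?_, fun s hs htr n hn => ?_⟩⟩, s₁, ?_, h.refines.nodup hv _,
    fun n hn => ⟨v, hvfn, hn⟩, ?_, hzx, hU, ?_, ?_, fun ht => h.tr u hufn (s₄ ▸ ht) _ s₂⟩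
  · refine List.Nodup.filter _ ?_
    unfold dropSubj
    split_ifs
    · exact h.nodup_x.filter _
    · exact h.nodup_x
  · obtain ⟨s, hs, hns⟩ := h.used n (hzx n hn)
    have hsQ := ((h.refines.mem_fnb_iff hQV (h.mem_of_mem_fn hs) hns).1 hn).2
    exact ⟨s, hsQ, (hsb hsQ).2 ⟨hns, (mem_dropSubj.1 (mem_fnb.1 hn).1).2⟩⟩
  · refine (hU n ⟨s, hs, hn⟩).2 (h.tr s (hQfn s hs) ?_ n ((hsb hs).1 hn).1)
    by_cases hsu : s = u
    · subst hsu
      simp only [E', fupd_same] at htr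
      rwa [(h.refines.wf s hu).next_tr] at htr
    · simpa only [E', fupd_of_ne _ _ hsu] using htr
  · rw [h.refines.ty v hv hvne, hG]; exact s₃
  · intro hs hl
    obtain rfl := h.refines.eq_of_mem hu hv s₂ hl
    rw [h.refines.isShared_of_mem hu hune hl, huv rfl] at hs
    simp at hs
  · rintro n ⟨s, hsQ, hn⟩ hs
    obtain ⟨hn, hl⟩ := (hsb hsQ).1 hn
    refine ⟨fun hnv => ?_, fun hnl => ?_⟩
    · obtain rfl := h.refines.eq_of_mem (hQV s hsQ) hv hn hnv
      rw [h.refines.isShared_of_mem hv hvne hnv, (hQV' s hsQ).2 rfl] at hs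
      simp at hs
    · by_contra htr
      rw [Bool.not_eq_true] at htr
      obtain ⟨h₆, h₇⟩ := (h.eq_subj_iff hufn ho hs).1 ⟨hnl, htr⟩
      exact hl h₆ h₇
  · rintro n ⟨s, hsP, hn⟩ hs
    have hsV := h.mem_of_mem_fn hsP
    by_cases hsv : s = v
    · subst hsv; exact .inr (.inl hn)
    by_cases hl : (E u).lin = true ∧ n = ρ u
    · exact .inr (.inr ((h.eq_subj_iff hufn ho hs).2 hl))
    have hl' : (E u).lin = true → n ≠ ρ u := fun h₁ h₂ => hl ⟨h₁, h₂⟩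
    refine .inl ?_
    have hsE : (E s).isShared = false := by
      rw [← h.refines.isShared_of_mem hsV (h.ne_endT hsP) hn, hs]
    have hsQ : s ∈ Q.fn := by
      obtain ⟨b, p, i, j, rfl, -⟩ := h.refines.name s hsV
      refine ht.mem_fn (hR.mono hV').wf ⟨hsV, fun h => absurd h hsv⟩ ?_
        ⟨b, p, i, rfl, fun hb' => hb b hb' p i hsV⟩ ?_
      · rw [fupd_isShared (h.refines.wf u hu), hsE]
      · by_cases hsu : Name.ch b p i = u
        · subst hsu
          rw [fupd_same]
          rcases (h.refines.mem_bname_iff hsV hune).1 hn with ⟨h₁, h₂⟩ | ⟨h₁, -⟩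
          · exact absurd h₁ (hl' h₂)
          · exact h₁
        · rw [fupd_of_ne _ _ hsu]; exact h.ne_endT hsP
    exact ⟨s, hsQ, (hsb hsQ).2 ⟨hn, hl'⟩⟩

/-- The tuple passed on is sufficient for the continuation. A name needed or bound by the process is
needed by its continuation, or it is used up by the input; it is passed on if it is needed and has
been received. A tail-recursive subject has been received. -/
theorem inp (h : State E ρ T V x (.inp u [.ch b true 0] Q))
    (hT : (bname (.ch b true 1) (E u).carried).map T = (E u).carried.G) :
    let E' := fupd (fupd E u (E u).next) (.ch b true 0) (E u).carried
    let ρ' := fupd (fupd ρ u (nextName (E u) (ρ u))) (.ch b true 0) (.ch b true 1)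
    let yt := bname (.ch b true 1) (E u).carried
    let z := fnb Q (dropSubj (E u) (ρ u) x ++ yt)
    let l := subjName (E u) (ρ u)
    let U := needed E ρ (.inp u [.ch b true 0] Q)
    (∃ V', State E' ρ' T V' z Q) ∧
      l ∈ U ∧ (T l).Minimal false (yt.map T) ∧ (∀ n ∈ yt, n ∉ U) ∧ (∀ n ∈ z, n ∈ x ∨ n ∈ yt) ∧
      (∀ n ∈ needed E' ρ' Q, (n ∈ U ∨ n ∈ yt) ∧ (n ∈ x ∨ n ∈ yt → n ∈ z)) ∧
      (∀ n ∈ needed E' ρ' Q, (T n).isShared = false → n = l → (T l).tr = true) ∧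
      (∀ n, n ∈ U ∨ n ∈ yt → (T n).isShared = false →
        n ∈ needed E' ρ' Q ∨ (n = l ∧ (T l).tr = false)) ∧
      ((T l).tr = true → l ∈ x) := by
  intro E' ρ' yt z l U
  have hnd := h.nodup
  have hfr := h.fresh
  simp only [Proc.bound, Proc.nameBase, List.flatMap_cons, List.flatMap_nil, List.append_nil,
    List.cons_append, List.nil_append, List.nodup_cons, List.mem_cons, forall_eq_or_imp]
    at hnd hfr
  obtain ⟨hu, ho, hune, ht⟩ := h.typed.inv_inp h.refines.wf (hfr.1 _ _)
  have hufn : u ∈ (Proc.inp u [.ch b true 0] Q).fn := by simp [Proc.fn]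
  have hyu : Name.ch b true 0 ≠ u := by rintro rfl; exact hfr.1 _ _ hu
  have hneV : ∀ s ∈ V, s ≠ .ch b true 0 := by rintro s hs rfl; exact hfr.1 _ _ hs
  have hQfn : ∀ s ∈ Q.fn, s ≠ .ch b true 0 → s ∈ (Proc.inp u [.ch b true 0] Q).fn :=
    fun s hs hne => by simp [Proc.fn, hs, hne]
  have hcar := (h.refines.wf u hu).carried hune
  have hcne : (E u).carried ≠ .endT := by
    intro h; have := hcar.2; rw [h] at this; simp [Ty.isEnd] at this
  have hR := (h.refines.step hu hune).insert (fun i => hfr.1 true i) hcar.1 hT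
  have hb : ∀ b' ∈ Q.bound, ∀ p i, Name.ch b' p i ∉ insert (Name.ch b true 0) V := by
    rintro b' hb' p i (h | h)
    · injection h with h; exact hnd.1 (h ▸ hb')
    · exact hfr.2 b' hb' p i h
  have hne' : ∀ s ∈ Q.fn, E' s ≠ .endT := ht.ne_endT_of_mem_fn h.source.2 hnd.2 hb hR.wf
  have hQV : ∀ s ∈ Q.fn, s ∈ insert (Name.ch b true 0) V := fun s hs => ht.mem_of_mem_fn hs
  obtain ⟨s₁, s₂, s₃, s₄, s₅⟩ := h.subj hufn ho
  have hyU : ∀ n ∈ yt, n ∉ U := by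
    intro n hn hU
    obtain ⟨b', p', i', hbp, hb'⟩ := h.needed_fresh hU
    obtain ⟨j, -, rfl⟩ := mem_bname.1 hn
    injection hbp with hbp
    exact hb' (by simp [Proc.bound, Proc.nameBase, hbp])
  have hxU : ∀ n ∈ x, n ∈ U := h.used
  have hρU : (E u).lin = true → ρ u ∈ U := fun hl =>
    ⟨u, hufn, (h.refines.self_mem hu hl hune).1⟩
  have hsb : ∀ {s n : Name}, s ∈ Q.fn → s ≠ .ch b true 0 →
      (n ∈ bname (ρ' s) (E' s) ↔ n ∈ bname (ρ s) (E s) ∧ ((E u).lin = true → n ≠ ρ u)) := by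
    intro s n hs hsy
    have hsV : s ∈ V := (hQV s hs).resolve_left hsy
    by_cases hsu : s = u
    · subst hsu
      have hne := hne' s hs
      simp only [E', ρ', fupd_of_ne _ _ hsy, fupd_same] at hne ⊢
      rw [h.refines.mem_bname_iff hu hune]
      have := h.refines.notMem_bname_next hu (C := (E s).next)
      constructor
      · intro hn
        exact ⟨.inr ⟨hne, hn⟩, fun hl hnu => this hl (hnu ▸ hn)⟩
      · rintro ⟨⟨h₁, h₂⟩ | ⟨-, h₂⟩, h₃⟩
        · exact absurd h₁ (h₃ h₂)
        · exact h₂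
    · simp only [E', ρ', fupd_of_ne _ _ hsy, fupd_of_ne _ _ hsu]
      refine ⟨fun hn => ⟨hn, fun hl hnu => hsu ?_⟩, fun hn => hn.1⟩
      subst hnu
      exact h.refines.eq_of_mem hsV hu hn (h.refines.self_mem hu hl hune).1
  have hyy : ∀ n, n ∈ bname (ρ' (.ch b true 0)) (E' (.ch b true 0)) ↔ n ∈ yt := by
    intro n; simp only [E', ρ', fupd_same]; rfl
  have hzmem : ∀ n, n ∈ dropSubj (E u) (ρ u) x ++ yt ↔
      (n ∈ x ∨ n ∈ yt) ∧ ((E u).lin = true → n ≠ ρ u) := by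
    intro n
    rw [List.mem_append, mem_dropSubj]
    constructor
    · rintro (⟨h₁, h₂⟩ | h₁)
      · exact ⟨.inl h₁, h₂⟩
      · exact ⟨.inr h₁, fun hl hnu => hyU n h₁ (hnu ▸ hρU hl)⟩
    · rintro ⟨h₁ | h₁, h₂⟩
      · exact .inl ⟨h₁, h₂⟩
      · exact .inr h₁
  have hU : ∀ n ∈ needed E' ρ' Q, (n ∈ U ∨ n ∈ yt) ∧ (n ∈ x ∨ n ∈ yt → n ∈ z) := by
    rintro n ⟨s, hs, hn⟩
    refine ⟨?_, fun hx => (hR.mem_fnb_iff hQV (hQV s hs) hn).2 ⟨(hzmem n).2 ⟨hx, ?_⟩, hs⟩⟩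
    · by_cases hsy : s = .ch b true 0
      · exact .inr ((hyy n).1 (hsy ▸ hn))
      · exact .inl ⟨s, hQfn s hs hsy, ((hsb hs hsy).1 hn).1⟩
    · by_cases hsy : s = .ch b true 0
      · have := (hyy n).1 (hsy ▸ hn)
        exact fun hl hnu => hyU n this (hnu ▸ hρU hl)
      · exact ((hsb hs hsy).1 hn).2
  have hzx : ∀ n ∈ z, n ∈ x ∨ n ∈ yt := fun n hn => ((hzmem n).1 (mem_fnb.1 hn).1).1
  refine ⟨⟨_, ⟨h.source.2, h.noNestedRec, hnd.2, hb, hR, ht, ?_, fun n hn => ?_,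
    fun s hs htr n hn => ?_⟩⟩, s₁, by rw [hT]; exact s₃, hyU, hzx, hU, ?_, ?_,
    fun ht => h.tr u hufn (s₄ ▸ ht) _ s₂⟩
  · refine List.Nodup.filter _ (List.Nodup.append ?_ nodup_bname ?_)
    · unfold dropSubj
      split_ifs
      · exact h.nodup_x.filter _
      · exact h.nodup_x
    · intro n hn hn'
      exact hyU n hn' (hxU n (mem_dropSubj.1 hn).1)
  · obtain ⟨hn₁, hn₂⟩ := (hzmem n).1 (mem_fnb.1 hn).1
    rcases hn₁ with hnx | hny
    · obtain ⟨s, hs, hns⟩ := hxU n hnx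
      have hsV := h.mem_of_mem_fn hs
      obtain ⟨m, hm, hmn⟩ := (mem_fnb.1 hn).2
      have hsQ : s ∈ Q.fn := by
        rw [h.refines.base_of_mem hsV hns] at hmn
        exact hR.inj m (hQV m hm) s (.inr hsV) hmn ▸ hm
      exact ⟨s, hsQ, (hsb hsQ (hneV s hsV)).2 ⟨hns, hn₂⟩⟩
    · have := (hyy n).2 hny
      exact ⟨_, ((hR.mem_fnb_iff hQV (.inl rfl) this).1 hn).2, this⟩
  · refine (hU n ⟨s, hs, hn⟩).2 ?_
    by_cases hsy : s = .ch b true 0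
    · exact .inr ((hyy n).1 (hsy ▸ hn))
    · refine .inl (h.tr s (hQfn s hs hsy) ?_ n ((hsb hs hsy).1 hn).1)
      by_cases hsu : s = u
      · subst hsu
        simp only [E', fupd_of_ne _ _ hsy, fupd_same] at htr
        rwa [(h.refines.wf s hu).next_tr] at htr
      · simpa only [E', fupd_of_ne _ _ hsy, fupd_of_ne _ _ hsu] using htr
  · rintro n ⟨s, hsQ, hn⟩ hs hnl
    by_contra htr
    rw [Bool.not_eq_true] at htr
    obtain ⟨h₆, h₇⟩ := (h.eq_subj_iff hufn ho hs).1 ⟨hnl, htr⟩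
    by_cases hsy : s = .ch b true 0
    · exact hyU n ((hyy n).1 (hsy ▸ hn)) (h₇ ▸ hρU h₆)
    · exact ((hsb hsQ hsy).1 hn).2 h₆ h₇
  · intro n hn hs
    have hfresh : ∀ s ∈ insert (Name.ch b true 0) V, ∃ b p i, s = .ch b p i ∧ b ∉ Q.bound := by
      intro s hs
      obtain ⟨b', p, i, j, rfl, -⟩ := hR.name s hs
      exact ⟨b', p, i, rfl, fun h => hb b' h p i hs⟩
    rcases hn with ⟨s, hsP, hn⟩ | hn
    · have hsV := h.mem_of_mem_fn hsP
      have hsy := hneV s hsV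
      by_cases hl : (E u).lin = true ∧ n = ρ u
      · exact .inr ((h.eq_subj_iff hufn ho hs).2 hl)
      have hl' : (E u).lin = true → n ≠ ρ u := fun h₁ h₂ => hl ⟨h₁, h₂⟩
      refine .inl ?_
      have hsE : (E s).isShared = false := by
        rw [← h.refines.isShared_of_mem hsV (h.ne_endT hsP) hn, hs]
      have hsQ : s ∈ Q.fn := by
        refine ht.mem_fn hR.wf (.inr hsV) ?_ (hfresh s (.inr hsV)) ?_
        · rw [fupd_of_ne _ _ hsy, fupd_isShared (h.refines.wf u hu), hsE]
        · rw [fupd_of_ne _ _ hsy]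
          by_cases hsu : s = u
          · subst hsu
            rw [fupd_same]
            rcases (h.refines.mem_bname_iff hsV hune).1 hn with ⟨h₁, h₂⟩ | ⟨h₁, -⟩
            · exact absurd h₁ (hl' h₂)
            · exact h₁
          · rw [fupd_of_ne _ _ hsu]; exact h.ne_endT hsP
      exact ⟨s, hsQ, (hsb hsQ hsy).2 ⟨hn, hl'⟩⟩
    · have hn' := (hyy n).2 hn
      have hE : E' (.ch b true 0) = (E u).carried := fupd_same ..
      have hyE : E' (.ch b true 0) ≠ .endT := by rw [hE]; exact hcne
      refine .inl ⟨_, ht.mem_fn hR.wf (.inl rfl) ?_ (hfresh _ (.inl rfl)) hyE, hn'⟩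
      rw [← hR.isShared_of_mem (.inl rfl) hyE hn', hs]

/-- The body of a restriction is broken down with the same tuple, extended by the breakdowns of the
endpoints if these are tail recursive. It needs all linear endpoints, unless they have type
`end`. -/
theorem res (h : State E ρ T V x (.res (.ch b true 0) C Q))
    (hT : (bname (.ch b true 1) C).map T = C.G)
    (hT' : (bname (.ch b false 1) C.dual).map T = C.dual.G) :
    let E' := fupd (fupd E (.ch b false 0) C.dual) (.ch b true 0) C
    let ρ' := fupd (fupd ρ (.ch b false 0) (.ch b false 1)) (.ch b true 0) (.ch b true 1)
    let U := needed E ρ (.res (.ch b true 0) C Q)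
    (C.tr = false → ∃ V', State E' ρ' T V' x Q) ∧
      (C.tr = true → (∃ V', State E' ρ' T V' (x ++ resNames (.ch b true 0) C) Q) ∧
        ∀ n ∈ resNames (.ch b true 0) C, n ∈ needed E' ρ' Q) ∧
      (∀ n ∈ U, n ∈ needed E' ρ' Q) ∧
      (∀ n ∈ needed E' ρ' Q, n ∈ U ∨ n ∈ resNames (.ch b true 0) C) ∧
      (∀ p i, Name.ch b p i ∉ U) ∧
      (C.isShared = false → ∀ n ∈ resNames (.ch b true 0) C, n ∉ needed E' ρ' Q → C = .endT) := by
  intro E' ρ' U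
  have hnd := h.nodup
  have hfr := h.fresh
  simp only [Proc.bound, Proc.nameBase, List.cons_append, List.nil_append, List.nodup_cons,
    List.mem_cons, forall_eq_or_imp] at hnd hfr
  have hneV : ∀ p, ∀ s ∈ V, s ≠ .ch b p 0 := by rintro p s hs rfl; exact hfr.1 _ _ hs
  have hCwf := h.source.2.1
  set W := insert (Name.ch b true 0) (insert (Name.ch b false 0) V) with hW
  have hRW : Refines E' ρ' T W :=
    (h.refines.insert (fun i => hfr.1 false i) hCwf.dual hT').insert (b := b) (p := true)
      (C := C) (fun i hi => by simp [hfr.1] at hi) hCwf hT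
  have hbW : ∀ b' ∈ Q.bound, ∀ p i, Name.ch b' p i ∉ W := by
    rintro b' hb' p i (h | h | h)
    · injection h with h; exact hnd.1 (h ▸ hb')
    · injection h with h; exact hnd.1 (h ▸ hb')
    · exact hfr.2 b' hb' p i h
  have hVW : V ⊆ W := fun s hs => .inr (.inr hs)
  obtain ⟨V', hV'W, ht, hVs, hshared⟩ : ∃ V' ⊆ W, SJ E' (fun _ => none) V' Q ∧
      (C.isShared = false → V' = W) ∧ (C.isShared = true → Name.ch b false 0 ∉ V') := by
    rcases hs : C.isShared with _ | _
    · exact ⟨W, subset_rfl, h.typed.inv_resS hs (hfr.1 _ _) (hfr.1 _ _) (by simp [Name.dual]),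
        fun _ => rfl, by simp⟩
    · refine ⟨_, Set.insert_subset_insert (Set.subset_insert _ _),
        h.typed.inv_res hs (hfr.1 _ _) (hfr.1 _ _) (by simp [Name.dual]), by simp, fun _ => ?_⟩
      simp [hfr.1]
  have hb : ∀ b' ∈ Q.bound, ∀ p i, Name.ch b' p i ∉ V' :=
    fun b' hb' p i h => hbW b' hb' p i (hV'W h)
  have hR := hRW.mono hV'W
  have hQV : ∀ s ∈ Q.fn, s ∈ V' := fun s hs => ht.mem_of_mem_fn hs
  have hEt : E' (.ch b true 0) = C ∧ ρ' (.ch b true 0) = .ch b true 1 :=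
    ⟨fupd_same .., fupd_same ..⟩
  have hEf : E' (.ch b false 0) = C.dual ∧ ρ' (.ch b false 0) = .ch b false 1 := by
    simp [E', ρ', fupd]
  have hEV : ∀ s ∈ V, E' s = E s ∧ ρ' s = ρ s := by
    intro s hs
    have h₁ := hneV true s hs
    have h₂ := hneV false s hs
    simp [E', ρ', fupd, h₁, h₂]
  have hPQ : ∀ s, s ∈ (Proc.res (.ch b true 0) C Q).fn ↔ s ∈ Q.fn ∧ s ∈ V := by
    intro s
    constructor
    · intro hs
      refine ⟨?_, h.mem_of_mem_fn hs⟩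
      simp only [Proc.fn, List.mem_filter] at hs
      exact hs.1
    · rintro ⟨hs, hsV⟩
      simp [Proc.fn, hs, hneV true s hsV, hneV false s hsV, Name.dual]
  have hUQ : ∀ n ∈ U, n ∈ needed E' ρ' Q := by
    rintro n ⟨s, hs, hn⟩
    obtain ⟨hsQ, hsV⟩ := (hPQ s).1 hs
    exact ⟨s, hsQ, by rwa [(hEV s hsV).1, (hEV s hsV).2]⟩
  have hQU : ∀ n ∈ needed E' ρ' Q, n ∈ U ∨ n ∈ resNames (.ch b true 0) C := by
    rintro n ⟨s, hs, hn⟩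
    rcases hV'W (hQV s hs) with rfl | rfl | hsV
    · rw [hEt.1, hEt.2] at hn
      obtain ⟨j, hj, rfl⟩ := mem_bname.1 hn
      exact .inr (mem_resNames.2 ⟨true, j, hj, rfl, .inl rfl⟩)
    · rw [hEf.1, hEf.2] at hn
      obtain ⟨j, hj, rfl⟩ := mem_bname.1 hn
      rw [Ty.dual_G, List.length_map] at hj
      refine .inr (mem_resNames.2 ⟨false, j, hj, rfl, .inr ?_⟩)
      by_contra hsh
      exact hshared (by simpa using hsh) (hQV _ hs)
    · rw [(hEV s hsV).1, (hEV s hsV).2] at hn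
      exact .inl ⟨s, (hPQ s).2 ⟨hs, hsV⟩, hn⟩
  have hbU : ∀ p i, Name.ch b p i ∉ U := by
    intro p i hU
    obtain ⟨b', p', i', hbp, hb'⟩ := h.needed_fresh hU
    injection hbp with hbp
    exact hb' (by simp [Proc.bound, Proc.nameBase, hbp])
  have hend : C.isShared = false → ∀ n ∈ resNames (.ch b true 0) C, n ∉ needed E' ρ' Q →
      C = .endT := by
    intro hs n hn hnU
    by_contra hne
    obtain ⟨p, j, hj, rfl, -⟩ := mem_resNames.1 hn
    have hVW := hVs hs
    refine hnU ⟨.ch b p 0, ht.mem_fn hR.wf ?_ ?_ ⟨b, p, 0, rfl, hnd.1⟩ ?_, ?_⟩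
    · rw [hVW]; cases p <;> simp [hW]
    · cases p
      · rw [hEf.1, Ty.dual_isShared, hs]
      · rw [hEt.1, hs]
    · cases p
      · rw [hEf.1]
        intro he
        rw [← Ty.dual_dual C, he] at hne
        exact hne rfl
      · rw [hEt.1]; exact hne
    · cases p
      · rw [hEf.1, hEf.2, mem_bname, Ty.dual_G, List.length_map]; exact ⟨j, hj, rfl⟩
      · rw [hEt.1, hEt.2, mem_bname]; exact ⟨j, hj, rfl⟩
  refine ⟨fun htr => ⟨V', ⟨h.source.2.2, h.noNestedRec, hnd.2, hb, hR, ht, h.nodup_x,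
    fun n hn => hUQ n (h.used n hn), ?_⟩⟩, fun htr => ?_, hUQ, hQU, hbU, hend⟩
  · intro s hs hst n hn
    rcases hV'W (hQV s hs) with rfl | rfl | hsV
    · rw [hEt.1, htr] at hst; simp at hst
    · rw [hEf.1, Ty.dual_tr, htr] at hst; simp at hst
    · rw [(hEV s hsV).1] at hst
      rw [(hEV s hsV).1, (hEV s hsV).2] at hn
      exact h.tr s ((hPQ s).2 ⟨hs, hsV⟩) hst n hn
  · have hCs : C.isShared = false := by cases C <;> simp_all [Ty.tr, Ty.isShared]
    have hCe : C ≠ .endT := by rintro rfl; simp [Ty.tr] at htr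
    have hresU : ∀ n ∈ resNames (.ch b true 0) C, n ∈ needed E' ρ' Q := by
      intro n hn
      by_contra hnU
      exact hCe (hend hCs n hn hnU)
    refine ⟨⟨V', ⟨h.source.2.2, h.noNestedRec, hnd.2, hb, hR, ht, ?_, fun n hn => ?_, ?_⟩⟩, hresU⟩
    · refine h.nodup_x.append ?_ ?_
      · simp only [resNames, hCs, Bool.false_eq_true, if_false, Name.withIdx, Name.dual]
        refine nodup_bname.append nodup_bname fun n hn hn' => ?_
        obtain ⟨j, -, rfl⟩ := mem_bname.1 hn
        obtain ⟨j', -, h⟩ := mem_bname.1 hn'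
        simp at h
      · intro n hn hn'
        obtain ⟨p, j, hj, rfl, -⟩ := mem_resNames.1 hn'
        exact hbU _ _ (h.used _ hn)
    · rcases List.mem_append.1 hn with hn | hn
      · exact hUQ n (h.used n hn)
      · exact hresU n hn
    · intro s hs hst n hn
      rw [List.mem_append]
      rcases hQU n ⟨s, hs, hn⟩ with hnU | hnr
      · left
        obtain ⟨t, htP, hnt⟩ := hnU
        obtain ⟨htQ, htV⟩ := (hPQ t).1 htP
        have hnt' := hnt
        rw [← (hEV t htV).1, ← (hEV t htV).2] at hnt'
        obtain rfl := hRW.eq_of_mem (hV'W (hQV s hs)) (hVW htV) hn hnt'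
        rw [(hEV s htV).1] at hst
        exact h.tr s htP hst n hnt
      · exact .inr hnr

/-- Each component gets the names received that it needs; no linear name is needed by both. -/
theorem par (h : State E ρ T V x (.par Q₁ Q₂)) :
    let z₁ := fnb Q₁ x
    let z₂ := fnb Q₂ x
    let U := needed E ρ (.par Q₁ Q₂)
    (∃ V', State E ρ T V' z₁ Q₁) ∧ (∃ V', State E ρ T V' z₂ Q₂) ∧
      (∀ n ∈ z₁, n ∈ x) ∧ (∀ n ∈ z₂, n ∈ x) ∧
      (∀ n, n ∈ U ↔ n ∈ needed E ρ Q₁ ∨ n ∈ needed E ρ Q₂) ∧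
      (∀ n ∈ needed E ρ Q₁, n ∈ x → n ∈ z₁) ∧ (∀ n ∈ needed E ρ Q₂, n ∈ x → n ∈ z₂) ∧
      (∀ n ∈ needed E ρ Q₁, (T n).isShared = false → n ∉ needed E ρ Q₂) := by
  intro z₁ z₂ U
  obtain ⟨V₁, V₂, t₁, t₂, hV₁, hV₂, hV⟩ := h.typed.inv_par
  have hnd := h.nodup
  have hfr := h.fresh
  rw [Proc.bound, List.nodup_append] at hnd
  simp only [Proc.bound, List.mem_append] at hfr
  have hfn₁ : ∀ s ∈ Q₁.fn, s ∈ V := fun s hs => hV₁ (t₁.mem_of_mem_fn hs)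
  have hfn₂ : ∀ s ∈ Q₂.fn, s ∈ V := fun s hs => hV₂ (t₂.mem_of_mem_fn hs)
  have hz₁ : ∀ n ∈ needed E ρ Q₁, n ∈ x → n ∈ z₁ := by
    rintro n ⟨s, hs, hn⟩ hx
    exact (h.refines.mem_fnb_iff hfn₁ (hfn₁ s hs) hn).2 ⟨hx, hs⟩
  have hz₂ : ∀ n ∈ needed E ρ Q₂, n ∈ x → n ∈ z₂ := by
    rintro n ⟨s, hs, hn⟩ hx
    exact (h.refines.mem_fnb_iff hfn₂ (hfn₂ s hs) hn).2 ⟨hx, hs⟩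
  refine ⟨⟨V₁, ⟨h.source.1, h.noNestedRec.1, hnd.1, fun b hb p i hi => hfr b (.inl hb) p i (hV₁ hi),
    h.refines.mono hV₁, t₁, h.nodup_x.filter _, fun n hn => ?_, fun s hs htr n hn => ?_⟩⟩,
    ⟨V₂, ⟨h.source.2, h.noNestedRec.2, hnd.2.1, fun b hb p i hi => hfr b (.inr hb) p i (hV₂ hi),
    h.refines.mono hV₂, t₂, h.nodup_x.filter _, fun n hn => ?_, fun s hs htr n hn => ?_⟩⟩,
    fun n hn => (mem_fnb.1 hn).1, fun n hn => (mem_fnb.1 hn).1, ?_, hz₁, hz₂, ?_⟩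
  · obtain ⟨s, hs, hns⟩ := h.used n (mem_fnb.1 hn).1
    exact ⟨s, ((h.refines.mem_fnb_iff hfn₁ (h.mem_of_mem_fn hs) hns).1 hn).2, hns⟩
  · exact hz₁ n ⟨s, hs, hn⟩ (h.tr s (by simp [Proc.fn, hs]) htr n hn)
  · obtain ⟨s, hs, hns⟩ := h.used n (mem_fnb.1 hn).1
    exact ⟨s, ((h.refines.mem_fnb_iff hfn₂ (h.mem_of_mem_fn hs) hns).1 hn).2, hns⟩
  · exact hz₂ n ⟨s, hs, hn⟩ (h.tr s (by simp [Proc.fn, hs]) htr n hn)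
  · intro n
    constructor
    · rintro ⟨s, hs, hn⟩
      exact (List.mem_append.1 hs).imp (fun hs => ⟨s, hs, hn⟩) fun hs => ⟨s, hs, hn⟩
    · rintro (⟨s, hs, hn⟩ | ⟨s, hs, hn⟩)
      · exact ⟨s, List.mem_append_left _ hs, hn⟩
      · exact ⟨s, List.mem_append_right _ hs, hn⟩
  · rintro n ⟨s, hs, hn⟩ hsh ⟨t, ht, hn'⟩
    obtain rfl := h.refines.eq_of_mem (hfn₁ s hs) (hfn₂ t ht) hn hn'
    have hne : E s ≠ .endT := h.ne_endT (by simp [Proc.fn, hs])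
    refine (hV s (hfn₁ s hs) ?_).1 (t₁.mem_of_mem_fn hs) (t₂.mem_of_mem_fn ht)
    rw [← h.refines.isShared_of_mem (hfn₁ s hs) hne hn, hsh]

/-- The state at the beginning of the body of a recursion. The linear names that `X` gets are tail
recursive: they are used in the body, and their types reduce to themselves. -/
theorem mu {X : ℕ} (h : State E ρ T V x (.mu X Q)) :
    let ns := Q.fn.dedup
    let m := ns.flatMap fun n => bname (ρ n) (E n)
    (∃ Δ₀ V', RecState X m Δ₀ true E ρ T V' m Q) ∧ (ns.flatMap fun n => (E n).G) = m.map T ∧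
      ∀ n, n ∈ m ↔ n ∈ needed E ρ (.mu X Q) := by
  intro ns m
  obtain ⟨Δ₀, V₀, hV₀, ht, h₁, h₂, h₃⟩ := h.typed.inv_mu
  have hfnV : ∀ s ∈ Q.fn, s ∈ V := fun s hs => h.mem_of_mem_fn (P := .mu X Q) hs
  have hm : ∀ n, n ∈ m ↔ n ∈ needed E ρ (.mu X Q) := by
    intro n; simp [m, ns, needed, Proc.fn]
  have hne : ∀ s ∈ Q.fn, E s ≠ .endT := fun s hs => h.ne_endT (P := .mu X Q) hs
  have hmn : m.Nodup := by
    refine List.nodup_flatMap.2 ⟨fun s hs => h.refines.nodup (hfnV s (List.mem_dedup.1 hs)) _, ?_⟩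
    refine (List.nodup_dedup Q.fn).imp_of_mem fun hs ht hst => ?_
    intro n hn hn'
    exact hst (h.refines.eq_of_mem (hfnV _ (List.mem_dedup.1 hs)) (hfnV _ (List.mem_dedup.1 ht))
      hn hn')
  have hfresh : ∀ n ∈ m, ∃ b p i, n = .ch b p i ∧ b ∉ Q.bound :=
    fun n hn => h.needed_fresh ((hm n).1 hn)
  have hused : ∀ n ∈ m, (T n).isShared = true ∨
      ∃ s ∈ V₀, (E s).isShared = false ∧ E s ≠ .endT ∧ n ∈ bname (ρ s) (E s) := by
    intro n hn
    obtain ⟨s, hs, hns⟩ := (hm n).1 hn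
    have := h.refines.isShared_of_mem (hfnV s hs) (hne s hs) hns
    rcases hsh : (E s).isShared with _ | _
    · exact .inr ⟨s, ht.mem_of_mem_fn hs, hsh, hne s hs, hns⟩
    · exact .inl (by rw [this, hsh])
  refine ⟨⟨Δ₀, V₀, h.source, h.noNestedRec, h.nodup, fun b hb p i hi => h.fresh b hb p i (hV₀ hi),
    h.refines.mono hV₀, ht, ⟨?_, ?_⟩, ⟨hmn, hfresh, ?_, fun _ n hn => hn, ?_⟩, hmn, hfresh,
    by simp⟩, ?_, hm⟩
  · intro hf d hd
    obtain ⟨hdV, hds⟩ := (h₂ d).1 hd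
    have hdfn := h₁ d hdV hds
    refine ⟨hdV, hds, ?_, fun n hn => (hm n).2 ⟨d, hdfn, hn⟩⟩
    obtain ⟨b, p, i, j, rfl, -⟩ := h.refines.name d (hV₀ hdV)
    obtain ⟨S', hS'⟩ := Option.ne_none_iff_exists'.1 hd
    obtain ⟨S, hS, -, hstep⟩ := Typed.reduces_of_frv ht hf (Function.update_self ..) hS'
      (fun hb => h.fresh b hb p i (hV₀ hdV)) (shEnv_eq_none.2 fun _ => hds)
    obtain ⟨-, -, rfl⟩ := linEnv_eq_some.1 hS
    -- The name is used in the body, and `X` is assigned the type that it has at the beginning.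
    have := hstep hdfn
    rw [h₃ _ _ hS'] at this
    exact (h.refines.wf _ (hV₀ hdV)).tr_of_transGen this
  · intro hf n hn
    refine (hused n hn).imp id fun ⟨s, hs, hsh, _, hns⟩ => ⟨s, (h₂ s).2 ⟨hs, hsh⟩, hns⟩
  · intro s hs _ n hn
    exact (hm n).2 ⟨s, hs, hn⟩
  · intro n hn
    exact (hused n hn).imp id fun ⟨s, hs, _, hne, hns⟩ => ⟨s, hs, hns, fun he => absurd he hne⟩
  · rw [List.map_flatMap]
    refine List.flatMap_congr fun s hs => ?_
    have hs' := List.mem_dedup.1 hs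
    exact (h.refines.ty s (hfnV s hs') (hne s hs')).symm

end State

/-! ### Typing the breakdown -/

theorem kinds_eq_cons (P : Proc) : ∃ ks, kinds P = .plain :: ks := by
  induction P with
  | res n C Q ih =>
    rw [kinds]
    split_ifs
    · exact ⟨_, rfl⟩
    · exact ih
  | _ => exact ⟨_, rfl⟩

/-- Adding a trio in front of a component outside of recursions. -/
theorem Outcome.consPlain {T T₀ : Name → Ty} {bd bd₀ : List ℕ} {k : ℕ} {x z : List Name}
    {A A₁ : Set Name} {P Q trio : Proc}
    (h : Outcome T₀ bd₀ (k + 1) (kinds Q) .plain z A₁ ∅ P)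
    (hbd : ∀ b ∉ bd, b ∉ bd₀ ∧ ∀ p i, T₀ (.ch b p i) = T (.ch b p i))
    (hz : ∀ n ∈ z, ∃ b p i, n = .ch b p i) (hx : ∀ n ∈ x, ∃ b p i, n = .ch b p i)
    (hxn : x.Nodup) (hAx : ∀ n ∈ x, n ∉ A)
    (hAch : ∀ n ∈ A, ∃ b p i, n = .ch b p i) (hA₁ : A₁ ⊆ A)
    (htrio : ∀ (T' : Name → Ty) (Γ : Env), (∀ b ∉ bd₀, ∀ p i, T' (.ch b p i) = T₀ (.ch b p i)) →
      T' (.prop false (k + 1) false) = .act true (z.map T') .endT →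
      (∀ n, n ∈ A ∨ n ∈ x ∨ n = .prop false (k + 1) false → Agrees T' Γ n) →
      LinTyped T' (fun _ => none) Γ ({n | (n ∈ A ∧ n ∉ A₁) ∨ n ∈ x ∨ n = .prop false (k + 1) false})
        trio) :
    Outcome T bd k (.plain :: kinds Q) .plain x A ∅
      (.par (.inp (.prop false k true) x trio) P) := by
  obtain ⟨ks, hks⟩ := kinds_eq_cons Q
  rw [hks] at h ⊢
  refine h.cons hbd (by simp) hz hx hAch hA₁ ?_
  intro T' Γ h₁ _ h₃ h₄ h₅ h₆ h₇
  have hxp : ∀ r j p, Name.prop r j p ∉ x := by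
    intro r j p hn
    obtain ⟨_, _, _, h⟩ := hx _ hn
    cases h
  have hAp : ∀ r j p, Name.prop r j p ∉ A := by
    intro r j p hn
    obtain ⟨_, _, _, h⟩ := hAch _ hn
    cases h
  refine (LinTyped.inpPlain (A := {n | (n ∈ A ∧ n ∉ A₁) ∨ n = .prop false (k + 1) false}) h₃ hxn
    (hxp _ _ _) ?_ ?_ (h₇ _ (.inr (.inl rfl))) ?_).congr_set fun n _ => ?_
  · rintro (⟨h, -⟩ | h)
    · exact hAp _ _ _ h
    · simp at h
  · rintro n hn - (⟨h, -⟩ | rfl)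
    · exact hAx n hn h
    · exact hxp _ _ _ hn
  · refine (htrio T' (bindShared Γ x (x.map T')) h₁ h₆ ?_).congr_set fun n _ => ?_
    · rintro n (hn | hn | rfl)
      · exact agrees_bindShared (.inr (h₇ n (.inl hn)))
      · exact agrees_bindShared_of_mem hn
      · exact agrees_bindShared (.inr (h₇ _ (.inr (.inr (.inr (.inl ⟨rfl, by simp⟩))))))
    · simp only [Set.mem_ofPred_eq, Set.mem_union]; tauto
  · simp only [Set.mem_ofPred_eq, Set.mem_union, Set.mem_insert_iff, Set.mem_sdiff,
      Set.mem_singleton_iff, PKind.name, Name.dual, Bool.not_true]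
    tauto

/-- The end of a trio outside of recursions, which has nothing left but the names that it sends. -/
theorem LinTyped.passPlain {T : Name → Ty} {Ξ : ℕ → Option Env} {Γ : Env} {L : Set Name}
    {z : List Name} {k : ℕ} (hT : T (.prop false k false) = .act true (z.map T) .endT)
    (hz : z.Nodup) (hzc : .prop false k false ∉ z)
    (hΓ : ∀ n, n ∈ z ∨ n = .prop false k false → Agrees T Γ n)
    (hL : ∀ n, (T n).isShared = false → (n ∈ L ↔ n = .prop false k false ∨ n ∈ z)) :
    LinTyped T Ξ Γ L (.out (.prop false k false) z .nil) := by
  refine LinTyped.outPlain hT hz hzc (hΓ _ (.inr rfl)) (fun n hn => hΓ n (.inl hn))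
    (fun n hn hs => (hL n hs).2 (.inr hn)) ((hL _ (by rw [hT]; rfl)).2 (.inl rfl))
    (LinTyped.nil ?_)
  rintro n ⟨h₁, h₂, h₃⟩
  by_contra hs
  rw [Bool.not_eq_true] at hs
  exact ((hL n hs).1 h₁).elim h₂ h₃

/-- The trios at the head of a recursion: the first one activates the body, and then hands the
tuple `m̃` that it receives on `c^r_X` to the body again. -/
theorem LinTyped.activate {T : Name → Ty} {Γ : Env} {L : Set Name} {m : List Name} {k X : ℕ}
    (hT : T (.prop true k false) = .mu (.act true (m.map T) .tvar))
    (hX : T (.propX X true) = .shared (m.map T)) (hm : m.Nodup)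
    (hmch : ∀ n ∈ m, ∃ b p i, n = .ch b p i)
    (hΓ : ∀ n, n ∈ m ∨ n = .prop true k false ∨ n = .propX X true → Agrees T Γ n)
    (hL : ∀ n, (T n).isShared = false → (n ∈ L ↔ n = .prop true k false ∨ n ∈ m)) :
    LinTyped T (fun _ => none) Γ L (.out (.prop true k false) m
      (.mu X (.inp (.propX X true) m (.out (.prop true k false) m (.pvar X))))) := by
  have hs : (T (.prop true k false)).isShared = false := by rw [hT]; rfl
  have htr : (T (.prop true k false)).tr = true := by rw [hT]; rfl
  have hXs : (T (.propX X true)).isShared = true := by rw [hX]; rfl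
  have hcm : .prop true k false ∉ m := by
    intro h
    obtain ⟨_, _, _, h⟩ := hmch _ h
    cases h
  have hXm : .propX X true ∉ m := by
    intro h
    obtain ⟨_, _, _, h⟩ := hmch _ h
    cases h
  have hL' : ∀ {L : Set Name}, (∀ n, (T n).isShared = false →
      (n ∈ L ↔ n = .prop true k false ∨ n ∈ m)) → ∀ n, (T n).isShared = false →
      (n ∈ ({.prop true k false} : Set Name) ↔
        n ∈ L ∧ n ∉ m ∧ (n = .prop true k false → (T (.prop true k false)).tr = true)) := by
    intro L hL n hn
    rw [hL n hn, Set.mem_singleton_iff]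
    constructor
    · rintro rfl; exact ⟨.inl rfl, hcm, fun _ => htr⟩
    · rintro ⟨h₁ | h₁, h₂, -⟩
      · exact h₁
      · exact absurd h₁ h₂
  refine LinTyped.out rfl (.inr (.inl hT)) (fun _ => ⟨(hL _ hs).2 (.inl rfl), hcm⟩)
    (hΓ _ (.inr (.inl rfl))) hm (fun n hn => hΓ n (.inl hn)) (fun n hn hs => (hL n hs).2 (.inr hn))
    (hL' hL) (LinTyped.mu ?_ ?_)
  · rintro n rfl -
    simp [Proc.fn, hcm]
  have hL₂ : ∀ n, (T n).isShared = false →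
      (n ∈ ({n | n = .prop true k false ∨ n ∈ m} : Set Name) ↔
        n = .prop true k false ∨ n ∈ m) := fun n _ => Iff.rfl
  refine LinTyped.inp (L' := {n | n = .prop true k false ∨ n ∈ m}) rfl (.inr (.inr hX))
    (by simp [hXs]) (hΓ _ (.inr (.inr rfl))) hm hXm ?_ ?_ ?_
  · rintro n hn - rfl
    exact hcm hn
  · intro n hn
    have : n ≠ .propX X true := by rintro rfl; rw [hXs] at hn; simp at hn
    simp only [Set.mem_ofPred_eq, Set.mem_singleton_iff, this, false_imp_iff, and_true]
    tauto
  · exact LinTyped.out rfl (.inr (.inl hT)) (fun _ => ⟨.inl rfl, hcm⟩)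
      (agrees_bindShared (.inr (hΓ _ (.inr (.inl rfl))))) hm
      (fun n hn => agrees_bindShared_of_mem hn) (fun n hn _ => .inr hn) (hL' hL₂)
      (LinTyped.pvar (Function.update_self ..) fun _ _ => Iff.rfl)

/-- The breakdown of a process is well typed. Its linear names are propagators, and those names
that it needs and does not receive. -/
theorem outcome_B {P : Proc} :
    ∀ {E : Name → Ty} {ρ : Name → Name} {T : Name → Ty} {V : Set Name} {k : ℕ} {x : List Name},
      State E ρ T V x P →
      Outcome T P.bound k (kinds P) .plain x {n | n ∈ needed E ρ P ∧ n ∉ x} ∅ (B E ρ k x P) := by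
  have hch : ∀ {E ρ T V x P}, State E ρ T V x P → ∀ n ∈ x, ∃ b p i, n = Name.ch b p i := by
    intro E ρ T V x P h n hn
    obtain ⟨b, p, i, h, -⟩ := h.needed_fresh (h.used n hn)
    exact ⟨b, p, i, h⟩
  have hAch : ∀ {E ρ T V x P}, State E ρ T V x P → ∀ n ∈ {n | n ∈ needed E ρ P ∧ n ∉ x},
      ∃ b p i, n = Name.ch b p i := by
    intro E ρ T V x P h n hn
    obtain ⟨b, p, i, h, -⟩ := h.needed_fresh hn.1
    exact ⟨b, p, i, h⟩
  have hprop : ∀ {x : List Name}, (∀ n ∈ x, ∃ b p i, n = Name.ch b p i) →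
      ∀ {r j p}, Name.prop r j p ∉ x := by
    intro x h r j p hn
    obtain ⟨_, _, _, h⟩ := h _ hn
    cases h
  induction P with
  | nil =>
    intro E ρ T V k x h
    obtain rfl : x = [] := List.eq_nil_iff_forall_not_mem.2 fun n hn => by
      obtain ⟨s, hs, -⟩ := h.used n hn
      simp [Proc.fn] at hs
    refine Outcome.single (by simp) (by simp) ?_
    intro T' Γ h₁ _ h₃ h₄
    refine (LinTyped.inpPlain (A := ∅) h₃ List.nodup_nil (by simp) (by simp) (by simp)
      (h₄ _ (.inr (.inl rfl))) (LinTyped.nil (by simp))).congr_set fun n _ => ?_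
    simp [needed, Proc.fn, PKind.name]
  | pvar Y =>
    intro E ρ T V k x h
    obtain ⟨Δ₀, h₀, -⟩ := h.typed.inv_pvar h.refines.wf
    cases h₀
  | out u vs Q ih =>
    intro E ρ T V k x h
    obtain ⟨v, rfl⟩ := h.source.1
    obtain ⟨⟨V', hQ⟩, -, -, -, -, -, -, hUQ, -⟩ := h.out
    refine (ih hQ).consPlain (fun b hb => ⟨hb, fun _ _ => rfl⟩) (hch hQ) (hch h) h.nodup_x
      (fun n hn hA => hA.2 hn) (hAch h)
      (fun n hn => ⟨(hUQ n hn.1).1, fun hx => hn.2 ((hUQ n hn.1).2 hx)⟩) ?_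
    intro T' Γ t₁ t₂ g
    obtain ⟨-, hl, hmin, hvs, hvU, hlv, hzx, -, hU₁, hU₂, htr⟩ := (h.congr (T' := T') t₁).out
    have hgU : ∀ n ∈ needed E ρ (.out u [v] Q), Agrees T' Γ n := by
      intro n hn
      by_cases hnx : n ∈ x
      · exact g n (.inr (.inl hnx))
      · exact g n (.inl ⟨hn, hnx⟩)
    set z := fnb Q (dropSubj (E u) (ρ u) x)
    set l := subjName (E u) (ρ u)
    set U := needed E ρ (.out u [v] Q)
    set U' := needed (fupd E u (E u).next) (fupd ρ u (nextName (E u) (ρ u))) Q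
    have hcU : ∀ r j p, Name.prop r j p ∉ U := by
      intro r j p hn
      obtain ⟨_, _, _, h, -⟩ := h.needed_fresh hn
      cases h
    refine LinTyped.out (L' := {n | (((n ∈ U ∧ n ∉ x) ∧ ¬ (n ∈ U' ∧ n ∉ z)) ∨ n ∈ x ∨
      n = .prop false (k + 1) false) ∧ n ∉ bname (ρ v) (E v) ∧ (n = l → (T' l).tr = true)}) rfl hmin
      (fun hs => ⟨?_, hlv hs⟩) (hgU l hl) hvs (fun n hn => hgU n (hvU n hn)) (fun n hn hs => ?_)
      (fun n _ => Iff.rfl) (LinTyped.passPlain t₂ hQ.nodup_x (hprop (hch hQ)) ?_ fun n hs => ?_)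
    · by_cases hlx : l ∈ x
      · exact .inr (.inl hlx)
      · exact .inl ⟨⟨hl, hlx⟩, fun h => hlx (htr ((hU₁ l h.1 hs).2 rfl))⟩
    · by_cases hnx : n ∈ x
      · exact .inr (.inl hnx)
      · exact .inl ⟨⟨hvU n hn, hnx⟩, fun h => (hU₁ n h.1 hs).1 hn⟩
    · rintro n (hn | rfl)
      · exact g n (.inr (.inl (hzx n hn)))
      · exact g _ (.inr (.inr rfl))
    · constructor
      · rintro ⟨hn, hnv, hnl⟩
        have hnot : ¬ (n = l ∧ (T' l).tr = false) := by
          rintro ⟨h₁, h₂⟩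
          rw [hnl h₁] at h₂; simp at h₂
        rcases hn with ⟨⟨hnU, hnx⟩, hn⟩ | hn | hn
        · rcases hU₂ n hnU hs with h₁ | h₁ | h₁
          · exact .inr (by_contra fun h₂ => hn ⟨h₁, h₂⟩)
          · exact absurd h₁ hnv
          · exact absurd h₁ hnot
        · rcases hU₂ n (h.used n hn) hs with h₁ | h₁ | h₁
          · exact .inr ((hUQ n h₁).2 hn)
          · exact absurd h₁ hnv
          · exact absurd h₁ hnot
        · exact .inl hn
      · rintro (rfl | hn)
        · refine ⟨.inr (.inr rfl), fun h => hcU _ _ _ (hvU _ h), fun h => ?_⟩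
          exact absurd (h ▸ hl) (hcU _ _ _)
        · exact ⟨.inr (.inl (hzx n hn)), hU₁ n (hQ.used n hn) hs⟩
  | inp u ys Q ih =>
    intro E ρ T V k x h
    obtain ⟨b, rfl⟩ := h.source.1
    set C := (E u).carried with hCdef
    have hT₀ : ∀ b' ∉ (Proc.inp u [.ch b true 0] Q).bound, b' ∉ Q.bound ∧ ∀ p i,
        extendTy T b C (.ch b' p i) = T (.ch b' p i) := by
      intro b' hb'
      simp only [Proc.bound, Proc.nameBase, List.flatMap_cons, List.flatMap_nil, List.append_nil,
        List.cons_append, List.nil_append, List.mem_cons, not_or] at hb'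
      exact ⟨hb'.2, extendTy_of_ne hb'.1⟩
    have hbQ : b ∉ Q.bound := by
      have := h.nodup
      simp only [Proc.bound, Proc.nameBase, List.flatMap_cons, List.flatMap_nil, List.append_nil,
        List.cons_append, List.nil_append, List.nodup_cons] at this
      exact this.1
    obtain ⟨⟨V', hQ⟩, -, -, hyU, -, hUQ, -⟩ :=
      (h.congr (T' := extendTy T b C) fun b hb => (hT₀ b hb).2).inp map_extendTy_true
    refine (ih hQ).consPlain hT₀ (hch hQ) (hch h) h.nodup_x (fun n hn hA => hA.2 hn) (hAch h) ?_ ?_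
    · rintro n ⟨hn, hnz⟩
      obtain ⟨h₁, h₂⟩ := hUQ n hn
      exact ⟨h₁.resolve_right fun h => hnz (h₂ (.inr h)), fun hx => hnz (h₂ (.inl hx))⟩
    intro T' Γ t₁ t₂ g
    have hyT : (bname (.ch b true 1) C).map T' = C.G := by
      rw [← map_extendTy_true (T := T)]
      refine List.map_congr_left fun n hn => ?_
      obtain ⟨j, -, rfl⟩ := mem_bname.1 hn
      exact t₁ b hbQ _ _
    obtain ⟨-, hl, hmin, -, hzx, -, hU₁, hU₂, htr⟩ := (h.congr (T' := T') fun b hb p i => by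
      rw [t₁ b (hT₀ b hb).1, (hT₀ b hb).2]).inp hyT
    have hgU : ∀ n ∈ needed E ρ (.inp u [.ch b true 0] Q), Agrees T' Γ n := by
      intro n hn
      by_cases hnx : n ∈ x
      · exact g n (.inr (.inl hnx))
      · exact g n (.inl ⟨hn, hnx⟩)
    set yt := bname (.ch b true 1) C with hyt
    set z := fnb Q (dropSubj (E u) (ρ u) x ++ yt)
    set l := subjName (E u) (ρ u)
    set U := needed E ρ (.inp u [.ch b true 0] Q)
    set U' := needed (fupd (fupd E u (E u).next) (.ch b true 0) C)
      (fupd (fupd ρ u (nextName (E u) (ρ u))) (.ch b true 0) (.ch b true 1)) Q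
    have hcU : ∀ r j p, Name.prop r j p ∉ U := by
      intro r j p hn
      obtain ⟨_, _, _, h, -⟩ := h.needed_fresh hn
      cases h
    have hcy : ∀ r j p, Name.prop r j p ∉ yt := by
      intro r j p hn
      obtain ⟨_, _, h⟩ := mem_bname.1 hn
      cases h
    refine LinTyped.inp (L' := {n | n ∈ yt ∨ ((((n ∈ U ∧ n ∉ x) ∧ ¬ (n ∈ U' ∧ n ∉ z)) ∨ n ∈ x ∨
      n = .prop false (k + 1) false) ∧ (n = l → (T' l).tr = true))}) rfl hmin (fun hs => ?_)
      (hgU l hl) nodup_bname (fun h => hyU l h hl) ?_ (fun n _ => Iff.rfl)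
      (LinTyped.passPlain t₂ hQ.nodup_x (hprop (hch hQ)) ?_ fun n hs => ?_)
    · by_cases hlx : l ∈ x
      · exact .inr (.inl hlx)
      · exact .inl ⟨⟨hl, hlx⟩, fun h => hlx (htr (hU₁ l h.1 hs rfl))⟩
    · rintro n hn - (h' | h' | rfl)
      · exact hyU n hn h'.1.1
      · exact hyU n hn (h.used n h')
      · exact hcy _ _ _ hn
    · rintro n (hn | rfl)
      · rcases hzx n hn with hn | hn
        · exact agrees_bindShared (.inr (g n (.inr (.inl hn))))
        · exact agrees_bindShared_of_mem hn
      · exact agrees_bindShared (.inr (g _ (.inr (.inr rfl))))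
    · have key : n ∈ U ∨ n ∈ yt → (n = l → (T' l).tr = true) → n ∈ U' := by
        intro h₁ hnl
        rcases hU₂ n h₁ hs with h₂ | ⟨h₂, h₃⟩
        · exact h₂
        · rw [hnl h₂] at h₃; simp at h₃
      constructor
      · rintro (hn | ⟨⟨⟨hnU, hnx⟩, hn⟩ | hn | hn, hnl⟩)
        · refine .inr ((hUQ n (key (.inr hn) ?_)).2 (.inr hn))
          rintro rfl; exact absurd hl (hyU _ hn)
        · exact .inr (by_contra fun h₂ => hn ⟨key (.inl hnU) hnl, h₂⟩)
        · exact .inr ((hUQ n (key (.inl (h.used n hn)) hnl)).2 (.inl hn))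
        · exact .inl hn
      · rintro (rfl | hn)
        · exact .inr ⟨.inr (.inr rfl), fun h => absurd (h ▸ hl) (hcU _ _ _)⟩
        · rcases hzx n hn with h₁ | h₁
          · exact .inr ⟨.inr (.inl h₁), hU₁ n (hQ.used n hn) hs⟩
          · exact .inl h₁
  | res a C Q ih =>
    intro E ρ T V k x h
    obtain ⟨⟨b, rfl⟩, hC, -⟩ := h.source
    have hT₀ : ∀ b' ∉ (Proc.res (.ch b true 0) C Q).bound, b' ∉ Q.bound ∧ ∀ p i,
        extendTy T b C (.ch b' p i) = T (.ch b' p i) := by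
      intro b' hb'
      simp only [Proc.bound, Proc.nameBase, List.cons_append, List.nil_append, List.mem_cons,
        not_or] at hb'
      exact ⟨hb'.2, extendTy_of_ne hb'.1⟩
    have hbQ : b ∉ Q.bound := by
      have := h.nodup
      simp only [Proc.bound, Proc.nameBase, List.cons_append, List.nil_append, List.nodup_cons]
        at this
      exact this.1
    obtain ⟨h₁, h₂, hUQ, hQU, hbU, hend⟩ :=
      (h.congr (T' := extendTy T b C) fun b hb => (hT₀ b hb).2).res
        map_extendTy_true map_extendTy_false
    have hrx : ∀ n ∈ resNames (.ch b true 0) C, n ∉ x := by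
      intro n hn hx
      obtain ⟨p, j, hj, rfl, -⟩ := mem_resNames.1 hn
      exact hbU _ _ (h.used _ hx)
    rw [kinds, B]
    by_cases htr : C.tr = true
    · rw [if_pos htr, if_pos htr]
      obtain ⟨⟨V', hQ⟩, hresU⟩ := h₂ htr
      refine Outcome.resAll (A₁ := {n | (n ∈ needed E ρ (.res (.ch b true 0) C Q) ∧ n ∉ x) ∨
        n ∈ resNames (.ch b true 0) C}) ((ih hQ).consPlain (T := extendTy T b C) (bd := Q.bound)
        (fun b hb => ⟨hb, fun _ _ => rfl⟩) (hch hQ) (hch h) h.nodup_x ?_ ?_ ?_ ?_) hC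
        (fun _ _ => rfl) hbQ hT₀ (fun n hn => .inl hn) (fun n hn => hn) (fun p i hn => hbU p i hn.1)
        (fun hs n hn hn' => absurd (.inr hn) hn')
      · rintro n hn (hA | hA)
        · exact hA.2 hn
        · exact hrx n hA hn
      · rintro n (hn | hn)
        · exact hAch h n hn
        · obtain ⟨p, j, hj, rfl, -⟩ := mem_resNames.1 hn
          exact ⟨_, _, _, rfl⟩
      · rintro n ⟨hn, hnz⟩
        have hnz' : n ∉ x ++ resNames (.ch b true 0) C := hnz
        rw [List.mem_append, not_or] at hnz'
        exact .inl ⟨(hQU n hn).resolve_right hnz'.2, hnz'.1⟩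
      · intro T' Γ t₁ t₂ g
        refine LinTyped.passPlain t₂ hQ.nodup_x (hprop (hch hQ)) ?_ fun n hs => ?_
        · rintro n (hn | rfl)
          · rcases List.mem_append.1 hn with hn | hn
            · exact g n (.inr (.inl hn))
            · exact g n (.inl (.inr hn))
          · exact g _ (.inr (.inr rfl))
        · constructor
          · rintro (⟨hn | hn, hn'⟩ | hn | hn)
            · exact .inr (by_contra fun hz => hn' ⟨hUQ n hn.1, hz⟩)
            · exact .inr (List.mem_append_right _ hn)
            · exact .inr (List.mem_append_left _ hn)
            · exact .inl hn
          · rintro (hn | hn)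
            · exact .inr (.inr hn)
            · rcases List.mem_append.1 hn with hn' | hn'
              · exact .inr (.inl hn')
              · exact .inl ⟨.inr hn', fun h => h.2 hn⟩
    · rw [if_neg htr, if_neg htr]
      obtain ⟨V', hQ⟩ := h₁ (by simpa using htr)
      refine Outcome.resAll (ih hQ) hC (fun _ _ => rfl) hbQ hT₀ (fun n hn => ⟨hUQ n hn.1, hn.2⟩)
        (fun n hn => (hQU n hn.1).imp (fun h => ⟨h, hn.2⟩) id) (fun p i hn => hbU p i hn.1) ?_
      exact fun hs n hn hn' => hend hs n hn fun hU => hn' ⟨hU, hrx n hn⟩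
  | par Q₁ Q₂ ih₁ ih₂ =>
    intro E ρ T V k x h
    obtain ⟨⟨V₁, hQ₁⟩, ⟨V₂, hQ₂⟩, hz₁, hz₂, hU, hx₁, hx₂, hdisj⟩ := h.par
    have o₁ := ih₁ (k := k + 1) hQ₁
    have o₂ := ih₂ (k := k + Q₁.size + 1) hQ₂
    have hlen := length_kinds Q₁
    rw [kinds, B]
    obtain ⟨ks₁, hks₁⟩ := kinds_eq_cons Q₁
    obtain ⟨ks₂, hks₂⟩ := kinds_eq_cons Q₂
    rw [hks₁] at o₁ hlen ⊢
    rw [hks₂] at o₂ ⊢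
    refine o₁.par o₂ (by rw [hlen]; omega) (by simp [Proc.bound]) (by simp) (hch hQ₁)
      (fun n hn => h.needed_fresh (h.used n (hz₂ n hn))) (hch h)
      (fun n hn => h.needed_fresh hn.1) ?_ ?_ ?_ ?_
    · exact fun n hn => ⟨(hU n).2 (.inl hn.1), fun hx => hn.2 (hx₁ n hn.1 hx)⟩
    · exact fun n hn => ⟨(hU n).2 (.inr hn.1), fun hx => hn.2 (hx₂ n hn.1 hx)⟩
    · exact fun n hn hs hn' => hdisj n hn.1 hs hn'.1
    intro T' Γ t₁ _ t₃ _ _ t₄ _ t₅ g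
    simp only [PKind.name, PKind.ty, Name.dual, Ty.dual, Bool.not_true, Bool.not_false]
      at t₃ t₄ t₅ g ⊢
    obtain ⟨-, -, -, -, -, -, -, hdisj⟩ := (h.congr (T' := T') t₁).par
    set z₁ := fnb Q₁ x
    set z₂ := fnb Q₂ x
    have hzU₁ : ∀ n ∈ z₁, n ∈ needed E ρ Q₁ := hQ₁.used
    have hzU₂ : ∀ n ∈ z₂, n ∈ needed E ρ Q₂ := hQ₂.used
    have hx := hch h
    have hc₁ := g (.prop false (k + 1) false) (by simp)
    have hc₂ := g (.prop false (k + Q₁.size + 1) false) (by simp)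
    have hne : Name.prop false (k + Q₁.size + 1) false ≠ .prop false (k + 1) false := by
      have : 0 < Q₁.size := by rw [← hlen]; simp
      simp; omega
    have hΓx : ∀ n ∈ x, Agrees T' (bindShared Γ x (x.map T')) n :=
      fun n hn => agrees_bindShared_of_mem hn
    have hAx : ∀ n ∈ {n | n ∈ needed E ρ (.par Q₁ Q₂) ∧ n ∉ x} \
        ({n | n ∈ needed E ρ Q₁ ∧ n ∉ z₁} ∪ {n | n ∈ needed E ρ Q₂ ∧ n ∉ z₂}), False := by
      rintro n ⟨⟨hn, hnx⟩, hn'⟩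
      refine hn' ?_
      rcases (hU n).1 hn with hn | hn
      · exact .inl ⟨hn, fun h => hnx (hz₁ n h)⟩
      · exact .inr ⟨hn, fun h => hnx (hz₂ n h)⟩
    refine (LinTyped.inpPlain (A := {n | n = .prop false (k + 1) false ∨
      n = .prop false (k + Q₁.size + 1) false}) t₃ h.nodup_x (hprop hx) (by simp) ?_
      (g _ (by simp)) ?_).congr_set fun n _ => ?_
    · rintro n hn - (rfl | rfl) <;> exact hprop hx hn
    · refine LinTyped.outPlain t₄ hQ₁.nodup_x (hprop (hch hQ₁)) (agrees_bindShared (.inr hc₁))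
        (fun n hn => hΓx n (hz₁ n hn)) (fun n hn _ => .inr (hz₁ n hn)) (.inl (.inl rfl))
        (LinTyped.passPlain t₅ hQ₂.nodup_x (hprop (hch hQ₂)) ?_ fun n hs => ?_)
      · rintro n (hn | rfl)
        · exact hΓx n (hz₂ n hn)
        · exact agrees_bindShared (.inr hc₂)
      · constructor
        · rintro ⟨(hn | hn) | hn, h₁, h₂⟩
          · exact absurd hn h₁
          · exact .inl hn
          · rcases (hU n).1 (h.used n hn) with h₃ | h₃
            · exact absurd (hx₁ n h₃ hn) h₂
            · exact .inr (hx₂ n h₃ hn)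
        · rintro (rfl | hn)
          · exact ⟨.inl (.inr rfl), hne, hprop (hch hQ₁)⟩
          · refine ⟨.inr (hz₂ n hn), ?_, fun h₁ => hdisj n (hzU₁ n h₁) hs (hzU₂ n hn)⟩
            rintro rfl; exact hprop (hch hQ₂) hn
    · constructor
      · rintro (rfl | rfl | rfl)
        · exact .inr (.inl rfl)
        · exact .inr (.inr (.inl rfl))
        · exact .inr (.inr (.inr rfl))
      · rintro (hn | rfl | rfl | rfl)
        · exact (hAx n hn).elim
        · exact .inl rfl
        · exact .inr (.inl rfl)
        · exact .inr (.inr rfl)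
  | mu X Q ih =>
    intro E ρ T V k x h
    obtain ⟨⟨Δ₀, V₀, hQ⟩, hM, hm⟩ := h.mu
    rw [kinds, B]
    set m := Q.fn.dedup.flatMap fun n => bname (ρ n) (E n)
    rw [hM]
    set T₀ : Name → Ty := fupd T (.propX X true) (.shared (m.map T))
    have hT₀ : ∀ b p i, T₀ (.ch b p i) = T (.ch b p i) := fun b p i => fupd_of_ne _ _ (by simp)
    have hmch : ∀ n ∈ m, ∃ b p i, n = .ch b p i := by
      intro n hn
      obtain ⟨b, p, i, h, -⟩ := hQ.fresh_m n hn
      exact ⟨b, p, i, h⟩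
    have hX : T₀ (.propX X true) = .shared (m.map T₀) := by
      rw [map_eq_of_ch hmch fun b p i _ => hT₀ b p i]; exact fupd_same ..
    have o := outcome_Brec (k := k + 1) (hQ.congr fun b _ => hT₀ b) hX
    obtain ⟨ks, hks⟩ := kindsRec_eq_cons X true Q
    rw [hks] at o ⊢
    simp only [if_true] at o ⊢
    have o' : Outcome T₀ Q.bound k (.plain :: .recSession :: ks) .plain x
        {n | n ∈ needed E ρ (.mu X Q) ∧ n ∉ x} {.propX X true} (.par (.inp (.prop false k true) x
          (.out (.prop true (k + 1) false) m (.mu X (.inp (.propX X true) m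
            (.out (.prop true (k + 1) false) m (.pvar X))))))
          (Brec X m true E ρ (k + 1) m Q)) := by
      refine o.cons (T := T₀) (bd := Q.bound) (fun b hb => ⟨hb, fun _ _ => rfl⟩)
        (fun n hn => ⟨⟨X, true, hn⟩, rfl⟩) hmch (hch h) (hAch h) (by simp) ?_
      intro T' Γ t₁ t₂ t₃ _ _ t₄ g
      simp only [PKind.name, PKind.ty, Name.dual, Ty.dual, Bool.not_true, Bool.not_false]
        at t₃ t₄ g ⊢
      have hX' : T' (.propX X true) = .shared (m.map T') := by
        rw [t₂ _ rfl, hX]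
        refine congrArg _ (map_eq_of_ch hmch fun b p i hn => ?_).symm
        obtain ⟨b', p', i', hbp, hb'⟩ := hQ.fresh_m _ hn
        injection hbp with hbp
        exact t₁ b (hbp ▸ hb') p i
      refine (LinTyped.inpPlain (A := {n | (n ∈ needed E ρ (.mu X Q) ∧ n ∉ x) ∨
        n = .prop true (k + 1) false}) t₃ h.nodup_x (hprop (hch h)) ?_ ?_ (g _ (.inr (.inl rfl)))
        (LinTyped.activate t₄ hX' hQ.nodup_m hmch ?_ fun n hs => ?_)).congr_set fun n _ => ?_
      · rintro (hn | hn)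
        · obtain ⟨_, _, _, hn⟩ := hAch h _ hn
          cases hn
        · simp at hn
      · rintro n hn - (hn' | rfl)
        · exact hn'.2 hn
        · exact hprop (hch h) hn
      · rintro n (hn | rfl | rfl)
        · by_cases hnx : n ∈ x
          · exact agrees_bindShared_of_mem hnx
          · exact agrees_bindShared (.inr (g n (.inl ⟨(hm n).1 hn, hnx⟩)))
        · exact agrees_bindShared (.inr (g _ (.inr (.inr (.inr (.inl (by simp)))))))
        · exact agrees_bindShared (.inr (g _ (.inr (.inr (.inr (.inr rfl))))))
      · constructor
        · rintro ((hn | hn) | hn)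
          · exact .inr ((hm n).2 hn.1)
          · exact .inl hn
          · exact .inr ((hm n).2 (h.used n hn))
        · rintro (hn | hn)
          · exact .inl (.inr hn)
          · by_cases hnx : n ∈ x
            · exact .inr hnx
            · exact .inl (.inl ⟨(hm n).1 hn, hnx⟩)
      · simp only [Set.mem_ofPred_eq, Set.mem_union, Set.mem_insert_iff, Set.mem_sdiff,
          Set.mem_singleton_iff, Set.mem_empty_iff_false, not_false_eq_true, and_true]
        tauto
    obtain ⟨T', h₁, h₂, h₃, h₄, h₅⟩ := o'
    have hX' : T' (.propX X true) = .shared (m.map T) := by rw [h₂ _ rfl]; exact fupd_same ..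
    refine ⟨T', fun b hb p i => by rw [h₁ b hb, hT₀], by simp, h₃, h₄, fun Γ hΓ => ?_⟩
    refine LinTyped.res rfl hX' (h₅ _ ?_)
    have hne : ∀ n, n ∈ {n | n ∈ needed E ρ (.mu X Q) ∧ n ∉ x} ∨
        n ∈ propSet k (.plain :: .recSession :: ks) → n ≠ .propX X true := by
      rintro n (hn | hn) rfl
      · obtain ⟨_, _, _, hn⟩ := hAch h _ hn
        cases hn
      · obtain ⟨_, _, _, hn, -⟩ := exists_of_mem_propSet hn
        cases hn
    rintro n (hn | hn | rfl)
    · rw [Agrees, Env.upd, if_neg (hne n (.inl hn))]; exact hΓ n (.inl hn)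
    · rw [Agrees, Env.upd, if_neg (hne n (.inr hn))]; exact hΓ n (.inr (.inl hn))
    · rw [Agrees, hX']; simp [Env.upd, Ty.isShared]

/-! ### The breakdown of an initialized process -/

theorem gEnv_eq_some {E : Env} {n : Name} {M : Ty} :
    gEnv E n = some M ↔
      ∃ b p j C, n = .ch b p (1 + j) ∧ E (.ch b p 1) = some C ∧ C.G[j]? = some M := by
  constructor
  · intro h
    match n, h with
    | .ch b p (i + 1), h =>
      obtain ⟨C, h₁, h₂⟩ := Option.bind_eq_some_iff.1 h
      exact ⟨b, p, i, C, by rw [Nat.add_comm], h₁, h₂⟩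
  · rintro ⟨b, p, j, C, rfl, h₁, h₂⟩
    rw [Nat.add_comm]
    simp [gEnv, h₁, h₂]

theorem gEnv_eq_none_of_not_ch {E : Env} {n : Name} (h : ∀ b p i, n ≠ .ch b p i) :
    gEnv E n = none := by
  cases n with
  | ch b p i => exact absurd rfl (h b p i)
  | _ => rfl

theorem gEnv_union {Γ Δ : Env} (h : ∀ n, Γ n = none ∨ Δ n = none) :
    (gEnv Γ).union (gEnv Δ) = gEnv (Γ.union Δ) := by
  funext n
  match n with
  | .ch b p 0 => rfl
  | .prop .. => rfl
  | .propX .. => rfl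
  | .ch b p (i + 1) =>
    rcases h (.ch b p 1) with h | h
    · simp [gEnv, Env.union, h]
    · cases hΓ : Γ (.ch b p 1) <;> simp [gEnv, Env.union, h, hΓ]

theorem remove_eq_some {E : Env} {x : List Name} {n : Name} {C : Ty} :
    E.remove x n = some C ↔ n ∉ x ∧ E n = some C := by
  simp [Env.remove]

theorem union_eq_some {E F : Env} {n : Name} {C : Ty} :
    E.union F n = some C ↔ E n = some C ∨ (E n = none ∧ F n = some C) := by
  cases h : E n <;> simp [Env.union, h]

theorem union_eq_none {E F : Env} {n : Name} : E.union F n = none ↔ E n = none ∧ F n = none := by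
  cases h : E n <;> simp [Env.union, h]

/-- The types of the propagators form a balanced environment. -/
theorem PropTyped.balanced {T : Name → Ty} {k : ℕ} {ks : List PKind} (h : PropTyped T k ks)
    {Θ : Env} (hΘ : ∀ n S, Θ n = some S → n ∈ propSet k ks ∧ T n = S) : Θ.Balanced := by
  intro n S S' hS hS'
  obtain ⟨⟨j, κ, hj, hn⟩, rfl⟩ := hΘ n S hS
  obtain ⟨-, rfl⟩ := hΘ _ S' hS'
  have hd := (h j κ hj).2
  rcases hn with rfl | ⟨-, -, rfl⟩
  · exact hd
  · rw [hd, Ty.dual_dual]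
    cases κ <;> rfl

/-- The breakdown of an initialized process starts in an admissible state. -/
theorem State.initial {Γ Δ : Env} {P : Proc} {x y : List Name}
    (hΓ : ∀ n C, Γ n = some C → n.Initial ∧ C.WF ∧ C.isShared = true)
    (hΔ : ∀ n S, Δ n = some S → n.Initial ∧ S.WF ∧ S.isShared = false)
    (hdisj : ∀ n, Γ n = none ∨ Δ n = none) (hsource : P.Source) (hbound : P.bound.Nodup)
    (hfresh : ∀ b ∈ P.bound, ∀ p i, Γ (.ch b p i) = none ∧ Δ (.ch b p i) = none)
    (hrec : P.NoNestedRec) (hP : Typed Γ (fun _ => none) Δ P) (hxnodup : x.Nodup)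
    (hx : ∀ n ∈ x, n ∈ P.fn) (hxtr : ∀ n ∈ P.fn, ∀ S, Δ n = some S → S.tr = true → n ∈ x)
    (hy : Indexed Γ Δ y x) :
    State (fun n => (Γ.union Δ n).getD .endT) id (fun n => (gEnv (Γ.union Δ) n).getD .endT)
      {n | Γ.union Δ n ≠ none} y P := by
  set U := Γ.union Δ with hU
  set E : Name → Ty := fun n => (U n).getD .endT with hE
  set V : Set Name := {n | U n ≠ none}
  have hV : ∀ n ∈ V, U n = some (E n) := by
    intro n hn
    obtain ⟨C, hC⟩ := Option.ne_none_iff_exists'.1 hn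
    simp [hE, hC]
  have hUprop : ∀ n C, U n = some C → n.Initial ∧ C.WF := by
    intro n C h
    rcases union_eq_some.1 h with h | ⟨-, h⟩
    · exact ⟨(hΓ n C h).1, (hΓ n C h).2.1⟩
    · exact ⟨(hΔ n C h).1, (hΔ n C h).2.1⟩
  have hinit : ∀ n ∈ V, ∃ b p, n = .ch b p 1 := fun n hn => (hUprop n _ (hV n hn)).1
  have hsh : shEnv E V = Γ := by
    funext n
    have := hdisj n
    cases h₁ : Γ n with
    | some C =>
      have hUn : U n = some C := union_eq_some.2 (.inl h₁)
      have hEn : E n = C := by simp [hE, hUn]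
      exact shEnv_eq_some.2 ⟨by simp [V, hUn], by rw [hEn, (hΓ n C h₁).2.2], hEn⟩
    | none =>
      refine shEnv_eq_none.2 fun hn => ?_
      rcases union_eq_some.1 (hV n hn) with h | ⟨-, h⟩
      · rw [h₁] at h; cases h
      · exact (hΔ n _ h).2.2
  have hlin : linEnv E V = Δ := by
    funext n
    cases h₁ : Δ n with
    | some C =>
      have hUn : U n = some C :=
        union_eq_some.2 (.inr ⟨(hdisj n).resolve_right (by simp [h₁]), h₁⟩)
      have hEn : E n = C := by simp [hE, hUn]
      exact linEnv_eq_some.2 ⟨by simp [V, hUn], by rw [hEn, (hΔ n C h₁).2.2], hEn⟩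
    | none =>
      refine linEnv_eq_none.2 fun hn => ?_
      rcases union_eq_some.1 (hV n hn) with h | ⟨-, h⟩
      · exact (hΓ n _ h).2.2
      · rw [h₁] at h; cases h
  have hSJ : SJ E (fun _ => none) V P := SJ.of_typed hP hsh hlin
  have hfV : ∀ n ∈ P.fn, n ∈ V := fun n hn => hSJ.mem_of_mem_fn hn
  -- The tuple `ỹ` consists of the breakdowns of the names in `x̃`.
  have hy' : y = x.flatMap fun n => bname n (E n) := by
    rw [hy]
    refine List.flatMap_congr fun n hn => ?_
    rw [← hU, hV n (hfV n (hx n hn))]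
  have hR : Refines E id (fun n => (gEnv U n).getD .endT) V := by
    refine ⟨fun s hs => (hUprop s _ (hV s hs)).2, fun s hs => ?_, fun s hs t ht hst => ?_,
      fun s hs _ => hinit s hs, fun s hs _ => ?_⟩
    · obtain ⟨b, p, rfl⟩ := hinit s hs
      exact ⟨b, p, 1, 1, rfl, rfl⟩
    · obtain ⟨b, p, rfl⟩ := hinit s hs
      obtain ⟨b', p', rfl⟩ := hinit t ht
      simp only [Name.withIdx, Name.ch.injEq, and_true] at hst
      rw [hst.1, hst.2]
    · obtain ⟨b, p, rfl⟩ := hinit s hs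
      refine map_bname_eq.2 fun j M hj => ?_
      have : gEnv U (.ch b p (1 + j)) = some M := gEnv_eq_some.2 ⟨b, p, j, _, rfl, hV _ hs, hj⟩
      simp [this]
  refine ⟨hsource, hrec, hbound, fun b hb p i hm => ?_, hR, hSJ, ?_, fun n hn => ?_,
    fun s hs htr n hn => ?_⟩
  · exact hm (union_eq_none.2 (hfresh b hb p i))
  · rw [hy', List.nodup_flatMap]
    refine ⟨fun s hs => hR.nodup (hfV s (hx s hs)) _,
      hxnodup.imp_of_mem fun hs ht hst n hn hn' => ?_⟩
    exact hst (hR.eq_of_mem (hfV _ (hx _ hs)) (hfV _ (hx _ ht)) hn hn')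
  · rw [hy'] at hn
    obtain ⟨s, hs, hn⟩ := List.mem_flatMap.1 hn
    exact ⟨s, hx s hs, hn⟩
  · rw [hy']
    refine List.mem_flatMap.2 ⟨s, ?_, hn⟩
    rcases union_eq_some.1 (hV s (hfV s hs)) with h | ⟨-, h⟩
    · have h₂ := (hΓ s _ h).2.2
      exfalso
      revert htr h₂
      cases E s <;> simp [Ty.tr, Ty.isShared]
    · exact hxtr s hs _ h htr

theorem mainTheorem3 (Γ Δ : Env) (P : Proc) (k : ℕ) (x y : List Name)
    (hΓ : ∀ n C, Γ n = some C → n.Initial ∧ C.WF ∧ C.isShared = true)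
    (hΔ : ∀ n S, Δ n = some S → n.Initial ∧ S.WF ∧ S.isShared = false)
    (hdisj : ∀ n, Γ n = none ∨ Δ n = none)
    (hsource : P.Source)
    (hinit : P.Initialized)
    (hbound : P.bound.Nodup)
    (hfresh : ∀ b ∈ P.bound, ∀ p i, Γ (.ch b p i) = none ∧ Δ (.ch b p i) = none)
    (hrec : P.NoNestedRec)
    (hP : Typed Γ (fun _ => none) Δ P)
    (hxnodup : x.Nodup)
    (hx : ∀ n ∈ x, n ∈ P.fn)
    (hxtr : ∀ n ∈ P.fn, ∀ S, Δ n = some S → S.tr = true → n ∈ x)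
    (hy : Indexed Γ Δ y x) :
    ∃ (Θ : Env) (M : List Ty),
      Θ.Balanced ∧
      (∀ n, Θ n ≠ none ↔ n ∈ propDom k P) ∧
      Θ (.prop false k true) = some (.act false M .endT) ∧
      y.map ((gEnv Γ).union (gEnv Δ)) = M.map some ∧
      Typed ((gEnv (Γ.remove x)).union Θ.sharedPart) (fun _ => none)
        ((gEnv (Δ.remove x)).union Θ.sessionPart)
        (breakdown Γ Δ k y P) := by
  classical
  have hst := State.initial hΓ hΔ hdisj hsource hbound hfresh hrec hP hxnodup hx hxtr hy
  obtain ⟨T', hch, -, hprop, hκ, hty⟩ := outcome_B (k := k) hst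
  set U := Γ.union Δ with hU
  set E : Name → Ty := fun n => (U n).getD .endT with hE
  set A : Set Name := {n | n ∈ needed E id P ∧ n ∉ y}
  have hEs : ∀ {s C}, U s = some C → E s = C := fun h => by simp [hE, h]
  have hUs : ∀ s ∈ P.fn, U s = some (E s) := by
    intro s hs
    obtain ⟨C, hC⟩ := Option.ne_none_iff_exists'.1 (hst.mem_of_mem_fn hs)
    rw [hEs hC, hC]
  have hUΔ : ∀ {s S}, Δ s = some S → U s = some S := fun {s S} h =>
    union_eq_some.2 (.inr ⟨(hdisj s).resolve_right (by simp [h]), h⟩)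
  -- The types of the broken-down names are kept, since source names are not bound in `P`.
  have hT : ∀ {n M}, gEnv U n = some M → T' n = M := by
    intro n M hn
    obtain ⟨b, p, j, C, rfl, h₁, -⟩ := gEnv_eq_some.1 hn
    rw [hch b ?_ p (1 + j)]
    · simp [hn]
    intro hb
    obtain ⟨h₂, h₃⟩ := hfresh b hb p 1
    rw [hU, union_eq_none.2 ⟨h₂, h₃⟩] at h₁
    cases h₁
  have hTU : ∀ n ∈ needed E id P, ∃ b p j, n = .ch b p (1 + j) ∧ Name.ch b p 1 ∈ P.fn ∧
      n ∈ bname (.ch b p 1) (E (.ch b p 1)) ∧ (E (.ch b p 1)).G[j]? = some (T' n) := by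
    rintro n ⟨s, hs, hn⟩
    obtain ⟨b, p, rfl⟩ := hinit s hs
    have hn' := hn
    obtain ⟨j, hj, rfl⟩ := mem_bname.1 hn
    refine ⟨b, p, j, rfl, hs, hn', ?_⟩
    have hG := List.getElem?_eq_getElem hj
    rw [hG, hT (gEnv_eq_some.2 ⟨b, p, j, _, rfl, hUs _ hs, hG⟩)]
  have hyx : ∀ {b p j M}, (E (.ch b p 1)).G[j]? = some M → Name.ch b p 1 ∈ P.fn →
      (Name.ch b p (1 + j) ∈ y ↔ Name.ch b p 1 ∈ x) := by
    intro b p j M hM hs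
    rw [hy, List.mem_flatMap]
    constructor
    · rintro ⟨s, hsx, hn⟩
      obtain ⟨b', p', rfl⟩ := hinit s (hx s hsx)
      rw [← hU, hUs _ (hx _ hsx)] at hn
      obtain ⟨j', -, h⟩ := mem_bname.1 hn
      injection h with h₁ h₂
      rwa [h₁, h₂]
    · intro hsx
      refine ⟨_, hsx, ?_⟩
      rw [← hU, hUs _ hs]
      exact mem_bname.2 ⟨j, (List.getElem?_eq_some_iff.1 hM).1, rfl⟩
  set Θ : Env := fun n => if n ∈ propSet k (kinds P) then some (T' n) else none with hΘ
  have hΘch : ∀ b p i, Θ (.ch b p i) = none := fun b p i => if_neg ch_notMem_propSet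
  obtain ⟨ks, hks⟩ := kinds_eq_cons P
  refine ⟨Θ, y.map T', hprop.balanced fun n S hn => ?_, fun n => ?_, ?_, ?_, ?_⟩
  · simpa [hΘ] using hn
  · simp only [hΘ, ne_eq, ite_eq_right_iff, reduceCtorEq, imp_false, not_not]
    rfl
  · have : Name.prop false k true ∈ propSet k (kinds P) := ⟨0, .plain, by simp [hks], .inl rfl⟩
    simp only [hΘ, if_pos this]
    exact congrArg some hκ
  · rw [gEnv_union hdisj, List.map_map]
    refine List.map_congr_left fun n hn => ?_
    obtain ⟨b, p, j, rfl, hs, -, hj⟩ := hTU n (hst.used n hn)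
    exact gEnv_eq_some.2 ⟨b, p, j, _, rfl, hUs _ hs, hj⟩
  -- The linear names are those needed and not received, the propagators, and names of type `end`.
  set L : Set Name := A ∪ propSet k (kinds P) ∪ {n | gEnv (Δ.remove x) n ≠ none}
  have hΔT : ∀ {n M}, gEnv (Δ.remove x) n = some M → gEnv U n = some M ∧ M.isShared = false ∧
      ∃ b p j, n = .ch b p (1 + j) ∧ Name.ch b p 1 ∉ x ∧ Δ (.ch b p 1) = some (E (.ch b p 1)) ∧
        (E (.ch b p 1)).G[j]? = some M := by
    intro n M h
    obtain ⟨b, p, j, C, rfl, h₁, h₂⟩ := gEnv_eq_some.1 h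
    obtain ⟨h₃, h₄⟩ := remove_eq_some.1 h₁
    refine ⟨gEnv_eq_some.2 ⟨b, p, j, C, rfl, hUΔ h₄, h₂⟩, ?_, b, p, j, rfl, h₃, ?_, ?_⟩
    · rw [(hΔ _ _ h₄).2.1.isShared_of_mem_G (List.mem_of_getElem? h₂), (hΔ _ _ h₄).2.2]
    · rw [hEs (hUΔ h₄), h₄]
    · rw [hEs (hUΔ h₄), h₂]
  have hAΓ : ∀ n ∈ A, ∃ b p j, n = .ch b p (1 + j) ∧ Name.ch b p 1 ∉ x ∧
      (E (.ch b p 1)).G[j]? = some (T' n) ∧ U (.ch b p 1) = some (E (.ch b p 1)) ∧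
      (T' n).isShared = (E (.ch b p 1)).isShared := by
    rintro n ⟨hn, hny⟩
    obtain ⟨b, p, j, rfl, hs, -, hj⟩ := hTU n hn
    refine ⟨b, p, j, rfl, fun h => hny ((hyx hj hs).2 h), hj, hUs _ hs, ?_⟩
    exact (hst.refines.wf _ (hst.mem_of_mem_fn hs)).isShared_of_mem_G (List.mem_of_getElem? hj)
  have hsh : ∀ {n M}, gEnv (Γ.remove x) n = some M → gEnv U n = some M ∧ M.isShared = true := by
    intro n M h
    obtain ⟨b, p, j, C, rfl, h₁, h₂⟩ := gEnv_eq_some.1 h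
    have h₃ := (remove_eq_some.1 h₁).2
    refine ⟨gEnv_eq_some.2 ⟨b, p, j, C, rfl, union_eq_some.2 (.inl h₃), h₂⟩, ?_⟩
    rw [(hΓ _ _ h₃).2.1.isShared_of_mem_G (List.mem_of_getElem? h₂), (hΓ _ _ h₃).2.2]
  have hΓT : ∀ n, Θ n = none → (T' n).isShared = false →
      (gEnv (Γ.remove x)).union Θ.sharedPart n = none := by
    intro n h hs
    refine union_eq_none.2 ⟨?_, by simp [Env.sharedPart, h]⟩
    rw [Option.eq_none_iff_forall_ne_some]
    intro M hM
    obtain ⟨h₁, h₂⟩ := hsh hM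
    rw [hT h₁, h₂] at hs
    cases hs
  have hlin : LinTyped T' (fun _ => none) ((gEnv (Γ.remove x)).union Θ.sharedPart) L
      (breakdown Γ Δ k y P) := by
    have hfin : {n | Δ n ≠ none}.Finite := hP.finite_support (by simp)
    refine (hty _ ?_).weaken hfin.toFinset.toList (fun n _ hn => .inl hn) ?_
    · rintro n (hn | hn | hn)
      · obtain ⟨b, p, j, rfl, hsx, hj, hUs', hTE⟩ := hAΓ n hn
        unfold Agrees
        split_ifs with hs
        · refine union_eq_some.2 (.inl (gEnv_eq_some.2 ⟨b, p, j, _, rfl, ?_, hj⟩))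
          refine remove_eq_some.2 ⟨hsx, ?_⟩
          rcases union_eq_some.1 hUs' with h | ⟨-, h⟩
          · exact h
          · rw [hTE, (hΔ _ _ h).2.2] at hs; cases hs
        · exact hΓT _ (hΘch _ _ _) (by simpa using hs)
      · obtain ⟨r, j, p, rfl, -, -⟩ := exists_of_mem_propSet hn
        simp [Agrees, Env.union, gEnv, Env.sharedPart, hΘ, hn, Option.filter_some]
      · exact absurd hn (by simp)
    · rintro n (hn | hn) hs
      · exact .inl hn
      by_cases hnA : n ∈ A
      · exact .inl (.inl hnA)
      obtain ⟨M, hM⟩ := Option.ne_none_iff_exists'.1 hn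
      obtain ⟨h₁, h₂, b, p, j, rfl, hsx, hΔs, hj⟩ := hΔT hM
      -- A name of the environment that is not needed and not received has type `end`.
      have hfn : Name.ch b p 1 ∉ P.fn := by
        intro hfn
        refine hnA ⟨⟨_, hfn, mem_bname.2 ⟨j, (List.getElem?_eq_some_iff.1 hj).1, rfl⟩⟩, ?_⟩
        rwa [hyx hj hfn]
      have hV : Name.ch b p 1 ∈ {n | U n ≠ none} := by simp [hUΔ hΔs]
      have hend : E (.ch b p 1) = .endT := by
        by_contra hne
        refine hfn (hst.typed.mem_fn hst.refines.wf hV (hΔ _ _ hΔs).2.2 ⟨b, p, 1, rfl, ?_⟩ hne)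
        exact fun hb => hst.fresh b hb p 1 hV
      rw [hend] at hj hΔs
      obtain ⟨rfl, rfl⟩ : j = 0 ∧ Ty.endT = M := by
        rcases j with _ | j <;> simp_all [Ty.G]
      exact .inr ⟨by simp [hΔs], hT h₁, hΓT _ (hΘch _ _ _) hs⟩
  have henv : linEnv T' L = (gEnv (Δ.remove x)).union Θ.sessionPart := by
    funext n
    by_cases hn : ∃ b p i, n = .ch b p i
    · obtain ⟨b, p, i, rfl⟩ := hn
      have hs : Θ.sessionPart (.ch b p i) = none := by simp [Env.sessionPart, hΘch]
      cases hM : gEnv (Δ.remove x) (.ch b p i) with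
      | some M =>
        obtain ⟨h₁, h₂, -⟩ := hΔT hM
        rw [union_eq_some.2 (.inl hM)]
        exact linEnv_eq_some.2 ⟨.inr (by simp [hM]), by rwa [hT h₁], hT h₁⟩
      | none =>
        rw [union_eq_none.2 ⟨hM, hs⟩, linEnv_eq_none]
        rintro ((hn | hn) | hn)
        · obtain ⟨b', p', j, h, hsx, hj, hUs', hTE⟩ := hAΓ _ hn
          rw [hTE]
          rcases union_eq_some.1 hUs' with h' | ⟨-, h'⟩
          · exact (hΓ _ _ h').2.2
          · rw [gEnv_eq_some.2 ⟨b', p', j, _, h, remove_eq_some.2 ⟨hsx, h'⟩, hj⟩] at hM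
            cases hM
        · exact absurd hn ch_notMem_propSet
        · exact absurd hM hn
    · push Not at hn
      have hg := gEnv_eq_none_of_not_ch (E := Δ.remove x) hn
      have hL : n ∈ L ↔ n ∈ propSet k (kinds P) := by
        refine ⟨?_, fun h => .inl (.inr h)⟩
        rintro ((h | h) | h)
        · obtain ⟨b, p, j, h, -⟩ := hAΓ n h
          exact absurd h (hn _ _ _)
        · exact h
        · exact absurd hg h
      simp only [linEnv, Env.union, hg, Option.orElse_none, Env.sessionPart, hΘ, hL]
      by_cases h : n ∈ propSet k (kinds P) <;> simp [h, Option.filter_some]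
  rw [← henv]
  exact hlin
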